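/- **Setting.** Let $S(u,z)=(iu,-z)$ on $\mathbb C\times\mathbb R$. Consider a $C^\infty$ $S$-symmetric family of vector fields with small real parameters $(\gamma,\beta,\mu)$, $$\dot u=(-\gamma+i\beta)u+a_0zu^*+a_1u^2u^*+a_2z^2u+a_3(u^*)^3+O_4,\qquad \dot z=\mu z+b_0u^2+b_0^*(u^*)^2+b_1z^3+b_2zuu^*+O_4,\tag{1}$$ whose coefficients are smooth functions of the parameters ($a_i,b_0$ complex, $b_1,b_2$ real), with $b_1<0$. For $\mu>0$ let $(0,\pm z_0)$, $z_0=\sqrt{\mu/|b_1|}+O(\mu)$, be its non-zero equilibria on the $z$-axis. The scaling $u\to z_0|b_1|^{1/4}e^{i\,\mathrm{Arg}(a_0)/2}u$, $z\to z_0z$, $t\to t/(z_0|a_0|)$ and $\rho=\gamma/(z_0|a_0|)$, $\omega=\beta/(z_0|a_0|)$ bring (1) to the rescaled form $$\dot u=(-\rho+i\omega)u+zu^*+\sqrt\mu f_1,\qquad \dot z=(A+iB)u^2+(A-iB)(u^*)^2+\sqrt\mu f_2,\tag{2}$$ $$f_1=\frac{a_1}{|a_0|}u^2u^*+\frac{a_2}{|a_0|\sqrt{|b_1|}}z^2u+\frac{a_3|a_0|}{a_0^2}(u^*)^3+\sqrt\mu\,O_3,\quad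 f_2=\Big(\frac{\sqrt{|b_1|}}{|a_0|}+O(\sqrt\mu)\Big)(z-z^3)+\frac{b_2}{|a_0|}zuu^*+\sqrt\mu\,O_3,$$ where $A+iB=a_0b_0\sqrt{|b_1|}/|a_0|^2$, everything depends smoothly on $(\rho,\omega,\sqrt\mu)$ near $(1/2,0,0)$, the $O_3$-terms respect the symmetry, and the equilibria on the $z$-axis are $O=(0,0)$ and $O^\pm=(0,\pm1)$. **Theorem.** Let $b_1<0$ and $A<0$ at the bifurcation moment ($(\rho,\omega,\sqrt\mu)=(1/2,0,0)$ in (2), zero parameters in (1)); for (1), $A<0$ means $\mathrm{Re}(a_0b_0)<0$. The coefficients in the constants below are taken at this moment. (i) For system (2) there is a surface $\rho=h(\omega,\sqrt\mu)$, with $h$ a $C^\infty$ function of $(\omega,\sqrt\mu)$ for all small $\omega$ and small $\sqrt\mu\ge0$, such that $$h=\tfrac12+k_1\sqrt\mu+k_2\,\omega+O(\mu+\omega^2),\qquad k_2=\frac{(9-\pi^2)B}{3A},$$ $$k_1=\frac{\sqrt{|b_1|}}{12|a_0|}+\Big(\mathrm{Re}\,a_1-\frac{B\,\mathrm{Im}\,a_1}{3A}\Big)\frac1{12|A||a_0|}+\Big(\mathrm{Re}\,a_2+\frac{B\,\mathrm{Im}\,a_2}{6A}\Big)\frac1{3|a_0|\sqrt{|b_1|}}+\Big(\mathrm{Re}\frac{a_3}{a_0^2}-\frac{B}{3A}\mathrm{Im}\frac{a_3}{a_0^2}\Big)\frac{|a_0|}{12|A|}+\frac{b_2}{24|A||a_0|}.$$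 For $\mu>0$ and $\rho=h(\omega,\sqrt\mu)$, system (2) has an $S$-symmetric four-winged heteroclinic connection: the unstable manifold of each of $O^\pm$ is the equilibrium together with two separatrices, the four separatrices are distinct and are images of one of them under powers of $S$, and they all tend to $O$ as $t\to+\infty$. (ii) As $\rho$ changes, the connections split with non-zero velocity: on the cross-section $z=1/2$, near the unperturbed connection, the first intersection point of the separatrix of $O^+$ and the trace of the local stable manifold of $O$ (a curve $x=Q(y)$, $u=x+iy$) depend smoothly on $(\rho,\omega,\sqrt\mu)$ near $(1/2,0,0)$; for $\mu>0$ the signed distance between them vanishes exactly when $\rho=h(\omega,\sqrt\mu)$, and its $\rho$-derivative is bounded away from zero. (iii) For the original family (1) there are $\delta>0$ and a function $h(\beta,\mu)$, $C^\infty$ on $\{0<\mu<\delta,\ |\beta|<\delta\sqrt\mu\}$ and continuous there and at the origin with $h(0,0)=0$, such that system (1) at $\gamma=h(\beta,\mu)$ has such a four-winged connection between $(0,\pm z_0)$ and $O$; in the rescaled parameters it satisfies the expansion in (i): with $\rho=h/(z_0|a_0|)$, $\omega=\beta/(z_0|a_0|)$ ($z_0$, $|a_0|$ taken at $\gamma=h(\beta,\mu)$),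 $\rho=\tfrac12+k_1\sqrt\mu+k_2\omega+O(\mu+\omega^2)$. -/

import Mathlib

open Set Filter Topology
open scoped ContDiff

namespace Z4

noncomputable section

/-- The phase space: a point is `(u, z)` with `u = x + i y`. -/
abbrev Phase := ℂ × ℝ

/-- Three real parameters: `(γ, β, μ)` for the original system, `(ρ, ω, s)` with `s = √μ` for the
rescaled system. -/
abbrev Param := ℝ × ℝ × ℝ

/-- The generator `(u, z) ↦ (i u, -z)` of the `ℤ/4`-symmetry. -/
def S (w : Phase) : Phase := (Complex.I * w.1, -w.2)

/-- The coefficients of the normal form, as functions of the parameters. -/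
structure Coeffs where
  a0 : Param → ℂ
  a1 : Param → ℂ
  a2 : Param → ℂ
  a3 : Param → ℂ
  b0 : Param → ℂ
  b1 : Param → ℝ
  b2 : Param → ℝ

namespace Coeffs

variable (c : Coeffs) (p : Param)

/-- All coefficients depend smoothly on the parameters. -/
structure SmoothOn (D : Set Param) : Prop where
  a0 : ContDiffOn ℝ ∞ c.a0 D
  a1 : ContDiffOn ℝ ∞ c.a1 D
  a2 : ContDiffOn ℝ ∞ c.a2 D
  a3 : ContDiffOn ℝ ∞ c.a3 D
  b0 : ContDiffOn ℝ ∞ c.b0 D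
  b1 : ContDiffOn ℝ ∞ c.b1 D
  b2 : ContDiffOn ℝ ∞ c.b2 D

/-- The complex number `A + i B = a₀ b₀ √|b₁| / |a₀|²`. -/
def AB : ℂ := c.a0 p * c.b0 p * ((√|c.b1 p| / ‖c.a0 p‖ ^ 2 : ℝ) : ℂ)

def A : ℝ := (c.AB p).re

def B : ℝ := (c.AB p).im

/-- The coefficient of `√μ` in the expansion of the bifurcation surface. -/
def k1 : ℝ :=
  √|c.b1 p| / (12 * ‖c.a0 p‖)
  + ((c.a1 p).re - (c.a1 p).im * c.B p / (3 * c.A p)) * (1 / (12 * |c.A p| * ‖c.a0 p‖))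
  + ((c.a2 p).re + (c.a2 p).im * c.B p / (6 * c.A p)) * (1 / (3 * ‖c.a0 p‖ * √|c.b1 p|))
  + ((c.a3 p / c.a0 p ^ 2).re - (c.a3 p / c.a0 p ^ 2).im * c.B p / (3 * c.A p))
      * (‖c.a0 p‖ / (12 * |c.A p|))
  + c.b2 p / (24 * |c.A p| * ‖c.a0 p‖)

/-- The coefficient of `ω` in the expansion of the bifurcation surface. -/
def k2 : ℝ := (9 - Real.pi ^ 2) * c.B p / (3 * c.A p)

end Coeffs

/-- The original family: a smooth `S`-symmetric family of vector fields with parameters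
`η = (γ, β, μ)` near `0`,
`u' = (-γ + iβ) u + a₀ z u* + a₁ u² u* + a₂ z² u + a₃ (u*)³ + O₄`,
`z' = μ z + b₀ u² + b₀* (u*)² + b₁ z³ + b₂ z u u* + O₄`.
`Ru`, `Rz` are the two `O₄` terms. -/
structure GeneralFamily where
  c : Coeffs
  Ru : Param → Phase → ℂ
  Rz : Param → Phase → ℝ
  r : ℝ
  r_pos : 0 < r
  c_smooth : c.SmoothOn (Metric.ball 0 r)
  Ru_smooth : ContDiffOn ℝ ∞ (fun q : Param × Phase => Ru q.1 q.2) (Metric.ball 0 r ×ˢ univ)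
  Rz_smooth : ContDiffOn ℝ ∞ (fun q : Param × Phase => Rz q.1 q.2) (Metric.ball 0 r ×ˢ univ)
  Ru_symm : ∀ η ∈ Metric.ball (0 : Param) r, ∀ w, Ru η (S w) = Complex.I * Ru η w
  Rz_symm : ∀ η ∈ Metric.ball (0 : Param) r, ∀ w, Rz η (S w) = -Rz η w
  Ru_order : ∀ η ∈ Metric.ball (0 : Param) r, Ru η =O[𝓝 0] fun w : Phase => ‖w‖ ^ 4
  Rz_order : ∀ η ∈ Metric.ball (0 : Param) r, Rz η =O[𝓝 0] fun w : Phase => ‖w‖ ^ 4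

/-- The vector field of the original family at `η = (γ, β, μ)`. -/
def GeneralFamily.field (G : GeneralFamily) (η : Param) : Phase → Phase := fun w =>
  let u : ℂ := w.1
  let v : ℂ := (starRingEnd ℂ) w.1
  let z : ℝ := w.2
  ( (-(η.1 : ℂ) + Complex.I * (η.2.1 : ℂ)) * u + G.c.a0 η * z * v + G.c.a1 η * u ^ 2 * v
      + G.c.a2 η * z ^ 2 * u + G.c.a3 η * v ^ 3 + G.Ru η w,
    η.2.2 * z + (G.c.b0 η * u ^ 2 + (starRingEnd ℂ) (G.c.b0 η) * v ^ 2).re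
      + G.c.b1 η * z ^ 3 + G.c.b2 η * z * ‖u‖ ^ 2 + G.Rz η w )

/-- The parameter values `ρ = 1/2`, `ω = 0`, `√μ = 0`. -/
def p0 : Param := (1 / 2, 0, 0)

/-- The rescaled family, with parameters `p = (ρ, ω, s)` near `(1/2, 0, 0)`, where `s = √μ`:
`u' = (-ρ + iω) u + z u* + s f₁`, `z' = (A + iB) u² + (A - iB) (u*)² + s f₂`, with
`f₁ = a₁/|a₀| u² u* + a₂/(|a₀| √|b₁|) z² u + a₃ |a₀|/a₀² (u*)³ + s O₃`,
`f₂ = (√|b₁|/|a₀| + s e) (z - z³) + b₂/|a₀| z u u* + s O₃`.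
`R1`, `R2` are the two `O₃` terms; they respect the symmetry and keep the equilibrium
`(0, 1)` (hence `(0, -1)`) in place. -/
structure RescaledFamily where
  c : Coeffs
  e : Param → ℝ
  R1 : Param → Phase → ℂ
  R2 : Param → Phase → ℝ
  r : ℝ
  r_pos : 0 < r
  c_smooth : c.SmoothOn (Metric.ball p0 r)
  e_smooth : ContDiffOn ℝ ∞ e (Metric.ball p0 r)
  R1_smooth : ContDiffOn ℝ ∞ (fun q : Param × Phase => R1 q.1 q.2) (Metric.ball p0 r ×ˢ univ)
  R2_smooth : ContDiffOn ℝ ∞ (fun q : Param × Phase => R2 q.1 q.2) (Metric.ball p0 r ×ˢ univ)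
  R1_symm : ∀ p ∈ Metric.ball p0 r, ∀ w, R1 p (S w) = Complex.I * R1 p w
  R2_symm : ∀ p ∈ Metric.ball p0 r, ∀ w, R2 p (S w) = -R2 p w
  R1_order : ∀ p ∈ Metric.ball p0 r, R1 p =O[𝓝 0] fun w : Phase => ‖w‖ ^ 3
  R2_order : ∀ p ∈ Metric.ball p0 r, R2 p =O[𝓝 0] fun w : Phase => ‖w‖ ^ 3
  R2_equilibrium : ∀ p ∈ Metric.ball p0 r, R2 p (0, 1) = 0

namespace RescaledFamily

variable (F : RescaledFamily)

def f1 (p : Param) (w : Phase) : ℂ :=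
  let u : ℂ := w.1
  let v : ℂ := (starRingEnd ℂ) w.1
  let z : ℝ := w.2
  F.c.a1 p / ‖F.c.a0 p‖ * u ^ 2 * v
    + F.c.a2 p / (‖F.c.a0 p‖ * √|F.c.b1 p| : ℝ) * z ^ 2 * u
    + F.c.a3 p * ‖F.c.a0 p‖ / F.c.a0 p ^ 2 * v ^ 3 + p.2.2 * F.R1 p w

def f2 (p : Param) (w : Phase) : ℝ :=
  (√|F.c.b1 p| / ‖F.c.a0 p‖ + p.2.2 * F.e p) * (w.2 - w.2 ^ 3)
    + F.c.b2 p / ‖F.c.a0 p‖ * w.2 * ‖w.1‖ ^ 2 + p.2.2 * F.R2 p w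

/-- The vector field of the rescaled family at `p = (ρ, ω, s)`. -/
def field (p : Param) : Phase → Phase := fun w =>
  let u : ℂ := w.1
  let v : ℂ := (starRingEnd ℂ) w.1
  let z : ℝ := w.2
  ( (-(p.1 : ℂ) + Complex.I * (p.2.1 : ℂ)) * u + z * v + p.2.2 * F.f1 p w,
    (F.c.AB p * u ^ 2 + (starRingEnd ℂ) (F.c.AB p) * v ^ 2).re + p.2.2 * F.f2 p w )

end RescaledFamily

/-- The unstable set of an equilibrium `e`: the points whose backward trajectories tend to `e`. -/
def unstableSet (X : Phase → Phase) (e : Phase) : Set Phase :=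
  {w | ∃ x : ℝ → Phase, x 0 = w ∧ IsIntegralCurveOn x (fun _ => X) (Iic 0) ∧
    Tendsto x atBot (𝓝 e)}

/-- The stable set of an equilibrium `e` inside `V`: the points whose forward trajectories stay
in `V` and tend to `e`. -/
def stableSetIn (X : Phase → Phase) (V : Set Phase) (e : Phase) : Set Phase :=
  {w | ∃ x : ℝ → Phase, x 0 = w ∧ IsIntegralCurveOn x (fun _ => X) (Ici 0) ∧
    (∀ t ∈ Ici (0 : ℝ), x t ∈ V) ∧ Tendsto x atTop (𝓝 e)}

/-- `X` has an `S`-symmetric four-winged heteroclinic connection between the equilibria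
`O⁺ = (0, ζ)`, `O⁻ = (0, -ζ)` and `O = 0`: the unstable manifold of each of `O⁺`, `O⁻` consists of
the equilibrium and of two separatrices, the four separatrices are distinct and are obtained from
one of them by the powers of `S`, and all of them tend to `O` as `t → +∞`. -/
def FourWingedConnection (X : Phase → Phase) (ζ : ℝ) : Prop :=
  0 < ζ ∧ X 0 = 0 ∧ X (0, ζ) = 0 ∧ X (0, -ζ) = 0 ∧ (∀ w, X (S w) = S (X w)) ∧
  ∃ Γ : ℝ → Phase,
    (∀ k : ℕ, IsIntegralCurve (S^[k] ∘ Γ) (fun _ => X) ∧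
      Tendsto (S^[k] ∘ Γ) atBot (𝓝 (S^[k] (0, ζ))) ∧
      Tendsto (S^[k] ∘ Γ) atTop (𝓝 0)) ∧
    (∀ j < 4, ∀ k < 4, j ≠ k → Disjoint (range (S^[j] ∘ Γ)) (range (S^[k] ∘ Γ))) ∧
    unstableSet X (0, ζ) = {(0, ζ)} ∪ range Γ ∪ range (S^[2] ∘ Γ) ∧
    unstableSet X (0, -ζ) = {(0, -ζ)} ∪ range (S ∘ Γ) ∪ range (S^[3] ∘ Γ)

/-- The parameter box `|ρ - 1/2| < ε`, `|ω| < δ`, `0 ≤ s < δ`. -/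
def box (ε δ : ℝ) : Set Param :=
  {p | |p.1 - 1 / 2| < ε ∧ |p.2.1| < δ ∧ 0 ≤ p.2.2 ∧ p.2.2 < δ}

/-- The separatrix of `O⁺ = (0, 1)` and the stable manifold of `O` split with a non-zero velocity
in `ρ` along the surface `ρ = h (ω, s)`. On the cross-section `z = 1/2`, near its
intersection `(u₀, 1/2)` with the unperturbed connection, the separatrix of `O⁺` has its first
intersection point `(P p, 1/2)`, the local stable manifold of `O` (taken in a fixed neighbourhood
`V` of `O`) is the curve `x = Q (p, y)`, and the signed distance `Re P - Q (p, Im P)` vanishes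
exactly on the surface and has a `ρ`-derivative bounded away from zero. -/
def SplitsWithNonzeroVelocity (X : Param → Phase → Phase) (u₀ : ℂ) (ε δ : ℝ)
    (h : ℝ × ℝ → ℝ) : Prop :=
  ∃ (V : Set Phase) (θ : ℝ) (P : Param → ℂ) (Q : Param × ℝ → ℝ) (κ : ℝ),
    IsOpen V ∧ (0 : Phase) ∈ V ∧ 0 < θ ∧ 0 < κ ∧
    ContDiffOn ℝ ∞ P (box ε δ) ∧
    ContDiffOn ℝ ∞ Q (box ε δ ×ˢ Ioo (u₀.im - θ) (u₀.im + θ)) ∧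
    ∀ p ∈ box ε δ, 0 < p.2.2 →
      (∀ u : ℂ, ‖u - u₀‖ < θ → (X p (u, 1 / 2)).2 < 0) ∧
      ‖P p - u₀‖ < θ ∧
      (∃ Γ : ℝ → Phase, Γ 0 = (P p, 1 / 2) ∧ IsIntegralCurveOn Γ (fun _ => X p) (Iic 0) ∧
        Tendsto Γ atBot (𝓝 (0, 1)) ∧ ∀ t < 0, 1 / 2 < (Γ t).2) ∧
      (∀ u : ℂ, ‖u - u₀‖ < θ →
        ((u, (1 / 2 : ℝ)) ∈ stableSetIn (X p) V 0 ↔ u.re = Q (p, u.im))) ∧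
      ((P p).re - Q (p, (P p).im) = 0 ↔ p.1 = h p.2) ∧
      ∃ v : ℝ, HasDerivAt (fun ρ => (P (ρ, p.2)).re - Q ((ρ, p.2), (P (ρ, p.2)).im)) v p.1 ∧
        κ ≤ |v|

/-- The wedge `0 < μ < δ`, `|β| < δ √μ` of parameters `(β, μ)`. -/
def wedge (δ : ℝ) : Set (ℝ × ℝ) := {q | 0 < q.2 ∧ q.2 < δ ∧ |q.1| < δ * √q.2}

end

end Z4

/-!
The statement is a Melnikov argument around an explicit connection, followed by a change of scales.

*The unperturbed connection.* For `s = √μ = 0`, `ρ = 1 / 2`, `ω = 0` the rescaled system has the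
connection `√(2 |A|) u = sech (t / 2) / 2`, `z = (1 - tanh (t / 2)) / 2` from `O⁺` to `O`. It meets the
section `z = 1 / 2` at `t = 0`. Reversing time and reflecting `z` exchanges its two halves up to the
sign of one coefficient, so both are treated at once (`IsHalfFamily`, `NormalFamily.half`).

*Half-line solutions.* At `s = 0` the `z`-axis consists of equilibria, so `O` and `O⁺` are not
hyperbolic there and invariant manifold theory does not apply uniformly in `s`. The trajectories that
matter approach the equilibria at a rate bounded below, however. Writing
them as the unperturbed connection plus `exp (-t / 4)` times a bounded function, in a moving frame in
which the linearization is triangular, turns the equation into a smooth equation in a space of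
bounded functions with an invertible linearization. The implicit function theorem
(`exists_smooth_implicit`, `exists_half_solutions`) yields smooth families of solutions on the
half-lines, up to and including `s = 0`.

*The splitting function.* The distance of the two families on the section is smooth in
`(ρ, ω, s)`, and its linearization is the integral of `melnikov` (`exists_halves`). In the coordinate
`z` the integrals are elementary except for `∫ log z / (1 - z) = -π ^ 2 / 6`, which is the source of
`π ^ 2` in `k₂` (`integral_mul_logKernel`). The `ρ`-derivative is non-zero, so the zero set is a smooth
surface `ρ = h (ω, s)` with the expansion read off the integral (`exists_surface`).

*Which trajectories these are.* For `s > 0` the difference of two trajectories that leave `O⁺`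
satisfies a cone condition (`eventually_cone`), so they all lie on one orbit and its image under `S²`
(`exists_meet`); this identifies the unstable set. At `O`, trajectories that stay in `nbhd 2 η` and
tend to `O` decay faster than the weight (`exists_decay`), so the trace of the local stable manifold
on the section consists of the half-line solutions found above (`exists_stable_trace`). Four wings
arise from one by the symmetry, and a common point of two wings would make `‖u‖` periodic
(`disjoint_wings`).

*The original family.* The terms of fourth order are `s ^ 4` times smooth functions in the scaled
coordinates (`exists_quartic`). The scales themselves depend on `|a₀|` at the parameters
`(γ, β, μ)`, which in turn depend on the scales; solving these equations by the implicit function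
theorem (`ScaledData.exists_scales`) conjugates the family with a rescaled family
(`ScaledData.field_scale`). The surface is carried back by solving `β / √μ = ω T` for `ω`, where
`s T` is the scale of time.
-/

namespace Z4

open scoped BoundedContinuousFunction NNReal

/-! ### Smooth calculus in spaces of bounded functions -/

section Nemytskii

universe u

variable {ι : Type*} [TopologicalSpace ι]
variable {V : Type u} [NormedAddCommGroup V] [NormedSpace ℝ V] [FiniteDimensional ℝ V]
variable {W : Type u} [NormedAddCommGroup W]

/-- Post-composition `f ↦ G ∘ f` of bounded continuous functions with values in a
finite-dimensional space with a continuous map `G`. -/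
noncomputable def postComp (G : V → W) (hG : Continuous G) (f : ι →ᵇ V) : ι →ᵇ W :=
  BoundedContinuousFunction.ofNormedAddCommGroup (fun t => G (f t)) (hG.comp f.continuous)
    (((isCompact_closedBall (0 : V) ‖f‖).exists_bound_of_continuousOn hG.continuousOn).choose)
    fun t => ((isCompact_closedBall (0 : V) ‖f‖).exists_bound_of_continuousOn
      hG.continuousOn).choose_spec (f t) (by simpa using f.norm_coe_le_norm t)

@[simp] lemma postComp_apply (G : V → W) (hG : Continuous G) (f : ι →ᵇ V) (t : ι) :
    postComp G hG f t = G (f t) := rfl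

lemma continuous_postComp {G : V → W} (hG : Continuous G) :
    Continuous (postComp G hG : (ι →ᵇ V) → ι →ᵇ W) := by
  rw [Metric.continuous_iff]
  intro f ε hε
  have huc := (isCompact_closedBall (0 : V) (‖f‖ + 1)).uniformContinuousOn_of_continuous
    hG.continuousOn
  rw [Metric.uniformContinuousOn_iff] at huc
  obtain ⟨δ, hδ, hd⟩ := huc (ε / 2) (by positivity)
  refine ⟨min δ 1, lt_min hδ one_pos, fun g hg => ?_⟩
  have hle : dist (postComp G hG g) (postComp G hG f) ≤ ε / 2 := by
    refine (BoundedContinuousFunction.dist_le (by positivity)).2 fun t => ?_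
    have h1 := (BoundedContinuousFunction.dist_coe_le_dist (f := g) (g := f) t)
    have h2 := lt_min_iff.1 hg
    have hft := f.norm_coe_le_norm t
    refine (hd _ ?_ _ ?_ (by linarith)).le
    · simp only [Metric.mem_closedBall, dist_zero_right]
      have := norm_sub_norm_le (g t) (f t)
      rw [dist_eq_norm] at h1
      linarith
    · simp; linarith
  linarith

variable [NormedSpace ℝ W]

/-- Pointwise application of a bounded family of continuous linear maps, as a bounded bilinear
operation. -/
noncomputable def pointwiseApply (ι : Type*) [TopologicalSpace ι] (V : Type u)
    [NormedAddCommGroup V] [NormedSpace ℝ V] (W : Type u) [NormedAddCommGroup W]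
    [NormedSpace ℝ W] : (ι →ᵇ (V →L[ℝ] W)) →L[ℝ] ((ι →ᵇ V) →L[ℝ] (ι →ᵇ W)) :=
  LinearMap.mkContinuous₂
    (LinearMap.mk₂ ℝ
      (fun (D : ι →ᵇ (V →L[ℝ] W)) (h : ι →ᵇ V) =>
        BoundedContinuousFunction.ofNormedAddCommGroup (fun t => D t (h t))
          (D.continuous.clm_apply h.continuous) (‖D‖ * ‖h‖)
          (fun t => (D t).le_of_opNorm_le_of_le (D.norm_coe_le_norm t) (h.norm_coe_le_norm t)))
      (fun D D' h => by ext t; simp) (fun c D h => by ext t; simp)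
      (fun D h h' => by ext t; simp) (fun c D h => by ext t; simp))
    1 (fun D h => by
      rw [one_mul]
      exact (BoundedContinuousFunction.norm_le (by positivity)).2 fun t =>
        (D t).le_of_opNorm_le_of_le (D.norm_coe_le_norm t) (h.norm_coe_le_norm t))

@[simp] lemma pointwiseApply_apply {V : Type u} [NormedAddCommGroup V] [NormedSpace ℝ V]
    (D : ι →ᵇ (V →L[ℝ] W)) (h : ι →ᵇ V) (t : ι) :
    pointwiseApply ι V W D h t = D t (h t) := rfl

lemma hasFDerivAt_postComp {G : V → W} {G' : V → V →L[ℝ] W} (hG : Continuous G)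
    (hG' : Continuous G') (h : ∀ x, HasFDerivAt G (G' x) x) (f : ι →ᵇ V) :
    HasFDerivAt (postComp G hG) (pointwiseApply ι V W (postComp G' hG' f)) f := by
  rw [hasFDerivAt_iff_isLittleO_nhds_zero, Asymptotics.isLittleO_iff]
  intro ε hε
  have huc := (isCompact_closedBall (0 : V) (‖f‖ + 1)).uniformContinuousOn_of_continuous
    hG'.continuousOn
  rw [Metric.uniformContinuousOn_iff] at huc
  obtain ⟨δ, hδ, hd⟩ := huc ε hε
  filter_upwards [Metric.ball_mem_nhds (0 : ι →ᵇ V) (lt_min hδ one_pos)] with k hk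
  have hk' : ‖k‖ < δ ∧ ‖k‖ < 1 := by simpa using hk
  refine (BoundedContinuousFunction.norm_le (by positivity)).2 fun t => ?_
  have hkt := k.norm_coe_le_norm t
  have hft := f.norm_coe_le_norm t
  have key := (convex_ball (f t) (min δ 1)).norm_image_sub_le_of_norm_hasFDerivWithin_le'
    (f := G) (f' := G') (φ := G' (f t)) (C := ε) (x := f t) (y := f t + k t)
    (fun x _ => (h x).hasFDerivWithinAt) (fun x hx => by
      have hx' : ‖x - f t‖ < δ ∧ ‖x - f t‖ < 1 := by simpa [dist_eq_norm] using hx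
      have := hd x (by
        simp only [Metric.mem_closedBall, dist_zero_right]
        calc ‖x‖ = ‖f t + (x - f t)‖ := by simp
          _ ≤ ‖f t‖ + ‖x - f t‖ := norm_add_le _ _
          _ ≤ _ := by linarith [hx'.2]) (f t) (by simp; linarith)
          (by simpa [dist_eq_norm] using hx'.1)
      rw [← dist_eq_norm]; exact this.le) (by simp [hδ])
    (by simp; exact ⟨by linarith [hk'.1], by linarith [hk'.2]⟩)
  simp only [add_sub_cancel_left] at key
  refine le_trans ?_ (mul_le_mul_of_nonneg_left hkt hε.le)
  simpa using key

lemma contDiff_postComp_nat (n : ℕ) :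
    ∀ {W : Type u} [NormedAddCommGroup W] [NormedSpace ℝ W] {G : V → W} (hG : ContDiff ℝ n G),
      ContDiff ℝ n (postComp G hG.continuous : (ι →ᵇ V) → ι →ᵇ W) := by
  induction n with
  | zero =>
    intro W _ _ G hG
    exact contDiff_zero.2 (continuous_postComp _)
  | succ n ih =>
    intro W _ _ G hG
    have hG2 : ContDiff ℝ ((n : ℕ∞ω) + 1) G := by exact_mod_cast hG
    obtain ⟨G', hG', hd⟩ := contDiff_succ_iff_hasFDerivAt.1 hG2
    have h1 : ContDiff ℝ n fun f : ι →ᵇ V =>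
        pointwiseApply ι V W (postComp G' hG'.continuous f) :=
      ContDiff.comp (g := fun D => pointwiseApply ι V W D)
        (by fun_prop) (ih hG')
    have : ContDiff ℝ ((n : ℕ∞ω) + 1) (postComp G hG.continuous : (ι →ᵇ V) → ι →ᵇ W) :=
      contDiff_succ_iff_hasFDerivAt.2
        ⟨fun f => pointwiseApply ι V W (postComp G' hG'.continuous f),
          h1,
          fun f => hasFDerivAt_postComp hG.continuous hG'.continuous hd f⟩
    exact_mod_cast this

/-- Post-composition with a smooth map is smooth for the sup norm. -/
lemma contDiff_postComp {G : V → W} (hG : ContDiff ℝ ∞ G) :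
    ContDiff ℝ ∞ (postComp G hG.continuous : (ι →ᵇ V) → ι →ᵇ W) :=
  contDiff_infty.2 fun n => contDiff_postComp_nat n (contDiff_infty.1 hG n)

end Nemytskii

section ParametricIntegral

open MeasureTheory

universe u

variable {V : Type u} [NormedAddCommGroup V] [NormedSpace ℝ V] [FiniteDimensional ℝ V]
variable {W : Type u} [NormedAddCommGroup W] [NormedSpace ℝ W] [FiniteDimensional ℝ W]

/-- Constant functions, as a continuous linear map. -/
noncomputable def constL (ι : Type*) [TopologicalSpace ι] (V : Type*) [NormedAddCommGroup V]
    [NormedSpace ℝ V] : V →L[ℝ] (ι →ᵇ V) :=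
  LinearMap.mkContinuous
    { toFun := fun v => BoundedContinuousFunction.const ι v
      map_add' := fun _ _ => rfl
      map_smul' := fun _ _ => rfl } 1
    (fun v => by
      rw [one_mul]; exact (BoundedContinuousFunction.norm_le (norm_nonneg _)).2 fun t => le_rfl)

@[simp] lemma constL_apply {ι : Type*} [TopologicalSpace ι] {V : Type*} [NormedAddCommGroup V]
    [NormedSpace ℝ V] (v : V) (t : ι) : constL ι V v t = v := rfl

/-- Integration over the unit interval, as a continuous linear map. -/
noncomputable def integralL (W : Type*) [NormedAddCommGroup W] [NormedSpace ℝ W]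
    [FiniteDimensional ℝ W] : (unitInterval →ᵇ W) →L[ℝ] W :=
  LinearMap.mkContinuous
    { toFun := fun f => ∫ t, f t
      map_add' := fun f g => integral_add
        (f.continuous.integrable_of_hasCompactSupport (HasCompactSupport.of_compactSpace _))
        (g.continuous.integrable_of_hasCompactSupport (HasCompactSupport.of_compactSpace _))
      map_smul' := fun c f => integral_smul c f } 1
    (fun f => by
      have := norm_integral_le_of_norm_le_const (μ := (volume : Measure unitInterval))
        (Eventually.of_forall f.norm_coe_le_norm)
      simpa using this)

lemma contDiff_integral_unitInterval {G : V × ℝ → W} (hG : ContDiff ℝ ∞ G) :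
    ContDiff ℝ ∞ fun v => ∫ t : unitInterval, G (v, t) := by
  let idb : unitInterval →ᵇ V × ℝ :=
    BoundedContinuousFunction.mkOfCompact ⟨fun t => ((0 : V), (t : ℝ)), by fun_prop⟩
  have h := (integralL W).contDiff.comp ((contDiff_postComp (ι := unitInterval) hG).comp
    (((constL unitInterval (V × ℝ)).contDiff.comp (ContinuousLinearMap.inl ℝ V ℝ).contDiff).add
      (contDiff_const (c := idb))))
  convert h using 2 with v
  change _ = ∫ t : unitInterval, _
  refine integral_congr_ae (Eventually.of_forall fun t => ?_)
  simp [idb]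

lemma integral_unitInterval_eq {W : Type*} [NormedAddCommGroup W] [NormedSpace ℝ W] (f : ℝ → W) :
    ∫ t : unitInterval, f t = ∫ t in (0 : ℝ)..1, f t := by
  rw [intervalIntegral.integral_of_le zero_le_one, ← integral_Icc_eq_integral_Ioc]
  exact integral_subtype_comap measurableSet_Icc f

/-- Hadamard's lemma: a smooth family vanishing at `x = 0` is a smooth family of linear maps
applied to `x`. -/
lemma exists_smooth_factor {Q : Type u} [NormedAddCommGroup Q] [NormedSpace ℝ Q]
    [FiniteDimensional ℝ Q] {f : Q × V → W} (hf : ContDiff ℝ ∞ f) (h0 : ∀ q, f (q, 0) = 0) :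
    ∃ M : Q × V → V →L[ℝ] W, ContDiff ℝ ∞ M ∧ ∀ q x, f (q, x) = M (q, x) x := by
  have hG : ContDiff ℝ ∞ fun v : (Q × V) × ℝ =>
      (fderiv ℝ f (v.1.1, v.2 • v.1.2)).comp (ContinuousLinearMap.inr ℝ Q V) := by
    have h1 : ContDiff ℝ ∞ (fderiv ℝ f) := hf.fderiv_right (by simp)
    have h2 : ContDiff ℝ ∞ fun v : (Q × V) × ℝ => (v.1.1, v.2 • v.1.2) := by fun_prop
    exact (h1.comp h2).clm_comp contDiff_const
  refine ⟨_, contDiff_integral_unitInterval hG, fun q x => ?_⟩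
  have hd : ∀ t : ℝ, HasDerivAt (fun t : ℝ => f (q, t • x))
      (fderiv ℝ f (q, t • x) (0, x)) t := fun t => by
    have h1 : HasDerivAt (fun t : ℝ => (q, t • x)) ((0 : Q), x) t := by
      have := (hasDerivAt_const t q).prodMk ((hasDerivAt_id t).smul_const x)
      simpa using this
    exact ((hf.differentiable (by simp)) (q, t • x)).hasFDerivAt.comp_hasDerivAt t h1
  have hc : Continuous fun t : ℝ => fderiv ℝ f (q, t • x) (0, x) :=
    ((hf.continuous_fderiv (by simp)).comp (by fun_prop)).clm_apply continuous_const
  have h2 := intervalIntegral.integral_eq_sub_of_hasDerivAt (a := 0) (b := 1)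
    (fun t _ => hd t) (hc.intervalIntegrable 0 1)
  simp only [one_smul, zero_smul, h0, sub_zero] at h2
  rw [← h2, ← integral_unitInterval_eq, ContinuousLinearMap.integral_apply]
  · simp
  · have hc2 : Continuous fun t : unitInterval => (fderiv ℝ f (q, (t : ℝ) • x)).comp
        (ContinuousLinearMap.inr ℝ Q V) :=
      (((hf.continuous_fderiv (by simp)).comp (by fun_prop)).clm_comp continuous_const)
    exact hc2.integrable_of_hasCompactSupport (HasCompactSupport.of_compactSpace _)

end ParametricIntegral

section Implicit

variable {Q X Y : Type*} [NormedAddCommGroup Q] [NormedSpace ℝ Q] [CompleteSpace Q]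
  [NormedAddCommGroup X] [NormedSpace ℝ X] [CompleteSpace X]
  [NormedAddCommGroup Y] [NormedSpace ℝ Y] [CompleteSpace Y]

/-- The implicit function theorem with a solution that is smooth on a whole neighbourhood:
near the base point the invertibility hypothesis persists, and the local solutions agree. -/
theorem exists_smooth_implicit {f : Q × X → Y} {q₀ : Q} {x₀ : X}
    (hf : ∀ᶠ v in 𝓝 (q₀, x₀), ContDiffAt ℝ ∞ f v) (h0 : f (q₀, x₀) = 0)
    (hinv : (fderiv ℝ f (q₀, x₀) ∘L .inr ℝ Q X).IsInvertible) :
    ∃ ψ : Q → X, ψ q₀ = x₀ ∧ (∀ᶠ q in 𝓝 q₀, ContDiffAt ℝ ∞ ψ q) ∧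
      (∀ᶠ v in 𝓝 (q₀, x₀), f v = 0 ↔ ψ v.1 = v.2) := by
  have hne : (∞ : ℕ∞ω) ≠ 0 := by simp
  have hf0 := hf.self_of_nhds
  refine ⟨hf0.implicitFunction hne hinv, hf0.implicitFunction_apply_self hne hinv, ?_, ?_⟩
  swap
  · simpa only [h0] using hf0.eventually_apply_eq_iff_implicitFunction hne hinv
  set ψ := hf0.implicitFunction hne hinv with hψ
  have hψ0 : ψ q₀ = x₀ := hf0.implicitFunction_apply_self hne hinv
  have hψ1 : ContDiffAt ℝ ∞ ψ q₀ := hf0.contDiffAt_implicitFunction hne hinv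
  have hcont : Tendsto (fun q => (q, ψ q)) (𝓝 q₀) (𝓝 (q₀, x₀)) := by
    have : ContinuousAt (fun q => (q, ψ q)) q₀ := continuousAt_id.prodMk hψ1.continuousAt
    simpa [ContinuousAt, hψ0] using this
  have e1 : ∀ᶠ q in 𝓝 q₀, ContDiffAt ℝ 1 ψ q :=
    (hψ1.of_le (by simp)).eventually (by simp)
  have e2 : ∀ᶠ q in 𝓝 q₀, f (q, ψ q) = 0 := by
    simpa [h0] using hf0.eventually_apply_implicitFunction hne hinv
  have e3 : ∀ᶠ v in 𝓝 (q₀, x₀), (fderiv ℝ f v ∘L .inr ℝ Q X).IsInvertible := by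
    have hc : ContinuousAt (fun v => fderiv ℝ f v ∘L .inr ℝ Q X) (q₀, x₀) :=
      (hf0.fderiv_right (m := 0) (by simp)).continuousAt.clm_comp continuousAt_const
    have ho : IsOpen {L : X →L[ℝ] Y | L.IsInvertible} :=
      ContinuousLinearEquiv.isOpen
    exact hc.eventually (ho.mem_nhds hinv)
  filter_upwards [e1, e2.eventually_nhds, hcont.eventually hf, hcont.eventually e3]
    with q h1 h2 h3 h4
  have hc1 : Tendsto (fun q' => (q', ψ q')) (𝓝 q) (𝓝 (q, ψ q)) :=
    continuousAt_id.prodMk h1.continuousAt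
  have h5 := hc1.eventually (h3.eventually_apply_eq_iff_implicitFunction hne h4)
  refine (h3.contDiffAt_implicitFunction hne h4).congr_of_eventuallyEq ?_
  filter_upwards [h5, h2] with q' h6 h7
  exact (h6.1 (by rw [h7, h2.self_of_nhds])).symm

end Implicit

end Z4

namespace Z4

open scoped BoundedContinuousFunction NNReal
open MeasureTheory

/-! ### Scalar linear equations on a half-line -/

/-- Bounded continuous functions on `[0, ∞)`. -/
abbrev BC := ℝ≥0 →ᵇ ℝ

/-- `x` solves `x' = μ x + n` on `[0, ∞)`. -/
def SolvesLinear (μ : ℝ → ℝ) (x n : BC) : Prop :=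
  ∀ t : ℝ, 0 ≤ t → HasDerivWithinAt (fun t : ℝ => x t.toNNReal)
    (μ t * x t.toNNReal + n t.toNNReal) (Ici 0) t

lemma BC.continuous_ext (x : BC) : Continuous fun t : ℝ => x t.toNNReal :=
  x.continuous.comp continuous_real_toNNReal

lemma BC.abs_le (x : BC) (t : ℝ≥0) : |x t| ≤ ‖x‖ := x.norm_coe_le_norm t

/-- A linear operator on `BC` from a formula with a uniform bound. -/
noncomputable def mkOp (T : BC → ℝ → ℝ) (K : ℝ) (hc : ∀ n, Continuous (T n))
    (hb : ∀ n (t : ℝ), 0 ≤ t → |T n t| ≤ K * ‖n‖)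
    (hadd : ∀ n n' t, T (n + n') t = T n t + T n' t)
    (hsmul : ∀ (c : ℝ) n t, T (c • n) t = c * T n t) : BC →L[ℝ] BC :=
  LinearMap.mkContinuous
    { toFun := fun n => BoundedContinuousFunction.ofNormedAddCommGroup (fun t : ℝ≥0 => T n t)
        ((hc n).comp NNReal.continuous_coe) (K * ‖n‖) (fun t => hb n t t.2)
      map_add' := fun n n' => by ext t; exact hadd n n' t
      map_smul' := fun c n => by ext t; exact hsmul c n t } K
    (fun n => (BoundedContinuousFunction.norm_le
      ((abs_nonneg _).trans (hb n 0 le_rfl))).2 fun t => hb n t t.2)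

lemma mkOp_apply {T : BC → ℝ → ℝ} {K : ℝ} (hc hb hadd hsmul) (n : BC) (t : ℝ≥0) :
    mkOp T K hc hb hadd hsmul n t = T n t := rfl

section

variable {μ m : ℝ → ℝ} {C d : ℝ}

lemma hasDerivAt_mul_integral (hm : ∀ t, HasDerivAt m (μ t * m t) t) (hpos : ∀ t, 0 < m t)
    (n : BC) (b t : ℝ) :
    HasDerivAt (fun t => m t * (b + ∫ s in (0 : ℝ)..t, n s.toNNReal / m s))
      (μ t * (m t * (b + ∫ s in (0 : ℝ)..t, n s.toNNReal / m s)) + n t.toNNReal) t := by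
  have hmc : Continuous m := continuous_iff_continuousAt.2 fun t => (hm t).continuousAt
  have hc : Continuous fun s : ℝ => n s.toNNReal / m s :=
    n.continuous_ext.div hmc fun t => (hpos t).ne'
  have h1 := intervalIntegral.integral_hasDerivAt_right (hc.intervalIntegrable 0 t)
    (hc.stronglyMeasurableAtFilter _ _) hc.continuousAt
  have h2 := (hm t).mul (h1.const_add b)
  refine h2.congr_deriv ?_
  have := (hpos t).ne'
  field_simp

lemma SolvesLinear.integral_eq (hm : ∀ t, HasDerivAt m (μ t * m t) t) (hpos : ∀ t, 0 < m t)
    {x n : BC} (h : SolvesLinear μ x n) {t : ℝ} (ht : 0 ≤ t) :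
    ∫ s in (0 : ℝ)..t, n s.toNNReal / m s = x t.toNNReal / m t - x 0 / m 0 := by
  have hmc : Continuous m := continuous_iff_continuousAt.2 fun t => (hm t).continuousAt
  have hc : Continuous fun s : ℝ => n s.toNNReal / m s :=
    n.continuous_ext.div hmc fun t => (hpos t).ne'
  have h1 := intervalIntegral.integral_eq_sub_of_hasDeriv_right
    (f := fun t : ℝ => x t.toNNReal / m t) (f' := fun s : ℝ => n s.toNNReal / m s) (a := 0) (b := t)
    (x.continuous_ext.div hmc fun t => (hpos t).ne').continuousOn (fun s hs => by
      rw [min_eq_left ht, max_eq_right ht] at hs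
      have h2 := ((h s hs.1.le).mono (Ioi_subset_Ici hs.1.le)).div
        (hm s).hasDerivWithinAt (hpos s).ne'
      refine h2.congr_deriv ?_
      have := (hpos s).ne'
      field_simp
      ring) (hc.intervalIntegrable 0 t)
  simpa using h1

/-- If solutions of `x' = μ x` decay, `x' = μ x + n`, `x 0 = a` has a bounded solution operator. -/
lemma exists_forward_solution (hm : ∀ t, HasDerivAt m (μ t * m t) t) (hpos : ∀ t, 0 < m t)
    (hd : 0 < d) (hdec : ∀ s t, 0 ≤ s → s ≤ t → m t ≤ C * Real.exp (-(d * (t - s))) * m s) :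
    ∃ (G : BC →L[ℝ] BC) (S : BC), ∀ (x n : BC) (a : ℝ),
      x = G n + a • S ↔ SolvesLinear μ x n ∧ x 0 = a := by
  have hmc : Continuous m := continuous_iff_continuousAt.2 fun t => (hm t).continuousAt
  have hc : ∀ n : BC, Continuous fun s : ℝ => n s.toNNReal / m s := fun n =>
    n.continuous_ext.div hmc fun t => (hpos t).ne'
  have hC : 0 ≤ C := by
    have := hdec 0 0 le_rfl le_rfl
    have h0 := hpos 0
    simp at this
    nlinarith
  have hb : ∀ (n : BC) (t : ℝ), 0 ≤ t →
      |m t * (0 + ∫ s in (0 : ℝ)..t, n s.toNNReal / m s)| ≤ C / d * ‖n‖ := by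
    intro n t ht
    have hF : ∀ s, HasDerivAt (fun s => ‖n‖ * (C / d) * Real.exp (-(d * (t - s))))
        (‖n‖ * (C * Real.exp (-(d * (t - s))))) s := fun s => by
      have h1 : HasDerivAt (fun s => -(d * (t - s))) d s := by
        have := (((hasDerivAt_id s).const_sub t).const_mul d).fun_neg
        simpa using this
      refine (h1.exp.const_mul _).congr_deriv ?_
      field_simp
    have hI := intervalIntegral.integral_eq_sub_of_hasDerivAt (a := 0) (b := t)
      (f' := fun s => ‖n‖ * (C * Real.exp (-(d * (t - s)))))
      (fun s _ => hF s) (Continuous.intervalIntegrable (by fun_prop) 0 t)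
    rw [zero_add, ← intervalIntegral.integral_const_mul]
    calc _ ≤ ∫ s in (0 : ℝ)..t, ‖n‖ * (C * Real.exp (-(d * (t - s)))) := by
          rw [← Real.norm_eq_abs]
          refine intervalIntegral.norm_integral_le_of_norm_le (μ := volume)
            (g := fun s => ‖n‖ * (C * Real.exp (-(d * (t - s))))) ht (Eventually.of_forall
            fun s hs => ?_) (Continuous.intervalIntegrable (μ := volume) (by fun_prop) 0 t)
          have h1 := hdec s t hs.1.le hs.2
          have h2 := n.abs_le s.toNNReal
          have h3 := hpos s
          have h4 := hpos t
          rw [Real.norm_eq_abs, abs_mul, abs_div, abs_of_pos h3, abs_of_pos h4]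
          calc m t * (|n s.toNNReal| / m s) = |n s.toNNReal| * (m t / m s) := by ring
            _ ≤ ‖n‖ * (C * Real.exp (-(d * (t - s)))) := by
              refine mul_le_mul h2 ?_ (by positivity) (norm_nonneg _)
              rw [div_le_iff₀ h3]; exact h1
      _ ≤ _ := by
          rw [hI]
          simp only [sub_self, mul_zero, neg_zero, Real.exp_zero, mul_one]
          have : 0 ≤ ‖n‖ * (C / d) * Real.exp (-(d * (t - 0))) := by positivity
          linarith
  let G := mkOp (fun n t => m t * (0 + ∫ s in (0 : ℝ)..t, n s.toNNReal / m s)) (C / d)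
    (fun n => continuous_iff_continuousAt.2 fun t =>
      (hasDerivAt_mul_integral hm hpos n 0 t).continuousAt) hb
    (fun n n' t => by
      have : ∀ s : ℝ, (n + n') s.toNNReal / m s = n s.toNNReal / m s + n' s.toNNReal / m s :=
        fun s => by rw [← add_div]; rfl
      simp only [this]
      rw [intervalIntegral.integral_add ((hc n).intervalIntegrable _ _)
        ((hc n').intervalIntegrable _ _)]
      ring)
    (fun c n t => by
      have : ∀ s : ℝ, (c • n) s.toNNReal / m s = c * (n s.toNNReal / m s) :=
        fun s => by rw [← mul_div_assoc]; rfl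
      simp only [this]
      rw [intervalIntegral.integral_const_mul]
      ring)
  let S : BC := BoundedContinuousFunction.ofNormedAddCommGroup (fun t : ℝ≥0 => m t / m 0)
    ((hmc.comp NNReal.continuous_coe).div_const _) C (fun t => by
      have h1 := hdec 0 t le_rfl t.2
      have h2 : Real.exp (-(d * ((t : ℝ) - 0))) ≤ 1 :=
        Real.exp_le_one_iff.2 (by have := mul_nonneg hd.le t.2; simp at this ⊢; linarith)
      rw [Real.norm_of_nonneg (div_nonneg (hpos _).le (hpos _).le), div_le_iff₀ (hpos _)]
      nlinarith [hpos 0, mul_le_mul_of_nonneg_left h2 hC])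
  have hval : ∀ (n : BC) (a t : ℝ), 0 ≤ t → (G n + a • S) t.toNNReal
      = m t * (a / m 0 + ∫ s in (0 : ℝ)..t, n s.toNNReal / m s) := by
    intro n a t ht
    change m (t.toNNReal : ℝ) * (0 + ∫ s in (0 : ℝ)..(t.toNNReal : ℝ), n s.toNNReal / m s)
      + a * (m (t.toNNReal : ℝ) / m 0) = _
    rw [Real.coe_toNNReal t ht]
    ring
  refine ⟨G, S, fun x n a => ⟨?_, ?_⟩⟩
  · intro hx
    refine ⟨fun t ht => ?_, ?_⟩
    · have h1 := (hasDerivAt_mul_integral hm hpos n (a / m 0) t).hasDerivWithinAt (s := Ici 0)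
      rw [hx, hval n a t ht]
      exact h1.congr (fun s hs => hval n a s hs) (hval n a t ht)
    · have := hval n a 0 le_rfl
      rw [hx]
      simp only [Real.toNNReal_zero] at this
      rw [this]
      have := (hpos 0).ne'
      simp; field_simp
  · rintro ⟨h, rfl⟩
    ext t
    have h1 := hval n (x 0) (t : ℝ) t.coe_nonneg
    have h2 := h.integral_eq hm hpos t.coe_nonneg
    rw [Real.toNNReal_coe] at h1 h2
    rw [h1, h2]
    have := (hpos t).ne'
    field_simp
    ring

/-- If solutions of `x' = μ x` grow, `x' = μ x + n` has exactly one bounded solution. -/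
lemma exists_backward_solution (hm : ∀ t, HasDerivAt m (μ t * m t) t) (hpos : ∀ t, 0 < m t)
    (hd : 0 < d) (hdec : ∀ s t, 0 ≤ t → t ≤ s → m t ≤ C * Real.exp (-(d * (s - t))) * m s) :
    ∃ G : BC →L[ℝ] BC, (∀ x n : BC, x = G n ↔ SolvesLinear μ x n) ∧
      ∀ n : BC, G n 0 = -(m 0 * ∫ s in Ioi (0 : ℝ), n s.toNNReal / m s) := by
  have hmc : Continuous m := continuous_iff_continuousAt.2 fun t => (hm t).continuousAt
  have hc : ∀ n : BC, Continuous fun s : ℝ => n s.toNNReal / m s := fun n =>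
    n.continuous_ext.div hmc fun t => (hpos t).ne'
  have hC : 0 ≤ C := by
    have := hdec 0 0 le_rfl le_rfl
    have h0 := hpos 0
    simp at this
    nlinarith
  have hexpI : ∀ t : ℝ, IntegrableOn (fun s => Real.exp (-(d * (s - t)))) (Ioi t) ∧
      ∫ s in Ioi t, Real.exp (-(d * (s - t))) = 1 / d := by
    intro t
    have h1 : ∀ s : ℝ, Real.exp (-(d * (s - t))) = Real.exp (d * t) * Real.exp (-d * s) := by
      intro s; rw [← Real.exp_add]; ring_nf
    simp only [h1]
    refine ⟨(integrableOn_exp_mul_Ioi (by linarith) t).const_mul _, ?_⟩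
    rw [integral_const_mul, integral_exp_mul_Ioi (by linarith), neg_div_neg_eq, ← mul_div_assoc,
      ← Real.exp_add]
    simp
  have hle : ∀ (n : BC) (t s : ℝ), 0 ≤ t → t ≤ s →
      ‖n s.toNNReal / m s‖ ≤ ‖n‖ * C / m t * Real.exp (-(d * (s - t))) := by
    intro n t s ht hs
    have h1 := hdec s t ht hs
    have h2 := n.abs_le s.toNNReal
    have h3 := hpos s
    have h4 := hpos t
    rw [Real.norm_eq_abs, abs_div, abs_of_pos h3, div_le_iff₀ h3]
    calc |n s.toNNReal| ≤ ‖n‖ * 1 := by linarith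
      _ ≤ ‖n‖ * (C * Real.exp (-(d * (s - t))) * m s / m t) := by
        refine mul_le_mul_of_nonneg_left ?_ (norm_nonneg _)
        rw [le_div_iff₀ h4]; linarith
      _ = _ := by ring
  have hint : ∀ (n : BC) (t : ℝ), 0 ≤ t →
      IntegrableOn (fun s : ℝ => n s.toNNReal / m s) (Ioi t) := fun n t ht =>
    Integrable.mono' ((hexpI t).1.const_mul (‖n‖ * C / m t))
      (hc n).aestronglyMeasurable.restrict
      ((ae_restrict_iff' measurableSet_Ioi).2 (Eventually.of_forall fun s hs =>
        hle n t s ht (le_of_lt hs)))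
  have hsplit : ∀ (n : BC) (t : ℝ), 0 ≤ t →
      -(∫ s in Ioi (0 : ℝ), n s.toNNReal / m s) + ∫ s in (0 : ℝ)..t, n s.toNNReal / m s
        = -∫ s in Ioi t, n s.toNNReal / m s := by
    intro n t ht
    have := intervalIntegral.integral_interval_add_Ioi (μ := volume) (hint n 0 le_rfl) (hint n t ht)
    linarith
  have hb : ∀ (n : BC) (t : ℝ), 0 ≤ t →
      |m t * (-(∫ s in Ioi (0 : ℝ), n s.toNNReal / m s)
        + ∫ s in (0 : ℝ)..t, n s.toNNReal / m s)| ≤ C / d * ‖n‖ := by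
    intro n t ht
    rw [hsplit n t ht, abs_mul, abs_neg, abs_of_pos (hpos t)]
    have h1 : |∫ s in Ioi t, n s.toNNReal / m s| ≤ ‖n‖ * C / m t * (1 / d) := by
      rw [← (hexpI t).2, ← integral_const_mul]
      exact norm_integral_le_of_norm_le ((hexpI t).1.const_mul _)
        ((ae_restrict_iff' measurableSet_Ioi).2 (Eventually.of_forall fun s hs =>
          hle n t s ht (le_of_lt hs)))
    calc _ ≤ m t * (‖n‖ * C / m t * (1 / d)) := mul_le_mul_of_nonneg_left h1 (hpos t).le
      _ = _ := by have := (hpos t).ne'; field_simp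
  let G := mkOp (fun n t => m t * (-(∫ s in Ioi (0 : ℝ), n s.toNNReal / m s)
      + ∫ s in (0 : ℝ)..t, n s.toNNReal / m s)) (C / d)
    (fun n => continuous_iff_continuousAt.2 fun t =>
      (hasDerivAt_mul_integral hm hpos n _ t).continuousAt) hb
    (fun n n' t => by
      have : ∀ s : ℝ, (n + n') s.toNNReal / m s = n s.toNNReal / m s + n' s.toNNReal / m s :=
        fun s => by rw [← add_div]; rfl
      simp only [this]
      rw [intervalIntegral.integral_add ((hc n).intervalIntegrable _ _)
        ((hc n').intervalIntegrable _ _), integral_add (hint n 0 le_rfl) (hint n' 0 le_rfl)]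
      ring)
    (fun c n t => by
      have : ∀ s : ℝ, (c • n) s.toNNReal / m s = c * (n s.toNNReal / m s) :=
        fun s => by rw [← mul_div_assoc]; rfl
      simp only [this]
      rw [intervalIntegral.integral_const_mul, integral_const_mul]
      ring)
  have hval : ∀ (n : BC) (t : ℝ), 0 ≤ t → G n t.toNNReal
      = m t * (-(∫ s in Ioi (0 : ℝ), n s.toNNReal / m s)
        + ∫ s in (0 : ℝ)..t, n s.toNNReal / m s) := by
    intro n t ht
    change m (t.toNNReal : ℝ) * (_ + ∫ s in (0 : ℝ)..(t.toNNReal : ℝ), n s.toNNReal / m s) = _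
    rw [Real.coe_toNNReal t ht]
  refine ⟨G, fun x n => ⟨?_, ?_⟩, fun n => ?_⟩
  · intro hx t ht
    have h1 := (hasDerivAt_mul_integral hm hpos n
      (-(∫ s in Ioi (0 : ℝ), n s.toNNReal / m s)) t).hasDerivWithinAt (s := Ici 0)
    rw [hx, hval n t ht]
    exact h1.congr (fun s hs => hval n s hs) (hval n t ht)
  · intro h
    have hlim : Tendsto (fun t : ℝ => x t.toNNReal / m t) atTop (𝓝 0) := by
      have he : Tendsto (fun t : ℝ => ‖x‖ * C / m 0 * Real.exp (-(d * (t - 0)))) atTop (𝓝 0) := by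
        have h1 : Tendsto (fun t : ℝ => d * (t - 0)) atTop atTop := by
          simpa using tendsto_id.const_mul_atTop hd
        simpa using (Real.tendsto_exp_neg_atTop_nhds_zero.comp h1).const_mul (‖x‖ * C / m 0)
      refine squeeze_zero_norm' ?_ he
      filter_upwards [eventually_ge_atTop 0] with t ht
      exact hle x 0 t le_rfl ht
    have hlim2 := intervalIntegral_tendsto_integral_Ioi 0 (hint n 0 le_rfl) tendsto_id
    have hlim3 : Tendsto (fun t : ℝ => ∫ s in (0 : ℝ)..t, n s.toNNReal / m s) atTop
        (𝓝 (0 - x 0 / m 0)) := by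
      refine (hlim.sub_const _).congr' ?_
      filter_upwards [eventually_ge_atTop 0] with t ht
      exact (h.integral_eq hm hpos ht).symm
    have hI := tendsto_nhds_unique hlim2 hlim3
    ext t
    have h1 := hval n (t : ℝ) t.coe_nonneg
    have h2 := h.integral_eq hm hpos t.coe_nonneg
    rw [Real.toNNReal_coe] at h1 h2
    rw [h1, h2, hI]
    have := (hpos t).ne'
    field_simp
    ring
  · have := hval n 0 le_rfl
    simp only [Real.toNNReal_zero, intervalIntegral.integral_same] at this
    rw [this]; ring

end

end Z4

namespace Z4

open scoped BoundedContinuousFunction NNReal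
open MeasureTheory

/-! ### The unperturbed connection -/

/-- Real coordinates `(X, Z, Y)` of the phase space, with `Z` measured from the section. -/
abbrev E := ℝ × ℝ × ℝ

/-- `sech (t / 2)`. -/
noncomputable def ka (t : ℝ) : ℝ := 1 / Real.cosh (t / 2)

/-- `tanh (t / 2)`. -/
noncomputable def th (t : ℝ) : ℝ := Real.sinh (t / 2) / Real.cosh (t / 2)

/-- The exponential weight. -/
noncomputable def wt (t : ℝ) : ℝ := Real.exp (-(t / 4))

/-- The equilibrium `O` in the coordinates `(X, Z, Y)`. -/
noncomputable def eqO : E := (0, -1 / 2, 0)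

/-- The half of the unperturbed connection between the section `Z = 0` and `O`. -/
noncomputable def baseOrbit (t : ℝ) : E := (ka t / 2, -th t / 2, 0)

lemma ka_sq_add_th_sq (t : ℝ) : ka t ^ 2 + th t ^ 2 = 1 := by
  have h := Real.cosh_sq (t / 2)
  have h1 := (Real.cosh_pos (t / 2)).ne'
  unfold ka th
  field_simp
  linarith

lemma ka_pos (t : ℝ) : 0 < ka t := by
  have := Real.cosh_pos (t / 2)
  unfold ka; positivity

lemma ka_le_one (t : ℝ) : ka t ≤ 1 := by
  nlinarith [ka_sq_add_th_sq t, sq_nonneg (th t), ka_pos t]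

lemma th_lt_one (t : ℝ) : th t < 1 := by
  nlinarith [ka_sq_add_th_sq t, ka_pos t]

lemma abs_th_le_one (t : ℝ) : |th t| ≤ 1 := by
  rw [← sq_le_one_iff_abs_le_one]
  nlinarith [ka_sq_add_th_sq t, ka_pos t]

lemma th_nonneg {t : ℝ} (ht : 0 ≤ t) : 0 ≤ th t :=
  div_nonneg (Real.sinh_nonneg_iff.2 (by linarith)) (Real.cosh_pos _).le

lemma wt_pos (t : ℝ) : 0 < wt t := Real.exp_pos _

lemma wt_le_one {t : ℝ} (ht : 0 ≤ t) : wt t ≤ 1 := Real.exp_le_one_iff.2 (by linarith)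

lemma wt_ne (t : ℝ) : wt t ≠ 0 := (wt_pos t).ne'

@[simp] lemma ka_zero : ka 0 = 1 := by simp [ka]
@[simp] lemma th_zero : th 0 = 0 := by simp [th]
@[simp] lemma wt_zero : wt 0 = 1 := by simp [wt]

lemma wt_sq (t : ℝ) : wt t ^ 2 = Real.exp (-(t / 2)) := by
  rw [wt, ← Real.exp_nat_mul]; congr 1; push_cast; ring

lemma ka_le_wt_sq (t : ℝ) : ka t ≤ 2 * wt t ^ 2 := by
  have h1 : Real.exp (t / 2) ≤ 2 * Real.cosh (t / 2) := by
    rw [Real.cosh_eq]; have := Real.exp_pos (-(t / 2)); linarith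
  rw [wt_sq, Real.exp_neg, ka, ← div_eq_mul_inv, div_le_div_iff₀ (Real.cosh_pos _) (Real.exp_pos _)]
  linarith

lemma wt_sq_le_ka {t : ℝ} (ht : 0 ≤ t) : wt t ^ 2 ≤ ka t := by
  have h1 : Real.cosh (t / 2) ≤ Real.exp (t / 2) := by
    rw [Real.cosh_eq]
    have := Real.exp_le_exp.2 (show -(t / 2) ≤ t / 2 by linarith)
    linarith
  rw [wt_sq, Real.exp_neg, ka, ← one_div]
  exact one_div_le_one_div_of_le (Real.cosh_pos _) h1

/-- The defect `1 - tanh` is quadratic in `sech`. -/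
lemma one_sub_th_le {t : ℝ} (ht : 0 ≤ t) : 1 - th t ≤ ka t := by
  have h := ka_sq_add_th_sq t
  have h1 := th_nonneg ht
  nlinarith [ka_pos t, ka_le_one t, th_lt_one t]

lemma hasDerivAt_ka (t : ℝ) : HasDerivAt ka (-(th t * ka t) / 2) t := by
  have h1 : HasDerivAt (fun t : ℝ => t / 2) (1 / 2) t := (hasDerivAt_id t).div_const 2
  have h2 := (hasDerivAt_const t (1 : ℝ)).div h1.cosh (Real.cosh_pos (t / 2)).ne'
  refine h2.congr_deriv ?_
  have := (Real.cosh_pos (t / 2)).ne'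
  unfold ka th; field_simp; ring

lemma hasDerivAt_th (t : ℝ) : HasDerivAt th (ka t ^ 2 / 2) t := by
  have h1 : HasDerivAt (fun t : ℝ => t / 2) (1 / 2) t := (hasDerivAt_id t).div_const 2
  have h2 := h1.sinh.div h1.cosh (Real.cosh_pos (t / 2)).ne'
  refine h2.congr_deriv ?_
  have := (Real.cosh_pos (t / 2)).ne'
  have h := Real.cosh_sq (t / 2)
  unfold ka; field_simp; linear_combination h

lemma hasDerivAt_wt (t : ℝ) : HasDerivAt wt (-(wt t) / 4) t := by
  have h1 : HasDerivAt (fun t : ℝ => -(t / 4)) (-(1 / 4)) t :=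
    ((hasDerivAt_id t).div_const 4).fun_neg
  refine h1.exp.congr_deriv ?_
  unfold wt; ring

lemma continuous_ka : Continuous ka :=
  continuous_iff_continuousAt.2 fun t => (hasDerivAt_ka t).continuousAt

lemma continuous_th : Continuous th :=
  continuous_iff_continuousAt.2 fun t => (hasDerivAt_th t).continuousAt

lemma continuous_wt : Continuous wt :=
  continuous_iff_continuousAt.2 fun t => (hasDerivAt_wt t).continuousAt

/-! ### Half-line solutions near the unperturbed connection -/

/-- Families of vector fields that have the equilibrium `O` for all parameters and, at the base
parameter, contain `baseOrbit`. The value `c = -1` is the half of the connection at `O`; `c = 1`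
is the half at `O⁺` after reversing time and reflecting `Z`. -/
structure IsHalfFamily (c b : ℝ) (f : Param × E → E) : Prop where
  smooth : ContDiff ℝ ∞ f
  equilibrium : ∀ p, f (p, eqO) = 0
  base : ∀ X Z Y : ℝ,
    f (p0, (X, Z, Y)) = (Z * X, -(X ^ 2 - Y ^ 2) - 2 * b * X * Y, (c - Z) * Y)

/-- The curve with weighted coordinates `ξ = (l₁, l₂, l₃)` in a frame moving along the base
orbit: with `ζ = X - i Z` it is given by `ζ = ζ₀ (1 + wt (l₁ + i l₂))`, `Y = wt l₃`. In this frame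
the linearization along the base orbit is triangular. -/
noncomputable def trajOf (l : E) (t : ℝ) : E :=
  (ka t / 2 + wt t * (ka t * l.1 - th t * l.2.1) / 2,
    -th t / 2 - wt t * (th t * l.1 + ka t * l.2.1) / 2, wt t * l.2.2)

/-- The curve described by a bounded function `ξ` in the moving frame. -/
noncomputable def traj (ξ : ℝ≥0 →ᵇ E) (t : ℝ) : E := trajOf (ξ t.toNNReal) t

/-- The curve of `ξ` is a solution on `[0, ∞)` which starts on the section `Z = 0`. -/
def IsHalfSolution (f : Param × E → E) (p : Param) (ξ : ℝ≥0 →ᵇ E) : Prop :=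
  (∀ t : ℝ, 0 ≤ t → HasDerivWithinAt (traj ξ) (f (p, traj ξ t)) (Ici 0) t) ∧ (ξ 0).2.1 = 0

/-- The values `(sech, tanh, weight, sech / weight, (1 - tanh) / weight)` along the base orbit. -/
abbrev FrameData := ℝ × ℝ × ℝ × ℝ × ℝ

/-- The frame data as a bounded function of time. -/
noncomputable def frameData : ℝ≥0 →ᵇ FrameData :=
  BoundedContinuousFunction.ofNormedAddCommGroup
    (fun t => (ka t, th t, wt t, ka t / wt t, (1 - th t) / wt t))
    (by
      have h1 := continuous_ka.comp NNReal.continuous_coe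
      have h2 := continuous_th.comp NNReal.continuous_coe
      have h3 := continuous_wt.comp NNReal.continuous_coe
      exact h1.prodMk (h2.prodMk (h3.prodMk ((h1.div h3 fun t => wt_ne t).prodMk
        ((continuous_const.sub h2).div h3 fun t => wt_ne t)))))
    2 (fun t => by
      have h1 := ka_pos t
      have h2 := ka_le_one t
      have h3 := abs_th_le_one t
      have h4 := wt_pos t
      have h5 := wt_le_one t.coe_nonneg
      have h6 : ka t / wt t ≤ 2 := by
        rw [div_le_iff₀ h4]
        have := ka_le_wt_sq t
        nlinarith
      have h7 : (1 - th t) / wt t ≤ 2 := by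
        refine le_trans ?_ h6
        gcongr
        exact one_sub_th_le t.2
      have h8 := th_lt_one t
      simp only [Prod.norm_def, Real.norm_eq_abs]
      rw [abs_of_pos h1, abs_of_pos h4, abs_of_pos (div_pos h1 h4),
        abs_of_pos (div_pos (by linarith) h4)]
      simp only [sup_le_iff]
      exact ⟨by linarith, by linarith, by linarith, h6, h7⟩)

lemma frameData_apply (t : ℝ≥0) :
    frameData t = (ka t, th t, wt t, ka t / wt t, (1 - th t) / wt t) := rfl

/-- The nonlinearity of the equation for `(l₁, l₂, l₃)`, written with the Hadamard factor `M` of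
the vector field at `O`; in this form it is smooth up to the value `0` of the weight. -/
noncomputable def frameRHS (c : ℝ) (M : Param × E → E →L[ℝ] E) (q : Param × FrameData × E) : E :=
  let k := q.2.1.1
  let T := q.2.1.2.1
  let w := q.2.1.2.2.1
  let l := q.2.2
  let v : E := (q.2.1.2.2.2.1 / 2 + (k * l.1 - T * l.2.1) / 2,
    q.2.1.2.2.2.2 / 2 - (T * l.1 + k * l.2.1) / 2, l.2.2)
  let m : E := M (q.1, w • v) v
  (2 * k * m.1 - 2 * T * m.2.1 + k / 2 * l.2.1,
    -(2 * T * m.1) - 2 * k * m.2.1 - k / 2 * l.1 - q.2.1.2.2.2.1 / 2 + T / 2 * l.2.1,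
    m.2.2 - (c + T / 2) * l.2.2)

lemma contDiff_frameRHS (c : ℝ) {M : Param × E → E →L[ℝ] E} (hM : ContDiff ℝ ∞ M) :
    ContDiff ℝ ∞ (frameRHS c M) := by
  have hv : ContDiff ℝ ∞ fun q : Param × FrameData × E =>
      ((q.2.1.2.2.2.1 / 2 + (q.2.1.1 * q.2.2.1 - q.2.1.2.1 * q.2.2.2.1) / 2,
        q.2.1.2.2.2.2 / 2 - (q.2.1.2.1 * q.2.2.1 + q.2.1.1 * q.2.2.2.1) / 2, q.2.2.2.2) : E) := by
    fun_prop
  have hw : ContDiff ℝ ∞ fun q : Param × FrameData × E => q.2.1.2.2.1 := by fun_prop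
  have hm := (hM.comp (contDiff_fst.prodMk (hw.smul hv))).clm_apply hv
  unfold frameRHS
  have h1 := hm.fst
  have h2 := hm.snd.fst
  have h3 := hm.snd.snd
  dsimp only [Function.comp_def] at h1 h2 h3
  refine ContDiff.prodMk ?_ (ContDiff.prodMk ?_ ?_)
  · have : ContDiff ℝ ∞ fun q : Param × FrameData × E => q.2.1.1 := by fun_prop
    have : ContDiff ℝ ∞ fun q : Param × FrameData × E => q.2.1.2.1 := by fun_prop
    fun_prop
  · fun_prop
  · fun_prop

section FrameEquation

variable {c b : ℝ} {f : Param × E → E} {M : Param × E → E →L[ℝ] E}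

lemma eqO_add_smul (l : E) (t : ℝ) :
    eqO + wt t • ((ka t / wt t / 2 + (ka t * l.1 - th t * l.2.1) / 2,
      (1 - th t) / wt t / 2 - (th t * l.1 + ka t * l.2.1) / 2, l.2.2) : E) = trajOf l t := by
  have := wt_ne t
  unfold eqO trajOf
  ext
  · simp; field_simp
  · simp; field_simp; ring
  · simp

/-- Along the frame data, `frameRHS` is expressed by the vector field itself. -/
lemma frameRHS_eq (hM : ∀ p x, f (p, eqO + x) = M (p, x) x) (p : Param) (l : E) (t : ℝ≥0) :
    frameRHS c M (p, frameData t, l) =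
      let F := f (p, trajOf l t)
      ((2 * ka t * F.1 - 2 * th t * F.2.1) / wt t + ka t / 2 * l.2.1,
        (-(2 * th t * F.1) - 2 * ka t * F.2.1 - ka t / 2) / wt t - ka t / 2 * l.1
          + th t / 2 * l.2.1,
        F.2.2 / wt t - (c + th t / 2) * l.2.2) := by
  have hw := wt_ne t
  have h1 := hM p (wt t • ((ka t / wt t / 2 + (ka t * l.1 - th t * l.2.1) / 2,
      (1 - th t) / wt t / 2 - (th t * l.1 + ka t * l.2.1) / 2, l.2.2) : E))
  rw [eqO_add_smul, map_smul] at h1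
  have h2 : M (p, wt t • ((ka t / wt t / 2 + (ka t * l.1 - th t * l.2.1) / 2,
      (1 - th t) / wt t / 2 - (th t * l.1 + ka t * l.2.1) / 2, l.2.2) : E))
      ((ka t / wt t / 2 + (ka t * l.1 - th t * l.2.1) / 2,
      (1 - th t) / wt t / 2 - (th t * l.1 + ka t * l.2.1) / 2, l.2.2) : E)
      = (wt t)⁻¹ • f (p, trajOf l t) := by rw [h1, smul_smul, inv_mul_cancel₀ hw, one_smul]
  simp only [frameRHS, frameData_apply, h2]
  ext
  · simp; field_simp
  · simp; field_simp; ring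
  · simp; field_simp

/-- At the base parameter `frameRHS` is the off-diagonal part of the linearization plus a
quadratic remainder. -/
lemma frameRHS_base (hf : IsHalfFamily c b f) (hM : ∀ p x, f (p, eqO + x) = M (p, x) x)
    (l : E) (t : ℝ≥0) :
    frameRHS c M (p0, frameData t, l) =
      (2 * b * th t * ka t * l.2.2
          + wt t * (-(ka t * l.1 - th t * l.2.1) * l.2.1 / 2 - 2 * th t * l.2.2 ^ 2
            + 2 * b * th t * (ka t * l.1 - th t * l.2.1) * l.2.2),
        ka t / 2 * l.1 + 2 * b * ka t ^ 2 * l.2.2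
          + wt t * ((ka t * l.1 - th t * l.2.1) * l.1 / 2 - 2 * ka t * l.2.2 ^ 2
            + 2 * b * ka t * (ka t * l.1 - th t * l.2.1) * l.2.2),
        wt t * ((th t * l.1 + ka t * l.2.1) * l.2.2 / 2)) := by
  have hw := wt_ne t
  have h := ka_sq_add_th_sq t
  rw [frameRHS_eq hM]
  unfold trajOf
  rw [hf.base]
  obtain ⟨l1, l2, l3⟩ := l
  dsimp only
  generalize ka t = k at *
  generalize th t = T at *
  generalize wt t = w at *
  refine Prod.ext ?_ (Prod.ext ?_ ?_)
  · dsimp only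
    field_simp
    linear_combination (-(w * l2 * (k + w * (k * l1 - T * l2)))) * h
  · dsimp only
    field_simp
    linear_combination ((k + w * (k * l1 - T * l2)) * (1 + w * l1)) * h
  · dsimp only
    field_simp
    ring

lemma hasDerivWithinAt_triple {g : ℝ → E} {v : E} {s : Set ℝ} {t : ℝ} :
    HasDerivWithinAt g v s t ↔ HasDerivWithinAt (fun t => (g t).1) v.1 s t ∧
      HasDerivWithinAt (fun t => (g t).2.1) v.2.1 s t ∧
      HasDerivWithinAt (fun t => (g t).2.2) v.2.2 s t := by
  constructor
  · intro h
    have h2 := (ContinuousLinearMap.snd ℝ ℝ (ℝ × ℝ)).hasFDerivAt.comp_hasDerivWithinAt t h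
    exact ⟨(ContinuousLinearMap.fst ℝ ℝ (ℝ × ℝ)).hasFDerivAt.comp_hasDerivWithinAt t h,
      (ContinuousLinearMap.fst ℝ ℝ ℝ).hasFDerivAt.comp_hasDerivWithinAt t h2,
      (ContinuousLinearMap.snd ℝ ℝ ℝ).hasFDerivAt.comp_hasDerivWithinAt t h2⟩
  · rintro ⟨h1, h2, h3⟩
    exact h1.prodMk (h2.prodMk h3)

lemma hasDerivWithinAt_trajOf_iff {l : ℝ → E} {F l' : E} {t : ℝ}
    (h1 : l'.1 = 1 / 4 * (l t).1 + ((2 * ka t * F.1 - 2 * th t * F.2.1) / wt t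
      + ka t / 2 * (l t).2.1))
    (h2 : l'.2.1 = (1 / 4 - th t / 2) * (l t).2.1
      + ((-(2 * th t * F.1) - 2 * ka t * F.2.1 - ka t / 2) / wt t - ka t / 2 * (l t).1
        + th t / 2 * (l t).2.1))
    (h3 : l'.2.2 = (1 / 4 + c + th t / 2) * (l t).2.2
      + (F.2.2 / wt t - (c + th t / 2) * (l t).2.2)) :
    HasDerivWithinAt (fun t => trajOf (l t) t) F (Ici 0) t ↔ HasDerivWithinAt l l' (Ici 0) t := by
  have hk := (hasDerivAt_ka t).hasDerivWithinAt (s := Ici 0)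
  have hT := (hasDerivAt_th t).hasDerivWithinAt (s := Ici 0)
  have hw := (hasDerivAt_wt t).hasDerivWithinAt (s := Ici 0)
  have hne := wt_ne t
  have h := ka_sq_add_th_sq t
  rw [hasDerivWithinAt_triple, hasDerivWithinAt_triple, h1, h2, h3]
  dsimp only [trajOf]
  constructor
  · rintro ⟨d1, d2, d3⟩
    have e1 := ((((hk.const_mul 2).fun_mul d1).fun_sub ((hT.const_mul 2).fun_mul d2)).sub_const
      1).fun_div hw hne
    have e2 := (((hT.const_mul 2).fun_mul d1).fun_add ((hk.const_mul 2).fun_mul d2)).fun_neg.fun_div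
      hw hne
    have e3 := d3.fun_div hw hne
    have k1 : ∀ s, (l s).1 = (2 * ka s * (ka s / 2 + wt s * (ka s * (l s).1 - th s * (l s).2.1) / 2)
        - 2 * th s * (-th s / 2 - wt s * (th s * (l s).1 + ka s * (l s).2.1) / 2) - 1) / wt s := by
      intro s
      have := wt_ne s
      have h := ka_sq_add_th_sq s
      field_simp
      linear_combination (-(1 + wt s * (l s).1)) * h
    have k2 : ∀ s, (l s).2.1 = -(2 * th s * (ka s / 2 + wt s * (ka s * (l s).1
        - th s * (l s).2.1) / 2)
        + 2 * ka s * (-th s / 2 - wt s * (th s * (l s).1 + ka s * (l s).2.1) / 2)) / wt s := by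
      intro s
      have := wt_ne s
      have h := ka_sq_add_th_sq s
      field_simp
      linear_combination (-(l s).2.1 * wt s) * h
    have k3 : ∀ s, (l s).2.2 = wt s * (l s).2.2 / wt s := fun s => by
      have := wt_ne s
      field_simp
    refine ⟨(e1.congr (fun s _ => k1 s) (k1 t)).congr_deriv ?_,
      (e2.congr (fun s _ => k2 s) (k2 t)).congr_deriv ?_,
      (e3.congr (fun s _ => k3 s) (k3 t)).congr_deriv ?_⟩
    · generalize ka t = k at *
      generalize th t = T at *
      generalize wt t = w at *
      clear * - hne h
      field_simp
      grind
    · generalize ka t = k at *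
      generalize th t = T at *
      generalize wt t = w at *
      clear * - hne h
      field_simp
      grind
    · field_simp
      ring
  · rintro ⟨d1, d2, d3⟩
    have e1 := (hk.div_const 2).fun_add
      ((hw.fun_mul ((hk.fun_mul d1).fun_sub (hT.fun_mul d2))).div_const 2)
    have e2 := (hT.fun_neg.div_const 2).fun_sub
      ((hw.fun_mul ((hT.fun_mul d1).fun_add (hk.fun_mul d2))).div_const 2)
    have e3 := hw.fun_mul d3
    refine ⟨e1.congr_deriv ?_, e2.congr_deriv ?_, e3.congr_deriv ?_⟩
    · generalize ka t = k at *
      generalize th t = T at *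
      generalize wt t = w at *
      clear * - hne h
      field_simp
      grind
    · generalize ka t = k at *
      generalize th t = T at *
      generalize wt t = w at *
      clear * - hne h
      field_simp
      grind
    · field_simp
      ring

end FrameEquation

end Z4

namespace Z4

open scoped BoundedContinuousFunction NNReal
open MeasureTheory

section HalfLine

lemma wt_div (s t : ℝ) : wt t = Real.exp (-(1 / 4 * (t - s))) * wt s := by
  rw [wt, wt, ← Real.exp_add]; congr 1; ring

/-- The coordinate transverse to the base orbit: the linearization is trivial in that direction, so
that the coefficient `1 / 4` comes from the weight alone. The initial value of the unique bounded
solution is a Melnikov integral. -/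
lemma exists_transverse_solution :
    ∃ G : BC →L[ℝ] BC, (∀ x n : BC, x = G n ↔ SolvesLinear (fun _ => 1 / 4) x n) ∧
      ∀ n : BC, G n 0 = -∫ s in Ioi (0 : ℝ), wt s * n s.toNNReal := by
  obtain ⟨G, h1, h2⟩ := exists_backward_solution (μ := fun _ => 1 / 4) (m := fun t => (wt t)⁻¹)
    (C := 1) (d := 1 / 4) (fun t => by
      refine ((hasDerivAt_wt t).fun_inv (wt_ne t)).congr_deriv ?_
      have := wt_ne t
      field_simp) (fun t => inv_pos.2 (wt_pos t)) (by norm_num) (fun s t _ _ => by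
      have h1 := wt_ne s
      have h2 := wt_ne t
      rw [wt_div t s]
      have := (Real.exp_pos (-(1 / 4 * (s - t)))).ne'
      field_simp
      exact le_rfl)
  refine ⟨G, h1, fun n => ?_⟩
  rw [h2]
  simp [div_eq_mul_inv, mul_comm]

/-- The coordinate along the base orbit; the condition `x 0 = 0` fixes the phase by starting on the
section. -/
lemma exists_phase_solution :
    ∃ G : BC →L[ℝ] BC, ∀ x n : BC,
      x = G n ↔ SolvesLinear (fun t => 1 / 4 - th t / 2) x n ∧ x 0 = 0 := by
  obtain ⟨G, S, h⟩ := exists_forward_solution (μ := fun t => 1 / 4 - th t / 2)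
    (m := fun t => ka t / wt t) (C := 2) (d := 1 / 4) (fun t => by
      refine ((hasDerivAt_ka t).fun_div (hasDerivAt_wt t) (wt_ne t)).congr_deriv ?_
      have := wt_ne t
      field_simp
      ring) (fun t => div_pos (ka_pos t) (wt_pos t)) (by norm_num) (fun s t hs _ => by
      have h1 := wt_pos s
      have h2 := wt_pos t
      have h3 := ka_le_wt_sq t
      have h4 := wt_sq_le_ka hs
      calc ka t / wt t ≤ 2 * wt t := by rw [div_le_iff₀ h2]; nlinarith
        _ = 2 * Real.exp (-(1 / 4 * (t - s))) * wt s := by rw [wt_div s t]; ring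
        _ ≤ _ := by
          refine mul_le_mul_of_nonneg_left ?_ (by positivity)
          rw [le_div_iff₀ h1]; nlinarith)
  exact ⟨G, fun x n => by simpa using h x n 0⟩

/-- On the half of the connection at `O` the `Y`-direction is stable, and `Y 0` is free. -/
lemma exists_forward_Y :
    ∃ (G : BC →L[ℝ] BC) (S : BC), ∀ (x n : BC) (a : ℝ),
      x = G n + a • S ↔ SolvesLinear (fun t => 1 / 4 + -1 + th t / 2) x n ∧ x 0 = a := by
  refine exists_forward_solution (μ := fun t => 1 / 4 + -1 + th t / 2)
    (m := fun t => wt t ^ 3 / ka t) (C := 2) (d := 1 / 4) (fun t => by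
      refine (((hasDerivAt_wt t).fun_pow 3).fun_div (hasDerivAt_ka t) (ka_pos t).ne').congr_deriv ?_
      have := (ka_pos t).ne'
      field_simp
      ring) (fun t => div_pos (pow_pos (wt_pos t) 3) (ka_pos t)) (by norm_num) (fun s t hs hst => by
      have h1 := wt_pos s
      have h2 := wt_pos t
      have h3 := ka_le_wt_sq s
      have h4 := wt_sq_le_ka (hs.trans hst)
      calc wt t ^ 3 / ka t ≤ wt t := by
            rw [div_le_iff₀ (ka_pos t)]; nlinarith
        _ = 2 * Real.exp (-(1 / 4 * (t - s))) * (wt s / 2) := by rw [wt_div s t]; ring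
        _ ≤ _ := by
          refine mul_le_mul_of_nonneg_left ?_ (by positivity)
          rw [le_div_iff₀ (ka_pos s)]; nlinarith)

/-- On the half of the connection at `O⁺` the `Y`-direction is unstable in reversed time. -/
lemma exists_backward_Y :
    ∃ G : BC →L[ℝ] BC, ∀ x n : BC, x = G n ↔
      SolvesLinear (fun t => 1 / 4 + 1 + th t / 2) x n := by
  obtain ⟨G, h, -⟩ := exists_backward_solution (μ := fun t => 1 / 4 + 1 + th t / 2)
    (m := fun t => (wt t ^ 5 * ka t)⁻¹) (C := 2) (d := 7 / 4) (fun t => by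
      have h1 := (ka_pos t).ne'
      have h2 := wt_ne t
      refine ((((hasDerivAt_wt t).fun_pow 5).fun_mul (hasDerivAt_ka t)).fun_inv
        (by positivity)).congr_deriv ?_
      field_simp
      ring) (fun t => inv_pos.2 (mul_pos (pow_pos (wt_pos t) 5) (ka_pos t))) (by norm_num)
    (fun s t ht hts => by
      have h1 := wt_pos s
      have h2 := wt_pos t
      have h3 := ka_le_wt_sq s
      have h4 := wt_sq_le_ka ht
      have he : wt s ^ 7 = Real.exp (-(7 / 4 * (s - t))) * wt t ^ 7 := by
        rw [wt_div t s, mul_pow, ← Real.exp_nat_mul]; congr 2; push_cast; ring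
      have h5 := ka_pos t
      have h6 := ka_pos s
      rw [← div_eq_mul_inv, inv_eq_one_div, div_le_div_iff₀ (by positivity) (by positivity)]
      calc 1 * (wt s ^ 5 * ka s) ≤ 2 * wt s ^ 7 := by nlinarith [pow_pos h1 5]
        _ = 2 * Real.exp (-(7 / 4 * (s - t))) * wt t ^ 7 := by rw [he]; ring
        _ ≤ 2 * Real.exp (-(7 / 4 * (s - t))) * (wt t ^ 5 * ka t) := by
          refine mul_le_mul_of_nonneg_left ?_ (by positivity)
          nlinarith [pow_pos h2 5])
  exact ⟨G, h⟩

end HalfLine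

end Z4

namespace Z4

open scoped BoundedContinuousFunction NNReal
open MeasureTheory

/-- Bounded curves in the moving frame. -/
abbrev BE := ℝ≥0 →ᵇ E

/-- The three coordinates of a bounded curve. -/
noncomputable def coord (i : Fin 3) : BE →L[ℝ] BC :=
  (match i with
    | 0 => ContinuousLinearMap.fst ℝ ℝ (ℝ × ℝ)
    | 1 => (ContinuousLinearMap.fst ℝ ℝ ℝ).comp (ContinuousLinearMap.snd ℝ ℝ (ℝ × ℝ))
    | 2 => (ContinuousLinearMap.snd ℝ ℝ ℝ).comp
        (ContinuousLinearMap.snd ℝ ℝ (ℝ × ℝ))).compLeftContinuousBounded ℝ≥0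

/-- The three coordinate inclusions. -/
noncomputable def incl (i : Fin 3) : BC →L[ℝ] BE :=
  (match i with
    | 0 => ContinuousLinearMap.inl ℝ ℝ (ℝ × ℝ)
    | 1 => (ContinuousLinearMap.inr ℝ ℝ (ℝ × ℝ)).comp (ContinuousLinearMap.inl ℝ ℝ ℝ)
    | 2 => (ContinuousLinearMap.inr ℝ ℝ (ℝ × ℝ)).comp
        (ContinuousLinearMap.inr ℝ ℝ ℝ)).compLeftContinuousBounded ℝ≥0

@[simp] lemma coord_zero (ξ : BE) (t : ℝ≥0) : coord 0 ξ t = (ξ t).1 := rfl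
@[simp] lemma coord_one (ξ : BE) (t : ℝ≥0) : coord 1 ξ t = (ξ t).2.1 := rfl
@[simp] lemma coord_two (ξ : BE) (t : ℝ≥0) : coord 2 ξ t = (ξ t).2.2 := rfl
@[simp] lemma incl_zero (x : BC) (t : ℝ≥0) : incl 0 x t = (x t, 0, 0) := rfl
@[simp] lemma incl_one (x : BC) (t : ℝ≥0) : incl 1 x t = (0, x t, 0) := rfl
@[simp] lemma incl_two (x : BC) (t : ℝ≥0) : incl 2 x t = (0, 0, x t) := rfl

lemma eq_iff_coord {ξ η : BE} :
    ξ = η ↔ coord 0 ξ = coord 0 η ∧ coord 1 ξ = coord 1 η ∧ coord 2 ξ = coord 2 η := by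
  refine ⟨fun h => by simp [h], fun ⟨h0, h1, h2⟩ => ?_⟩
  ext t
  · exact DFunLike.congr_fun h0 t
  · exact DFunLike.congr_fun h1 t
  · exact DFunLike.congr_fun h2 t

/-- The triple `(p, frame data, ξ)` as a bounded function of time. -/
noncomputable def frameInput (q : Param × BE) : ℝ≥0 →ᵇ Param × FrameData × E :=
  constL ℝ≥0 (Param × FrameData × E) (q.1, 0, 0)
    + (((ContinuousLinearMap.inr ℝ Param (FrameData × E)).comp
        (ContinuousLinearMap.inr ℝ FrameData E)).compLeftContinuousBounded ℝ≥0 q.2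
      + ((ContinuousLinearMap.inr ℝ Param (FrameData × E)).comp
        (ContinuousLinearMap.inl ℝ FrameData E)).compLeftContinuousBounded ℝ≥0 frameData)

lemma frameInput_apply (q : Param × BE) (t : ℝ≥0) :
    frameInput q t = (q.1, frameData t, q.2 t) := by
  simp [frameInput]

/-- The linear part of `frameInput`. -/
noncomputable def frameInputL : Param × BE →L[ℝ] (ℝ≥0 →ᵇ Param × FrameData × E) :=
  ((constL ℝ≥0 (Param × FrameData × E)).comp
      (ContinuousLinearMap.inl ℝ Param (FrameData × E))).comp (ContinuousLinearMap.fst ℝ Param BE)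
    + (((ContinuousLinearMap.inr ℝ Param (FrameData × E)).comp
        (ContinuousLinearMap.inr ℝ FrameData E)).compLeftContinuousBounded ℝ≥0).comp
      (ContinuousLinearMap.snd ℝ Param BE)

lemma frameInputL_apply (q : Param × BE) (t : ℝ≥0) :
    frameInputL q t = (q.1, 0, q.2 t) := by
  simp [frameInputL]

lemma frameInput_eq : frameInput = fun q => frameInputL q + frameInput 0 := by
  funext q
  refine BoundedContinuousFunction.ext fun t => ?_
  simp only [frameInput_apply, BoundedContinuousFunction.add_apply, frameInputL_apply]
  simp

lemma hasFDerivAt_frameInput (q : Param × BE) : HasFDerivAt frameInput frameInputL q := by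
  rw [frameInput_eq]
  exact frameInputL.hasFDerivAt.add_const (frameInput 0)

lemma contDiff_frameInput : ContDiff ℝ ∞ frameInput := by
  rw [frameInput_eq]
  exact frameInputL.contDiff.add contDiff_const

section Nonlinearity

variable {c b : ℝ} {f : Param × E → E} {M : Param × E → E →L[ℝ] E}

/-- The nonlinearity as a map of bounded curves. -/
noncomputable def frameOp (c : ℝ) (hM : ContDiff ℝ ∞ M) (q : Param × BE) : BE :=
  postComp (frameRHS c M) (contDiff_frameRHS c hM).continuous (frameInput q)

lemma frameOp_apply (hM : ContDiff ℝ ∞ M) (q : Param × BE) (t : ℝ≥0) :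
    frameOp c hM q t = frameRHS c M (q.1, frameData t, q.2 t) := by
  rw [frameOp, postComp_apply, frameInput_apply]

lemma contDiff_frameOp (hM : ContDiff ℝ ∞ M) : ContDiff ℝ ∞ (frameOp c hM) :=
  (contDiff_postComp (contDiff_frameRHS c hM)).comp contDiff_frameInput

lemma fderiv_frameOp_apply (hM : ContDiff ℝ ∞ M) (q v : Param × BE) (t : ℝ≥0) :
    fderiv ℝ (frameOp c hM) q v t =
      fderiv ℝ (frameRHS c M) (q.1, frameData t, q.2 t) (v.1, 0, v.2 t) := by
  have hR := contDiff_frameRHS c hM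
  have h1 := hasFDerivAt_postComp (ι := ℝ≥0) hR.continuous (hR.continuous_fderiv (by simp))
    (fun x => (hR.differentiable (by simp) x).hasFDerivAt) (frameInput q)
  have h2 := h1.comp q (hasFDerivAt_frameInput q)
  have h3 : HasFDerivAt (frameOp c hM) _ q := h2
  rw [h3.fderiv, ContinuousLinearMap.comp_apply, pointwiseApply_apply, postComp_apply,
    frameInput_apply, frameInputL_apply]

lemma trajOf_zero (t : ℝ) : trajOf 0 t = baseOrbit t := by
  simp [trajOf, baseOrbit]

/-- The derivative of the nonlinearity at the base orbit. -/
lemma fderiv_frameOp_base (hf : IsHalfFamily c b f) (hM : ContDiff ℝ ∞ M)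
    (hMf : ∀ p x, f (p, eqO + x) = M (p, x) x) (v : Param) (η : BE) (t : ℝ≥0) :
    fderiv ℝ (frameOp c hM) (p0, 0) (v, η) t =
      let D := fderiv ℝ f (p0, baseOrbit t) (v, 0)
      ((2 * ka t * D.1 - 2 * th t * D.2.1) / wt t + 2 * b * th t * ka t * (η t).2.2,
        (-(2 * th t * D.1) - 2 * ka t * D.2.1) / wt t
          + (ka t / 2 * (η t).1 + 2 * b * ka t ^ 2 * (η t).2.2),
        D.2.2 / wt t) := by
  have hR := contDiff_frameRHS c hM
  have hd := (hR.differentiable (by simp) (p0, frameData t, 0)).hasFDerivAt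
  rw [fderiv_frameOp_apply]
  -- the derivative in the direction of the parameters
  have h1 : fderiv ℝ (frameRHS c M) (p0, frameData t, 0) (v, 0, 0) =
      ((2 * ka t * (fderiv ℝ f (p0, baseOrbit t) (v, 0)).1
          - 2 * th t * (fderiv ℝ f (p0, baseOrbit t) (v, 0)).2.1) / wt t,
        (-(2 * th t * (fderiv ℝ f (p0, baseOrbit t) (v, 0)).1)
          - 2 * ka t * (fderiv ℝ f (p0, baseOrbit t) (v, 0)).2.1) / wt t,
        (fderiv ℝ f (p0, baseOrbit t) (v, 0)).2.2 / wt t) := by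
    have hl : HasDerivAt (fun ε : ℝ => ((p0 + ε • v, frameData t, 0) : Param × FrameData × E))
        (v, 0, 0) 0 := by
      have h0 : HasDerivAt (fun ε : ℝ => p0 + ε • v) v 0 := by
        simpa using ((hasDerivAt_id (0 : ℝ)).smul_const v).const_add p0
      exact h0.prodMk (hasDerivAt_const _ _)
    have hl0 : ((p0 + (0 : ℝ) • v, frameData t, 0) : Param × FrameData × E)
        = (p0, frameData t, 0) := by simp
    have e1 := hd.comp_hasDerivAt_of_eq (0 : ℝ) hl hl0.symm
    have hfl : HasDerivAt (fun ε : ℝ => ((p0 + ε • v, baseOrbit t) : Param × E)) (v, 0) 0 := by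
      have h0 : HasDerivAt (fun ε : ℝ => p0 + ε • v) v 0 := by
        simpa using ((hasDerivAt_id (0 : ℝ)).smul_const v).const_add p0
      exact h0.prodMk (hasDerivAt_const _ _)
    have hfl0 : ((p0 + (0 : ℝ) • v, baseOrbit t) : Param × E) = (p0, baseOrbit t) := by simp
    have hfd := (hf.smooth.differentiable (by simp) (p0, baseOrbit t)).hasFDerivAt
    have e2 := hfd.comp_hasDerivAt_of_eq (0 : ℝ) hfl hfl0.symm
    rw [← hasDerivWithinAt_univ, hasDerivWithinAt_triple] at e2
    simp only [hasDerivWithinAt_univ, Function.comp_def] at e2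
    obtain ⟨d1, d2, d3⟩ := e2
    refine e1.unique ?_
    simp only [Function.comp_def, frameRHS_eq hMf, trajOf_zero]
    refine HasDerivAt.prodMk ?_ (HasDerivAt.prodMk ?_ ?_)
    · exact (((d1.const_mul (2 * ka t)).fun_sub (d2.const_mul (2 * th t))).div_const
        (wt t)).add_const _
    · exact ((((((d1.const_mul (2 * th t)).fun_neg).fun_sub (d2.const_mul (2 * ka t))).sub_const
        _).div_const (wt t)).sub_const _).add_const _
    · exact (d3.div_const (wt t)).sub_const _
  -- the derivative in the direction of the curve
  have h2 : fderiv ℝ (frameRHS c M) (p0, frameData t, 0) (0, 0, η t) =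
      (2 * b * th t * ka t * (η t).2.2,
        ka t / 2 * (η t).1 + 2 * b * ka t ^ 2 * (η t).2.2, 0) := by
    have hl : HasDerivAt (fun ε : ℝ => ((p0, frameData t, ε • η t) : Param × FrameData × E))
        (0, 0, η t) 0 := by
      have h0 : HasDerivAt (fun ε : ℝ => ε • η t) (η t) 0 := by
        simpa using (hasDerivAt_id (0 : ℝ)).smul_const (η t)
      exact (hasDerivAt_const _ _).prodMk ((hasDerivAt_const _ _).prodMk h0)
    have hl0 : ((p0, frameData t, (0 : ℝ) • η t) : Param × FrameData × E)
        = (p0, frameData t, 0) := by simp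
    have e1 := hd.comp_hasDerivAt_of_eq (0 : ℝ) hl hl0.symm
    refine e1.unique ?_
    simp only [Function.comp_def, frameRHS_base hf hMf]
    have hlin : ∀ k : ℝ, HasDerivAt (fun ε : ℝ => ε * k) k 0 := fun k => by
      simpa using (hasDerivAt_id (0 : ℝ)).mul_const k
    have hquad : ∀ k : ℝ, HasDerivAt (fun ε : ℝ => ε ^ 2 * k) 0 0 := fun k => by
      simpa using (hasDerivAt_pow 2 (0 : ℝ)).mul_const k
    refine HasDerivAt.prodMk ?_ (HasDerivAt.prodMk ?_ ?_)
    · have h := (hlin (2 * b * th t * ka t * (η t).2.2)).fun_add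
        (hquad (wt t * (-(ka t * (η t).1 - th t * (η t).2.1) * (η t).2.1 / 2
          - 2 * th t * (η t).2.2 ^ 2
          + 2 * b * th t * (ka t * (η t).1 - th t * (η t).2.1) * (η t).2.2)))
      rw [add_zero] at h
      refine h.congr_of_eventuallyEq (Eventually.of_forall fun ε => ?_)
      simp; ring
    · have h := (hlin (ka t / 2 * (η t).1 + 2 * b * ka t ^ 2 * (η t).2.2)).fun_add
        (hquad (wt t * ((ka t * (η t).1 - th t * (η t).2.1) * (η t).1 / 2
          - 2 * ka t * (η t).2.2 ^ 2
          + 2 * b * ka t * (ka t * (η t).1 - th t * (η t).2.1) * (η t).2.2)))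
      rw [add_zero] at h
      refine h.congr_of_eventuallyEq (Eventually.of_forall fun ε => ?_)
      simp; ring
    · refine (hquad (wt t * ((th t * (η t).1 + ka t * (η t).2.1) * (η t).2.2 / 2))
        ).congr_of_eventuallyEq (Eventually.of_forall fun ε => ?_)
      simp; ring
  have h3 : ((v, 0, η t) : Param × FrameData × E) = (v, 0, 0) + (0, 0, η t) := by simp
  change fderiv ℝ (frameRHS c M) (p0, frameData t, 0) (v, 0, η t) = _
  rw [h3, map_add, h1, h2]
  ext <;> simp

/-- Being a half-solution is a system of three scalar linear equations with the nonlinearity on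
the right. -/
lemma isHalfSolution_iff (hM : ContDiff ℝ ∞ M)
    (hMf : ∀ p x, f (p, eqO + x) = M (p, x) x) (p : Param) (ξ : BE) :
    IsHalfSolution f p ξ ↔
      SolvesLinear (fun _ => 1 / 4) (coord 0 ξ) (coord 0 (frameOp c hM (p, ξ))) ∧
      (SolvesLinear (fun t => 1 / 4 - th t / 2) (coord 1 ξ) (coord 1 (frameOp c hM (p, ξ))) ∧
        coord 1 ξ 0 = 0) ∧
      SolvesLinear (fun t => 1 / 4 + c + th t / 2) (coord 2 ξ)
        (coord 2 (frameOp c hM (p, ξ))) := by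
  have key : ∀ t : ℝ, 0 ≤ t → (HasDerivWithinAt (traj ξ) (f (p, traj ξ t)) (Ici 0) t ↔
      HasDerivWithinAt (fun t : ℝ => coord 0 ξ t.toNNReal)
        (1 / 4 * coord 0 ξ t.toNNReal + coord 0 (frameOp c hM (p, ξ)) t.toNNReal) (Ici 0) t ∧
      HasDerivWithinAt (fun t : ℝ => coord 1 ξ t.toNNReal)
        ((1 / 4 - th t / 2) * coord 1 ξ t.toNNReal + coord 1 (frameOp c hM (p, ξ)) t.toNNReal)
        (Ici 0) t ∧
      HasDerivWithinAt (fun t : ℝ => coord 2 ξ t.toNNReal)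
        ((1 / 4 + c + th t / 2) * coord 2 ξ t.toNNReal
          + coord 2 (frameOp c hM (p, ξ)) t.toNNReal) (Ici 0) t) := by
    intro t ht
    have e := frameOp_apply (c := c) hM (p, ξ) t.toNNReal
    rw [frameRHS_eq hMf, Real.coe_toNNReal t ht] at e
    have h := hasDerivWithinAt_trajOf_iff (c := c) (l := fun t : ℝ => ξ t.toNNReal)
      (F := f (p, traj ξ t)) (t := t)
      (l' := (1 / 4 * coord 0 ξ t.toNNReal + coord 0 (frameOp c hM (p, ξ)) t.toNNReal,
        (1 / 4 - th t / 2) * coord 1 ξ t.toNNReal + coord 1 (frameOp c hM (p, ξ)) t.toNNReal,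
        (1 / 4 + c + th t / 2) * coord 2 ξ t.toNNReal
          + coord 2 (frameOp c hM (p, ξ)) t.toNNReal))
      (by simp only [coord_zero, e]; rfl) (by simp only [coord_one, e]; rfl)
      (by simp only [coord_two, e]; rfl)
    rw [hasDerivWithinAt_triple (g := fun t : ℝ => ξ t.toNNReal)] at h
    exact h
  constructor
  · rintro ⟨h, h0⟩
    exact ⟨fun t ht => ((key t ht).1 (h t ht)).1, ⟨fun t ht => ((key t ht).1 (h t ht)).2.1, h0⟩,
      fun t ht => ((key t ht).1 (h t ht)).2.2⟩
  · rintro ⟨h1, ⟨h2, h0⟩, h3⟩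
    exact ⟨fun t ht => (key t ht).2 ⟨h1 t ht, h2 t ht, h3 t ht⟩, h0⟩

end Nonlinearity

end Z4

namespace Z4

open scoped BoundedContinuousFunction NNReal
open MeasureTheory

/-- If `K ^ 3 = 0` then `1 - K` is invertible. -/
lemma isInvertible_id_sub_of_cube {X : Type*} [NormedAddCommGroup X] [NormedSpace ℝ X]
    (K : X →L[ℝ] X) (h : ∀ x, K (K (K x)) = 0) :
    (ContinuousLinearMap.id ℝ X - K).IsInvertible := by
  refine ⟨ContinuousLinearEquiv.equivOfInverse (ContinuousLinearMap.id ℝ X - K)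
    (ContinuousLinearMap.id ℝ X + K + K.comp K) (fun x => ?_) (fun x => ?_), rfl⟩
  · simp [h]
  · simp [h]

/-- Half-solutions near the base orbit form a smooth family: they are the values of a smooth map
`ψ` of the parameters and of the initial value `a` of `Y` (where that one is free). The last
conjunct is the variational equation along the base orbit, in the components that matter. -/
theorem exists_half_solutions {c b : ℝ} {f : Param × E → E} (hf : IsHalfFamily c b f)
    (Gy : BC →L[ℝ] BC) (Sy : BC) (Bd : ℝ → ℝ → Prop)
    (hy : ∀ (x n : BC) (a : ℝ), x = Gy n + a • Sy ↔
      SolvesLinear (fun t => 1 / 4 + c + th t / 2) x n ∧ Bd a (x 0)) :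
    ∃ ψ : Param × ℝ → BE, ψ (p0, 0) = 0 ∧ (∀ᶠ q in 𝓝 (p0, (0 : ℝ)), ContDiffAt ℝ ∞ ψ q) ∧
      (∀ᶠ v in 𝓝 ((p0, (0 : ℝ)), (0 : BE)),
        (IsHalfSolution f v.1.1 v.2 ∧ Bd v.1.2 (v.2 0).2.2) ↔ ψ v.1 = v.2) ∧
      ∀ (v : Param) (a : ℝ), ∃ n : BC,
        (∀ t : ℝ≥0, n t = (fderiv ℝ f (p0, baseOrbit t) (v, 0)).2.2 / wt t) ∧
        SolvesLinear (fun t => 1 / 4 + c + th t / 2)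
          (coord 2 (fderiv ℝ ψ (p0, 0) (v, a))) n ∧
        Bd a (coord 2 (fderiv ℝ ψ (p0, 0) (v, a)) 0) ∧
        (fderiv ℝ ψ (p0, 0) (v, a) 0).1 = -∫ s in Ioi (0 : ℝ),
          (2 * ka s * (fderiv ℝ f (p0, baseOrbit s) (v, 0)).1
            - 2 * th s * (fderiv ℝ f (p0, baseOrbit s) (v, 0)).2.1
            + 2 * b * th s * ka s
              * (wt s * coord 2 (fderiv ℝ ψ (p0, 0) (v, a)) s.toNNReal)) := by
  obtain ⟨M, hM, hMf⟩ := exists_smooth_factor (f := fun q : Param × E => f (q.1, eqO + q.2))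
    (hf.smooth.comp (by fun_prop)) (fun p => by simpa using hf.equilibrium p)
  obtain ⟨Gr, hr, hr0⟩ := exists_transverse_solution
  obtain ⟨Gt, ht⟩ := exists_phase_solution
  let G : BE →L[ℝ] BE := (incl 0).comp (Gr.comp (coord 0)) + (incl 1).comp (Gt.comp (coord 1))
    + (incl 2).comp (Gy.comp (coord 2))
  have hG0 : ∀ ξ, coord 0 (G ξ) = Gr (coord 0 ξ) := fun ξ => by
    ext t; simp [G]
  have hG1 : ∀ ξ, coord 1 (G ξ) = Gt (coord 1 ξ) := fun ξ => by
    ext t; simp [G]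
  have hG2 : ∀ ξ, coord 2 (G ξ) = Gy (coord 2 ξ) := fun ξ => by
    ext t; simp [G]
  have hS0 : coord 0 (incl 2 Sy) = 0 := by ext t; simp
  have hS1 : coord 1 (incl 2 Sy) = 0 := by ext t; simp
  have hS2 : coord 2 (incl 2 Sy) = Sy := by ext t; simp
  -- the equation `ξ = G (N (p, ξ)) + a S`, first for a general right-hand side
  have hcomp : ∀ (ξ n : BE) (a : ℝ), ξ = G n + a • incl 2 Sy ↔
      SolvesLinear (fun _ => 1 / 4) (coord 0 ξ) (coord 0 n) ∧
      (SolvesLinear (fun t => 1 / 4 - th t / 2) (coord 1 ξ) (coord 1 n) ∧ coord 1 ξ 0 = 0) ∧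
      SolvesLinear (fun t => 1 / 4 + c + th t / 2) (coord 2 ξ) (coord 2 n) ∧
      Bd a (coord 2 ξ 0) := by
    intro ξ n a
    rw [eq_iff_coord]
    simp only [map_add, map_smul, hG0, hG1, hG2, hS0, hS1, hS2, smul_zero, add_zero]
    rw [hr, ht, hy]
  let Φ : (Param × ℝ) × BE → BE := fun q =>
    q.2 - G (frameOp c hM (q.1.1, q.2)) - q.1.2 • incl 2 Sy
  have hΦ : ∀ q : (Param × ℝ) × BE, Φ q = 0 ↔
      IsHalfSolution f q.1.1 q.2 ∧ Bd q.1.2 (q.2 0).2.2 := by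
    intro q
    rw [isHalfSolution_iff (c := c) hM hMf]
    have := hcomp q.2 (frameOp c hM (q.1.1, q.2)) q.1.2
    simp only [Φ, sub_sub, sub_eq_zero]
    rw [this]
    simp only [coord_two]
    tauto
  have hN := contDiff_frameOp (c := c) hM
  have hΦs : ContDiff ℝ ∞ Φ := by
    have h1 : ContDiff ℝ ∞ fun q : (Param × ℝ) × BE => frameOp c hM (q.1.1, q.2) :=
      hN.comp (by fun_prop)
    exact (contDiff_snd.sub (G.contDiff.comp h1)).sub (by fun_prop)
  have hzero : frameOp c hM (p0, 0) = 0 := by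
    refine BoundedContinuousFunction.ext fun t => ?_
    rw [frameOp_apply, frameRHS_base hf hMf]
    simp
  have hS3 : (0 : ℝ) • incl 2 Sy = 0 := by ext t <;> simp
  have hf0 : ∀ t : ℝ≥0, fderiv ℝ f (p0, baseOrbit t) (0, 0) = 0 := fun t => map_zero _
  have hΦ0 : Φ ((p0, 0), 0) = 0 := by simp [Φ, hzero, hS3]
  have hΦd : ∀ (v : Param) (a : ℝ) (η : BE), fderiv ℝ Φ ((p0, 0), 0) ((v, a), η) =
      η - G (fderiv ℝ (frameOp c hM) (p0, 0) (v, η)) - a • incl 2 Sy := by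
    intro v a η
    have h1 := (hN.differentiable (by simp) (p0, (0 : BE))).hasFDerivAt
    let J : (Param × ℝ) × BE →L[ℝ] Param × BE :=
      ((ContinuousLinearMap.fst ℝ Param ℝ).comp (ContinuousLinearMap.fst ℝ (Param × ℝ) BE)).prod
        (ContinuousLinearMap.snd ℝ (Param × ℝ) BE)
    have hJ : HasFDerivAt (fun q : (Param × ℝ) × BE => (q.1.1, q.2)) J ((p0, 0), 0) :=
      J.hasFDerivAt
    have h2 := G.hasFDerivAt.comp ((p0, (0 : ℝ)), (0 : BE))
      (HasFDerivAt.comp ((p0, (0 : ℝ)), (0 : BE)) h1 hJ)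
    have h3 : HasFDerivAt (fun q : (Param × ℝ) × BE => q.1.2 • incl 2 Sy)
        (((ContinuousLinearMap.snd ℝ Param ℝ).comp
          (ContinuousLinearMap.fst ℝ (Param × ℝ) BE)).smulRight (incl 2 Sy)) ((p0, 0), 0) :=
      (((ContinuousLinearMap.snd ℝ Param ℝ).comp
          (ContinuousLinearMap.fst ℝ (Param × ℝ) BE)).smulRight (incl 2 Sy)).hasFDerivAt
    have h4 : HasFDerivAt Φ _ ((p0, 0), 0) := (hasFDerivAt_snd.sub h2).sub h3
    rw [h4.fderiv]
    rfl
  have hbase := fderiv_frameOp_base (c := c) hf hM hMf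
  have hinv : (fderiv ℝ Φ ((p0, 0), 0) ∘L .inr ℝ (Param × ℝ) BE).IsInvertible := by
    -- `K` is strictly triangular: coordinate 2 acts on coordinate 0, and both act on coordinate 1
    let K : BE →L[ℝ] BE := G.comp ((fderiv ℝ (frameOp c hM) (p0, 0)).comp
      (ContinuousLinearMap.inr ℝ Param BE))
    have hK : fderiv ℝ Φ ((p0, 0), 0) ∘L .inr ℝ (Param × ℝ) BE
        = ContinuousLinearMap.id ℝ BE - K := by
      ext1 η
      have := hΦd 0 0 η
      rw [hS3, sub_zero] at this
      exact this
    rw [hK]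
    have k2 : ∀ η, coord 2 (K η) = 0 := fun η => by
      have : coord 2 (fderiv ℝ (frameOp c hM) (p0, 0) (0, η)) = 0 := by
        ext t
        rw [coord_two, hbase]
        simp [hf0]
      change coord 2 (G (fderiv ℝ (frameOp c hM) (p0, 0) (0, η))) = 0
      rw [hG2, this, map_zero]
    have k0 : ∀ η, coord 2 η = 0 → coord 0 (K η) = 0 := fun η h => by
      have : coord 0 (fderiv ℝ (frameOp c hM) (p0, 0) (0, η)) = 0 := by
        ext t
        have h' : (η t).2.2 = 0 := DFunLike.congr_fun h t
        rw [coord_zero, hbase]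
        simp [h', hf0]
      change coord 0 (G (fderiv ℝ (frameOp c hM) (p0, 0) (0, η))) = 0
      rw [hG0, this, map_zero]
    have k1 : ∀ η, coord 2 η = 0 → coord 0 η = 0 → coord 1 (K η) = 0 := fun η h h2 => by
      have : coord 1 (fderiv ℝ (frameOp c hM) (p0, 0) (0, η)) = 0 := by
        ext t
        have h' : (η t).2.2 = 0 := DFunLike.congr_fun h t
        have h'' : (η t).1 = 0 := DFunLike.congr_fun h2 t
        rw [coord_one, hbase]
        simp [h', h'', hf0]
      change coord 1 (G (fderiv ℝ (frameOp c hM) (p0, 0) (0, η))) = 0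
      rw [hG1, this, map_zero]
    refine isInvertible_id_sub_of_cube K fun η => ?_
    rw [eq_iff_coord]
    simp only [map_zero]
    exact ⟨k0 _ (k2 _), k1 _ (k2 _) (k0 _ (k2 _)), k2 _⟩
  obtain ⟨ψ, hψ0, hψs, hψ⟩ := exists_smooth_implicit (q₀ := (p0, (0 : ℝ))) (x₀ := (0 : BE))
    (Eventually.of_forall fun v => hΦs.contDiffAt) hΦ0 hinv
  refine ⟨ψ, hψ0, hψs, ?_, fun v a => ?_⟩
  · filter_upwards [hψ] with v hv
    rw [← hΦ, hv]
  · have hψd : DifferentiableAt ℝ ψ (p0, 0) := hψs.self_of_nhds.differentiableAt (by simp)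
    set η := fderiv ℝ ψ (p0, 0) (v, a) with hη
    -- differentiate the identity `Φ (q, ψ q) = 0`
    have hcont : Tendsto (fun q => (q, ψ q)) (𝓝 (p0, (0 : ℝ))) (𝓝 ((p0, 0), 0)) := by
      have : ContinuousAt (fun q => (q, ψ q)) (p0, (0 : ℝ)) :=
        continuousAt_id.prodMk hψd.continuousAt
      simpa [ContinuousAt, hψ0] using this
    have hid : (fun q => Φ (q, ψ q)) =ᶠ[𝓝 (p0, (0 : ℝ))] fun _ => 0 := by
      filter_upwards [hcont.eventually hψ] with q hq
      exact hq.2 rfl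
    have hpair : HasFDerivAt (fun q => (q, ψ q))
        ((ContinuousLinearMap.id ℝ (Param × ℝ)).prod (fderiv ℝ ψ (p0, 0))) (p0, (0 : ℝ)) :=
      (hasFDerivAt_id _).prodMk hψd.hasFDerivAt
    have hΦda : HasFDerivAt Φ (fderiv ℝ Φ ((p0, 0), 0)) ((p0, 0), ψ (p0, 0)) := by
      rw [hψ0]; exact (hΦs.differentiable (by simp) _).hasFDerivAt
    have h1 : HasFDerivAt (fun q => Φ (q, ψ q)) _ (p0, (0 : ℝ)) :=
      HasFDerivAt.comp (p0, (0 : ℝ)) hΦda hpair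
    have h2 : HasFDerivAt (fun q => Φ (q, ψ q)) (0 : Param × ℝ →L[ℝ] BE) (p0, (0 : ℝ)) :=
      (hasFDerivAt_const (0 : BE) _).congr_of_eventuallyEq hid
    have h3 := DFunLike.congr_fun (h1.unique h2) (v, a)
    have h4 : fderiv ℝ Φ ((p0, 0), 0) ((v, a), η) = 0 := h3
    rw [hΦd, sub_sub, sub_eq_zero] at h4
    obtain ⟨s0, -, s2, s3⟩ := (hcomp η _ a).1 h4
    refine ⟨_, fun t => ?_, s2, s3, ?_⟩
    · rw [coord_two, hbase]
    · have h5 := (hr _ _).2 s0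
      have h6 := hr0 (coord 0 (fderiv ℝ (frameOp c hM) (p0, 0) (v, η)))
      rw [← h5] at h6
      rw [← coord_zero, h6]
      congr 1
      refine setIntegral_congr_fun measurableSet_Ioi fun s hs => ?_
      have hw := wt_ne s
      rw [coord_zero, hbase, Real.coe_toNNReal s (le_of_lt hs)]
      simp only [coord_two]
      field_simp

end Z4

namespace Z4

open MeasureTheory

/-! ### The integrals over the unperturbed connection -/

lemma integral_pow_mul_log (n : ℕ) :
    ∫ z in (0 : ℝ)..1, z ^ n * -Real.log z = 1 / ((n : ℝ) + 1) ^ 2 := by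
  have hn : (n : ℝ) + 1 ≠ 0 := by positivity
  have h := intervalIntegral.integral_eq_sub_of_hasDerivAt_of_le (a := 0) (b := 1)
    (f := fun z : ℝ => z ^ n * (-(z * Real.log z)) / (n + 1) + z ^ (n + 1) / (n + 1) ^ 2)
    (f' := fun z => z ^ n * -Real.log z) zero_le_one
    (by
      have := Real.continuous_mul_log
      exact Continuous.continuousOn (by fun_prop))
    (fun z hz => by
      have hz0 := hz.1.ne'
      have h1 : HasDerivAt (fun z : ℝ => -(z * Real.log z)) (-(Real.log z + 1)) z := by
        refine ((hasDerivAt_id z).fun_mul (Real.hasDerivAt_log hz0)).fun_neg.congr_deriv ?_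
        simp [hz0]
      rcases n with _ | n
      · have := ((h1.const_mul 1).div_const (1 : ℝ)).fun_add
          ((hasDerivAt_id z).div_const (1 : ℝ))
        refine (this.congr_deriv ?_).congr_of_eventuallyEq
          (Eventually.of_forall fun y => ?_)
        · simp
        · beta_reduce
          rw [Nat.cast_zero, id]
          ring
      · have := (((hasDerivAt_pow (n + 1) z).fun_mul h1).div_const (((n + 1 : ℕ) : ℝ) + 1)).fun_add
          ((hasDerivAt_pow (n + 1 + 1) z).div_const ((((n + 1 : ℕ) : ℝ) + 1) ^ 2))
        refine this.congr_deriv ?_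
        push_cast at hn ⊢
        field_simp
        ring)
    ((intervalIntegral.intervalIntegrable_log').neg.continuousOn_mul (by fun_prop))
  rw [h]
  simp

lemma integrable_pow_mul_log (n : ℕ) :
    IntegrableOn (fun z : ℝ => z ^ n * -Real.log z) (Ioc 0 1) :=
  (intervalIntegrable_iff_integrableOn_Ioc_of_le zero_le_one).1
    ((intervalIntegral.intervalIntegrable_log').neg.continuousOn_mul (by fun_prop))

/-- The dilogarithm integral behind the term `π ^ 2` of the expansion. -/
lemma integral_log_div_one_sub :
    ∫ z in (0 : ℝ)..1, -Real.log z / (1 - z) = Real.pi ^ 2 / 6 := by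
  have hnn : ∀ z ∈ Ioc (0 : ℝ) 1, 0 ≤ -Real.log z := fun z hz => by
    have := Real.log_nonpos hz.1.le hz.2; linarith
  have hint : ∀ n : ℕ, ∫ z in Ioc (0 : ℝ) 1, z ^ n * -Real.log z = 1 / ((n : ℝ) + 1) ^ 2 :=
    fun n => by rw [← intervalIntegral.integral_of_le zero_le_one, integral_pow_mul_log]
  have hz2 : HasSum (fun n : ℕ => 1 / ((n : ℝ) + 1) ^ 2) (Real.pi ^ 2 / 6) := by
    have := (hasSum_nat_add_iff' 1).2 hasSum_zeta_two
    simpa using this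
  have h := hasSum_integral_of_summable_integral_norm
    (μ := volume.restrict (Ioc (0 : ℝ) 1)) (F := fun n (z : ℝ) => z ^ n * -Real.log z)
    (fun n => integrable_pow_mul_log n) (by
      refine hz2.summable.congr fun n => ?_
      rw [← hint n]
      refine setIntegral_congr_fun measurableSet_Ioc fun z hz => ?_
      exact (Real.norm_of_nonneg (mul_nonneg (pow_nonneg hz.1.le n) (hnn z hz))).symm)
  simp only [hint] at h
  rw [intervalIntegral.integral_of_le zero_le_one, ← h.unique hz2,
    integral_Ioc_eq_integral_Ioo, integral_Ioc_eq_integral_Ioo]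
  refine setIntegral_congr_fun measurableSet_Ioo fun z hz => ?_
  rw [tsum_mul_right, tsum_geometric_of_lt_one hz.1.le hz.2]
  field_simp

/-- The function `(-log z - (1 - z)) / (1 - z) ^ 2`; multiplied by `X` it is the response of `Y`
to the rotation `ω` along the unperturbed connection, written in the coordinate `z`. -/
noncomputable def logKernel (z : ℝ) : ℝ := (-Real.log z - (1 - z)) / (1 - z) ^ 2

lemma logKernel_nonneg {z : ℝ} (hz : 0 < z) : 0 ≤ logKernel z := by
  have := Real.log_le_sub_one_of_pos hz
  exact div_nonneg (by linarith) (sq_nonneg _)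

lemma logKernel_le {z : ℝ} (h0 : 0 < z) (h1 : z < 1) : logKernel z ≤ 2 + 4 * -Real.log z := by
  have hl := Real.log_neg h0 h1
  have hp : 0 < (1 - z) ^ 2 := pow_pos (by linarith) 2
  rw [logKernel, div_le_iff₀ hp]
  rcases le_total z (1 / 2) with h | h
  · have : 1 / 4 ≤ (1 - z) ^ 2 := by nlinarith
    nlinarith
  · have h2 := Real.log_le_sub_one_of_pos (inv_pos.2 h0)
    rw [Real.log_inv] at h2
    have h3 : z⁻¹ - 1 - (1 - z) ≤ 2 * (1 - z) ^ 2 := by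
      have : z⁻¹ - 1 - (1 - z) = (1 - z) ^ 2 * z⁻¹ := by field_simp
      rw [this, mul_comm]
      refine mul_le_mul_of_nonneg_right ?_ hp.le
      rw [inv_le_comm₀ h0 (by norm_num)]; linarith
    nlinarith

lemma hasDerivAt_logKernel {z : ℝ} (h0 : 0 < z) (h1 : z < 1) :
    HasDerivAt logKernel ((2 * z * logKernel z - 1) / (z * (1 - z))) z := by
  have hne : (1 - z) ≠ 0 := by linarith
  have e := (((Real.hasDerivAt_log h0.ne').fun_neg).fun_sub ((hasDerivAt_id z).const_sub 1)).fun_div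
    (((hasDerivAt_id z).const_sub 1).fun_pow 2) (pow_ne_zero 2 hne)
  refine e.congr_deriv ?_
  unfold logKernel
  simp only [id]
  field_simp
  ring

lemma continuousOn_logKernel : ContinuousOn logKernel (Ioo 0 1) := fun _ hz =>
  (hasDerivAt_logKernel hz.1 hz.2).continuousAt.continuousWithinAt

lemma integrableOn_logKernel : IntegrableOn logKernel (Ioo 0 1) := by
  have h1 : IntegrableOn (fun z : ℝ => 2 + 4 * -Real.log z) (Ioo 0 1) := by
    have h := (intervalIntegrable_iff_integrableOn_Ioo_of_le (μ := volume) zero_le_one).1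
      (intervalIntegral.intervalIntegrable_log' (a := 0) (b := 1))
    exact (integrableOn_const (by simp)).add (h.neg.const_mul 4)
  refine Integrable.mono' h1 (continuousOn_logKernel.aestronglyMeasurable measurableSet_Ioo) ?_
  refine (ae_restrict_iff' measurableSet_Ioo).2 (Eventually.of_forall fun z hz => ?_)
  rw [Real.norm_of_nonneg (logKernel_nonneg hz.1)]
  exact logKernel_le hz.1 hz.2

lemma intervalIntegrable_logKernel : IntervalIntegrable logKernel volume 0 1 :=
  (intervalIntegrable_iff_integrableOn_Ioo_of_le zero_le_one).2 integrableOn_logKernel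

lemma integral_logKernel : ∫ z in (0 : ℝ)..1, logKernel z = 1 := by
  have hd : ∀ z ∈ Ioo (0 : ℝ) 1,
      HasDerivAt (fun z => -(z * Real.log z) / (1 - z)) (logKernel z) z := by
    intro z hz
    have h0 := hz.1.ne'
    have hne : (1 - z) ≠ 0 := by linarith [hz.2]
    have e := (((hasDerivAt_id z).fun_mul (Real.hasDerivAt_log h0)).fun_neg).fun_div
      ((hasDerivAt_id z).const_sub 1) hne
    refine e.congr_deriv ?_
    unfold logKernel
    simp only [id]
    field_simp
    ring
  have ha : Tendsto (fun z => -(z * Real.log z) / (1 - z)) (𝓝[>] 0) (𝓝 0) := by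
    have : ContinuousAt (fun z => -(z * Real.log z) / (1 - z)) 0 :=
      (Real.continuous_mul_log.neg.continuousAt).div (by fun_prop) (by norm_num)
    have h := this.tendsto
    simp only [zero_mul, neg_zero, zero_div] at h
    exact h.mono_left nhdsWithin_le_nhds
  have hb : Tendsto (fun z => -(z * Real.log z) / (1 - z)) (𝓝[<] 1) (𝓝 1) := by
    have h : HasDerivAt (fun z => z * Real.log z) 1 1 := by
      simpa using (hasDerivAt_id (1 : ℝ)).fun_mul (Real.hasDerivAt_log one_ne_zero)
    have h2 := h.tendsto_slope
    refine (h2.mono_left (nhdsWithin_mono 1 fun z hz => (ne_of_lt hz))).congr fun z => ?_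
    rw [slope_def_field, Real.log_one, mul_zero, sub_zero, ← neg_div_neg_eq, neg_sub]
  rw [intervalIntegral.integral_eq_sub_of_hasDerivAt_of_tendsto zero_lt_one hd
    intervalIntegrable_logKernel ha hb]
  norm_num

lemma integral_mul_logKernel :
    ∫ z in (0 : ℝ)..1, (1 - 2 * z) * logKernel z = -(9 - Real.pi ^ 2) / 3 := by
  have h1 : ∫ z in (0 : ℝ)..1, ((1 - z) * logKernel z + 1) = Real.pi ^ 2 / 6 := by
    rw [← integral_log_div_one_sub, intervalIntegral.integral_of_le zero_le_one,
      intervalIntegral.integral_of_le zero_le_one,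
      integral_Ioc_eq_integral_Ioo, integral_Ioc_eq_integral_Ioo]
    refine setIntegral_congr_fun measurableSet_Ioo fun z hz => ?_
    have hne : (1 - z) ≠ 0 := by linarith [hz.2]
    simp only [logKernel]
    field_simp
    ring
  have hi : IntervalIntegrable (fun z => (1 - z) * logKernel z) volume 0 1 :=
    intervalIntegrable_logKernel.continuousOn_mul (by fun_prop)
  rw [intervalIntegral.integral_add hi (by simp)] at h1
  have h2 : ∀ z, (1 - 2 * z) * logKernel z = 2 * ((1 - z) * logKernel z) - logKernel z :=
    fun z => by ring
  simp only [h2]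
  rw [intervalIntegral.integral_sub (hi.const_mul 2) intervalIntegrable_logKernel,
    intervalIntegral.integral_const_mul, integral_logKernel]
  simp at h1
  linarith

end Z4

namespace Z4

open scoped BoundedContinuousFunction NNReal
open MeasureTheory

/-! ### The normalized family in real coordinates -/

/-- The rescaled family in the real coordinates `(X, Z, Y)`, where `√(2 |A|) u = X + i Y`
and `Z = z - 1 / 2`; the unperturbed part is normalized to `A = -1 / 2`, with `b = B / |A|`. The
perturbation `g` is only specified along the plane `Y = 0` at the base parameter. -/
structure NormalFamily where
  b : Param → ℝ
  g : Param × E → E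
  (α₁ α₂ β₁ β₂ γ₀ γ₁ : ℝ)
  b_smooth : ContDiff ℝ ∞ b
  g_smooth : ContDiff ℝ ∞ g
  g_rot : ∀ p X Z Y, g (p, (-X, Z, -Y)) =
    (-(g (p, (X, Z, Y))).1, (g (p, (X, Z, Y))).2.1, -(g (p, (X, Z, Y))).2.2)
  g_bot : ∀ p, (g (p, (0, -1 / 2, 0))).2.1 = 0
  g_top : ∀ p, (g (p, (0, 1 / 2, 0))).2.1 = 0
  g_base : ∀ X Z, g (p0, (X, Z, 0)) =
    (X * (α₁ * X ^ 2 + α₂ * (Z + 1 / 2) ^ 2),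
      γ₀ * ((Z + 1 / 2) - (Z + 1 / 2) ^ 3) + γ₁ * (Z + 1 / 2) * X ^ 2,
      X * (β₁ * X ^ 2 + β₂ * (Z + 1 / 2) ^ 2))
  γ₀_pos : 0 < γ₀

/-- The coordinate `z` along the half `σ` of the unperturbed connection. -/
noncomputable def zOrbit (σ t : ℝ) : ℝ := (1 + σ * th t) / 2

namespace NormalFamily

variable (N : NormalFamily)

/-- The vector field of the normalized family. -/
noncomputable def field (q : Param × E) : E :=
  ((q.2.2.1 + 1 / 2 - q.1.1) * q.2.1 - q.1.2.1 * q.2.2.2 + q.1.2.2 * (N.g q).1,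
    -(q.2.1 ^ 2 - q.2.2.2 ^ 2) - 2 * N.b q.1 * q.2.1 * q.2.2.2 + q.1.2.2 * (N.g q).2.1,
    -((q.2.2.1 + 1 / 2 + q.1.1) * q.2.2.2) + q.1.2.1 * q.2.1 + q.1.2.2 * (N.g q).2.2)

lemma contDiff_field : ContDiff ℝ ∞ N.field := by
  have h1 := N.b_smooth
  have h2 := N.g_smooth
  unfold field
  have hb : ContDiff ℝ ∞ fun q : Param × E => N.b q.1 := h1.comp contDiff_fst
  fun_prop

/-- The two halves of the family: `σ = -1` is the family itself; `σ = 1` is the family with time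
reversed and `Z` reflected, so that `O⁺` takes the place of `O`. -/
noncomputable def half (σ : ℝ) (q : Param × E) : E :=
  let F := N.field (q.1, (q.2.1, -σ * q.2.2.1, q.2.2.2))
  (-σ * F.1, F.2.1, -σ * F.2.2)

lemma contDiff_half (σ : ℝ) : ContDiff ℝ ∞ (N.half σ) := by
  have h : ContDiff ℝ ∞ fun q : Param × E => N.field (q.1, (q.2.1, -σ * q.2.2.1, q.2.2.2)) :=
    N.contDiff_field.comp (by fun_prop)
  unfold half
  fun_prop

lemma g_axis (p : Param) (Z : ℝ) : (N.g (p, (0, Z, 0))).1 = 0 ∧ (N.g (p, (0, Z, 0))).2.2 = 0 := by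
  have h := N.g_rot p 0 Z 0
  rw [neg_zero] at h
  have h1 := congrArg Prod.fst h
  have h2 := congrArg (fun x => x.2.2) h
  dsimp only at h1 h2
  constructor <;> linarith

lemma isHalfFamily {σ : ℝ} (hσ : σ = 1 ∨ σ = -1) : IsHalfFamily σ (N.b p0) (N.half σ) where
  smooth := N.contDiff_half σ
  equilibrium p := by
    have h : (N.g (p, (0, -σ * (-1 / 2), 0))).2.1 = 0 := by
      rcases hσ with rfl | rfl
      · convert N.g_top p using 6; norm_num
      · convert N.g_bot p using 6; norm_num
    have h2 := N.g_axis p (-σ * (-1 / 2))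
    simp only [half, field, eqO, h, h2]
    simp
  base X Z Y := by
    rcases hσ with rfl | rfl <;>
      refine Prod.ext ?_ (Prod.ext ?_ ?_) <;> dsimp only [half, field, p0] <;> ring

lemma fderiv_half (σ : ℝ) (v : Param) (t : ℝ) :
    fderiv ℝ (N.half σ) (p0, baseOrbit t) (v, 0) =
      (σ * (ka t / 2) * (v.1 - v.2.2 * (N.α₁ * (ka t / 2) ^ 2 + N.α₂ * zOrbit σ t ^ 2)),
        v.2.2 * (N.γ₀ * (zOrbit σ t - zOrbit σ t ^ 3) + N.γ₁ * zOrbit σ t * (ka t / 2) ^ 2),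
        -σ * (ka t / 2) * (v.2.1 + v.2.2 * (N.β₁ * (ka t / 2) ^ 2 + N.β₂ * zOrbit σ t ^ 2))) := by
  have hp : HasDerivAt (fun ε : ℝ => p0 + ε • v) v 0 := by
    simpa using ((hasDerivAt_id (0 : ℝ)).smul_const v).const_add p0
  have hl : HasDerivAt (fun ε : ℝ => ((p0 + ε • v, baseOrbit t) : Param × E)) (v, 0) 0 :=
    hp.prodMk (hasDerivAt_const _ _)
  have hl0 : ((p0 + (0 : ℝ) • v, baseOrbit t) : Param × E) = (p0, baseOrbit t) := by simp
  have e1 := (((N.contDiff_half σ).differentiable (by simp)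
    (p0, baseOrbit t)).hasFDerivAt).comp_hasDerivAt_of_eq (0 : ℝ) hl hl0.symm
  refine e1.unique ?_
  set x : E := (ka t / 2, -σ * (-th t / 2), 0) with hx
  have hg : DifferentiableAt ℝ (fun ε : ℝ => N.g (p0 + ε • v, x)) 0 :=
    ((N.g_smooth.differentiable (by simp)).comp (by fun_prop : Differentiable ℝ
      fun ε : ℝ => ((p0 + ε • v, x) : Param × E))) 0
  have hg0 : N.g (p0 + (0 : ℝ) • v, x) = N.g (p0, x) := by simp
  have hgb := N.g_base (ka t / 2) (-σ * (-th t / 2))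
  have hz : -σ * (-th t / 2) + 1 / 2 = zOrbit σ t := by unfold zOrbit; ring
  rw [hz] at hgb
  have hsmall : ∀ φ : ℝ → ℝ, DifferentiableAt ℝ φ 0 →
      HasDerivAt (fun ε : ℝ => (0 + ε * v.2.2) * φ ε) (v.2.2 * φ 0) 0 := by
    intro φ hφ
    have h := (((hasDerivAt_id (0 : ℝ)).mul_const v.2.2).const_add 0).fun_mul hφ.hasDerivAt
    refine h.congr_deriv ?_
    simp
  have d1 := hsmall _ hg.fst
  have d2 := hsmall _ hg.snd.fst
  have d3 := hsmall _ hg.snd.snd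
  rw [hg0, hgb] at d1 d2 d3
  have hr : HasDerivAt (fun ε : ℝ => 1 / 2 + ε * v.1) v.1 0 := by
    simpa using ((hasDerivAt_id (0 : ℝ)).mul_const v.1).const_add (1 / 2)
  have ho : HasDerivAt (fun ε : ℝ => 0 + ε * v.2.1) v.2.1 0 := by
    simpa using ((hasDerivAt_id (0 : ℝ)).mul_const v.2.1).const_add 0
  have k1 := (((hr.const_sub (-σ * (-th t / 2) + 1 / 2)).mul_const (ka t / 2)).fun_add
    d1).const_mul (-σ)
  have k2 := (hasDerivAt_const (0 : ℝ) (-(ka t / 2) ^ 2)).fun_add d2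
  have k3 := ((ho.mul_const (ka t / 2)).fun_add d3).const_mul (-σ)
  refine HasDerivAt.prodMk ((k1.congr_deriv ?_).congr_of_eventuallyEq
      (Eventually.of_forall fun ε => ?_))
    (HasDerivAt.prodMk ((k2.congr_deriv ?_).congr_of_eventuallyEq
      (Eventually.of_forall fun ε => ?_)) ((k3.congr_deriv ?_).congr_of_eventuallyEq
      (Eventually.of_forall fun ε => ?_)))
  · ring
  · simp [field, baseOrbit, p0, hx]
  · ring
  · simp [field, baseOrbit, p0, hx]
  · ring
  · simp [field, baseOrbit, p0, hx]

end NormalFamily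

end Z4

namespace Z4

open scoped BoundedContinuousFunction NNReal
open MeasureTheory

/-! ### The splitting function and its derivative -/

section Orbit

variable {σ : ℝ}

lemma zOrbit_mul_one_sub (hσ : σ = 1 ∨ σ = -1) (t : ℝ) :
    zOrbit σ t * (1 - zOrbit σ t) = (ka t / 2) ^ 2 := by
  have h := ka_sq_add_th_sq t
  unfold zOrbit
  rcases hσ with rfl | rfl <;> linear_combination (-1 / 4) * h

lemma zOrbit_mem (hσ : σ = 1 ∨ σ = -1) (t : ℝ) : zOrbit σ t ∈ Ioo (0 : ℝ) 1 := by
  have h := abs_lt.1 (show |th t| < 1 by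
    rw [← sq_lt_one_iff_abs_lt_one]
    nlinarith [ka_sq_add_th_sq t, pow_pos (ka_pos t) 2])
  unfold zOrbit
  rcases hσ with rfl | rfl <;> constructor <;> linarith [h.1, h.2]

lemma hasDerivAt_zOrbit (hσ : σ = 1 ∨ σ = -1) (t : ℝ) :
    HasDerivAt (zOrbit σ) (σ * (zOrbit σ t * (1 - zOrbit σ t))) t := by
  refine ((((hasDerivAt_th t).const_mul σ).const_add 1).div_const 2).congr_deriv ?_
  rw [zOrbit_mul_one_sub hσ]
  ring

lemma neg_log_zOrbit_le (hσ : σ = 1 ∨ σ = -1) {t : ℝ} (ht : 0 ≤ t) :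
    -Real.log (zOrbit σ t) ≤ t + 3 := by
  have h1 : Real.exp (-(t + 3)) ≤ zOrbit σ t := by
    have hk := wt_sq_le_ka ht
    have hw : wt t ^ 2 * wt t ^ 2 = Real.exp (-t) := by
      rw [wt_sq, ← Real.exp_add]; congr 1; ring
    have h3 : Real.exp (-3) ≤ 1 / 4 := by
      rw [Real.exp_neg, ← one_div]
      refine one_div_le_one_div_of_le (by norm_num) ?_
      have := Real.add_one_le_exp (3 : ℝ)
      linarith
    have h4 : wt t ^ 2 * wt t ^ 2 ≤ ka t * ka t :=
      mul_le_mul hk hk (sq_nonneg _) (ka_pos t).le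
    have h5 := zOrbit_mul_one_sub hσ t
    have h6 := zOrbit_mem hσ t
    have h7 : (ka t / 2) ^ 2 ≤ zOrbit σ t := by
      rw [← h5]; nlinarith [h6.1, h6.2]
    rw [neg_add, Real.exp_add, ← hw]
    nlinarith [Real.exp_pos (-3), pow_pos (wt_pos t) 2]
  have h2 := Real.log_le_log (Real.exp_pos _) h1
  rw [Real.log_exp] at h2
  linarith

end Orbit

namespace NormalFamily

variable (N : NormalFamily)

/-- The first-order change of `Y` along the unperturbed connection, divided by `X`, in the
direction `v` of the parameters and as a function of `z`. -/
noncomputable def response (v : Param) (z : ℝ) : ℝ :=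
  v.2.1 * logKernel z + v.2.2 * (N.β₁ * ((1 - z) / 3) + N.β₂ * ((1 + 2 * z) / 6))

lemma hasDerivAt_response (v : Param) {z : ℝ} (hz : z ∈ Ioo (0 : ℝ) 1) :
    HasDerivAt (N.response v) ((2 * z * N.response v z
      - (v.2.1 + v.2.2 * (N.β₁ * (z * (1 - z)) + N.β₂ * z ^ 2))) / (z * (1 - z))) z := by
  have h0 := hz.1.ne'
  have h1 : 1 - z ≠ 0 := by linarith [hz.2]
  have h := ((hasDerivAt_logKernel hz.1 hz.2).const_mul v.2.1).fun_add
    ((((((hasDerivAt_id z).const_sub 1).div_const 3).const_mul N.β₁).fun_add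
      (((((hasDerivAt_id z).const_mul 2).const_add 1).div_const 6).const_mul N.β₂)).const_mul v.2.2)
  refine h.congr_deriv ?_
  unfold response
  field_simp
  ring

lemma abs_response_le (v : Param) {z : ℝ} (hz : z ∈ Ioo (0 : ℝ) 1) :
    |N.response v z| ≤ |v.2.1| * (2 + 4 * -Real.log z) + |v.2.2| * (|N.β₁| + |N.β₂|) := by
  unfold response
  refine (abs_add_le _ _).trans (add_le_add ?_ ?_)
  · rw [abs_mul, abs_of_nonneg (logKernel_nonneg hz.1)]
    exact mul_le_mul_of_nonneg_left (logKernel_le hz.1 hz.2) (abs_nonneg _)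
  · rw [abs_mul]
    refine mul_le_mul_of_nonneg_left ((abs_add_le _ _).trans (add_le_add ?_ ?_)) (abs_nonneg _)
    · rw [abs_mul, abs_of_nonneg (a := (1 - z) / 3) (by linarith [hz.2])]
      exact mul_le_of_le_one_right (abs_nonneg _) (by linarith [hz.1])
    · rw [abs_mul, abs_of_nonneg (a := (1 + 2 * z) / 6) (by linarith [hz.1])]
      exact mul_le_of_le_one_right (abs_nonneg _) (by linarith [hz.2])

/-- The response in the weighted frame is a bounded function. -/
lemma exists_response {σ : ℝ} (hσ : σ = 1 ∨ σ = -1) (v : Param) :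
    ∃ x : BC, ∀ t : ℝ≥0, x t = ka t / 2 * N.response v (zOrbit σ t) / wt t := by
  have hq : Continuous fun t : ℝ => N.response v (zOrbit σ t) :=
    continuous_iff_continuousAt.2 fun t => ContinuousAt.comp (g := N.response v)
      (N.hasDerivAt_response v (zOrbit_mem hσ t)).continuousAt
      (hasDerivAt_zOrbit hσ t).continuousAt
  refine ⟨BoundedContinuousFunction.ofNormedAddCommGroup
    (fun t : ℝ≥0 => ka t / 2 * N.response v (zOrbit σ t) / wt t)
    ((((continuous_ka.div_const 2).mul hq).div continuous_wt wt_ne).comp NNReal.continuous_coe)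
    (|v.2.1| * 30 + |v.2.2| * (|N.β₁| + |N.β₂|)) (fun t => ?_), fun t => rfl⟩
  have ht : (0 : ℝ) ≤ t := t.coe_nonneg
  have h1 := ka_pos t
  have h2 := ka_le_wt_sq t
  have h3 := wt_pos t
  have h4 := wt_le_one ht
  have h5 := neg_log_zOrbit_le hσ ht
  have h6 := N.abs_response_le v (zOrbit_mem hσ t)
  have h7 : wt t * t ≤ 4 := by
    have h8 : wt t * Real.exp (t / 4) = 1 := by
      rw [wt, ← Real.exp_add]; simp
    have := Real.add_one_le_exp ((t : ℝ) / 4)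
    nlinarith
  rw [Real.norm_eq_abs, abs_div, abs_mul, abs_of_pos h3, abs_of_pos (half_pos h1),
    div_le_iff₀ h3]
  have h9 : |N.response v (zOrbit σ t)| ≤
      |v.2.1| * (14 + 4 * t) + |v.2.2| * (|N.β₁| + |N.β₂|) := by
    refine h6.trans (add_le_add ?_ le_rfl)
    exact mul_le_mul_of_nonneg_left (by linarith) (abs_nonneg _)
  have hA := abs_nonneg v.2.1
  have hB : 0 ≤ |v.2.2| * (|N.β₁| + |N.β₂|) := by positivity
  calc ka t / 2 * |N.response v (zOrbit σ t)|
      ≤ wt t ^ 2 * (|v.2.1| * (14 + 4 * t) + |v.2.2| * (|N.β₁| + |N.β₂|)) :=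
        mul_le_mul (by linarith) h9 (abs_nonneg _) (sq_nonneg _)
    _ = (|v.2.1| * (14 * wt t + 4 * (wt t * t)) + wt t * (|v.2.2| * (|N.β₁| + |N.β₂|)))
          * wt t := by ring
    _ ≤ _ := by
      refine mul_le_mul_of_nonneg_right (add_le_add ?_ ?_) h3.le
      · exact mul_le_mul_of_nonneg_left (by linarith) hA
      · exact mul_le_of_le_one_left hB h4

/-- The response solves the variational equation for `Y`. -/
lemma solvesLinear_response {σ : ℝ} (hσ : σ = 1 ∨ σ = -1) (v : Param) {x n : BC}
    (hx : ∀ t : ℝ≥0, x t = ka t / 2 * N.response v (zOrbit σ t) / wt t)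
    (hn : ∀ t : ℝ≥0, n t = (fderiv ℝ (N.half σ) (p0, baseOrbit t) (v, 0)).2.2 / wt t) :
    SolvesLinear (fun t => 1 / 4 + σ + th t / 2) x n := by
  intro t ht
  have hz := zOrbit_mem hσ t
  have h := (((hasDerivAt_ka t).div_const 2).fun_mul
    ((N.hasDerivAt_response v hz).comp t (hasDerivAt_zOrbit hσ t))).fun_div (hasDerivAt_wt t)
      (wt_ne t)
  refine (h.hasDerivWithinAt.congr (fun s hs => ?_) ?_).congr_deriv ?_
  · rw [hx, Real.coe_toNNReal s hs]; rfl
  · rw [hx, Real.coe_toNNReal t ht]; rfl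
  · rw [hx, hn, fderiv_half, Real.coe_toNNReal t ht]
    have h1 := wt_ne t
    have h2 := hz.1.ne'
    have h3 : 1 - zOrbit σ t ≠ 0 := by linarith [hz.2]
    have h4 := zOrbit_mul_one_sub hσ t
    have h5 : th t = σ * (2 * zOrbit σ t - 1) := by
      unfold zOrbit; rcases hσ with rfl | rfl <;> ring
    simp only [Function.comp_def]
    rw [← h4, h5]
    generalize zOrbit σ t = z at *
    generalize N.response v z = q at *
    rcases hσ with rfl | rfl <;> field_simp <;> ring

/-- The Melnikov integrand in the coordinate `z`. -/
noncomputable def melnikov (v : Param) (z : ℝ) : ℝ :=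
  -4 * v.1 + 4 * v.2.2 * (N.α₁ * (z * (1 - z)) + N.α₂ * z ^ 2)
    - 2 * (1 - 2 * z) * v.2.2 * (N.γ₀ * (1 + z) + N.γ₁ * z)
    + 4 * N.b p0 * ((1 - 2 * z) * N.response v z)

/-- The coefficient of `s` in the expansion of the bifurcation surface. -/
noncomputable def slope : ℝ :=
  N.α₁ / 6 + N.α₂ / 3 + N.γ₀ / 12 + N.γ₁ / 12 + N.b p0 * N.β₁ / 18 - N.b p0 * N.β₂ / 18

lemma melnikov_eq (v : Param) (z : ℝ) : N.melnikov v z =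
    ((-4 * v.1 + v.2.2 * (-2 * N.γ₀ + 4 * N.b p0 * (N.β₁ / 3 + N.β₂ / 6)))
      + v.2.2 * (4 * N.α₁ + 2 * N.γ₀ - 2 * N.γ₁ - 4 * N.b p0 * N.β₁) * z
      + v.2.2 * (-4 * N.α₁ + 4 * N.α₂ + 4 * N.γ₀ + 4 * N.γ₁
        + 4 * N.b p0 * (2 * N.β₁ / 3 - 2 * N.β₂ / 3)) * z ^ 2)
      + 4 * N.b p0 * v.2.1 * ((1 - 2 * z) * logKernel z) := by
  unfold melnikov response; ring

lemma intervalIntegrable_melnikov (v : Param) :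
    IntervalIntegrable (N.melnikov v) volume 0 1 := by
  rw [show N.melnikov v = _ from funext (N.melnikov_eq v)]
  refine IntervalIntegrable.add (Continuous.intervalIntegrable (by fun_prop) _ _) ?_
  exact (intervalIntegrable_logKernel.continuousOn_mul (by fun_prop)).const_mul _

lemma integral_melnikov (v : Param) : ∫ z in (0 : ℝ)..1, N.melnikov v z =
    -4 * v.1 - 4 * N.b p0 * (9 - Real.pi ^ 2) / 3 * v.2.1 + 4 * N.slope * v.2.2 := by
  have hL : IntervalIntegrable (fun z => (1 - 2 * z) * logKernel z) volume 0 1 :=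
    intervalIntegrable_logKernel.continuousOn_mul (by fun_prop)
  have hpoly : ∀ a b c : ℝ, ∫ z in (0 : ℝ)..1, (a + b * z + c * z ^ 2) = a + b / 2 + c / 3 := by
    intro a b c
    rw [intervalIntegral.integral_add (Continuous.intervalIntegrable (by fun_prop) _ _)
      (Continuous.intervalIntegrable (by fun_prop) _ _), intervalIntegral.integral_add
      (Continuous.intervalIntegrable (by fun_prop) _ _)
      (Continuous.intervalIntegrable (by fun_prop) _ _), intervalIntegral.integral_const_mul,
      intervalIntegral.integral_const_mul, integral_id, integral_pow]
    simp
    ring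
  simp only [melnikov_eq]
  rw [intervalIntegral.integral_add (Continuous.intervalIntegrable (by fun_prop) _ _)
    (hL.const_mul _), hpoly, intervalIntegral.integral_const_mul, integral_mul_logKernel]
  unfold slope
  ring

end NormalFamily

lemma th_surj {y : ℝ} (hy : y ∈ Ioo (0 : ℝ) 1) : ∃ t ∈ Ioi (0 : ℝ), th t = y := by
  have hlim : Tendsto th atTop (𝓝 1) := by
    have h1 : Tendsto (fun t => 1 - 2 * Real.exp (-(t / 2))) atTop (𝓝 (1 - 2 * 0)) := by
      refine Tendsto.const_sub _ (Tendsto.const_mul _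
        (Real.tendsto_exp_neg_atTop_nhds_zero.comp ?_))
      exact tendsto_id.atTop_div_const two_pos
    rw [mul_zero, sub_zero] at h1
    refine tendsto_of_tendsto_of_tendsto_of_le_of_le' h1 tendsto_const_nhds ?_
      (Eventually.of_forall fun t => (th_lt_one t).le)
    filter_upwards [eventually_ge_atTop 0] with t ht
    have := one_sub_th_le ht
    have h2 := ka_le_wt_sq t
    rw [wt_sq] at h2
    linarith
  obtain ⟨T, hT, hT0⟩ := ((hlim.eventually (lt_mem_nhds hy.2)).and (eventually_gt_atTop 0)).exists
  obtain ⟨t, ht, h⟩ := intermediate_value_Ioo hT0.le continuous_th.continuousOn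
    (show y ∈ Ioo (th 0) (th T) from ⟨by simpa using hy.1, hT⟩)
  exact ⟨t, ht.1, h⟩

lemma th_pos {t : ℝ} (ht : 0 < t) : 0 < th t :=
  div_pos (Real.sinh_pos_iff.2 (by linarith)) (Real.cosh_pos _)

lemma strictMono_th : StrictMono th :=
  strictMono_of_deriv_pos fun t => by
    rw [(hasDerivAt_th t).deriv]
    have := ka_pos t
    positivity

/-- Integrals over a half of the unperturbed connection in the coordinate `z`. -/
lemma integral_zOrbit {σ : ℝ} (hσ : σ = 1 ∨ σ = -1) (J : ℝ → ℝ) :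
    ∫ t in Ioi (0 : ℝ), J (zOrbit σ t) * (zOrbit σ t * (1 - zOrbit σ t)) =
      ∫ z in (zOrbit σ '' Ioi 0), J z := by
  have hinj : InjOn (zOrbit σ) (Ioi 0) := by
    intro s _ t _ h
    refine strictMono_th.injective ?_
    unfold zOrbit at h
    rcases hσ with rfl | rfl <;> linarith
  rw [integral_image_eq_integral_abs_deriv_smul measurableSet_Ioi
    (fun t _ => (hasDerivAt_zOrbit hσ t).hasDerivWithinAt) hinj]
  refine setIntegral_congr_fun measurableSet_Ioi fun t _ => ?_
  have hz := zOrbit_mem hσ t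
  have h1 : |σ| = 1 := by rcases hσ with rfl | rfl <;> simp
  rw [abs_mul, h1, one_mul, abs_of_pos (mul_pos hz.1 (by linarith [hz.2])), smul_eq_mul, mul_comm]

lemma zOrbit_one_image : zOrbit 1 '' Ioi 0 = Ioo (1 / 2) 1 := by
  ext z
  constructor
  · rintro ⟨t, ht, rfl⟩
    have := th_pos ht
    have h2 := th_lt_one t
    unfold zOrbit
    constructor <;> linarith
  · rintro ⟨h1, h2⟩
    obtain ⟨t, ht, h⟩ := th_surj (y := 2 * z - 1) ⟨by linarith, by linarith⟩
    exact ⟨t, ht, by unfold zOrbit; linarith⟩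

lemma zOrbit_neg_one_image : zOrbit (-1) '' Ioi 0 = Ioo 0 (1 / 2) := by
  ext z
  constructor
  · rintro ⟨t, ht, rfl⟩
    have := th_pos ht
    have h2 := th_lt_one t
    unfold zOrbit
    constructor <;> linarith
  · rintro ⟨h1, h2⟩
    obtain ⟨t, ht, h⟩ := th_surj (y := 1 - 2 * z) ⟨by linarith, by linarith⟩
    exact ⟨t, ht, by unfold zOrbit; linarith⟩

namespace NormalFamily

variable (N : NormalFamily)

/-- The derivative of the initial value of the first weighted coordinate, as an integral over
one half of the unperturbed connection. -/
lemma integral_half {σ : ℝ} (hσ : σ = 1 ∨ σ = -1) (v : Param) {x : BC}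
    (hx : ∀ t : ℝ≥0, x t = ka t / 2 * N.response v (zOrbit σ t) / wt t) :
    -∫ s in Ioi (0 : ℝ),
          (2 * ka s * (fderiv ℝ (N.half σ) (p0, baseOrbit s) (v, 0)).1
            - 2 * th s * (fderiv ℝ (N.half σ) (p0, baseOrbit s) (v, 0)).2.1
            + 2 * N.b p0 * th s * ka s * (wt s * x s.toNNReal)) =
      σ * ∫ z in (zOrbit σ '' Ioi 0), N.melnikov v z := by
  rw [← integral_zOrbit hσ, ← integral_const_mul, ← integral_neg]
  refine setIntegral_congr_fun measurableSet_Ioi fun t ht => ?_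
  have h1 := wt_ne t
  have h4 := zOrbit_mul_one_sub hσ t
  have h5 : th t = σ * (2 * zOrbit σ t - 1) := by
    unfold zOrbit; rcases hσ with rfl | rfl <;> ring
  rw [fderiv_half, hx, Real.coe_toNNReal t (le_of_lt ht), mul_div_cancel₀ _ h1]
  unfold melnikov
  dsimp only
  rw [← h4, h5]
  generalize zOrbit σ t = z at *
  generalize N.response v z = q at *
  rcases hσ with rfl | rfl
  · linear_combination (2 * (-2 * v.1 + 2 * v.2.2 * (N.α₁ * (z * (1 - z)) + N.α₂ * z ^ 2))
      - 4 * N.b p0 * (2 * z - 1) * q) * h4 * (-1)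
  · linear_combination (2 * (-2 * v.1 + 2 * v.2.2 * (N.α₁ * (z * (1 - z)) + N.α₂ * z ^ 2))
      - 4 * N.b p0 * (2 * z - 1) * q) * h4

end NormalFamily

end Z4

namespace Z4

open scoped BoundedContinuousFunction NNReal
open MeasureTheory

namespace NormalFamily

variable (N : NormalFamily)

/-- The two halves of the perturbed connections: a smooth family `ψs` of solutions that tend to
`O`, parametrized by the value of `Y` on the section, and a smooth family `ψu` for the
separatrix of `O⁺`. Their distance on the section has the stated derivative. -/
theorem exists_halves : ∃ (ψs : Param × ℝ → BE) (ψu : Param → BE),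
    ψs (p0, 0) = 0 ∧ ψu p0 = 0 ∧
    (∀ᶠ q in 𝓝 (p0, (0 : ℝ)), ContDiffAt ℝ ∞ ψs q) ∧ (∀ᶠ p in 𝓝 p0, ContDiffAt ℝ ∞ ψu p) ∧
    (∀ᶠ v in 𝓝 ((p0, (0 : ℝ)), (0 : BE)),
      (IsHalfSolution (N.half (-1)) v.1.1 v.2 ∧ (v.2 0).2.2 = v.1.2) ↔ ψs v.1 = v.2) ∧
    (∀ᶠ v in 𝓝 (p0, (0 : BE)), IsHalfSolution (N.half 1) v.1 v.2 ↔ ψu v.1 = v.2) ∧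
    ∃ D' : Param →L[ℝ] ℝ,
      HasFDerivAt (fun p => (ψu p 0).1 - (ψs (p, (ψu p 0).2.2) 0).1) D' p0 ∧
      ∀ v, D' v =
        -4 * v.1 - 4 * N.b p0 * (9 - Real.pi ^ 2) / 3 * v.2.1 + 4 * N.slope * v.2.2 := by
  obtain ⟨Gs, Ss, hs⟩ := exists_forward_Y
  obtain ⟨Gu, hu⟩ := exists_backward_Y
  obtain ⟨ψs, s0, s1, s2, s3⟩ := exists_half_solutions (N.isHalfFamily (Or.inr rfl)) Gs Ss
    (fun a y => y = a) hs
  have hu' : ∀ (x n : BC) (a : ℝ), x = Gu n + a • (0 : BC) ↔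
      SolvesLinear (fun t => 1 / 4 + 1 + th t / 2) x n ∧ True := fun x n a => by
    have h0 : a • (0 : BC) = 0 := by ext; simp
    rw [h0, add_zero, and_true, hu]
  obtain ⟨ψu, u0, u1, u2, u3⟩ := exists_half_solutions (N.isHalfFamily (Or.inl rfl)) Gu 0
    (fun _ _ => True) hu'
  have hι : ContDiff ℝ ∞ fun p : Param => (p, (0 : ℝ)) := by fun_prop
  have hιc : Tendsto (fun p : Param => (p, (0 : ℝ))) (𝓝 p0) (𝓝 (p0, 0)) := hι.continuous.tendsto _
  refine ⟨ψs, fun p => ψu (p, 0), s0, u0, s1, ?_, s2, ?_, ?_⟩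
  · filter_upwards [hιc.eventually u1] with p hp
    exact hp.comp p hι.contDiffAt
  · have hc : Tendsto (fun v : Param × BE => ((v.1, (0 : ℝ)), v.2)) (𝓝 (p0, (0 : BE)))
        (𝓝 ((p0, 0), 0)) :=
      (by fun_prop : Continuous fun v : Param × BE => ((v.1, (0 : ℝ)), v.2)).tendsto _
    filter_upwards [hc.eventually u2] with v hv
    simpa using hv
  · let ev : BE →L[ℝ] E := BoundedContinuousFunction.evalCLM ℝ (0 : ℝ≥0)
    have hev : ∀ x : BE, ev x = x 0 := fun x => rfl
    let π₁ : E →L[ℝ] ℝ := ContinuousLinearMap.fst ℝ ℝ (ℝ × ℝ)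
    let π₃ : E →L[ℝ] ℝ := (ContinuousLinearMap.snd ℝ ℝ ℝ).comp
      (ContinuousLinearMap.snd ℝ ℝ (ℝ × ℝ))
    have hψu : HasFDerivAt (fun p => ψu (p, 0)) ((fderiv ℝ ψu (p0, 0)).comp
        (ContinuousLinearMap.inl ℝ Param ℝ)) p0 :=
      HasFDerivAt.comp p0 (g := ψu) (f := fun p => (p, (0 : ℝ)))
        (u1.self_of_nhds.differentiableAt (by simp)).hasFDerivAt
        (ContinuousLinearMap.inl ℝ Param ℝ).hasFDerivAt
    have hyu : HasFDerivAt (fun p => (ψu (p, 0) 0).2.2) _ p0 :=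
      (π₃.comp ev).hasFDerivAt.comp p0 hψu
    have hxu : HasFDerivAt (fun p => (ψu (p, 0) 0).1) _ p0 :=
      (π₁.comp ev).hasFDerivAt.comp p0 hψu
    have hy0 : (ψu (p0, 0) 0).2.2 = 0 := by rw [u0]; rfl
    have hψs0 : HasFDerivAt ψs (fderiv ℝ ψs (p0, 0)) (p0, (ψu (p0, 0) 0).2.2) := by
      rw [hy0]
      exact (s1.self_of_nhds.differentiableAt (by simp)).hasFDerivAt
    have hψs : HasFDerivAt (fun p => ψs (p, (ψu (p, 0) 0).2.2)) _ p0 :=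
      HasFDerivAt.comp p0 (f := fun p => (p, (ψu (p, 0) 0).2.2)) hψs0
        ((hasFDerivAt_id p0).prodMk hyu)
    have hxs : HasFDerivAt (fun p => (ψs (p, (ψu (p, 0) 0).2.2) 0).1) _ p0 :=
      (π₁.comp ev).hasFDerivAt.comp p0 hψs
    refine ⟨_, hxu.sub hxs, fun v => ?_⟩
    -- the variations of both halves are given by the response
    obtain ⟨nu, nu1, nu2, -, nu3⟩ := u3 v 0
    obtain ⟨xu, hxu⟩ := N.exists_response (Or.inl rfl : (1 : ℝ) = 1 ∨ (1 : ℝ) = -1) v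
    have eu : coord 2 (fderiv ℝ ψu (p0, 0) (v, 0)) = xu := by
      rw [(hu _ _).2 nu2, (hu _ _).2 (N.solvesLinear_response (Or.inl rfl) v hxu nu1)]
    have hyuv : (fderiv ℝ ψu (p0, 0) (v, 0) 0).2.2 = N.response v (1 / 2) / 2 := by
      have := DFunLike.congr_fun eu 0
      rw [coord_two, hxu] at this
      rw [this]
      simp [zOrbit]
      ring
    set a : ℝ := N.response v (1 / 2) / 2 with ha
    obtain ⟨ns, ns1, ns2, ns3, ns4⟩ := s3 v a
    obtain ⟨xs, hxs'⟩ := N.exists_response (Or.inr rfl : (-1 : ℝ) = 1 ∨ (-1 : ℝ) = -1) v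
    have hxs0 : xs 0 = a := by
      rw [hxs']; simp [zOrbit, ha]; ring
    have es : coord 2 (fderiv ℝ ψs (p0, 0) (v, a)) = xs := by
      rw [(hs _ _ a).2 ⟨ns2, ns3⟩,
        (hs _ _ a).2 ⟨N.solvesLinear_response (Or.inr rfl) v hxs' ns1, hxs0⟩]
    rw [eu, N.integral_half (Or.inl rfl) v hxu, zOrbit_one_image] at nu3
    rw [es, N.integral_half (Or.inr rfl) v hxs', zOrbit_neg_one_image] at ns4
    have hval : (fderiv ℝ ψu (p0, 0) (v, 0) 0).1
        - (fderiv ℝ ψs (p0, 0) (v, (fderiv ℝ ψu (p0, 0) (v, 0) 0).2.2) 0).1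
        = ∫ z in (0 : ℝ)..1, N.melnikov v z := by
      have hi := N.intervalIntegrable_melnikov v
      have h1 : IntervalIntegrable (N.melnikov v) volume 0 (1 / 2) :=
        hi.mono_set (by
          rw [uIcc_of_le (by norm_num), uIcc_of_le (by norm_num)]
          exact Icc_subset_Icc le_rfl (by norm_num))
      have h2 : IntervalIntegrable (N.melnikov v) volume (1 / 2) 1 :=
        hi.mono_set (by
          rw [uIcc_of_le (by norm_num), uIcc_of_le (by norm_num)]
          exact Icc_subset_Icc (by norm_num) le_rfl)
      rw [hyuv, nu3, ns4, ← intervalIntegral.integral_add_adjacent_intervals h1 h2,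
        intervalIntegral.integral_of_le (by norm_num), intervalIntegral.integral_of_le
        (by norm_num), integral_Ioc_eq_integral_Ioo, integral_Ioc_eq_integral_Ioo]
      ring
    rw [← N.integral_melnikov v, ← hval]
    rfl

end NormalFamily

end Z4

namespace Z4

open scoped NNReal

/-! ### Uniqueness of trajectories -/

section Uniqueness

variable {G : Type*} [NormedAddCommGroup G] [NormedSpace ℝ G] {X : G → G} {x y : ℝ → G}

lemma exists_lipschitzOnWith_images (hX : ContDiff ℝ 1 X) {a b : ℝ}
    (hx : ContinuousOn x (Icc a b)) (hy : ContinuousOn y (Icc a b)) :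
    ∃ K : ℝ≥0, LipschitzOnWith K X (x '' Icc a b ∪ y '' Icc a b) :=
  LocallyLipschitzOn.exists_lipschitzOnWith_of_compact
    ((isCompact_Icc.image_of_continuousOn hx).union (isCompact_Icc.image_of_continuousOn hy))
    hX.locallyLipschitz.locallyLipschitzOn

lemma integralCurve_unique_right (hX : ContDiff ℝ 1 X) {a b : ℝ} (hab : a ≤ b)
    (hx : IsIntegralCurveOn x (fun _ => X) (Icc a b))
    (hy : IsIntegralCurveOn y (fun _ => X) (Icc a b)) (h : x a = y a) : x b = y b := by
  obtain ⟨K, hK⟩ := exists_lipschitzOnWith_images hX hx.continuousOn hy.continuousOn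
  refine ODE_solution_unique_of_mem_Icc_right (v := fun _ => X)
    (s := fun _ => x '' Icc a b ∪ y '' Icc a b) (fun _ _ => hK) hx.continuousOn
    (fun t ht => ?_) (fun t ht => Or.inl (mem_image_of_mem _ (Ico_subset_Icc_self ht)))
    hy.continuousOn (fun t ht => ?_)
    (fun t ht => Or.inr (mem_image_of_mem _ (Ico_subset_Icc_self ht))) h ⟨hab, le_rfl⟩
  · exact (hx t (Ico_subset_Icc_self ht)).mono_of_mem_nhdsWithin (Icc_mem_nhdsGE_of_mem ht)
  · exact (hy t (Ico_subset_Icc_self ht)).mono_of_mem_nhdsWithin (Icc_mem_nhdsGE_of_mem ht)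

lemma integralCurve_unique_left (hX : ContDiff ℝ 1 X) {a b : ℝ} (hab : a ≤ b)
    (hx : IsIntegralCurveOn x (fun _ => X) (Icc a b))
    (hy : IsIntegralCurveOn y (fun _ => X) (Icc a b)) (h : x b = y b) : x a = y a := by
  obtain ⟨K, hK⟩ := exists_lipschitzOnWith_images hX hx.continuousOn hy.continuousOn
  refine ODE_solution_unique_of_mem_Icc_left (v := fun _ => X)
    (s := fun _ => x '' Icc a b ∪ y '' Icc a b) (fun _ _ => hK) hx.continuousOn
    (fun t ht => ?_) (fun t ht => Or.inl (mem_image_of_mem _ (Ioc_subset_Icc_self ht)))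
    hy.continuousOn (fun t ht => ?_)
    (fun t ht => Or.inr (mem_image_of_mem _ (Ioc_subset_Icc_self ht))) h ⟨le_rfl, hab⟩
  · exact (hx t (Ioc_subset_Icc_self ht)).mono_of_mem_nhdsWithin (Icc_mem_nhdsLE_of_mem ht)
  · exact (hy t (Ioc_subset_Icc_self ht)).mono_of_mem_nhdsWithin (Icc_mem_nhdsLE_of_mem ht)

lemma integralCurve_shift (hx : IsIntegralCurve x fun _ => X) (a : ℝ) :
    IsIntegralCurve (fun t => x (t + a)) fun _ => X :=
  hx.comp_add a

lemma integralCurve_unique (hX : ContDiff ℝ 1 X) (hx : IsIntegralCurve x fun _ => X)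
    (hy : IsIntegralCurve y fun _ => X) (h : x 0 = y 0) : x = y := by
  funext t
  rcases le_total 0 t with ht | ht
  · exact integralCurve_unique_right hX ht (hx.isIntegralCurveOn _) (hy.isIntegralCurveOn _) h
  · exact integralCurve_unique_left hX ht (hx.isIntegralCurveOn _) (hy.isIntegralCurveOn _) h

/-- Two trajectories with a common point are time shifts of each other. -/
lemma integralCurve_shift_of_meet (hX : ContDiff ℝ 1 X) (hx : IsIntegralCurve x fun _ => X)
    (hy : IsIntegralCurve y fun _ => X) {a b : ℝ} (h : x a = y b) (t : ℝ) :
    x t = y (t + (b - a)) := by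
  have := congrFun (integralCurve_unique hX (integralCurve_shift hx a) (integralCurve_shift hy b)
    (by simpa using h)) (t - a)
  simpa [sub_add_eq_add_sub, add_sub_assoc] using this

lemma integralCurveOn_shift {a : ℝ} (ha : 0 ≤ a) (hx : IsIntegralCurveOn x (fun _ => X) (Ici 0)) :
    IsIntegralCurveOn (fun t => x (t + a)) (fun _ => X) (Ici 0) := by
  intro t ht
  have h1 : HasDerivWithinAt (fun t : ℝ => t + a) 1 (Ici 0) t :=
    ((hasDerivAt_id t).add_const a).hasDerivWithinAt
  have h2 := (hx (t + a) (add_nonneg ht ha)).scomp t h1 fun s hs => add_nonneg hs ha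
  simpa [Function.comp_def] using h2

lemma integralCurveOn_neg (hx : IsIntegralCurveOn x (fun _ => X) (Iic 0)) :
    IsIntegralCurveOn (fun t => x (-t)) (fun _ => -X) (Ici 0) := by
  intro t ht
  have h2 := (hx (-t) (by simpa using ht)).scomp t (hasDerivAt_neg t).hasDerivWithinAt
    (fun s (hs : s ∈ Ici (0 : ℝ)) => by simpa using hs)
  simpa [Function.comp_def] using h2

lemma integralCurveOn_neg' (hx : IsIntegralCurveOn x (fun _ => -X) (Ici 0)) :
    IsIntegralCurveOn (fun t => x (-t)) (fun _ => X) (Iic 0) := by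
  intro t ht
  have h2 := (hx (-t) (by simpa using ht)).scomp t (hasDerivAt_neg t).hasDerivWithinAt
    (fun s (hs : s ∈ Iic (0 : ℝ)) => by simpa using hs)
  simpa [Function.comp_def] using h2

end Uniqueness

/-! ### Orbits on a one-dimensional stable manifold -/

section Cone

/-- Two solutions that tend to an equilibrium with an invariant cone field stay in the cone
`dY² + dZ² ≤ dX²` relative to each other. -/
lemma exists_cone {F : E → E} {e : E} {L : E →L[ℝ] E} (hL : HasStrictFDerivAt F L e) {c : ℝ}
    (hc : 0 < c) (hcone : ∀ d : E, c * ‖d‖ ^ 2 ≤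
      2 * (d.2.2 * (L d).2.2 + d.2.1 * (L d).2.1 - d.1 * (L d).1)) :
    ∃ r > 0, ∀ x y : ℝ → E, IsIntegralCurveOn x (fun _ => F) (Ici 0) →
      IsIntegralCurveOn y (fun _ => F) (Ici 0) → Tendsto x atTop (𝓝 e) → Tendsto y atTop (𝓝 e) →
      (∀ t, 0 ≤ t → dist (x t) e < r ∧ dist (y t) e < r) →
      ((x 0).2.2 - (y 0).2.2) ^ 2 + ((x 0).2.1 - (y 0).2.1) ^ 2 ≤ ((x 0).1 - (y 0).1) ^ 2 := by
  have h1 := hL.isLittleO.def (show 0 < c / 6 by positivity)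
  obtain ⟨r, hr, h⟩ := Metric.eventually_nhds_iff_ball.1 h1
  refine ⟨r, hr, fun x y hx hy hxe hye hxy => ?_⟩
  set Q : ℝ → ℝ := fun t => ((x t).2.2 - (y t).2.2) ^ 2 + ((x t).2.1 - (y t).2.1) ^ 2
    - ((x t).1 - (y t).1) ^ 2 with hQ
  have hlim : Tendsto Q atTop (𝓝 0) := by
    have hc : Continuous fun v : E × E => (v.1.2.2 - v.2.2.2) ^ 2 + (v.1.2.1 - v.2.2.1) ^ 2
      - (v.1.1 - v.2.1) ^ 2 := by fun_prop
    have := (hc.tendsto (e, e)).comp (hxe.prodMk_nhds hye)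
    simpa [Function.comp_def] using this
  have hder : ∀ t, 0 ≤ t → HasDerivWithinAt Q
      (2 * (((x t).2.2 - (y t).2.2) * ((F (x t)).2.2 - (F (y t)).2.2)
        + ((x t).2.1 - (y t).2.1) * ((F (x t)).2.1 - (F (y t)).2.1)
        - ((x t).1 - (y t).1) * ((F (x t)).1 - (F (y t)).1))) (Ici 0) t := by
    intro t ht
    obtain ⟨x1, x2, x3⟩ := hasDerivWithinAt_triple.1 (hx t ht)
    obtain ⟨y1, y2, y3⟩ := hasDerivWithinAt_triple.1 (hy t ht)
    refine ((((x3.fun_sub y3).fun_pow 2).fun_add ((x2.fun_sub y2).fun_pow 2)).fun_sub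
      ((x1.fun_sub y1).fun_pow 2)).congr_deriv ?_
    simp
    ring
  have hmono : MonotoneOn Q (Ici 0) := by
    refine monotoneOn_of_deriv_nonneg (convex_Ici 0)
      (fun t ht => (hder t ht).continuousWithinAt) (fun t ht => ?_) (fun t ht => ?_)
    · rw [interior_Ici] at ht ⊢
      exact ((hder t (le_of_lt ht)).hasDerivAt
        (Ici_mem_nhds ht)).differentiableAt.differentiableWithinAt
    · rw [interior_Ici] at ht
      rw [((hder t (le_of_lt ht)).hasDerivAt (Ici_mem_nhds ht)).deriv]
      obtain ⟨hxr, hyr⟩ := hxy t (le_of_lt ht)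
      have hlip := h (x t, y t) (by
        rw [Metric.mem_ball, Prod.dist_eq]; exact max_lt hxr hyr)
      have hcd := hcone (x t - y t)
      dsimp only at hlip
      set d := x t - y t with hd
      set R := F (x t) - F (y t) - L d with hR
      have hF : F (x t) - F (y t) = L d + R := by rw [hR]; abel
      have e1 : (F (x t)).1 - (F (y t)).1 = (L d).1 + R.1 := congrArg Prod.fst hF
      have e2 : (F (x t)).2.1 - (F (y t)).2.1 = (L d).2.1 + R.2.1 :=
        congrArg (fun v : E => v.2.1) hF
      have e3 : (F (x t)).2.2 - (F (y t)).2.2 = (L d).2.2 + R.2.2 :=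
        congrArg (fun v : E => v.2.2) hF
      have d1 : (x t).1 - (y t).1 = d.1 := rfl
      have d2 : (x t).2.1 - (y t).2.1 = d.2.1 := rfl
      have d3 : (x t).2.2 - (y t).2.2 = d.2.2 := rfl
      rw [e1, e2, e3, d1, d2, d3]
      have n : ∀ a b : ℝ, |a| ≤ ‖d‖ → |b| ≤ ‖R‖ → |a * b| ≤ ‖d‖ * (c / 6 * ‖d‖) := by
        intro a b ha hb
        rw [abs_mul]
        exact mul_le_mul ha (hb.trans hlip) (abs_nonneg _) (norm_nonneg _)
      have m1 := abs_le.1 (n d.1 R.1 (norm_fst_le d) (norm_fst_le R))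
      have m2 := abs_le.1 (n d.2.1 R.2.1 ((norm_fst_le d.2).trans (norm_snd_le d))
        ((norm_fst_le R.2).trans (norm_snd_le R)))
      have m3 := abs_le.1 (n d.2.2 R.2.2 ((norm_snd_le d.2).trans (norm_snd_le d))
        ((norm_snd_le R.2).trans (norm_snd_le R)))
      nlinarith [m1.1, m1.2, m2.1, m2.2, m3.1, m3.2]
  have h0 : Q 0 ≤ 0 := ge_of_tendsto hlim (by
    filter_upwards [eventually_ge_atTop 0] with t ht
    exact hmono (mem_Ici.2 le_rfl) ht ht)
  simp only [hQ] at h0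
  linarith

/-- The rotation by `π` about the axis. -/
def rot (x : E) : E := (-x.1, x.2.1, -x.2.2)

/-- Under the cone condition the solutions that tend to the equilibrium form, up to the rotation
`rot`, a single orbit. -/
lemma exists_meet {F : E → E} {e : E} {L : E →L[ℝ] E} (hL : HasStrictFDerivAt F L e) {c : ℝ}
    (hc : 0 < c) (hcone : ∀ d : E, c * ‖d‖ ^ 2 ≤
      2 * (d.2.2 * (L d).2.2 + d.2.1 * (L d).2.1 - d.1 * (L d).1))
    (he : F e = 0) (hrot : ∀ x, F (rot x) = rot (F x)) (hre : rot e = e) {x y : ℝ → E}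
    (hx : IsIntegralCurveOn x (fun _ => F) (Ici 0)) (hy : IsIntegralCurveOn y (fun _ => F) (Ici 0))
    (hxe : Tendsto x atTop (𝓝 e)) (hye : Tendsto y atTop (𝓝 e)) :
    (∃ t, 0 ≤ t ∧ x t = e) ∨ (∃ t, 0 ≤ t ∧ y t = e) ∨
      ∃ s t, 0 ≤ s ∧ 0 ≤ t ∧ (x s = y t ∨ x s = rot (y t)) := by
  obtain ⟨r, hr, h⟩ := exists_cone hL hc hcone
  have hrotc : Continuous rot := by unfold rot; fun_prop
  obtain ⟨T, hT⟩ := eventually_atTop.1 (((hxe.eventually (Metric.ball_mem_nhds e hr)).and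
    (hye.eventually (Metric.ball_mem_nhds e hr))).and
    ((hrotc.tendsto e).comp hye |>.eventually
      (by rw [hre]; exact Metric.ball_mem_nhds e hr)) |>.and (eventually_ge_atTop 0))
  have hT0 : 0 ≤ T := (hT T le_rfl).2
  have hshift : ∀ {z : ℝ → E} (a : ℝ), Tendsto z atTop (𝓝 e) →
      Tendsto (fun t => z (t + a)) atTop (𝓝 e) := fun a hz =>
    hz.comp (tendsto_atTop_add_const_right _ a tendsto_id)
  have he1 : e.1 = 0 := by
    have := congrArg Prod.fst hre
    simp only [rot] at this
    linarith
  have hconst : IsIntegralCurveOn (fun _ : ℝ => e) (fun _ => F) (Ici 0) :=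
    (isIntegralCurve_const fun _ => he).isIntegralCurveOn _
  -- a solution that meets the axis is the equilibrium
  have haxis : ∀ {z : ℝ → E}, IsIntegralCurveOn z (fun _ => F) (Ici 0) → Tendsto z atTop (𝓝 e) →
      (∀ t, T ≤ t → dist (z t) e < r) → (z T).1 = 0 → z T = e := by
    intro z hz hze hzr h0
    have := h _ _ (integralCurveOn_shift hT0 hz) hconst (hshift T hze) tendsto_const_nhds
      (fun t ht => ⟨hzr _ (by linarith), by simpa using hr⟩)
    simp only [zero_add, h0, he1] at this
    have h2 : (z T).2.2 = e.2.2 := by nlinarith [sq_nonneg ((z T).2.1 - e.2.1)]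
    have h3 : (z T).2.1 = e.2.1 := by nlinarith [sq_nonneg ((z T).2.2 - e.2.2)]
    exact Prod.ext (by rw [h0, he1]) (Prod.ext h3 h2)
  by_cases hx0 : (x T).1 = 0
  · exact Or.inl ⟨T, hT0, haxis hx hxe (fun t ht => (hT t ht).1.1.1) hx0⟩
  by_cases hy0 : (y T).1 = 0
  · exact Or.inr (Or.inl ⟨T, hT0, haxis hy hye (fun t ht => (hT t ht).1.1.2) hy0⟩)
  refine Or.inr (Or.inr ?_)
  set m := min |(x T).1| |(y T).1| with hm
  have hmpos : 0 < m := lt_min (abs_pos.2 hx0) (abs_pos.2 hy0)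
  have hivt : ∀ {z : ℝ → E}, IsIntegralCurveOn z (fun _ => F) (Ici 0) → Tendsto z atTop (𝓝 e) →
      m ≤ |(z T).1| → ∃ t, T ≤ t ∧ |(z t).1| = m := by
    intro z hz hze hmz
    have hl : Tendsto (fun t => |(z t).1|) atTop (𝓝 0) := by
      have := ((continuous_abs.comp continuous_fst).tendsto e).comp hze
      simpa [he1, Function.comp_def] using this
    obtain ⟨t, ht, htT⟩ := ((hl.eventually (gt_mem_nhds hmpos)).and (eventually_ge_atTop T)).exists
    obtain ⟨s, hs, hsm⟩ := intermediate_value_Icc' htT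
      (f := fun t => |(z t).1|) (continuous_abs.comp_continuousOn (continuous_fst.comp_continuousOn
        (hz.continuousOn.mono fun s hs => hT0.trans hs.1))) ⟨le_of_lt ht, hmz⟩
    exact ⟨s, hs.1, hsm⟩
  obtain ⟨s, hs, hsm⟩ := hivt hx hxe (min_le_left _ _)
  obtain ⟨t, ht, htm⟩ := hivt hy hye (min_le_right _ _)
  have hry : IsIntegralCurveOn (fun t => rot (y t)) (fun _ => F) (Ici 0) := by
    intro t ht
    obtain ⟨y1, y2, y3⟩ := hasDerivWithinAt_triple.1 (hy t ht)
    beta_reduce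
    rw [hrot]
    exact hasDerivWithinAt_triple.2 ⟨y1.fun_neg, y2, y3.fun_neg⟩
  have hrye : Tendsto (fun t => rot (y t)) atTop (𝓝 e) := by
    have := (hrotc.tendsto e).comp hye
    rwa [hre] at this
  have hmeet : ∀ {z : ℝ → E}, IsIntegralCurveOn z (fun _ => F) (Ici 0) → Tendsto z atTop (𝓝 e) →
      (∀ t, T ≤ t → dist (z t) e < r) → (x s).1 = (z t).1 → x s = z t := by
    intro z hz hze hzr h0
    have := h _ _ (integralCurveOn_shift (hT0.trans hs) hx)
      (integralCurveOn_shift (hT0.trans ht) hz)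
      (hshift s hxe) (hshift t hze)
      (fun t' ht' => ⟨(hT _ (by linarith)).1.1.1, hzr _ (by linarith)⟩)
    simp only [zero_add, h0, sub_self] at this
    have h2 : (x s).2.2 = (z t).2.2 := by nlinarith [sq_nonneg ((x s).2.1 - (z t).2.1)]
    have h3 : (x s).2.1 = (z t).2.1 := by nlinarith [sq_nonneg ((x s).2.2 - (z t).2.2)]
    exact Prod.ext h0 (Prod.ext h3 h2)
  refine ⟨s, t, hT0.trans hs, hT0.trans ht, ?_⟩
  rcases abs_eq_abs.1 (hsm.trans htm.symm) with h0 | h0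
  · exact Or.inl (hmeet hy hye (fun t ht => (hT t ht).1.1.2) h0)
  · exact Or.inr (hmeet hry hrye (fun t ht => (hT t ht).1.2) h0)

end Cone

end Z4

namespace Z4

/-! ### Four wings from one separatrix -/

section FourWings

lemma S_iterate (k : ℕ) (w : Phase) : S^[k] w = (Complex.I ^ k * w.1, (-1) ^ k * w.2) := by
  induction k with
  | zero => simp
  | succ k ih =>
    rw [Function.iterate_succ_apply', ih, S]
    refine Prod.ext ?_ ?_
    · dsimp only; ring
    · dsimp only; ring

lemma S_iterate_four (w : Phase) : S (S^[3] w) = w := by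
  rw [← Function.iterate_succ_apply' S 3, S_iterate]
  simp [Complex.I_pow_four, show ((-1 : ℝ)) ^ 4 = 1 by norm_num]

lemma continuous_S : Continuous S := by unfold S; fun_prop

lemma hasDerivWithinAt_S {x : ℝ → Phase} {v : Phase} {s : Set ℝ} {t : ℝ}
    (h : HasDerivWithinAt x v s t) : HasDerivWithinAt (fun t => S (x t)) (S v) s t := by
  have h1 := (ContinuousLinearMap.fst ℝ ℂ ℝ).hasFDerivAt.comp_hasDerivWithinAt t h
  have h2 := (ContinuousLinearMap.snd ℝ ℂ ℝ).hasFDerivAt.comp_hasDerivWithinAt t h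
  exact (h1.const_mul Complex.I).prodMk h2.fun_neg

variable {X : Phase → Phase}

lemma integralCurveOn_S (hS : ∀ w, X (S w) = S (X w)) {x : ℝ → Phase} {s : Set ℝ}
    (hx : IsIntegralCurveOn x (fun _ => X) s) :
    IsIntegralCurveOn (fun t => S (x t)) (fun _ => X) s := fun t ht => by
  have := hasDerivWithinAt_S (hx t ht)
  rwa [← hS] at this

lemma integralCurveOn_S_iterate (hS : ∀ w, X (S w) = S (X w)) (k : ℕ) {x : ℝ → Phase} {s : Set ℝ}
    (hx : IsIntegralCurveOn x (fun _ => X) s) :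
    IsIntegralCurveOn (S^[k] ∘ x) (fun _ => X) s := by
  induction k with
  | zero => exact hx
  | succ k ih =>
    rw [Function.iterate_succ']
    exact integralCurveOn_S hS ih

lemma mem_unstableSet_S_iterate (hS : ∀ w, X (S w) = S (X w)) (k : ℕ) {e w : Phase}
    (h : w ∈ unstableSet X e) :
    S^[k] w ∈ unstableSet X (S^[k] e) := by
  obtain ⟨x, h0, hx, hl⟩ := h
  exact ⟨S^[k] ∘ x, by simp [h0], integralCurveOn_S_iterate hS k hx,
    ((continuous_S.iterate k).tendsto e).comp hl⟩

lemma range_subset_unstableSet {Γ : ℝ → Phase} {e : Phase} (hΓ : IsIntegralCurve Γ fun _ => X)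
    (hl : Tendsto Γ atBot (𝓝 e)) : range Γ ⊆ unstableSet X e := by
  rintro _ ⟨t, rfl⟩
  exact ⟨fun s => Γ (s + t), by simp, (integralCurve_shift hΓ t).isIntegralCurveOn _,
    hl.comp (tendsto_atBot_add_const_right _ t tendsto_id)⟩

/-- The wings of an orbit that leaves the axis and is asymptotic to the axis at both ends are
disjoint: a common point would make `‖u‖` periodic. -/
lemma disjoint_wings (hX : ContDiff ℝ 1 X) (hS : ∀ w, X (S w) = S (X w)) {Γ : ℝ → Phase} {ζ : ℝ}
    (hΓ : IsIntegralCurve Γ fun _ => X) (hbot : Tendsto Γ atBot (𝓝 (0, ζ)))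
    (htop : Tendsto Γ atTop (𝓝 0)) (hne : ∃ t, (Γ t).1 ≠ 0) {j k : ℕ} (hj : j < 4) (hk : k < 4)
    (hjk : j ≠ k) : Disjoint (range (S^[j] ∘ Γ)) (range (S^[k] ∘ Γ)) := by
  rw [Set.disjoint_left]
  rintro _ ⟨a, rfl⟩ ⟨b, hb⟩
  have hint : ∀ k, IsIntegralCurve (S^[k] ∘ Γ) fun _ => X := fun k => by
    rw [← isIntegralCurveOn_univ]
    exact integralCurveOn_S_iterate hS k (hΓ.isIntegralCurveOn _)
  have hshift := integralCurve_shift_of_meet hX (hint j) (hint k) hb.symm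
  set c := b - a
  have hu : ∀ t, Complex.I ^ j * (Γ t).1 = Complex.I ^ k * (Γ (t + c)).1 := fun t => by
    have := congrArg Prod.fst (hshift t)
    simpa [S_iterate] using this
  have hnorm : ∀ t, ‖(Γ (t + c)).1‖ = ‖(Γ t).1‖ := fun t => by
    have := congrArg norm (hu t)
    simpa using this.symm
  obtain ⟨t, ht⟩ := hne
  have hn : ∀ n : ℕ, ‖(Γ (t + n * c)).1‖ = ‖(Γ t).1‖ := by
    intro n
    induction n with
    | zero => simp
    | succ n ih =>
      rw [← ih, ← hnorm (t + n * c)]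
      congr 3
      push_cast; ring
  have hcontra : ∀ {l : Filter ℝ} {z : ℝ}, Tendsto Γ l (𝓝 (0, z)) →
      Tendsto (fun n : ℕ => t + n * c) atTop l → False := by
    intro l z hl hc
    have h1 : Tendsto (fun n : ℕ => ‖(Γ (t + n * c)).1‖) atTop (𝓝 ‖((0, z) : Phase).1‖) :=
      (((continuous_norm.comp continuous_fst).tendsto ((0, z) : Phase)).comp hl).comp hc
    simp only [hn, norm_zero] at h1
    exact ht (norm_eq_zero.1 (tendsto_nhds_unique tendsto_const_nhds h1))
  rcases lt_trichotomy c 0 with hc | hc | hc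
  · exact hcontra hbot (tendsto_atBot_add_const_left _ _
      (tendsto_natCast_atTop_atTop.atTop_mul_const_of_neg hc))
  · have h1 := hu t
    rw [hc, add_zero] at h1
    have h2 := mul_right_cancel₀ ht h1
    have h3 : Complex.I ^ 3 = -Complex.I := by rw [pow_succ, Complex.I_sq]; ring
    interval_cases j <;> interval_cases k <;>
      first | exact hjk rfl | norm_num [h3, Complex.I_sq, Complex.ext_iff] at h2
  · exact hcontra htop (tendsto_atTop_add_const_left _ _
      (tendsto_natCast_atTop_atTop.atTop_mul_const hc))

/-- One separatrix of `O⁺` that tends to `O` and carries, with its image under `S²`, the unstable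
set of `O⁺` gives the four-winged connection. -/
lemma fourWingedConnection_of {ζ : ℝ} (hX : ContDiff ℝ 1 X) (hS : ∀ w, X (S w) = S (X w))
    (hζ : 0 < ζ) (he : X (0, ζ) = 0) {Γ : ℝ → Phase} (hΓ : IsIntegralCurve Γ fun _ => X)
    (hbot : Tendsto Γ atBot (𝓝 (0, ζ))) (htop : Tendsto Γ atTop (𝓝 0))
    (hne : ∃ t, (Γ t).1 ≠ 0)
    (hun : unstableSet X (0, ζ) ⊆ {(0, ζ)} ∪ range Γ ∪ range (S^[2] ∘ Γ)) :
    FourWingedConnection X ζ := by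
  have hint : ∀ k, IsIntegralCurve (S^[k] ∘ Γ) fun _ => X := fun k => by
    rw [← isIntegralCurveOn_univ]
    exact integralCurveOn_S_iterate hS k (hΓ.isIntegralCurveOn _)
  have hlb : ∀ k, Tendsto (S^[k] ∘ Γ) atBot (𝓝 (S^[k] (0, ζ))) := fun k =>
    ((continuous_S.iterate k).tendsto _).comp hbot
  have hS1 : S^[1] (0, ζ) = (0, -ζ) := by simp [S]
  have hS2 : S^[2] (0, ζ) = (0, ζ) := by simp [S]
  have hS3 : S^[3] (0, ζ) = (0, -ζ) := by simp [S]
  have he' : X (0, -ζ) = 0 := by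
    rw [← hS1, Function.iterate_one, hS, he]; simp [S]
  have hX0 : X 0 = 0 := by
    have h := hS 0
    have h0 : S 0 = 0 := by simp [S]
    rw [h0] at h
    have h1 := congrArg Prod.fst h
    have h2 := congrArg Prod.snd h
    simp only [S] at h1 h2
    refine Prod.ext ?_ ?_
    · have h3 : (1 - Complex.I) * (X 0).1 = 0 := by linear_combination h1
      rcases mul_eq_zero.1 h3 with h4 | h4
      · simp [Complex.ext_iff] at h4
      · exact h4
    · change (X 0).2 = 0; linarith
  have hconst : ∀ e, X e = 0 → e ∈ unstableSet X e := fun e he =>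
    ⟨fun _ => e, rfl, (isIntegralCurve_const fun _ => he).isIntegralCurveOn _, tendsto_const_nhds⟩
  refine ⟨hζ, hX0, he, he', hS, Γ, fun k => ⟨hint k, hlb k, ?_⟩,
    fun j hj k hk hjk => disjoint_wings hX hS hΓ hbot htop hne hj hk hjk,
    subset_antisymm hun ?_, subset_antisymm (fun w hw => ?_) ?_⟩
  · have h := ((continuous_S.iterate k).tendsto 0).comp htop
    rwa [show S^[k] 0 = 0 by rw [S_iterate]; simp] at h
  · refine union_subset (union_subset (by simpa using hconst _ he) ?_) ?_
    · exact range_subset_unstableSet hΓ hbot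
    · exact range_subset_unstableSet (hint 2) (hS2 ▸ hlb 2)
  · have h := mem_unstableSet_S_iterate hS 3 hw
    rw [show S^[3] (0, -ζ) = (0, ζ) by simp [S]] at h
    have hw4 := S_iterate_four w
    rcases hun h with (h | ⟨t, ht⟩) | ⟨t, ht⟩
    · left; left
      rw [mem_singleton_iff] at h ⊢
      rw [← hw4, h, ← hS1, Function.iterate_one]
    · left; right
      exact ⟨t, by rw [← hw4, ← ht]; rfl⟩
    · right
      refine ⟨t, ?_⟩
      rw [← hw4, ← ht]
      exact Function.iterate_succ_apply' S 2 (Γ t)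
  · refine union_subset (union_subset (by simpa using hconst _ he') ?_) ?_
    · exact range_subset_unstableSet (hint 1) (hS1 ▸ hlb 1)
    · exact range_subset_unstableSet (hint 3) (hS3 ▸ hlb 3)

end FourWings

end Z4

namespace Z4

/-! ### The bifurcation surface -/

/-- A `C²` function is approximated by its linearization up to a quadratic error. -/
lemma exists_quadratic_bound {G : Type*} [NormedAddCommGroup G] [NormedSpace ℝ G] {h : G → ℝ}
    {q₀ : G} (hh : ContDiffAt ℝ ∞ h q₀) :
    ∃ C, 0 ≤ C ∧ ∀ᶠ q in 𝓝 q₀, |h q - h q₀ - fderiv ℝ h q₀ (q - q₀)| ≤ C * ‖q - q₀‖ ^ 2 := by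
  have h1 : ContDiffAt ℝ 1 (fderiv ℝ h) q₀ := hh.fderiv_right (m := 1) (by norm_cast)
  obtain ⟨K, t, ht, hK⟩ := h1.exists_lipschitzOnWith
  have hd : ∀ᶠ q in 𝓝 q₀, DifferentiableAt ℝ h q :=
    ((hh.of_le (m := 1) (by norm_cast)).eventually (by simp)).mono
      fun q hq => hq.differentiableAt (by simp)
  obtain ⟨r, hr, hb⟩ := Metric.eventually_nhds_iff_ball.1 (hd.and ht)
  refine ⟨K, K.2, Metric.eventually_nhds_iff_ball.2 ⟨r, hr, fun q hq => ?_⟩⟩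
  have hsub : ∀ x ∈ Metric.closedBall q₀ ‖q - q₀‖, x ∈ Metric.ball q₀ r := fun x hx => by
    rw [Metric.mem_closedBall] at hx
    rw [Metric.mem_ball, dist_eq_norm] at hq
    exact hx.trans_lt hq
  have := (convex_closedBall q₀ ‖q - q₀‖).norm_image_sub_le_of_norm_fderiv_le'
    (φ := fderiv ℝ h q₀) (C := K * ‖q - q₀‖) (fun x hx => (hb x (hsub x hx)).1) (fun x hx => by
      have h2 := hK.norm_sub_le (hb x (hsub x hx)).2 (mem_of_mem_nhds ht)
      refine h2.trans (mul_le_mul_of_nonneg_left ?_ K.2)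
      rwa [Metric.mem_closedBall, dist_eq_norm] at hx)
    (Metric.mem_closedBall_self (norm_nonneg _)) (y := q) (by simp [dist_eq_norm])
  rw [Real.norm_eq_abs] at this
  calc _ ≤ _ := this
    _ = _ := by ring

/-- The zero set of a function with a non-zero `ρ`-derivative is a smooth surface
`ρ = h (ω, s)`, and the linearization of `h` is read off the derivative. -/
lemma exists_surface {D : Param → ℝ} (hD : ∀ᶠ p in 𝓝 p0, ContDiffAt ℝ ∞ D p) (h0 : D p0 = 0)
    {D' : Param →L[ℝ] ℝ} (hD' : HasFDerivAt D D' p0) {a k₁ k₂ : ℝ} (ha : a ≠ 0)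
    (hval : ∀ v, D' v = -a * v.1 + a * k₂ * v.2.1 + a * k₁ * v.2.2) :
    ∃ (h : ℝ × ℝ → ℝ) (C : ℝ), h (0, 0) = 1 / 2 ∧ 0 ≤ C ∧
      (∀ᶠ q in 𝓝 ((0, 0) : ℝ × ℝ), ContDiffAt ℝ ∞ h q) ∧
      (∀ᶠ p in 𝓝 p0, D p = 0 ↔ h p.2 = p.1) ∧
      ∀ᶠ q in 𝓝 ((0, 0) : ℝ × ℝ),
        |h q - (1 / 2 + k₁ * q.2 + k₂ * q.1)| ≤ C * (q.2 ^ 2 + q.1 ^ 2) := by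
  have hswap : Tendsto (fun v : (ℝ × ℝ) × ℝ => ((v.2, v.1) : Param)) (𝓝 ((0, 0), 1 / 2))
      (𝓝 p0) :=
    (by fun_prop : Continuous fun v : (ℝ × ℝ) × ℝ => ((v.2, v.1) : Param)).tendsto _
  let σ : (ℝ × ℝ) × ℝ →L[ℝ] Param :=
    (ContinuousLinearMap.snd ℝ (ℝ × ℝ) ℝ).prod (ContinuousLinearMap.fst ℝ (ℝ × ℝ) ℝ)
  have hfd : HasFDerivAt (fun v : (ℝ × ℝ) × ℝ => D (v.2, v.1)) (D'.comp σ) ((0, 0), 1 / 2) :=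
    HasFDerivAt.comp (g := D) (f := fun v : (ℝ × ℝ) × ℝ => ((v.2, v.1) : Param)) _ hD'
      σ.hasFDerivAt
  obtain ⟨h, hh0, hhs, hh⟩ := exists_smooth_implicit (q₀ := ((0, 0) : ℝ × ℝ)) (x₀ := (1 / 2 : ℝ))
    (f := fun v => D (v.2, v.1)) (by
      filter_upwards [hswap.eventually hD] with v hv
      exact ContDiffAt.comp (g := D) (f := fun v : (ℝ × ℝ) × ℝ => ((v.2, v.1) : Param)) v hv
        (by fun_prop)) h0 (by
      rw [hfd.fderiv]
      refine ⟨ContinuousLinearEquiv.equivOfInverse (D'.comp σ ∘L .inr ℝ (ℝ × ℝ) ℝ)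
        ((-a⁻¹) • ContinuousLinearMap.id ℝ ℝ) (fun x => ?_) (fun x => ?_), rfl⟩
      · simp [σ, hval]; field_simp
      · simp [σ, hval]; field_simp)
  have hhd := hhs.self_of_nhds.differentiableAt (by simp)
  have hgraph : Tendsto (fun q : ℝ × ℝ => (q, h q)) (𝓝 (0, 0)) (𝓝 ((0, 0), 1 / 2)) := by
    have : ContinuousAt (fun q : ℝ × ℝ => (q, h q)) (0, 0) :=
      continuousAt_id.prodMk hhd.continuousAt
    simpa [ContinuousAt, hh0] using this
  have hder : ∀ v : ℝ × ℝ, fderiv ℝ h (0, 0) v = k₂ * v.1 + k₁ * v.2 := by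
    intro v
    have e1 : HasFDerivAt (fun q => D (h q, q)) (D'.comp ((fderiv ℝ h (0, 0)).prod
        (ContinuousLinearMap.id ℝ (ℝ × ℝ)))) (0, 0) := by
      refine HasFDerivAt.comp (g := D) (f := fun q : ℝ × ℝ => ((h q, q) : Param)) _ ?_
        (hhd.hasFDerivAt.prodMk (hasFDerivAt_id _))
      rw [hh0]; exact hD'
    have e2 : (fun q : ℝ × ℝ => D (h q, q)) =ᶠ[𝓝 (0, 0)] fun _ => 0 := by
      filter_upwards [hgraph.eventually hh] with q hq
      exact hq.2 rfl
    have e3 := DFunLike.congr_fun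
      (e1.unique ((hasFDerivAt_const (0 : ℝ) _).congr_of_eventuallyEq e2)) v
    simp only [ContinuousLinearMap.comp_apply, ContinuousLinearMap.prod_apply, hval,
      ContinuousLinearMap.id_apply, _root_.zero_apply] at e3
    refine mul_left_cancel₀ ha ?_
    linarith
  obtain ⟨C, hC, hq⟩ := exists_quadratic_bound hhs.self_of_nhds
  refine ⟨h, C, hh0, hC, hhs, ?_, ?_⟩
  · have hc : Tendsto (fun p : Param => (p.2, p.1)) (𝓝 p0) (𝓝 ((0, 0), 1 / 2)) :=
      (by fun_prop : Continuous fun p : Param => (p.2, p.1)).tendsto _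
    exact hc.eventually hh
  · filter_upwards [hq] with q hq
    have e0 : q - (0, 0) = q := by simp
    rw [hh0, e0, hder] at hq
    have hn : ‖q‖ ^ 2 ≤ q.2 ^ 2 + q.1 ^ 2 := by
      rw [Prod.norm_def, Real.norm_eq_abs, Real.norm_eq_abs]
      rcases max_cases |q.1| |q.2| with ⟨h, -⟩ | ⟨h, -⟩ <;> rw [h, sq_abs]
      · nlinarith [sq_nonneg q.2]
      · nlinarith [sq_nonneg q.1]
    calc |h q - (1 / 2 + k₁ * q.2 + k₂ * q.1)| = |h q - 1 / 2 - (k₂ * q.1 + k₁ * q.2)| := by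
          congr 1; ring
      _ ≤ C * ‖q‖ ^ 2 := hq
      _ ≤ _ := mul_le_mul_of_nonneg_left hn hC

end Z4

namespace Z4

open scoped BoundedContinuousFunction NNReal

/-! ### Curves near the unperturbed connection -/

lemma norm_apply_le (ξ : BE) (t : ℝ≥0) :
    |(ξ t).1| ≤ ‖ξ‖ ∧ |(ξ t).2.1| ≤ ‖ξ‖ ∧ |(ξ t).2.2| ≤ ‖ξ‖ := by
  have h := ξ.norm_coe_le_norm t
  exact ⟨(norm_fst_le _).trans h, ((norm_fst_le _).trans (norm_snd_le _)).trans h,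
    ((norm_snd_le _).trans (norm_snd_le _)).trans h⟩

lemma abs_combination_le {k T a b m : ℝ} (hk : |k| ≤ 1) (hT : |T| ≤ 1) (ha : |a| ≤ m)
    (hb : |b| ≤ m) : |k * a + T * b| ≤ 2 * m := by
  have h1 : |k * a| ≤ m := by
    rw [abs_mul]; nlinarith [abs_nonneg a, abs_nonneg k]
  have h2 : |T * b| ≤ m := by
    rw [abs_mul]; nlinarith [abs_nonneg b, abs_nonneg T]
  exact (abs_add_le _ _).trans (by linarith)

/-- The curve of `ξ` stays within `wt t * ‖ξ‖` of the unperturbed connection. -/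
lemma dist_traj_le (ξ : BE) (t : ℝ) :
    dist (traj ξ t) (baseOrbit t) ≤ wt t * ‖ξ‖ := by
  obtain ⟨h1, h2, h3⟩ := norm_apply_le ξ t.toNNReal
  have hk : |ka t| ≤ 1 := by rw [abs_of_pos (ka_pos t)]; exact ka_le_one t
  have hT := abs_th_le_one t
  have hw := wt_pos t
  have e1 := abs_combination_le hk (by rwa [abs_neg] : |-th t| ≤ 1) h1 h2
  have e2 := abs_combination_le hT hk h1 h2
  rw [Prod.dist_eq, Prod.dist_eq, Real.dist_eq, Real.dist_eq, Real.dist_eq]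
  refine max_le ?_ (max_le ?_ ?_)
  · have : (traj ξ t).1 - (baseOrbit t).1
        = wt t * ((ka t * (ξ t.toNNReal).1 + -th t * (ξ t.toNNReal).2.1) / 2) := by
      simp only [traj, trajOf, baseOrbit]; ring
    rw [this, abs_mul, abs_of_pos hw, abs_div, abs_two]
    exact mul_le_mul_of_nonneg_left (by linarith) hw.le
  · have : (traj ξ t).2.1 - (baseOrbit t).2.1
        = -(wt t * ((th t * (ξ t.toNNReal).1 + ka t * (ξ t.toNNReal).2.1) / 2)) := by
      simp only [traj, trajOf, baseOrbit]; ring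
    rw [this, abs_neg, abs_mul, abs_of_pos hw, abs_div, abs_two]
    exact mul_le_mul_of_nonneg_left (by linarith) hw.le
  · have : (traj ξ t).2.2 - (baseOrbit t).2.2 = wt t * (ξ t.toNNReal).2.2 := by
      simp only [traj, trajOf, baseOrbit]; ring
    rw [this, abs_mul, abs_of_pos hw]
    exact mul_le_mul_of_nonneg_left h3 hw.le

lemma tendsto_wt : Tendsto wt atTop (𝓝 0) := by
  unfold wt
  exact Real.tendsto_exp_neg_atTop_nhds_zero.comp (tendsto_id.atTop_div_const (by norm_num))

lemma tendsto_ka : Tendsto ka atTop (𝓝 0) := by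
  have h : Tendsto (fun t => 2 * wt t ^ 2) atTop (𝓝 0) := by
    simpa using (tendsto_wt.pow 2).const_mul 2
  exact squeeze_zero (fun t => (ka_pos t).le) ka_le_wt_sq h

lemma tendsto_baseOrbit : Tendsto baseOrbit atTop (𝓝 eqO) := by
  have h1 : Tendsto th atTop (𝓝 1) := by
    have h : Tendsto (fun t => 1 - th t) atTop (𝓝 0) := by
      refine squeeze_zero' (Eventually.of_forall fun t => by linarith [th_lt_one t]) ?_ tendsto_ka
      filter_upwards [eventually_ge_atTop 0] with t ht using one_sub_th_le ht
    simpa using h.const_sub 1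
  have h2 := (tendsto_ka.div_const 2).prodMk_nhds ((h1.neg.div_const 2).prodMk_nhds
    (tendsto_const_nhds (x := (0 : ℝ))))
  simpa [baseOrbit, eqO, Function.comp_def] using! h2

lemma tendsto_traj (ξ : BE) : Tendsto (traj ξ) atTop (𝓝 eqO) := by
  refine tendsto_baseOrbit.congr_dist ?_
  have h : Tendsto (fun t => wt t * ‖ξ‖) atTop (𝓝 0) := by
    simpa using tendsto_wt.mul_const ‖ξ‖
  refine squeeze_zero' (Eventually.of_forall fun t => dist_nonneg) ?_ h
  refine Eventually.of_forall fun t => ?_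
  rw [dist_comm]
  exact dist_traj_le ξ t

lemma continuous_baseOrbit : Continuous baseOrbit :=
  (continuous_ka.div_const 2).prodMk
    ((continuous_th.neg.div_const 2).prodMk continuous_const)

lemma traj_zero_eq (ξ : BE) (h : (ξ 0).2.1 = 0) :
    traj ξ 0 = ((1 + (ξ 0).1) / 2, 0, (ξ 0).2.2) := by
  simp only [traj, trajOf, Real.toNNReal_zero, ka_zero, th_zero, wt_zero, h]
  ext <;> simp
  ring

/-- An open condition on a compact piece of the unperturbed connection holds nearby. -/
lemma eventually_near_baseOrbit {U : Set (Param × E)} (hU : IsOpen U) {a b : ℝ}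
    (h : ∀ t ∈ Icc a b, (p0, baseOrbit t) ∈ U) :
    ∃ δ > 0, ∀ p, dist p p0 < δ → ∀ t ∈ Icc a b, ∀ x, dist x (baseOrbit t) < δ → (p, x) ∈ U := by
  have hK : IsCompact ((fun t => (p0, baseOrbit t)) '' Icc a b) :=
    isCompact_Icc.image (continuous_const.prodMk continuous_baseOrbit)
  obtain ⟨δ, hδ, hsub⟩ := hK.exists_thickening_subset_open hU (by
    rintro _ ⟨t, ht, rfl⟩; exact h t ht)
  refine ⟨δ, hδ, fun p hp t ht x hx => hsub ?_⟩
  rw [Metric.mem_thickening_iff]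
  exact ⟨_, mem_image_of_mem _ ht, max_lt hp hx⟩

/-- Half-solutions near the unperturbed connection leave the section into `Z < 0` and stay
there. -/
lemma eventually_neg {c b : ℝ} {f : Param × E → E} (hf : IsHalfFamily c b f) :
    ∀ᶠ v in 𝓝 (p0, (0 : BE)), IsHalfSolution f v.1 v.2 → ∀ t, 0 < t → (traj v.2 t).2.1 < 0 := by
  obtain ⟨δ, hδ, h⟩ := eventually_near_baseOrbit (U := {v | (f v).2.1 < 0}) (a := 0) (b := 1)
    (isOpen_lt hf.smooth.continuous.snd.fst continuous_const) (fun t _ => by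
      rw [Set.mem_ofPred_eq, baseOrbit, hf.base]
      have := ka_pos t
      simp
      positivity)
  have hT := th_pos one_pos
  have hev : ∀ᶠ v in 𝓝 (p0, (0 : BE)), dist v.1 p0 < δ ∧ ‖v.2‖ < δ ∧ ‖v.2‖ < th 1 / 2 := by
    have h1 : Tendsto (fun v : Param × BE => dist v.1 p0) (𝓝 (p0, 0)) (𝓝 0) := by
      have := (by fun_prop : Continuous fun v : Param × BE => dist v.1 p0).tendsto (p0, 0)
      simpa using this
    have h2 : Tendsto (fun v : Param × BE => ‖v.2‖) (𝓝 (p0, 0)) (𝓝 0) := by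
      have := (by fun_prop : Continuous fun v : Param × BE => ‖v.2‖).tendsto (p0, 0)
      simpa using this
    exact (h1.eventually (gt_mem_nhds hδ)).and ((h2.eventually (gt_mem_nhds hδ)).and
      (h2.eventually (gt_mem_nhds (half_pos hT))))
  filter_upwards [hev] with v ⟨v1, v2, v3⟩ hsol t ht
  have hder : ∀ t, 0 ≤ t → HasDerivWithinAt (fun t => (traj v.2 t).2.1)
      (f (v.1, traj v.2 t)).2.1 (Ici 0) t := fun t ht =>
    (hasDerivWithinAt_triple.1 (hsol.1 t ht)).2.1
  have hclose : ∀ t, 0 ≤ t → dist (traj v.2 t) (baseOrbit t) ≤ ‖v.2‖ := fun t ht =>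
    (dist_traj_le v.2 t).trans (mul_le_of_le_one_left (norm_nonneg _) (wt_le_one ht))
  rcases le_total t 1 with h1 | h1
  · have hanti : StrictAntiOn (fun t => (traj v.2 t).2.1) (Icc 0 1) := by
      refine strictAntiOn_of_deriv_neg (convex_Icc 0 1)
        (fun t ht => ((hder t ht.1).mono Icc_subset_Ici_self).continuousWithinAt) fun t ht => ?_
      rw [interior_Icc] at ht
      rw [((hder t ht.1.le).hasDerivAt (Ici_mem_nhds ht.1)).deriv]
      exact h v.1 v1 t (Ioo_subset_Icc_self ht) _ ((hclose t ht.1.le).trans_lt v2)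
    have := hanti (left_mem_Icc.2 zero_le_one) ⟨ht.le, h1⟩ ht
    simpa [traj_zero_eq _ hsol.2] using this
  · have h2 := (hclose t ht.le)
    rw [Prod.dist_eq, Prod.dist_eq] at h2
    have h3 := (le_max_left _ _).trans ((le_max_right _ _).trans h2)
    rw [Real.dist_eq] at h3
    have h4 := (abs_le.1 h3).2
    have h5 := strictMono_th.monotone h1
    simp only [baseOrbit] at h4
    linarith

end Z4

namespace Z4

open scoped BoundedContinuousFunction NNReal

/-! ### The separatrices of `O⁺` -/

/-- Gluing a backward and a forward trajectory. -/
lemma exists_glue {G : Type*} [NormedAddCommGroup G] [NormedSpace ℝ G] {X : G → G} {x y : ℝ → G}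
    (hx : IsIntegralCurveOn x (fun _ => X) (Iic 0)) (hy : IsIntegralCurveOn y (fun _ => X) (Ici 0))
    (h : x 0 = y 0) :
    ∃ Γ : ℝ → G, IsIntegralCurve Γ (fun _ => X) ∧ EqOn Γ x (Iic 0) ∧ EqOn Γ y (Ici 0) := by
  classical
  set Γ : ℝ → G := fun t => if t ≤ 0 then x t else y t with hΓ
  have h1 : EqOn Γ x (Iic 0) := fun t ht => if_pos ht
  have h2 : EqOn Γ y (Ici 0) := fun t ht => by
    rcases eq_or_lt_of_le (mem_Ici.1 ht) with rfl | ht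
    · simp [hΓ, h]
    · exact if_neg (not_le.2 ht)
  have hl : ∀ t, t ≤ 0 → HasDerivWithinAt Γ (X (Γ t)) (Iic 0) t := fun t ht => by
    rw [h1 ht]; exact (hx t ht).congr h1 (h1 ht)
  have hr : ∀ t, 0 ≤ t → HasDerivWithinAt Γ (X (Γ t)) (Ici 0) t := fun t ht => by
    rw [h2 ht]; exact (hy t ht).congr h2 (h2 ht)
  refine ⟨Γ, fun t => ?_, h1, h2⟩
  rcases lt_trichotomy t 0 with ht | rfl | ht
  · exact (hl t ht.le).hasDerivAt (Iic_mem_nhds ht)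
  · rw [← hasDerivWithinAt_univ, ← Iic_union_Ici (a := (0 : ℝ))]
    exact (hl 0 le_rfl).union (hr 0 le_rfl)
  · exact (hr t ht.le).hasDerivAt (Ici_mem_nhds ht)

/-- The equilibrium `O⁺` in the coordinates `(X, Z, Y)`. -/
noncomputable def eqTop : E := (0, 1 / 2, 0)

/-- The reflection of `Z`. -/
def refl (x : E) : E := (x.1, -x.2.1, x.2.2)

lemma refl_refl (x : E) : refl (refl x) = x := by simp [refl]

lemma continuous_refl : Continuous refl := by unfold refl; fun_prop

lemma refl_eqO : refl eqO = eqTop := by simp [refl, eqO, eqTop]; norm_num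

lemma refl_eqTop : refl eqTop = eqO := by rw [← refl_eqO, refl_refl]

lemma refl_rot (x : E) : refl (rot x) = rot (refl x) := rfl

namespace NormalFamily

variable (N : NormalFamily)

lemma half_neg_one (q : Param × E) : N.half (-1) q = N.field q := by
  simp [half]

lemma half_one (p : Param) (x : E) : N.half 1 (p, x) = -refl (N.field (p, refl x)) := by
  ext <;> simp [half, refl]

lemma field_rot (p : Param) (x : E) : N.field (p, rot x) = rot (N.field (p, x)) := by
  obtain ⟨X, Z, Y⟩ := x
  simp only [field, rot, N.g_rot]
  refine Prod.ext ?_ (Prod.ext ?_ ?_) <;> dsimp only <;> ring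

lemma half_one_rot (p : Param) (x : E) : N.half 1 (p, rot x) = rot (N.half 1 (p, x)) := by
  rw [half_one, half_one, refl_rot, field_rot]
  ext <;> simp [refl, rot]

lemma contDiff_field_right (p : Param) : ContDiff ℝ 1 fun x => N.field (p, x) :=
  (N.contDiff_field.of_le (by norm_cast)).comp (by fun_prop)

lemma hasDerivWithinAt_refl {x : ℝ → E} {v : E} {s : Set ℝ} {t : ℝ}
    (h : HasDerivWithinAt x v s t) : HasDerivWithinAt (fun t => refl (x t)) (refl v) s t := by
  obtain ⟨h1, h2, h3⟩ := hasDerivWithinAt_triple.1 h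
  exact hasDerivWithinAt_triple.2 ⟨h1, h2.fun_neg, h3⟩

/-- Reversing time and reflecting `Z` turns backward trajectories into forward trajectories of
`half 1`. -/
lemma integralCurveOn_reverse {p : Param} {x : ℝ → E}
    (hx : IsIntegralCurveOn x (fun _ y => N.field (p, y)) (Iic 0)) :
    IsIntegralCurveOn (fun t => refl (x (-t))) (fun _ y => N.half 1 (p, y)) (Ici 0) := by
  intro t ht
  have h := hasDerivWithinAt_refl (integralCurveOn_neg (X := fun y => N.field (p, y)) hx t ht)
  have e : N.half 1 (p, refl (x (-t))) = refl (-N.field (p, x (-t))) := by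
    rw [half_one, refl_refl]; ext <;> simp [refl]
  beta_reduce
  rw [e]
  exact h

lemma integralCurveOn_reverse' {p : Param} {x : ℝ → E}
    (hx : IsIntegralCurveOn x (fun _ y => N.half 1 (p, y)) (Ici 0)) :
    IsIntegralCurveOn (fun t => refl (x (-t))) (fun _ y => N.field (p, y)) (Iic 0) := by
  have h : IsIntegralCurveOn (fun t => refl (x t)) (fun _ => -fun y => N.field (p, y)) (Ici 0) := by
    intro t ht
    have h := hasDerivWithinAt_refl (hx t ht)
    have e : refl (N.half 1 (p, x t)) = -N.field (p, refl (x t)) := by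
      rw [half_one]; ext <;> simp [refl]
    rw [e] at h
    exact h
  exact integralCurveOn_neg' h

/-- The derivative of the perturbation at `O⁺`. -/
noncomputable def topDeriv (p : Param) : E →L[ℝ] E :=
  (fderiv ℝ N.g (p, eqTop)).comp (ContinuousLinearMap.inr ℝ Param E)

lemma continuous_topDeriv : Continuous N.topDeriv :=
  ((N.g_smooth.continuous_fderiv (by simp)).comp (by fun_prop)).clm_comp continuous_const

lemma hasDerivAt_topDeriv (p : Param) (d : E) :
    HasDerivAt (fun ε : ℝ => N.g (p, eqTop + ε • d)) (N.topDeriv p d) 0 := by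
  have hl : HasDerivAt (fun ε : ℝ => ((p, eqTop + ε • d) : Param × E)) (0, d) 0 := by
    have h0 : HasDerivAt (fun ε : ℝ => eqTop + ε • d) d 0 := by
      simpa using ((hasDerivAt_id (0 : ℝ)).smul_const d).const_add eqTop
    exact (hasDerivAt_const _ _).prodMk h0
  have h0 : ((p, eqTop + (0 : ℝ) • d) : Param × E) = (p, eqTop) := by simp
  exact ((N.g_smooth.differentiable (by simp) (p, eqTop)).hasFDerivAt).comp_hasDerivAt_of_eq
    (0 : ℝ) hl h0.symm

lemma hasDerivAt_triple {g : ℝ → E} {v : E} {t : ℝ} (h : HasDerivAt g v t) :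
    HasDerivAt (fun t => (g t).1) v.1 t ∧ HasDerivAt (fun t => (g t).2.1) v.2.1 t ∧
      HasDerivAt (fun t => (g t).2.2) v.2.2 t := by
  simpa only [hasDerivWithinAt_univ] using
    hasDerivWithinAt_triple.1 (h.hasDerivWithinAt (s := univ))

/-- By the symmetry under `rot`, the linearization at `O⁺` splits into the axis and the plane. -/
lemma topDeriv_axis (p : Param) (a : ℝ) :
    (N.topDeriv p (0, a, 0)).1 = 0 ∧ (N.topDeriv p (0, a, 0)).2.2 = 0 := by
  obtain ⟨h1, -, h3⟩ := hasDerivAt_triple (N.hasDerivAt_topDeriv p (0, a, 0))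
  have e : ∀ ε : ℝ, eqTop + ε • ((0, a, 0) : E) = (0, 1 / 2 + ε * a, 0) := fun ε => by
    simp [eqTop]
  simp only [e, (N.g_axis p _).1, (N.g_axis p _).2] at h1 h3
  exact ⟨h1.unique (hasDerivAt_const _ _), h3.unique (hasDerivAt_const _ _)⟩

lemma topDeriv_plane (p : Param) (a b : ℝ) : (N.topDeriv p (a, 0, b)).2.1 = 0 := by
  obtain ⟨-, h2, -⟩ := hasDerivAt_triple (N.hasDerivAt_topDeriv p (a, 0, b))
  obtain ⟨-, h3, -⟩ := hasDerivAt_triple (N.hasDerivAt_topDeriv p (-(a, 0, b)))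
  have e : ∀ ε : ℝ, (N.g (p, eqTop + ε • (-(a, 0, b) : E))).2.1
      = (N.g (p, eqTop + ε • ((a, 0, b) : E))).2.1 := fun ε => by
    have := congrArg (fun x => x.2.1) (N.g_rot p (ε * a) (1 / 2) (ε * b))
    simpa [eqTop] using this
  simp only [e] at h3
  have h := h2.unique h3
  rw [map_neg, Prod.snd_neg, Prod.fst_neg] at h
  linarith

lemma topDeriv_base : (N.topDeriv p0 (0, 1, 0)).2.1 = -2 * N.γ₀ := by
  obtain ⟨-, h2, -⟩ := hasDerivAt_triple (N.hasDerivAt_topDeriv p0 (0, 1, 0))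
  have e : ∀ ε : ℝ, (N.g (p0, eqTop + ε • ((0, 1, 0) : E))).2.1
      = N.γ₀ * ((1 + ε) - (1 + ε) ^ 3) := fun ε => by
    have h : eqTop + ε • ((0, 1, 0) : E) = (0, 1 / 2 + ε, 0) := by simp [eqTop]
    rw [h, N.g_base]
    ring
  simp only [e] at h2
  have h3 := ((((hasDerivAt_id (0 : ℝ)).const_add 1).fun_sub
    (((hasDerivAt_id (0 : ℝ)).const_add 1).fun_pow 3)).const_mul N.γ₀)
  rw [h2.unique h3]
  simp
  ring

/-- The linearization of `half 1` at the equilibrium. -/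
lemma fderiv_half_one (p : Param) (d : E) :
    fderiv ℝ (fun x => N.half 1 (p, x)) eqO d =
      (-((1 - p.1) * d.1 - p.2.1 * d.2.2 + p.2.2 * (N.topDeriv p (refl d)).1),
        p.2.2 * (N.topDeriv p (refl d)).2.1,
        -(-((1 + p.1) * d.2.2) + p.2.1 * d.1 + p.2.2 * (N.topDeriv p (refl d)).2.2)) := by
  have hd : DifferentiableAt ℝ (fun x => N.half 1 (p, x)) eqO :=
    ((N.contDiff_half 1).differentiable (by simp)).comp
      (by fun_prop : Differentiable ℝ fun x : E => (p, x)) eqO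
  have hl : HasDerivAt (fun ε : ℝ => eqO + ε • d) d 0 := by
    simpa using ((hasDerivAt_id (0 : ℝ)).smul_const d).const_add eqO
  have e1 := hd.hasFDerivAt.comp_hasDerivAt_of_eq (0 : ℝ) hl (by simp)
  refine e1.unique ?_
  obtain ⟨g1, g2, g3⟩ := hasDerivAt_triple (N.hasDerivAt_topDeriv p (refl d))
  have hlin : ∀ k : ℝ, HasDerivAt (fun ε : ℝ => ε * k) k 0 := fun k => by
    simpa using (hasDerivAt_id (0 : ℝ)).mul_const k
  have k1 := (((((hlin d.2.1).fun_neg.const_add (1 - p.1)).fun_mul (hlin d.1)).fun_sub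
    ((hlin d.2.2).const_mul p.2.1)).fun_add (g1.const_mul p.2.2)).fun_neg
  have k2 := ((((hlin d.1).fun_pow 2).fun_sub ((hlin d.2.2).fun_pow 2)).fun_neg.fun_sub
    (((hlin d.1).const_mul (2 * N.b p)).fun_mul (hlin d.2.2))).fun_add (g2.const_mul p.2.2)
  have k3 := (((((hlin d.2.1).fun_neg.const_add (1 + p.1)).fun_mul (hlin d.2.2)).fun_neg).fun_add
    ((hlin d.1).const_mul p.2.1)).fun_add (g3.const_mul p.2.2)|>.fun_neg
  have hr : ∀ ε : ℝ, ((eqO + ε • d).1, -1 * (eqO + ε • d).2.1, (eqO + ε • d).2.2)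
      = eqTop + ε • refl d := fun ε => by
    simp [eqO, eqTop, refl]; ring
  refine HasDerivAt.prodMk ((k1.congr_deriv ?_).congr_of_eventuallyEq
      (Eventually.of_forall fun ε => ?_))
    (HasDerivAt.prodMk ((k2.congr_deriv ?_).congr_of_eventuallyEq
      (Eventually.of_forall fun ε => ?_)) ((k3.congr_deriv ?_).congr_of_eventuallyEq
      (Eventually.of_forall fun ε => ?_)))
  · simp
  · simp only [hr]
    simp only [field, eqTop, refl, Prod.fst_add, Prod.snd_add, Prod.smul_fst, Prod.smul_snd,
      smul_eq_mul]
    ring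
  · simp
  · simp only [hr]
    simp only [field, eqTop, refl, Prod.fst_add, Prod.snd_add, Prod.smul_fst, Prod.smul_snd,
      smul_eq_mul]
    ring
  · simp
  · simp only [hr]
    simp only [field, eqTop, refl, Prod.fst_add, Prod.snd_add, Prod.smul_fst, Prod.smul_snd,
      smul_eq_mul]
    ring

/-- Near the base parameter and for `s > 0` the cone condition holds at `O⁺`. Along the axis the
rate is only of order `s`, given by `γ₀`; hence the constant `c` depends on `s`. -/
lemma eventually_cone : ∀ᶠ p in 𝓝 p0, 0 < p.2.2 → ∃ c > 0, ∀ d : E, c * ‖d‖ ^ 2 ≤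
    2 * (d.2.2 * (fderiv ℝ (fun x => N.half 1 (p, x)) eqO d).2.2
      + d.2.1 * (fderiv ℝ (fun x => N.half 1 (p, x)) eqO d).2.1
      - d.1 * (fderiv ℝ (fun x => N.half 1 (p, x)) eqO d).1) := by
  have c1 : ∀ᶠ p in 𝓝 p0, p.2.2 * ‖N.topDeriv p‖ < 1 / 16 := by
    have h : Continuous fun p : Param => p.2.2 * ‖N.topDeriv p‖ :=
      (by fun_prop : Continuous fun p : Param => p.2.2).mul N.continuous_topDeriv.norm
    have h2 := h.tendsto p0
    simp only [p0, zero_mul] at h2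
    exact h2.eventually (gt_mem_nhds (by norm_num))
  have c2 : ∀ᶠ p in 𝓝 p0, (N.topDeriv p (0, 1, 0)).2.1 < -N.γ₀ := by
    have h : Continuous fun p : Param => (N.topDeriv p (0, 1, 0)).2.1 :=
      (N.continuous_topDeriv.clm_apply continuous_const).snd.fst
    refine (h.tendsto p0).eventually (gt_mem_nhds ?_)
    rw [topDeriv_base]; linarith [N.γ₀_pos]
  have c3 : ∀ᶠ p : Param in 𝓝 p0, |p.1 - 1 / 2| < 1 / 8 ∧ |p.2.1| < 1 / 16 := by
    have h : Continuous fun p : Param => |p.1 - 1 / 2| := by fun_prop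
    have h' : Continuous fun p : Param => |p.2.1| := by fun_prop
    exact ((h.tendsto p0).eventually (gt_mem_nhds (by simp [p0]))).and
      ((h'.tendsto p0).eventually (gt_mem_nhds (by simp [p0])))
  filter_upwards [c1, c2, c3] with p h1 h2 ⟨h3, h4⟩ hs
  have hγ := N.γ₀_pos
  refine ⟨min (1 / 8) (2 * (p.2.2 * N.γ₀)), by positivity, fun d => ?_⟩
  obtain ⟨X, Z, Y⟩ := d
  rw [fderiv_half_one]
  have hsplit : N.topDeriv p (refl (X, Z, Y))
      = N.topDeriv p (X, 0, Y) + (-Z) • N.topDeriv p (0, 1, 0) := by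
    rw [← map_smul, ← map_add]
    simp [refl]
  obtain ⟨a1, a2⟩ := N.topDeriv_axis p 1
  have a3 := N.topDeriv_plane p X Y
  rw [hsplit]
  simp only [Prod.fst_add, Prod.snd_add, Prod.smul_fst, Prod.smul_snd, smul_eq_mul, a1, a2, a3,
    mul_zero, add_zero, zero_add]
  set G := N.topDeriv p (X, 0, Y) with hG
  set D := (N.topDeriv p (0, 1, 0)).2.1 with hD
  have hGn : p.2.2 * ‖G‖ ≤ 1 / 16 * max |X| |Y| := by
    have e : ‖((X, 0, Y) : E)‖ = max |X| |Y| := by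
      simp [Prod.norm_def]
    have := (N.topDeriv p).le_opNorm (X, 0, Y)
    rw [e] at this
    calc p.2.2 * ‖G‖ ≤ p.2.2 * (‖N.topDeriv p‖ * max |X| |Y|) :=
          mul_le_mul_of_nonneg_left this hs.le
      _ = p.2.2 * ‖N.topDeriv p‖ * max |X| |Y| := by ring
      _ ≤ _ := mul_le_mul_of_nonneg_right h1.le (le_max_of_le_left (abs_nonneg _))
  have hm2 : (max |X| |Y|) ^ 2 ≤ X ^ 2 + Y ^ 2 := by
    rcases max_cases |X| |Y| with ⟨h, -⟩ | ⟨h, -⟩ <;> rw [h, sq_abs]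
    · nlinarith [sq_nonneg Y]
    · nlinarith [sq_nonneg X]
  have hcross : ∀ x g : ℝ, |x| ≤ max |X| |Y| → |g| ≤ ‖G‖ →
      |p.2.2 * (x * g)| ≤ 1 / 16 * (X ^ 2 + Y ^ 2) := by
    intro x g hx hg
    rw [abs_mul, abs_mul, abs_of_pos hs]
    calc p.2.2 * (|x| * |g|) ≤ p.2.2 * (max |X| |Y| * ‖G‖) := by
          refine mul_le_mul_of_nonneg_left (mul_le_mul hx hg (abs_nonneg _) ?_) hs.le
          exact le_max_of_le_left (abs_nonneg _)
      _ = max |X| |Y| * (p.2.2 * ‖G‖) := by ring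
      _ ≤ max |X| |Y| * (1 / 16 * max |X| |Y|) :=
          mul_le_mul_of_nonneg_left hGn (le_max_of_le_left (abs_nonneg _))
      _ = 1 / 16 * (max |X| |Y|) ^ 2 := by ring
      _ ≤ _ := by linarith
  have b1 := abs_le.1 (hcross X G.1 (le_max_left _ _) (norm_fst_le G))
  have b2 := abs_le.1 (hcross Y G.2.2 (le_max_right _ _)
    ((norm_snd_le G.2).trans (norm_snd_le G)))
  have b3 := abs_le.1 (show |p.2.1 * (X * Y)| ≤ 1 / 16 * (X ^ 2 + Y ^ 2) by
    rw [abs_mul]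
    have hXY : |X * Y| ≤ X ^ 2 + Y ^ 2 := by
      rw [abs_le]; constructor <;> nlinarith [sq_nonneg (X + Y), sq_nonneg (X - Y)]
    exact mul_le_mul h4.le hXY (abs_nonneg _) (by norm_num))
  have hn : ‖((X, Z, Y) : E)‖ ^ 2 ≤ X ^ 2 + Y ^ 2 + Z ^ 2 := by
    simp only [Prod.norm_def, Real.norm_eq_abs]
    rcases max_cases |X| (max |Z| |Y|) with ⟨h, -⟩ | ⟨h, -⟩
    · rw [h, sq_abs]; nlinarith [sq_nonneg Y, sq_nonneg Z]
    · rcases max_cases |Z| |Y| with ⟨h', -⟩ | ⟨h', -⟩ <;> rw [h, h', sq_abs]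
      · nlinarith [sq_nonneg Y, sq_nonneg X]
      · nlinarith [sq_nonneg X, sq_nonneg Z]
  have hmin1 : min (1 / 8) (2 * (p.2.2 * N.γ₀)) ≤ 1 / 8 := min_le_left _ _
  have hmin2 : min (1 / 8) (2 * (p.2.2 * N.γ₀)) ≤ 2 * (p.2.2 * N.γ₀) := min_le_right _ _
  have hmin0 : 0 ≤ min (1 / 8) (2 * (p.2.2 * N.γ₀)) := by positivity
  have hZ : p.2.2 * N.γ₀ * Z ^ 2 ≤ -(p.2.2 * D) * Z ^ 2 := by
    refine mul_le_mul_of_nonneg_right ?_ (sq_nonneg Z)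
    nlinarith
  have h5 := abs_lt.1 h3
  have hX : 3 / 8 * X ^ 2 ≤ (1 - p.1) * X ^ 2 :=
    mul_le_mul_of_nonneg_right (by linarith) (sq_nonneg X)
  have hY : 3 / 8 * Y ^ 2 ≤ (1 + p.1) * Y ^ 2 :=
    mul_le_mul_of_nonneg_right (by linarith) (sq_nonneg Y)
  calc min (1 / 8) (2 * (p.2.2 * N.γ₀)) * ‖((X, Z, Y) : E)‖ ^ 2
      ≤ min (1 / 8) (2 * (p.2.2 * N.γ₀)) * (X ^ 2 + Y ^ 2 + Z ^ 2) :=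
        mul_le_mul_of_nonneg_left hn hmin0
    _ ≤ 1 / 8 * (X ^ 2 + Y ^ 2) + 2 * (p.2.2 * N.γ₀) * Z ^ 2 := by
        nlinarith [sq_nonneg X, sq_nonneg Y, sq_nonneg Z]
    _ ≤ _ := by linarith [b1.1, b1.2, b2.1, b2.2, b3.1, b3.2]

/-- The backward trajectories that tend to `O⁺` belong to one orbit and its rotation. -/
lemma eventually_unstable : ∀ᶠ p in 𝓝 p0, 0 < p.2.2 → ∀ Γ : ℝ → E,
    IsIntegralCurve Γ (fun _ x => N.field (p, x)) → Tendsto Γ atBot (𝓝 eqTop) →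
    Tendsto Γ atTop (𝓝 eqO) → ∀ x : ℝ → E, IsIntegralCurveOn x (fun _ y => N.field (p, y)) (Iic 0) →
    Tendsto x atBot (𝓝 eqTop) → x 0 = eqTop ∨ (∃ t, x 0 = Γ t) ∨ ∃ t, x 0 = rot (Γ t) := by
  filter_upwards [N.eventually_cone] with p hp hs Γ hΓ hbot htop x hx hxb
  obtain ⟨c, hc, hcone⟩ := hp hs
  have hsd : HasStrictFDerivAt (fun x => N.half 1 (p, x))
      (fderiv ℝ (fun x => N.half 1 (p, x)) eqO) eqO :=
    ContDiffAt.hasStrictFDerivAt (n := ∞)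
      (((N.contDiff_half 1).comp (by fun_prop : ContDiff ℝ ∞ fun x : E => (p, x))).contDiffAt)
      (by simp)
  have heq : N.half 1 (p, eqO) = 0 := (N.isHalfFamily (Or.inl rfl)).equilibrium p
  have hfeq : N.field (p, eqTop) = 0 := by
    rw [half_one, refl_eqO, neg_eq_zero] at heq
    rw [← refl_refl (N.field (p, eqTop)), heq]
    simp [refl]
  have hrev : ∀ {y : ℝ → E}, Tendsto y atBot (𝓝 eqTop) →
      Tendsto (fun t => refl (y (-t))) atTop (𝓝 eqO) := fun hy => by
    rw [← refl_eqTop]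
    exact ((continuous_refl.tendsto _).comp hy).comp tendsto_neg_atTop_atBot
  have hX := N.contDiff_field_right p
  have hrotΓ : IsIntegralCurve (fun t => rot (Γ t)) (fun _ x => N.field (p, x)) := by
    intro t
    beta_reduce
    rw [field_rot]
    have h1 := hasDerivWithinAt_triple.1 ((hΓ t).hasDerivWithinAt (s := univ))
    rw [← hasDerivWithinAt_univ]
    exact hasDerivWithinAt_triple.2 ⟨h1.1.fun_neg, h1.2.1, h1.2.2.fun_neg⟩
  have hconst : IsIntegralCurve (fun _ : ℝ => eqTop) (fun _ x => N.field (p, x)) :=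
    isIntegralCurve_const fun _ => hfeq
  have hinj : ∀ {y z : E}, refl y = refl z → y = z := fun {y z} h => by
    rw [← refl_refl y, h, refl_refl]
  have hback : ∀ {y : ℝ → E} {s a : ℝ}, 0 ≤ s → IsIntegralCurve y (fun _ x => N.field (p, x)) →
      x (-s) = y a → x 0 = y (a + s) := by
    intro y s a hs hy h
    have := integralCurve_unique_right hX (neg_nonpos.2 hs)
      (hx.mono Icc_subset_Iic_self) ((integralCurve_shift hy (a + s)).isIntegralCurveOn _)
      (by rw [h]; congr 1; ring)
    simpa using this
  rcases exists_meet hsd hc hcone heq (N.half_one_rot p) (by simp [rot, eqO])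
    (N.integralCurveOn_reverse hx) (N.integralCurveOn_reverse (hΓ.isIntegralCurveOn _))
    (hrev hxb) (hrev hbot) with ⟨t, ht, h⟩ | ⟨t, ht, h⟩ | ⟨s, t, hs, ht, h | h⟩
  · left
    have h' : x (-t) = eqTop := hinj (by rw [h, refl_eqTop])
    exact hback (a := 0) ht hconst h'
  · exfalso
    have h' : Γ (-t) = eqTop := hinj (by rw [h, refl_eqTop])
    have h2 : ∀ r, Γ r = eqTop := fun r =>
      integralCurve_shift_of_meet hX hΓ hconst (b := 0) h' r
    have h3 : eqTop = eqO := by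
      refine tendsto_nhds_unique ?_ htop
      rw [show Γ = fun _ => eqTop from funext h2]
      exact tendsto_const_nhds
    have h4 := congrArg (fun v : E => v.2.1) h3
    simp only [eqTop, eqO] at h4
    norm_num at h4
  · exact Or.inr (Or.inl ⟨_, hback hs hΓ (hinj h)⟩)
  · rw [← refl_rot] at h
    exact Or.inr (Or.inr ⟨_, hback hs hrotΓ (hinj h)⟩)

end NormalFamily

end Z4

namespace Z4

open scoped BoundedContinuousFunction NNReal

/-! ### Trajectories near `O` -/

lemma norm_sq_le_sum (d : E) : ‖d‖ ^ 2 ≤ d.1 ^ 2 + d.2.1 ^ 2 + d.2.2 ^ 2 := by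
  obtain ⟨X, Z, Y⟩ := d
  simp only [Prod.norm_def, Real.norm_eq_abs]
  rcases max_cases |X| (max |Z| |Y|) with ⟨h, -⟩ | ⟨h, -⟩
  · rw [h, sq_abs]; nlinarith [sq_nonneg Y, sq_nonneg Z]
  · rcases max_cases |Z| |Y| with ⟨h', -⟩ | ⟨h', -⟩ <;> rw [h, h', sq_abs]
    · nlinarith [sq_nonneg Y, sq_nonneg X]
    · nlinarith [sq_nonneg X, sq_nonneg Z]

lemma abs_coord_le (d : E) : |d.1| ≤ ‖d‖ ∧ |d.2.1| ≤ ‖d‖ ∧ |d.2.2| ≤ ‖d‖ :=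
  ⟨norm_fst_le d, (norm_fst_le d.2).trans (norm_snd_le d), (norm_snd_le d.2).trans (norm_snd_le d)⟩

lemma dist_baseOrbit_eqO_le {t : ℝ} (ht : 0 ≤ t) : dist (baseOrbit t) eqO ≤ ka t := by
  have h1 := ka_pos t
  have h2 := one_sub_th_le ht
  have h3 := th_lt_one t
  rw [Prod.dist_eq, Prod.dist_eq, Real.dist_eq, Real.dist_eq, Real.dist_eq]
  simp only [baseOrbit, eqO]
  refine max_le ?_ (max_le ?_ ?_)
  · rw [abs_le]; constructor <;> linarith
  · rw [abs_le]; constructor <;> linarith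
  · simpa using h1.le

namespace NormalFamily

variable (N : NormalFamily)

lemma field_base (X Z Y : ℝ) : N.field (p0, (X, Z, Y)) =
    (Z * X, -(X ^ 2 - Y ^ 2) - 2 * N.b p0 * X * Y, (-1 - Z) * Y) := by
  rw [← half_neg_one]
  exact (N.isHalfFamily (Or.inr rfl)).base X Z Y

lemma hasDerivAt_baseOrbit (t : ℝ) : HasDerivAt baseOrbit (N.field (p0, baseOrbit t)) t := by
  rw [baseOrbit, field_base]
  refine (((hasDerivAt_ka t).div_const 2).prodMk
    (((hasDerivAt_th t).fun_neg.div_const 2).prodMk (hasDerivAt_const t (0 : ℝ)))).congr_deriv ?_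
  refine Prod.ext ?_ (Prod.ext ?_ ?_) <;> dsimp only <;> ring

lemma exists_lipschitz {W : Type*} [NormedAddCommGroup W] [NormedSpace ℝ W] {f : Param × E → W}
    (hf : ContDiff ℝ 1 f) (R : ℝ) : ∃ K : ℝ, 0 ≤ K ∧ ∀ p x q y, dist p p0 ≤ R → dist x eqO ≤ R →
      dist q p0 ≤ R → dist y eqO ≤ R → ‖f (p, x) - f (q, y)‖ ≤ K * ‖(p, x) - (q, y)‖ := by
  obtain ⟨K, hK⟩ := LocallyLipschitzOn.exists_lipschitzOnWith_of_compact
    ((isCompact_closedBall p0 R).prod (isCompact_closedBall eqO R))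
    hf.locallyLipschitz.locallyLipschitzOn
  exact ⟨K, K.2, fun p x q y hp hx hq hy => hK.norm_sub_le (mk_mem_prod hp hx) (mk_mem_prod hq hy)⟩

/-- Continuous dependence: on a bounded time interval, trajectories that start close to the
unperturbed connection stay close to it. -/
lemma exists_close (T : ℝ) {ε : ℝ} (hε : 0 < ε) : ∃ δ > 0, ∀ p, dist p p0 < δ → ∀ x : ℝ → E,
    IsIntegralCurveOn x (fun _ y => N.field (p, y)) (Ici 0) → dist (x 0) (baseOrbit 0) < δ →
    ∀ t ∈ Icc 0 T, dist (x t) (baseOrbit t) < ε := by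
  obtain ⟨K, hK, hlip⟩ := exists_lipschitz (N.contDiff_field.of_le (by norm_cast)) 3
  set M := 12 * K + 1 with hM
  set ε' := min (ε / 2) 1 with hε'
  have hε'0 : 0 < ε' := lt_min (half_pos hε) one_pos
  set δ := min 1 (ε' * Real.exp (-(M * T)) / 2) with hδ
  have hexp := Real.exp_pos (-(M * T))
  have hδ0 : 0 < δ := lt_min one_pos (by positivity)
  by_cases hT : T < 0
  · exact ⟨1, one_pos, fun p _ x _ _ t ht => absurd (ht.1.trans ht.2) (not_le.2 hT)⟩
  rw [not_lt] at hT
  have hbound : 3 * δ ^ 2 * Real.exp (M * T) ≤ ε' ^ 2 := by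
    have h1 : δ ≤ ε' * Real.exp (-(M * T)) / 2 := min_le_right _ _
    have h2 : Real.exp (-(M * T)) * Real.exp (M * T) = 1 := by rw [← Real.exp_add]; simp
    have h3 : Real.exp (-(M * T)) ≤ 1 := Real.exp_le_one_iff.2 (by
      have : 0 ≤ M * T := by positivity
      linarith)
    have h4 : δ ^ 2 ≤ (ε' * Real.exp (-(M * T)) / 2) ^ 2 := by gcongr
    calc 3 * δ ^ 2 * Real.exp (M * T)
        ≤ 3 * (ε' * Real.exp (-(M * T)) / 2) ^ 2 * Real.exp (M * T) := by gcongr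
      _ = 3 / 4 * ε' ^ 2 * Real.exp (-(M * T)) * (Real.exp (-(M * T)) * Real.exp (M * T)) := by ring
      _ = 3 / 4 * ε' ^ 2 * Real.exp (-(M * T)) := by rw [h2, mul_one]
      _ ≤ 3 / 4 * ε' ^ 2 * 1 := by gcongr
      _ ≤ ε' ^ 2 := by nlinarith [sq_nonneg ε']
  refine ⟨δ, hδ0, fun p hp x hx hx0 t ht => ?_⟩
  set d : ℝ → E := fun t => x t - baseOrbit t with hd
  have hder : ∀ t, 0 ≤ t → HasDerivWithinAt d (N.field (p, x t) - N.field (p0, baseOrbit t))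
      (Ici 0) t := fun t ht => (hx t ht).sub (N.hasDerivAt_baseOrbit t).hasDerivWithinAt
  set φ : ℝ → ℝ := fun t => (d t).1 ^ 2 + (d t).2.1 ^ 2 + (d t).2.2 ^ 2 with hφ
  set e : ℝ → E := fun t => N.field (p, x t) - N.field (p0, baseOrbit t) with he
  have hφd : ∀ t, 0 ≤ t → HasDerivWithinAt φ
      (2 * ((d t).1 * (e t).1 + (d t).2.1 * (e t).2.1 + (d t).2.2 * (e t).2.2)) (Ici 0) t := by
    intro t ht
    obtain ⟨d1, d2, d3⟩ := hasDerivWithinAt_triple.1 (hder t ht)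
    refine (((d1.fun_pow 2).fun_add (d2.fun_pow 2)).fun_add (d3.fun_pow 2)).congr_deriv ?_
    simp [he]
    ring
  have hmain := image_le_of_deriv_right_lt_deriv_boundary' (f := φ) (a := 0) (b := T)
    (B := fun t => 3 * δ ^ 2 * Real.exp (M * t))
    (B' := fun t => 3 * δ ^ 2 * (Real.exp (M * t) * M))
    (fun t ht => ((hφd t ht.1).mono Icc_subset_Ici_self).continuousWithinAt)
    (fun t ht => (hφd t ht.1).mono (Ici_subset_Ici.2 ht.1))
    (by
      obtain ⟨h1, h2, h3⟩ := abs_coord_le (d 0)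
      have h0 : ‖d 0‖ ≤ δ := by rw [hd]; rw [dist_eq_norm] at hx0; exact hx0.le
      have k1 := sq_le_sq' (abs_le.1 (h1.trans h0)).1 (abs_le.1 (h1.trans h0)).2
      have k2 := sq_le_sq' (abs_le.1 (h2.trans h0)).1 (abs_le.1 (h2.trans h0)).2
      have k3 := sq_le_sq' (abs_le.1 (h3.trans h0)).1 (abs_le.1 (h3.trans h0)).2
      simp only [hφ, mul_zero, Real.exp_zero]
      linarith)
    (by fun_prop)
    (fun t _ => by
      have h := ((hasDerivAt_id t).const_mul M).exp.const_mul (3 * δ ^ 2)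
      simpa using h.hasDerivWithinAt)
    (fun t ht heq => by
      have hB1 : 3 * δ ^ 2 * Real.exp (M * t) ≤ 3 * δ ^ 2 * Real.exp (M * T) := by
        gcongr; exact ht.2.le
      have hB0 : δ ^ 2 ≤ 3 * δ ^ 2 * Real.exp (M * t) := by
        have : 1 ≤ Real.exp (M * t) := Real.one_le_exp (mul_nonneg (by positivity) ht.1)
        nlinarith [sq_nonneg δ]
      have hφ1 : φ t ≤ 1 := by
        rw [heq]
        have : ε' ≤ 1 := min_le_right _ _
        nlinarith
      have hns := norm_sq_le_sum (d t)
      have hn1 : ‖d t‖ ≤ 1 := by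
        have : ‖d t‖ ^ 2 ≤ 1 := hns.trans hφ1
        nlinarith [norm_nonneg (d t)]
      have hbo : dist (baseOrbit t) eqO ≤ 1 := (dist_baseOrbit_eqO_le ht.1).trans (ka_le_one t)
      have hxe : dist (x t) eqO ≤ 3 := by
        have h1 := dist_triangle (x t) (baseOrbit t) eqO
        have h2 : dist (x t) (baseOrbit t) = ‖d t‖ := dist_eq_norm _ _
        linarith
      have hpd : dist p p0 ≤ δ := hp.le
      have hδ1 : δ ≤ 1 := min_le_left _ _
      have hen : ‖e t‖ ≤ K * (δ + ‖d t‖) := by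
        refine (hlip p (x t) p0 (baseOrbit t) (by linarith) hxe (by simp) (by linarith)).trans ?_
        refine mul_le_mul_of_nonneg_left ?_ hK
        rw [Prod.norm_def]
        refine max_le ?_ ?_
        · rw [dist_eq_norm] at hpd
          exact hpd.trans (le_add_of_nonneg_right (norm_nonneg _))
        · exact le_add_of_nonneg_left hδ0.le
      obtain ⟨a1, a2, a3⟩ := abs_coord_le (d t)
      obtain ⟨b1, b2, b3⟩ := abs_coord_le (e t)
      have hm : ∀ a b : ℝ, |a| ≤ ‖d t‖ → |b| ≤ ‖e t‖ → a * b ≤ ‖d t‖ * (K * (δ + ‖d t‖)) := by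
        intro a b ha hb
        refine (le_abs_self _).trans ?_
        rw [abs_mul]
        exact mul_le_mul ha (hb.trans hen) (abs_nonneg _) (norm_nonneg _)
      have m1 := hm _ _ a1 b1
      have m2 := hm _ _ a2 b2
      have m3 := hm _ _ a3 b3
      have h5 : ‖d t‖ * (K * (δ + ‖d t‖)) ≤ K * (3 / 2 * ‖d t‖ ^ 2 + δ ^ 2 / 2) := by
        have : ‖d t‖ * (δ + ‖d t‖) ≤ 3 / 2 * ‖d t‖ ^ 2 + δ ^ 2 / 2 := by
          nlinarith [sq_nonneg (‖d t‖ - δ)]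
        calc _ = K * (‖d t‖ * (δ + ‖d t‖)) := by ring
          _ ≤ _ := mul_le_mul_of_nonneg_left this hK
      have h6 : K * (3 / 2 * ‖d t‖ ^ 2 + δ ^ 2 / 2) ≤ K * (2 * φ t) := by
        refine mul_le_mul_of_nonneg_left ?_ hK
        have h7 : ‖d t‖ ^ 2 ≤ φ t := hns
        have h8 : δ ^ 2 ≤ φ t := by rw [heq]; exact hB0
        linarith
      have hφ0 : 0 < φ t := by rw [heq]; positivity
      have e1 : 3 * δ ^ 2 * (Real.exp (M * t) * M) = M * φ t := by rw [heq]; ring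
      rw [e1, hM]
      linarith)
  have h1 := hmain ht
  have h2 : φ t ≤ ε' ^ 2 := by
    refine (h1.trans ?_).trans hbound
    have : M * t ≤ M * T := mul_le_mul_of_nonneg_left ht.2 (by positivity)
    gcongr
  have h3 : ‖d t‖ ≤ ε' := by
    have h4 := (norm_sq_le_sum (d t)).trans h2
    exact (sq_le_sq₀ (norm_nonneg _) hε'0.le).1 h4
  have h4 : ε' ≤ ε / 2 := min_le_left _ _
  rw [dist_eq_norm]
  change ‖d t‖ < ε
  linarith

end NormalFamily

end Z4

namespace Z4

open scoped BoundedContinuousFunction NNReal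

namespace NormalFamily

variable (N : NormalFamily)

/-- By the symmetry under `rot`, the planar components of `g` vanish to first order on the axis
and the axial component is constant there to second order. -/
lemma exists_bounds_g : ∃ C : ℝ, 0 ≤ C ∧ ∀ p X Z Y, dist p p0 ≤ 1 → dist ((X, Z, Y) : E) eqO ≤ 1 →
    |X * (N.g (p, (X, Z, Y))).1 + Y * (N.g (p, (X, Z, Y))).2.2| ≤ C * (X ^ 2 + Y ^ 2) ∧
    |(N.g (p, (X, Z, Y))).2.1 - (N.g (p, (0, Z, 0))).2.1| ≤ C * (X ^ 2 + Y ^ 2) := by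
  obtain ⟨K₁, hK₁, h₁⟩ := exists_lipschitz (N.g_smooth.of_le (by norm_cast)) 1
  obtain ⟨K₂, hK₂, h₂⟩ := exists_lipschitz (N.g_smooth.fderiv_right (m := 1) (by norm_cast)) 1
  refine ⟨2 * K₁ + K₂, by positivity, fun p X Z Y hp hx => ?_⟩
  set m := max |X| |Y| with hm
  have hm0 : 0 ≤ m := le_max_of_le_left (abs_nonneg _)
  have hm2 : m ^ 2 ≤ X ^ 2 + Y ^ 2 := by
    rcases max_cases |X| |Y| with ⟨h, -⟩ | ⟨h, -⟩ <;> rw [hm, h, sq_abs]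
    · nlinarith [sq_nonneg Y]
    · nlinarith [sq_nonneg X]
  have hdist : ∀ τ ∈ Icc (0 : ℝ) 1, dist ((τ * X, Z, τ * Y) : E) eqO ≤ 1 := by
    intro τ hτ
    simp only [eqO, Prod.dist_eq, Real.dist_eq, sub_zero, abs_mul, max_le_iff] at hx ⊢
    rw [abs_of_nonneg hτ.1]
    exact ⟨by nlinarith [hτ.1, hτ.2, abs_nonneg X, hx.1], hx.2.1,
      by nlinarith [hτ.1, hτ.2, abs_nonneg Y, hx.2.2]⟩
  have hnorm : ‖((X, 0, Y) : E)‖ = m := by simp [Prod.norm_def, hm]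
  constructor
  · have h := h₁ p (X, Z, Y) p (0, Z, 0) hp hx hp (by simpa using hdist 0 ⟨le_rfl, zero_le_one⟩)
    have e : ‖((p, (X, Z, Y)) : Param × E) - (p, (0, Z, 0))‖ = m := by
      simp [Prod.norm_def, hm]
    rw [e] at h
    obtain ⟨a1, -, a3⟩ := abs_coord_le (N.g (p, (X, Z, Y)) - N.g (p, (0, Z, 0)))
    rw [Prod.fst_sub, (N.g_axis p Z).1, sub_zero] at a1
    rw [Prod.snd_sub, Prod.snd_sub, (N.g_axis p Z).2, sub_zero] at a3
    have b1 : |X * (N.g (p, (X, Z, Y))).1| ≤ m * (K₁ * m) := by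
      rw [abs_mul]; exact mul_le_mul (le_max_left _ _) (a1.trans h) (abs_nonneg _) hm0
    have b3 : |Y * (N.g (p, (X, Z, Y))).2.2| ≤ m * (K₁ * m) := by
      rw [abs_mul]; exact mul_le_mul (le_max_right _ _) (a3.trans h) (abs_nonneg _) hm0
    calc _ ≤ m * (K₁ * m) + m * (K₁ * m) := (abs_add_le _ _).trans (add_le_add b1 b3)
      _ = 2 * K₁ * m ^ 2 := by ring
      _ ≤ (2 * K₁ + K₂) * m ^ 2 := by nlinarith [sq_nonneg m]
      _ ≤ _ := mul_le_mul_of_nonneg_left hm2 (by positivity)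
  · -- the derivative along the segment to the axis vanishes on the axis
    set A : ℝ → E →L[ℝ] E := fun τ => (fderiv ℝ N.g (p, (τ * X, Z, τ * Y))).comp
      (ContinuousLinearMap.inr ℝ Param E) with hA
    have hder : ∀ τ, HasDerivAt (fun τ : ℝ => (N.g (p, (τ * X, Z, τ * Y))).2.1)
        (A τ (X, 0, Y)).2.1 τ := by
      intro τ
      have hlin : ∀ k : ℝ, HasDerivAt (fun ε : ℝ => ε * k) k τ := fun k => by
        simpa using (hasDerivAt_id τ).mul_const k
      have hl : HasDerivAt (fun τ : ℝ => ((p, (τ * X, Z, τ * Y)) : Param × E))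
          (0, (X, 0, Y)) τ :=
        (hasDerivAt_const _ _).prodMk ((hlin X).prodMk ((hasDerivAt_const _ _).prodMk (hlin Y)))
      exact (hasDerivAt_triple
        ((N.g_smooth.differentiable (by simp) _).hasFDerivAt.comp_hasDerivAt τ hl)).2.1
    have h0 : (A 0 (X, 0, Y)).2.1 = 0 := by
      have h1 := hder 0
      have h2 : HasDerivAt (fun τ : ℝ => (N.g (p, (-τ * X, Z, -τ * Y))).2.1)
          (-(A 0 (X, 0, Y)).2.1) 0 := by
        have := (show HasDerivAt (fun τ : ℝ => (N.g (p, (τ * X, Z, τ * Y))).2.1)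
          (A 0 (X, 0, Y)).2.1 (-0) by rw [neg_zero]; exact h1).scomp 0 (hasDerivAt_neg (0 : ℝ))
        simpa [Function.comp_def] using this
      have e : ∀ τ : ℝ, (N.g (p, (-τ * X, Z, -τ * Y))).2.1
          = (N.g (p, (τ * X, Z, τ * Y))).2.1 := fun τ => by
        rw [neg_mul, neg_mul, N.g_rot]
      simp only [e] at h2
      have := h1.unique h2
      linarith
    have hbd : ∀ τ ∈ Ico (0 : ℝ) 1, ‖(A τ (X, 0, Y)).2.1‖ ≤ K₂ * m ^ 2 := by
      intro τ hτ
      have hτ' : τ ∈ Icc (0 : ℝ) 1 := Ico_subset_Icc_self hτ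
      have h := h₂ p (τ * X, Z, τ * Y) p (0 * X, Z, 0 * Y) hp (hdist τ hτ') hp
        (hdist 0 ⟨le_rfl, zero_le_one⟩)
      have e : ‖((p, (τ * X, Z, τ * Y)) : Param × E) - (p, (0 * X, Z, 0 * Y))‖ = τ * m := by
        simp [Prod.norm_def, hm, abs_of_nonneg hτ.1, mul_max_of_nonneg _ _ hτ.1]
        rw [max_eq_right (mul_nonneg hτ.1 (abs_nonneg Y))]
      rw [e] at h
      have h3 : (A τ (X, 0, Y)).2.1 = ((fderiv ℝ N.g (p, (τ * X, Z, τ * Y))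
          - fderiv ℝ N.g (p, (0 * X, Z, 0 * Y))) (0, (X, 0, Y))).2.1 := by
        have : (A 0 (X, 0, Y)).2.1 = (fderiv ℝ N.g (p, (0 * X, Z, 0 * Y)) (0, (X, 0, Y))).2.1 := rfl
        rw [_root_.sub_apply, Prod.snd_sub, Prod.fst_sub, ← this, h0, sub_zero]
        rfl
      have h4 := ContinuousLinearMap.le_opNorm (fderiv ℝ N.g (p, (τ * X, Z, τ * Y))
          - fderiv ℝ N.g (p, (0 * X, Z, 0 * Y))) (0, (X, 0, Y))
      have h5 : ‖((0, (X, 0, Y)) : Param × E)‖ = m := by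
        rw [Prod.norm_def, hnorm]; simp [hm0]
      rw [h5] at h4
      rw [h3]
      refine ((abs_coord_le _).2.1.trans h4).trans ?_
      calc _ ≤ K₂ * (τ * m) * m := mul_le_mul_of_nonneg_right h hm0
        _ = τ * (K₂ * m ^ 2) := by ring
        _ ≤ K₂ * m ^ 2 := mul_le_of_le_one_left (by positivity) hτ'.2
    have h := norm_image_sub_le_of_norm_deriv_le_segment'
      (fun τ _ => (hder τ).hasDerivWithinAt) hbd 1 ⟨zero_le_one, le_rfl⟩
    simp only [one_mul, zero_mul, sub_zero, mul_one, Real.norm_eq_abs] at h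
    calc _ ≤ K₂ * m ^ 2 := h
      _ ≤ (2 * K₁ + K₂) * m ^ 2 := by nlinarith [sq_nonneg m]
      _ ≤ _ := mul_le_mul_of_nonneg_left hm2 (by positivity)

/-- On the axis, the perturbation pushes away from `O`. -/
lemma exists_axis_sign : ∃ η > 0, ∀ᶠ p in 𝓝 p0, ∀ Z, |Z + 1 / 2| < η →
    0 ≤ (Z + 1 / 2) * (N.g (p, (0, Z, 0))).2.1 := by
  set A : Param × ℝ → ℝ := fun v => (fderiv ℝ N.g (v.1, (0, v.2, 0)) (0, (0, 1, 0))).2.1 with hA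
  have hAc : Continuous A :=
    (((N.g_smooth.continuous_fderiv (by simp)).comp
      (by fun_prop : Continuous fun v : Param × ℝ => ((v.1, (0, v.2, 0)) : Param × E))).clm_apply
      continuous_const).snd.fst
  have hder : ∀ p Z, HasDerivAt (fun Z : ℝ => (N.g (p, (0, Z, 0))).2.1) (A (p, Z)) Z := by
    intro p Z
    have hl : HasDerivAt (fun Z : ℝ => ((p, (0, Z, 0)) : Param × E)) (0, (0, 1, 0)) Z :=
      (hasDerivAt_const _ _).prodMk ((hasDerivAt_const _ _).prodMk
        ((hasDerivAt_id Z).prodMk (hasDerivAt_const _ _)))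
    exact (hasDerivAt_triple
      ((N.g_smooth.differentiable (by simp) _).hasFDerivAt.comp_hasDerivAt Z hl)).2.1
  have h0 : A (p0, -1 / 2) = N.γ₀ := by
    have h1 := hder p0 (-1 / 2)
    simp only [N.g_base] at h1
    have h2 := ((((hasDerivAt_id (-1 / 2 : ℝ)).add_const (1 / 2)).fun_sub
      (((hasDerivAt_id (-1 / 2 : ℝ)).add_const (1 / 2)).fun_pow 3)).const_mul N.γ₀).fun_add
      ((((hasDerivAt_id (-1 / 2 : ℝ)).add_const (1 / 2)).const_mul N.γ₁).mul_const ((0 : ℝ) ^ 2))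
    rw [h1.unique h2]
    norm_num
  have hpos : ∀ᶠ v in 𝓝 (p0, (-1 / 2 : ℝ)), 0 < A v :=
    (hAc.tendsto _).eventually (lt_mem_nhds (by rw [h0]; exact N.γ₀_pos))
  obtain ⟨η, hη, h⟩ := Metric.eventually_nhds_iff_ball.1 hpos
  refine ⟨η, hη, ?_⟩
  filter_upwards [Metric.ball_mem_nhds p0 hη] with p hp Z hZ
  have hmono : StrictMonoOn (fun Z : ℝ => (N.g (p, (0, Z, 0))).2.1) (Metric.ball (-1 / 2) η) := by
    refine strictMonoOn_of_deriv_pos (convex_ball _ _)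
      (fun Z _ => (hder p Z).continuousAt.continuousWithinAt) fun Z hZ => ?_
    rw [(hder p Z).deriv]
    rw [Metric.isOpen_ball.interior_eq] at hZ
    refine h (p, Z) ?_
    rw [← ball_prod_same]
    exact mk_mem_prod hp hZ
  have hc : (-1 / 2 : ℝ) ∈ Metric.ball (-1 / 2 : ℝ) η := Metric.mem_ball_self hη
  have hZm : Z ∈ Metric.ball (-1 / 2 : ℝ) η := by
    rw [Metric.mem_ball, Real.dist_eq]
    convert hZ using 2; ring
  have hb := N.g_bot p
  rcases le_total (-1 / 2) Z with h1 | h1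
  · have := hmono.monotoneOn hc hZm h1
    simp only [hb] at this
    exact mul_nonneg (by linarith) this
  · have := hmono.monotoneOn hZm hc h1
    simp only [hb] at this
    exact mul_nonneg_of_nonpos_of_nonpos (by linarith) this

/-- A neighbourhood of `O` that contains no long piece of the axis. It is wide away from the axis,
so that for `K ≥ 1` it contains the half of the unperturbed connection from the section to `O`. -/
def nbhd (K η : ℝ) : Set E := {x | |x.2.1 + 1 / 2| < K * (|x.1| + |x.2.2|) + η}

lemma abs_sq_sub_sq_le (X Y : ℝ) : |X ^ 2 - Y ^ 2| ≤ X ^ 2 + Y ^ 2 := by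
  rw [abs_le]; constructor <;> linarith [sq_nonneg X, sq_nonneg Y]

lemma abs_two_mul_le (X Y : ℝ) : |2 * X * Y| ≤ X ^ 2 + Y ^ 2 := by
  rw [abs_le]; constructor <;> linarith [sq_nonneg (X + Y), sq_nonneg (X - Y)]

/-- Near `O`, the function `X ^ 2 + Y ^ 2` decreases and `(Z + 1 / 2) ^ 2 - (X ^ 2 + Y ^ 2)`
increases along the flow. -/
lemma exists_cone_estimates : ∃ η > 0, ∀ᶠ p in 𝓝 p0, 0 ≤ p.2.2 → ∀ X Z Y m : ℝ,
    0 < m → m ≤ η / 4 → X ^ 2 + Y ^ 2 ≤ m ^ 2 → (X, Z, Y) ∈ nbhd 2 η →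
    2 * (X * (N.field (p, (X, Z, Y))).1 + Y * (N.field (p, (X, Z, Y))).2.2)
      ≤ -(3 / 4) * (X ^ 2 + Y ^ 2) ∧
    0 ≤ 2 * (Z + 1 / 2) * (N.field (p, (X, Z, Y))).2.1
      - 2 * (X * (N.field (p, (X, Z, Y))).1 + Y * (N.field (p, (X, Z, Y))).2.2) := by
  obtain ⟨C, hC, hCb⟩ := N.exists_bounds_g
  obtain ⟨η₀, hη₀, hsign⟩ := N.exists_axis_sign
  set B := |N.b p0| + 1 with hB
  have hB0 : 0 < B := by positivity
  set η := min (1 / 32) (min (η₀ / 4) (3 / (16 * (1 + B + C)))) with hη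
  have hη0 : 0 < η := lt_min (by norm_num) (lt_min (by linarith) (by positivity))
  have hη1 : η ≤ 1 / 32 := min_le_left _ _
  have hη2 : η ≤ η₀ / 4 := (min_le_right _ _).trans (min_le_left _ _)
  have hη3 : η * (1 + B + C) ≤ 3 / 16 := by
    have h : η ≤ 3 / (16 * (1 + B + C)) := (min_le_right _ _).trans (min_le_right _ _)
    rw [le_div_iff₀ (by positivity)] at h
    linarith
  refine ⟨η, hη0, ?_⟩
  have c1 : ∀ᶠ p : Param in 𝓝 p0, |p.1 - 1 / 2| < 1 / 32 ∧ p.2.2 * C < 1 / 32 ∧ p.2.2 < 1 := by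
    have h : Continuous fun p : Param => |p.1 - 1 / 2| := by fun_prop
    have h' : Continuous fun p : Param => p.2.2 * C := by fun_prop
    have h'' : Continuous fun p : Param => p.2.2 := by fun_prop
    exact ((h.tendsto p0).eventually (gt_mem_nhds (by simp [p0]))).and
      (((h'.tendsto p0).eventually (gt_mem_nhds (by simp [p0]))).and
      ((h''.tendsto p0).eventually (gt_mem_nhds (by simp [p0]))))
  have c2 : ∀ᶠ p in 𝓝 p0, |N.b p| < B :=
    (N.b_smooth.continuous.abs.tendsto p0).eventually (gt_mem_nhds (by rw [hB]; linarith))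
  filter_upwards [c1, c2, hsign, Metric.closedBall_mem_nhds p0 one_pos]
    with p ⟨hρ, hsC, hs1⟩ hb hsg hp hs X Z Y m hm hmη hWm hV
  replace hV : |Z + 1 / 2| < 2 * (|X| + |Y|) + η := hV
  have hXm : |X| ≤ m := abs_le_of_sq_le_sq (by linarith [sq_nonneg Y]) hm.le
  have hYm : |Y| ≤ m := abs_le_of_sq_le_sq (by linarith [sq_nonneg X]) hm.le
  have hz : |Z + 1 / 2| < 2 * η := by linarith
  have hdist : dist ((X, Z, Y) : E) eqO ≤ 1 := by
    simp only [eqO, Prod.dist_eq, Real.dist_eq, sub_zero, max_le_iff]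
    refine ⟨by linarith, ?_, by linarith⟩
    rw [show Z - -1 / 2 = Z + 1 / 2 by ring]; linarith
  obtain ⟨g1, g2⟩ := hCb p X Z Y hp hdist
  have hax := hsg Z (by linarith)
  simp only [field]
  set w := X ^ 2 + Y ^ 2 with hw
  have hw0 : 0 ≤ w := by positivity
  set G := N.g (p, (X, Z, Y)) with hG
  set G0 := (N.g (p, (0, Z, 0))).2.1 with hG0
  clear_value G G0 η B
  clear hCb hsign c1 c2 hsg
  have hW : 2 * (X * ((Z + 1 / 2 - p.1) * X - p.2.1 * Y + p.2.2 * G.1)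
        + Y * (-((Z + 1 / 2 + p.1) * Y) + p.2.1 * X + p.2.2 * G.2.2)) ≤ -(3 / 4) * w := by
    have e : 2 * (X * ((Z + 1 / 2 - p.1) * X - p.2.1 * Y + p.2.2 * G.1)
        + Y * (-((Z + 1 / 2 + p.1) * Y) + p.2.1 * X + p.2.2 * G.2.2))
        = -(2 * p.1) * w + 2 * ((Z + 1 / 2) * (X ^ 2 - Y ^ 2))
          + 2 * (p.2.2 * (X * G.1 + Y * G.2.2)) := by ring
    rw [e]
    have b1 : (Z + 1 / 2) * (X ^ 2 - Y ^ 2) ≤ 1 / 16 * w := by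
      refine (le_abs_self _).trans ?_
      rw [abs_mul]
      exact mul_le_mul (by linarith) (abs_sq_sub_sq_le X Y) (abs_nonneg _) (by norm_num)
    have b2 : p.2.2 * (X * G.1 + Y * G.2.2) ≤ 1 / 32 * w := by
      calc _ ≤ p.2.2 * (C * w) := mul_le_mul_of_nonneg_left ((le_abs_self _).trans g1) hs
        _ = p.2.2 * C * w := by ring
        _ ≤ _ := mul_le_mul_of_nonneg_right hsC.le hw0
    have b3 : -(2 * p.1) * w ≤ -(15 / 16) * w :=
      mul_le_mul_of_nonneg_right (by linarith [(abs_lt.1 hρ).1]) hw0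
    linarith
  refine ⟨hW, ?_⟩
  have d1 : |(Z + 1 / 2) * (-(X ^ 2 - Y ^ 2) - 2 * N.b p * X * Y)| ≤ 2 * η * ((1 + B) * w) := by
    rw [abs_mul]
    refine mul_le_mul hz.le ?_ (abs_nonneg _) (by positivity)
    have k1 : |X ^ 2 - Y ^ 2| ≤ w := abs_sq_sub_sq_le X Y
    have k2 : |2 * N.b p * X * Y| ≤ B * w := by
      rw [show 2 * N.b p * X * Y = N.b p * (2 * X * Y) by ring, abs_mul]
      exact mul_le_mul hb.le (abs_two_mul_le X Y) (abs_nonneg _) hB0.le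
    have k3 := abs_sub (-(X ^ 2 - Y ^ 2)) (2 * N.b p * X * Y)
    rw [abs_neg] at k3
    linarith
  have d2 : |(Z + 1 / 2) * (p.2.2 * (G.2.1 - G0))| ≤ 2 * η * (C * w) := by
    rw [abs_mul, abs_mul, abs_of_nonneg hs]
    refine mul_le_mul hz.le ?_ (by positivity) (by positivity)
    calc p.2.2 * |G.2.1 - G0| ≤ 1 * (C * w) := mul_le_mul hs1.le g2 (abs_nonneg _) zero_le_one
      _ = C * w := one_mul _
  have d3 : 0 ≤ p.2.2 * ((Z + 1 / 2) * G0) := mul_nonneg hs hax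
  have d4 : 2 * η * ((1 + B) * w) + 2 * η * (C * w) ≤ 3 / 8 * w := by
    have : η * (1 + B + C) * w ≤ 3 / 16 * w := mul_le_mul_of_nonneg_right hη3 hw0
    linarith
  have e : 2 * (Z + 1 / 2) * (-(X ^ 2 - Y ^ 2) - 2 * N.b p * X * Y + p.2.2 * G.2.1)
      = 2 * ((Z + 1 / 2) * (-(X ^ 2 - Y ^ 2) - 2 * N.b p * X * Y))
        + 2 * ((Z + 1 / 2) * (p.2.2 * (G.2.1 - G0))) + 2 * (p.2.2 * ((Z + 1 / 2) * G0)) := by ring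
  rw [e]
  linarith [(abs_le.1 d1).1, (abs_le.1 d2).1]

/-- Trajectories that stay in `nbhd 2 η` and tend to `O` do so at an exponential rate that beats
the weight. The reason: `X ^ 2 + Y ^ 2` decays, and `z ^ 2 - (X ^ 2 + Y ^ 2)` increases to `0`. -/
lemma exists_decay : ∃ η > 0, ∀ᶠ p in 𝓝 p0, 0 ≤ p.2.2 → ∀ (x : ℝ → E) (m : ℝ),
    IsIntegralCurveOn x (fun _ y => N.field (p, y)) (Ici 0) → (∀ t, 0 ≤ t → x t ∈ nbhd 2 η) →
    Tendsto x atTop (𝓝 eqO) → 0 < m → m ≤ η / 4 → (x 0).1 ^ 2 + (x 0).2.2 ^ 2 ≤ m ^ 2 →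
    ∀ t, 0 ≤ t → dist (x t) eqO ≤ m * Real.exp (-(5 / 16 * t)) := by
  obtain ⟨η, hη0, hcone⟩ := N.exists_cone_estimates
  refine ⟨η, hη0, ?_⟩
  filter_upwards [hcone] with p hcone hs x m hx hV hlim hm hmη h0
  set W : ℝ → ℝ := fun t => (x t).1 ^ 2 + (x t).2.2 ^ 2 with hW
  set F : ℝ → E := fun t => N.field (p, x t) with hF
  set W' : ℝ → ℝ := fun t => 2 * ((x t).1 * (F t).1 + (x t).2.2 * (F t).2.2) with hW'
  have hWd : ∀ t, 0 ≤ t → HasDerivWithinAt W (W' t) (Ici 0) t := by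
    intro t ht
    obtain ⟨x1, -, x3⟩ := hasDerivWithinAt_triple.1 (hx t ht)
    refine ((x1.fun_pow 2).fun_add (x3.fun_pow 2)).congr_deriv ?_
    simp [hW', hF]
    ring
  have hest : ∀ t, 0 ≤ t → W t ≤ m ^ 2 → W' t ≤ -(3 / 4) * W t ∧
      0 ≤ 2 * ((x t).2.1 + 1 / 2) * (F t).2.1 - W' t := fun t ht hWm =>
    hcone hs (x t).1 (x t).2.1 (x t).2.2 m hm hmη hWm (hV t ht)
  -- a fence: `W` cannot cross `m ^ 2 * exp (-5 t / 8)` from below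
  have htrap : ∀ t, 0 ≤ t → W t ≤ m ^ 2 * Real.exp (-(5 / 8) * t) := by
    intro T hT
    have := image_le_of_deriv_right_lt_deriv_boundary' (f := W) (a := 0) (b := T)
      (B := fun t => m ^ 2 * Real.exp (-(5 / 8) * t))
      (B' := fun t => m ^ 2 * (Real.exp (-(5 / 8) * t) * -(5 / 8)))
      (fun t ht => ((hWd t ht.1).mono Icc_subset_Ici_self).continuousWithinAt)
      (fun t ht => (hWd t ht.1).mono (Ici_subset_Ici.2 ht.1))
      (by simpa [hW] using h0) (by fun_prop)
      (fun t _ => by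
        have h := ((hasDerivAt_id t).const_mul (-(5 / 8 : ℝ))).exp.const_mul (m ^ 2)
        simpa using h.hasDerivWithinAt)
      (fun t ht heq => by
        have hexp : Real.exp (-(5 / 8) * t) ≤ 1 := Real.exp_le_one_iff.2 (by linarith [ht.1])
        have hWp : 0 < W t := by rw [heq]; positivity
        have h1 : W t ≤ m ^ 2 := by
          rw [heq]; exact mul_le_of_le_one_right (sq_nonneg m) hexp
        have h2 := (hest t ht.1 h1).1
        have e : m ^ 2 * (Real.exp (-(5 / 8) * t) * -(5 / 8)) = -(5 / 8) * W t := by rw [heq]; ring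
        rw [e]
        linarith)
    exact this ⟨hT, le_rfl⟩
  have hWm : ∀ t, 0 ≤ t → W t ≤ m ^ 2 := fun t ht => (htrap t ht).trans
    (mul_le_of_le_one_right (sq_nonneg m) (Real.exp_le_one_iff.2 (by linarith)))
  -- the axial part is dominated by the planar part
  set Q : ℝ → ℝ := fun t => ((x t).2.1 + 1 / 2) ^ 2 - W t with hQ
  have hQd : ∀ t, 0 ≤ t → HasDerivWithinAt Q
      (2 * ((x t).2.1 + 1 / 2) * (F t).2.1 - W' t) (Ici 0) t := by
    intro t ht
    obtain ⟨-, x2, -⟩ := hasDerivWithinAt_triple.1 (hx t ht)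
    refine (((x2.add_const (1 / 2)).fun_pow 2).fun_sub (hWd t ht)).congr_deriv ?_
    simp [hF]
  have hQmono : MonotoneOn Q (Ici 0) := by
    refine monotoneOn_of_deriv_nonneg (convex_Ici 0)
      (fun t ht => (hQd t ht).continuousWithinAt) (fun t ht => ?_) (fun t ht => ?_)
    · rw [interior_Ici] at ht ⊢
      exact ((hQd t (le_of_lt ht)).hasDerivAt
        (Ici_mem_nhds ht)).differentiableAt.differentiableWithinAt
    · rw [interior_Ici] at ht
      rw [((hQd t (le_of_lt ht)).hasDerivAt (Ici_mem_nhds ht)).deriv]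
      exact (hest t (le_of_lt ht) (hWm t (le_of_lt ht))).2
  have hQlim : Tendsto Q atTop (𝓝 0) := by
    have hc : Continuous fun y : E => (y.2.1 + 1 / 2) ^ 2 - (y.1 ^ 2 + y.2.2 ^ 2) := by fun_prop
    have := (hc.tendsto eqO).comp hlim
    have e : ((eqO.2.1 + 1 / 2) ^ 2 - (eqO.1 ^ 2 + eqO.2.2 ^ 2) : ℝ) = 0 := by
      simp only [eqO]; norm_num
    rw [e] at this
    exact this
  intro t ht
  have hQ0 : Q t ≤ 0 := ge_of_tendsto hQlim (by
    filter_upwards [eventually_ge_atTop t] with r hr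
    exact hQmono ht (ht.trans hr) hr)
  have hexp2 : Real.exp (-(5 / 8) * t) = Real.exp (-(5 / 16 * t)) ^ 2 := by
    rw [← Real.exp_nat_mul]; congr 1; push_cast; ring
  have hWt := htrap t ht
  rw [hexp2, ← mul_pow] at hWt
  have hpos : 0 ≤ m * Real.exp (-(5 / 16 * t)) := by positivity
  have hWd' : W t = (x t).1 ^ 2 + (x t).2.2 ^ 2 := rfl
  have hQd' : Q t = ((x t).2.1 + 1 / 2) ^ 2 - W t := rfl
  rw [Prod.dist_eq, Prod.dist_eq, Real.dist_eq, Real.dist_eq, Real.dist_eq]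
  simp only [eqO, sub_zero]
  refine max_le ?_ (max_le ?_ ?_)
  · exact abs_le_of_sq_le_sq (by nlinarith [sq_nonneg (x t).2.2]) hpos
  · rw [show (x t).2.1 - -1 / 2 = (x t).2.1 + 1 / 2 by ring]
    exact abs_le_of_sq_le_sq (by linarith) hpos
  · exact abs_le_of_sq_le_sq (by nlinarith [sq_nonneg (x t).1]) hpos

end NormalFamily

end Z4

namespace Z4

open scoped BoundedContinuousFunction NNReal

/-! ### The trace of the local stable manifold on the section -/

/-- A curve that stays close to the unperturbed connection in the weighted sense is described by
bounded frame coordinates. -/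
lemma exists_frame {x : ℝ → E} (hx : ContinuousOn x (Ici 0)) {r : ℝ} (hr : 0 ≤ r)
    (h : ∀ t, 0 ≤ t → dist (x t) (baseOrbit t) ≤ r * wt t / 4) :
    ∃ ξ : BE, ‖ξ‖ ≤ r ∧ ∀ t, 0 ≤ t → traj ξ t = x t := by
  set l : ℝ≥0 → E := fun t =>
    (2 / wt t * (ka t * ((x t).1 - (baseOrbit t).1) - th t * ((x t).2.1 - (baseOrbit t).2.1)),
     2 / wt t * (-th t * ((x t).1 - (baseOrbit t).1) + -ka t * ((x t).2.1 - (baseOrbit t).2.1)),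
     (x t).2.2 / wt t) with hl
  have hxc : Continuous fun t : ℝ≥0 => x t :=
    hx.comp_continuous NNReal.continuous_coe fun t => t.coe_nonneg
  have hlc : Continuous l := by
    have h1 := continuous_ka.comp NNReal.continuous_coe
    have h2 := continuous_th.comp NNReal.continuous_coe
    have h3 := continuous_wt.comp NNReal.continuous_coe
    have h4 := continuous_baseOrbit.comp NNReal.continuous_coe
    have h5 : Continuous fun t : ℝ≥0 => 2 / wt t :=
      continuous_const.div h3 fun t => wt_ne t
    exact (h5.mul ((h1.mul (hxc.fst.sub h4.fst)).sub (h2.mul (hxc.snd.fst.sub h4.snd.fst)))).prodMk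
      ((h5.mul ((h2.neg.mul (hxc.fst.sub h4.fst)).add (h1.neg.mul
        (hxc.snd.fst.sub h4.snd.fst)))).prodMk (hxc.snd.snd.div h3 fun t => wt_ne t))
  have hbd : ∀ t, ‖l t‖ ≤ r := by
    intro t
    have hw := wt_pos t
    have hk : |ka t| ≤ 1 := by rw [abs_of_pos (ka_pos t)]; exact ka_le_one t
    have hT := abs_th_le_one t
    have hd := h t t.coe_nonneg
    obtain ⟨d1, d2, d3⟩ := abs_coord_le (x t - baseOrbit t)
    rw [← dist_eq_norm] at d1 d2 d3
    replace d1 : |(x t).1 - (baseOrbit t).1| ≤ r * wt t / 4 := d1.trans hd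
    replace d2 : |(x t).2.1 - (baseOrbit t).2.1| ≤ r * wt t / 4 := d2.trans hd
    replace d3 : |(x t).2.2 - (baseOrbit t).2.2| ≤ r * wt t / 4 := d3.trans hd
    have key : ∀ v, |v| ≤ 2 * (r * wt t / 4) → |2 / wt t * v| ≤ r := by
      intro v hv
      rw [abs_mul, abs_of_pos (by positivity)]
      calc 2 / wt t * |v| ≤ 2 / wt t * (2 * (r * wt t / 4)) :=
            mul_le_mul_of_nonneg_left hv (by positivity)
        _ = r := by field_simp; ring
    simp only [hl, Prod.norm_def, Real.norm_eq_abs]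
    refine max_le (key _ ?_) (max_le (key _ ?_) ?_)
    · have := abs_combination_le hk (by rwa [abs_neg] : |-th t| ≤ 1) d1 d2
      rwa [neg_mul, ← sub_eq_add_neg] at this
    · exact abs_combination_le (by rwa [abs_neg]) (by rwa [abs_neg]) d1 d2
    · rw [abs_div, abs_of_pos hw, div_le_iff₀ hw]
      simp only [baseOrbit, sub_zero] at d3
      nlinarith [mul_nonneg hr hw.le]
  refine ⟨BoundedContinuousFunction.ofNormedAddCommGroup l hlc r hbd,
    BoundedContinuousFunction.norm_ofNormedAddCommGroup_le _ hr hbd, fun t ht => ?_⟩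
  have e := ka_sq_add_th_sq t
  have hw := wt_ne t
  have h1 : ∀ v, wt t * (2 / wt t * v) = 2 * v := fun v => by field_simp
  simp only [traj, trajOf, BoundedContinuousFunction.coe_ofNormedAddCommGroup, hl, baseOrbit,
    Real.coe_toNNReal t ht]
  refine Prod.ext ?_ (Prod.ext ?_ ?_)
  · dsimp only
    field_simp
    grind
  · dsimp only
    field_simp
    grind
  · dsimp only
    field_simp

lemma wt_antitone : Antitone wt := fun s t h => by
  unfold wt
  exact Real.exp_le_exp.2 (by linarith)

namespace NormalFamily

variable (N : NormalFamily)

/-- On the section `Z = 0` near the unperturbed connection, the local stable set of `O` is a graph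
over the `Y`-axis: by the decay estimate its trajectories have small bounded frame coordinates, and
half-solutions with such coordinates are unique for given `Y`. -/
lemma exists_stable_trace {ψs : Param × ℝ → BE} (h0 : ψs (p0, 0) = 0)
    (hc : ContinuousAt ψs (p0, 0))
    (hψ : ∀ᶠ v in 𝓝 ((p0, (0 : ℝ)), (0 : BE)),
      (IsHalfSolution (N.half (-1)) v.1.1 v.2 ∧ (v.2 0).2.2 = v.1.2) ↔ ψs v.1 = v.2) :
    ∃ η > 0, ∃ θ > 0, ∀ᶠ p in 𝓝 p0, 0 ≤ p.2.2 → ∀ V, nbhd 1 η ⊆ V → V ⊆ nbhd 2 η →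
      ∀ X Y, |X - 1 / 2| < θ → |Y| < θ →
      ((∃ x : ℝ → E, x 0 = (X, 0, Y) ∧ IsIntegralCurveOn x (fun _ y => N.field (p, y)) (Ici 0) ∧
        (∀ t, 0 ≤ t → x t ∈ V) ∧ Tendsto x atTop (𝓝 eqO)) ↔
        X = (1 + (ψs (p, Y) 0).1) / 2) := by
  obtain ⟨η, hη, hdecay⟩ := N.exists_decay
  obtain ⟨r₁, hr₁, hiff⟩ := Metric.eventually_nhds_iff_ball.1 hψ
  have hψ0 : ∀ᶠ q in 𝓝 (p0, (0 : ℝ)), ‖ψs q‖ < min r₁ (η / 4) := by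
    have h : Tendsto (fun q => ‖ψs q‖) (𝓝 (p0, 0)) (𝓝 0) := by
      have h := hc.norm.tendsto
      simpa only [h0, norm_zero] using h
    exact h.eventually (gt_mem_nhds (lt_min hr₁ (by positivity)))
  obtain ⟨r₂, hr₂, hsmall⟩ := Metric.eventually_nhds_iff_ball.1 hψ0
  set r := r₁ / 2 with hr
  have hr0 : 0 < r := half_pos hr₁
  obtain ⟨T, hT0, hT1, hT2⟩ : ∃ T, 0 ≤ T ∧ wt T ≤ r / 20 ∧ 3 * wt T ^ 2 ≤ η / 4 := by
    have h1 := tendsto_wt.eventually (gt_mem_nhds (show (0 : ℝ) < r / 20 by positivity))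
    have h2 : Tendsto (fun t => 3 * wt t ^ 2) atTop (𝓝 0) := by
      simpa using (tendsto_wt.pow 2).const_mul 3
    obtain ⟨T, a, b, c⟩ := ((eventually_ge_atTop (0 : ℝ)).and (h1.and (h2.eventually
      (gt_mem_nhds (show (0 : ℝ) < η / 4 by positivity))))).exists
    exact ⟨T, a, b.le, c.le⟩
  have hw := wt_pos T
  set ε := min (r * wt T / 4) (wt T ^ 2) with hε
  have hε0 : 0 < ε := lt_min (by positivity) (by positivity)
  obtain ⟨δ, hδ, hclose⟩ := N.exists_close T hε0
  have hp1 : ∀ᶠ p in 𝓝 p0, dist p p0 < min δ (min r₁ r₂) :=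
    Metric.ball_mem_nhds p0 (lt_min hδ (lt_min hr₁ hr₂))
  refine ⟨η, hη, min δ (min r₁ r₂), lt_min hδ (lt_min hr₁ hr₂), ?_⟩
  filter_upwards [hdecay, hp1] with p hdec hpd hs V hV1 hV2 X Y hX hY
  simp only [lt_min_iff] at hpd hX hY
  have hmem : ∀ ξ : BE, ‖ξ‖ < r₁ → ((IsHalfSolution (N.half (-1)) p ξ ∧ (ξ 0).2.2 = Y) ↔
      ψs (p, Y) = ξ) := fun ξ hξ => hiff ((p, Y), ξ) (by
    rw [Metric.mem_ball, Prod.dist_eq, Prod.dist_eq]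
    refine max_lt (max_lt hpd.2.1 ?_) ?_
    · simpa using hY.2.1
    · simpa using hξ)
  have hψn := hsmall (p, Y) (by
    rw [Metric.mem_ball, Prod.dist_eq]
    exact max_lt hpd.2.2 (by simpa using hY.2.2))
  rw [lt_min_iff] at hψn
  constructor
  · rintro ⟨x, hx0, hx, hxV, hlim⟩
    have hclose' := hclose p hpd.1 x hx (by
      rw [hx0, ← trajOf_zero, Prod.dist_eq, Prod.dist_eq]
      simp only [trajOf, ka_zero, th_zero, wt_zero, Real.dist_eq]
      simp only [sup_lt_iff]
      refine ⟨by simpa using hX.1, by simpa using hδ, by simpa using hY.1⟩)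
    -- up to time `T` the curve is close to the connection by continuity, after it by decay
    have hfar : ∀ t, T ≤ t → dist (x t) eqO ≤ 3 * wt T * wt t := by
      intro t ht
      have hT' := hclose' T ⟨hT0, le_rfl⟩
      obtain ⟨d1, -, d3⟩ := abs_coord_le (x T - baseOrbit T)
      rw [← dist_eq_norm] at d1 d3
      replace d1 : |(x T).1 - (baseOrbit T).1| ≤ wt T ^ 2 :=
        (d1.trans hT'.le).trans (min_le_right _ _)
      replace d3 : |(x T).2.2 - (baseOrbit T).2.2| ≤ wt T ^ 2 :=
        (d3.trans hT'.le).trans (min_le_right _ _)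
      simp only [baseOrbit, sub_zero] at d1 d3
      have hk := ka_le_wt_sq T
      have hk0 := ka_pos T
      have hdx : |(x T).1| ≤ 2 * wt T ^ 2 := by
        rw [abs_le] at d1 ⊢
        constructor <;> linarith [d1.1, d1.2, sq_nonneg (wt T)]
      have h := hdec hs (fun t => x (t + T)) (3 * wt T ^ 2) (integralCurveOn_shift hT0 hx)
        (fun t ht => hV2 (hxV _ (by linarith)))
        (hlim.comp (tendsto_atTop_add_const_right _ T tendsto_id)) (by positivity) hT2 (by
          simp only [zero_add]
          have a1 := sq_le_sq' (abs_le.1 hdx).1 (abs_le.1 hdx).2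
          have a3 := sq_le_sq' (abs_le.1 d3).1 (abs_le.1 d3).2
          nlinarith [sq_nonneg (wt T ^ 2)]) (t - T) (by linarith)
      simp only [sub_add_cancel] at h
      refine h.trans ?_
      have e : wt t = Real.exp (-(1 / 4 * (t - T))) * wt T := wt_div T t
      have e2 : Real.exp (-(5 / 16 * (t - T))) ≤ Real.exp (-(1 / 4 * (t - T))) :=
        Real.exp_le_exp.2 (by linarith)
      calc 3 * wt T ^ 2 * Real.exp (-(5 / 16 * (t - T)))
          ≤ 3 * wt T ^ 2 * Real.exp (-(1 / 4 * (t - T))) :=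
            mul_le_mul_of_nonneg_left e2 (by positivity)
        _ = 3 * wt T * wt t := by rw [e]; ring
    have hall : ∀ t, 0 ≤ t → dist (x t) (baseOrbit t) ≤ r * wt t / 4 := by
      intro t ht
      rcases le_total t T with h | h
      · refine ((hclose' t ⟨ht, h⟩).le.trans (min_le_left _ _)).trans ?_
        have := mul_le_mul_of_nonneg_left (wt_antitone h) hr0.le
        linarith
      · have h1 := hfar t h
        have h2 := (dist_baseOrbit_eqO_le ht).trans (ka_le_wt_sq t)
        have h3 := dist_triangle_right (x t) (baseOrbit t) eqO
        have h4 := wt_antitone h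
        have hwt := wt_pos t
        have h5 : wt t * wt t ≤ wt T * wt t := mul_le_mul_of_nonneg_right h4 hwt.le
        have h6 : wt T * wt t ≤ r / 20 * wt t := mul_le_mul_of_nonneg_right hT1 hwt.le
        nlinarith
    obtain ⟨ξ, hξ, hξx⟩ := exists_frame (fun t ht => (hx t ht).continuousWithinAt) hr0.le hall
    have hx0' := hξx 0 le_rfl
    rw [hx0] at hx0'
    have hb : (ξ 0).2.1 = 0 := by
      have := congrArg (fun v : E => v.2.1) hx0'
      simp only [traj, trajOf, Real.toNNReal_zero, ka_zero, th_zero, wt_zero] at this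
      linarith
    rw [traj_zero_eq ξ hb, Prod.mk.injEq, Prod.mk.injEq] at hx0'
    have hhalf : IsHalfSolution (N.half (-1)) p ξ := by
      refine ⟨fun t ht => ?_, hb⟩
      rw [half_neg_one, hξx t ht]
      exact (hx t ht).congr (fun s hs => hξx s hs) (hξx t ht)
    rw [(hmem ξ (by linarith)).1 ⟨hhalf, hx0'.2.2⟩]
    exact hx0'.1.symm
  · intro hXe
    obtain ⟨⟨hcurve, hb⟩, hY0⟩ := (hmem (ψs (p, Y)) hψn.1).2 rfl
    refine ⟨traj (ψs (p, Y)), ?_, fun t ht => ?_, fun t ht => hV1 ?_, tendsto_traj _⟩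
    · rw [traj_zero_eq _ hb, hY0, hXe]
    · have := hcurve t ht
      rwa [half_neg_one] at this
    · have h1 := (dist_traj_le (ψs (p, Y)) t).trans
        (mul_le_of_le_one_left (norm_nonneg _) (wt_le_one ht))
      obtain ⟨d1, d2, -⟩ := abs_coord_le (traj (ψs (p, Y)) t - baseOrbit t)
      rw [← dist_eq_norm] at d1 d2
      replace d1 : |(traj (ψs (p, Y)) t).1 - (baseOrbit t).1| < η / 4 :=
        (d1.trans h1).trans_lt hψn.2
      replace d2 : |(traj (ψs (p, Y)) t).2.1 - (baseOrbit t).2.1| < η / 4 :=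
        (d2.trans h1).trans_lt hψn.2
      simp only [baseOrbit] at d1 d2
      have h2 := one_sub_th_le ht
      have h3 := th_lt_one t
      change |_| < 1 * (|_| + |_|) + η
      rw [abs_lt] at d1 d2 ⊢
      have h4 := le_abs_self (traj (ψs (p, Y)) t).1
      have h5 := abs_nonneg (traj (ψs (p, Y)) t).2.2
      have h6 := abs_nonneg (traj (ψs (p, Y)) t).1
      constructor <;> linarith [d1.1, d1.2, d2.1, d2.2]

end NormalFamily

end Z4

namespace Z4

open scoped BoundedContinuousFunction NNReal

/-! ### Splitting of the separatrix for systems in normal form -/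

namespace NormalFamily

variable (N : NormalFamily)

/-- The splitting of the separatrix of `O⁺` and of the local stable manifold of `O` on the section
`Z = 0`, in real coordinates: the separatrix has its first intersection with the section at
`(X, Y) = P p`, and the trace of the stable manifold is `X = Q (p, Y)`. -/
theorem exists_splitting : ∃ (P : Param → ℝ × ℝ) (Q : Param × ℝ → ℝ),
    P p0 = (1 / 2, 0) ∧ Q (p0, 0) = 1 / 2 ∧
    (∀ᶠ p in 𝓝 p0, ContDiffAt ℝ ∞ P p) ∧ (∀ᶠ q in 𝓝 (p0, (0 : ℝ)), ContDiffAt ℝ ∞ Q q) ∧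
    (∃ D' : Param →L[ℝ] ℝ, HasFDerivAt (fun p => (P p).1 - Q (p, (P p).2)) D' p0 ∧
      ∀ v, D' v = -2 * v.1 - 2 * N.b p0 * (9 - Real.pi ^ 2) / 3 * v.2.1 + 2 * N.slope * v.2.2) ∧
    (∃ η > 0, ∃ θ > 0, ∀ᶠ p in 𝓝 p0, 0 ≤ p.2.2 → ∀ V, nbhd 1 η ⊆ V → V ⊆ nbhd 2 η →
      ∀ X Y, |X - 1 / 2| < θ → |Y| < θ →
      ((∃ x : ℝ → E, x 0 = (X, 0, Y) ∧ IsIntegralCurveOn x (fun _ y => N.field (p, y)) (Ici 0) ∧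
        (∀ t, 0 ≤ t → x t ∈ V) ∧ Tendsto x atTop (𝓝 eqO)) ↔ X = Q (p, Y))) ∧
    (∀ᶠ p in 𝓝 p0, ∃ x : ℝ → E, x 0 = ((P p).1, 0, (P p).2) ∧
      IsIntegralCurveOn x (fun _ y => N.field (p, y)) (Iic 0) ∧ Tendsto x atBot (𝓝 eqTop) ∧
      ∀ t < 0, 0 < (x t).2.1) ∧
    (∃ θ > 0, ∀ᶠ p in 𝓝 p0, ∀ X Y, |X - 1 / 2| < θ → |Y| < θ → (N.field (p, (X, 0, Y))).2.1 < 0) ∧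
    ∀ᶠ p in 𝓝 p0, 0 < p.2.2 → (P p).1 = Q (p, (P p).2) → ∃ Γ : ℝ → E,
      IsIntegralCurve Γ (fun _ y => N.field (p, y)) ∧ Tendsto Γ atBot (𝓝 eqTop) ∧
      Tendsto Γ atTop (𝓝 eqO) ∧ (Γ 0).1 ≠ 0 ∧
      ∀ x : ℝ → E, IsIntegralCurveOn x (fun _ y => N.field (p, y)) (Iic 0) →
        Tendsto x atBot (𝓝 eqTop) → x 0 = eqTop ∨ (∃ t, x 0 = Γ t) ∨ ∃ t, x 0 = rot (Γ t) := by
  obtain ⟨ψs, ψu, hs0, hu0, hs, hu, hsol, huol, D', hD', hval⟩ := N.exists_halves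
  set ev : BE →L[ℝ] E := BoundedContinuousFunction.evalCLM ℝ (0 : ℝ≥0)
  have hsc : ContinuousAt ψs (p0, 0) := hs.self_of_nhds.continuousAt
  have huc : ContinuousAt ψu p0 := hu.self_of_nhds.continuousAt
  have hP0 : ((1 + (ψu p0 0).1) / 2, (ψu p0 0).2.2) = ((1 / 2, 0) : ℝ × ℝ) := by rw [hu0]; simp
  have hQ0 : (1 + (ψs (p0, 0) 0).1) / 2 = 1 / 2 := by rw [hs0]; simp
  have huh : ∀ᶠ p in 𝓝 p0, IsHalfSolution (N.half 1) p (ψu p) := by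
    have ht : Tendsto (fun p => (p, ψu p)) (𝓝 p0) (𝓝 (p0, 0)) := by
      have := continuousAt_id.tendsto.prodMk_nhds huc.tendsto
      rwa [hu0] at this
    filter_upwards [ht.eventually huol] with p hp using hp.2 rfl
  have hneg : ∀ᶠ p in 𝓝 p0, ∀ t, 0 < t → (traj (ψu p) t).2.1 < 0 := by
    have ht : Tendsto (fun p => (p, ψu p)) (𝓝 p0) (𝓝 (p0, 0)) := by
      have := continuousAt_id.tendsto.prodMk_nhds huc.tendsto
      rwa [hu0] at this
    filter_upwards [ht.eventually (eventually_neg (N.isHalfFamily (Or.inl rfl))), huh]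
      with p hp hp' using hp hp'
  have hun : ∀ᶠ p in 𝓝 p0, ∃ x : ℝ → E, x 0 = ((1 + (ψu p 0).1) / 2, 0, (ψu p 0).2.2) ∧
      IsIntegralCurveOn x (fun _ y => N.field (p, y)) (Iic 0) ∧ Tendsto x atBot (𝓝 eqTop) ∧
      ∀ t < 0, 0 < (x t).2.1 := by
    filter_upwards [huh, hneg] with p hp hn
    refine ⟨fun t => refl (traj (ψu p) (-t)), ?_, integralCurveOn_reverse' N hp.1, ?_, ?_⟩
    · beta_reduce
      rw [neg_zero, traj_zero_eq _ hp.2]; simp [refl]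
    · rw [← refl_eqO]
      exact (continuous_refl.tendsto _).comp ((tendsto_traj _).comp tendsto_neg_atBot_atTop)
    · intro t ht
      have := hn (-t) (by linarith)
      simp only [refl]
      linarith
  refine ⟨fun p => ((1 + (ψu p 0).1) / 2, (ψu p 0).2.2), fun q => (1 + (ψs q 0).1) / 2, hP0, hQ0,
    ?_, ?_, ⟨(1 / 2 : ℝ) • D', ?_, fun v => ?_⟩, N.exists_stable_trace hs0 hsc hsol, hun, ?_, ?_⟩
  · filter_upwards [hu] with p hp
    have h : ContDiffAt ℝ ∞ (fun p => ev (ψu p)) p := ev.contDiff.contDiffAt.comp p hp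
    exact ((contDiffAt_const.add (contDiffAt_fst.comp p h)).div_const 2).prodMk
      (contDiffAt_snd.comp p (contDiffAt_snd.comp p h))
  · filter_upwards [hs] with q hq
    have h : ContDiffAt ℝ ∞ (fun q => ev (ψs q)) q := ev.contDiff.contDiffAt.comp q hq
    exact (contDiffAt_const.add (contDiffAt_fst.comp q h)).div_const 2
  · refine (hD'.const_smul (1 / 2 : ℝ)).congr_of_eventuallyEq (Eventually.of_forall fun p => ?_)
    simp only [Pi.smul_apply, smul_eq_mul]
    ring
  · rw [_root_.smul_apply, hval, smul_eq_mul]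
    ring
  · have hc : Continuous fun v : Param × ℝ × ℝ => (N.field (v.1, (v.2.1, 0, v.2.2))).2.1 :=
      (N.contDiff_field.continuous.comp (by fun_prop : Continuous fun v : Param × ℝ × ℝ =>
        ((v.1, (v.2.1, 0, v.2.2)) : Param × E))).snd.fst
    have h := (hc.tendsto (p0, 1 / 2, 0)).eventually (gt_mem_nhds
      (show (N.field (p0, (1 / 2, 0, 0))).2.1 < 0 by rw [field_base]; norm_num))
    obtain ⟨θ, hθ, h⟩ := Metric.eventually_nhds_iff_ball.1 h
    refine ⟨θ, hθ, ?_⟩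
    filter_upwards [Metric.ball_mem_nhds p0 hθ] with p hp X Y hX hY
    refine h (p, X, Y) ?_
    rw [Metric.mem_ball, Prod.dist_eq, Prod.dist_eq]
    exact max_lt hp (max_lt (by simpa [Real.dist_eq] using hX) (by simpa [Real.dist_eq] using hY))
  · have hstab : ∀ᶠ p in 𝓝 p0, IsHalfSolution (N.half (-1)) p (ψs (p, (ψu p 0).2.2)) ∧
        (ψs (p, (ψu p 0).2.2) 0).2.2 = (ψu p 0).2.2 := by
      have h1 : Tendsto (fun p => (p, (ev (ψu p)).2.2)) (𝓝 p0) (𝓝 (p0, 0)) := by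
        have h := continuousAt_id.tendsto.prodMk_nhds
          ((ev.continuous.continuousAt.comp huc).snd.snd.tendsto)
        simpa only [Function.comp_apply, hu0, map_zero, id, Prod.snd_zero] using h
      have h2 := h1.prodMk_nhds (hsc.tendsto.comp h1)
      rw [hs0] at h2
      filter_upwards [h2.eventually hsol] with p hp using hp.2 rfl
    have hX : ∀ᶠ p in 𝓝 p0, 0 < (1 + (ev (ψu p)).1) / 2 := by
      have h := (((ev.continuous.continuousAt.comp huc).fst.const_add 1).div_const 2).tendsto
      refine h.eventually (lt_mem_nhds ?_)
      simp [hu0]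
    filter_upwards [hun, hstab, N.eventually_unstable, hX] with p ⟨x, hx0, hx, hxlim, _⟩ ⟨hy, hyY⟩
      huniq hXp hsp heq
    have hy' : IsIntegralCurveOn (traj (ψs (p, (ψu p 0).2.2))) (fun _ y => N.field (p, y))
        (Ici 0) := by
      intro t ht
      have := hy.1 t ht
      rwa [half_neg_one] at this
    obtain ⟨Γ, hΓ, h1, h2⟩ := exists_glue (X := fun y => N.field (p, y)) hx hy' (by
      rw [hx0, traj_zero_eq _ hy.2, hyY]
      exact Prod.ext heq rfl)
    have hbot : Tendsto Γ atBot (𝓝 eqTop) := hxlim.congr' (by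
      filter_upwards [eventually_le_atBot 0] with t ht using (h1 ht).symm)
    have htop : Tendsto Γ atTop (𝓝 eqO) := (tendsto_traj _).congr' (by
      filter_upwards [eventually_ge_atTop 0] with t ht using (h2 ht).symm)
    refine ⟨Γ, hΓ, hbot, htop, ?_, huniq hsp Γ hΓ hbot htop⟩
    rw [h1 (mem_Iic.2 le_rfl), hx0]
    exact hXp.ne'

end NormalFamily

end Z4

namespace Z4

/-! ### The rescaled family in real coordinates -/

/-- The point of the phase space with real coordinates `x`, where the plane is scaled by `k`. -/
noncomputable def ofE (k : ℝ) (x : E) : Phase := (⟨x.1 / k, x.2.2 / k⟩, x.2.1 + 1 / 2)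

/-- The real coordinates of a point of the phase space; inverse to `ofE k`. -/
noncomputable def toE (k : ℝ) (w : Phase) : E := (k * w.1.re, w.2 - 1 / 2, k * w.1.im)

lemma ofE_toE {k : ℝ} (hk : k ≠ 0) (w : Phase) : ofE k (toE k w) = w := by
  refine Prod.ext (Complex.ext ?_ ?_) ?_ <;> simp [ofE, toE, hk]

lemma contDiff_mk_complex {G : Type*} [NormedAddCommGroup G] [NormedSpace ℝ G] {a b : G → ℝ}
    (ha : ContDiff ℝ ∞ a) (hb : ContDiff ℝ ∞ b) :
    ContDiff ℝ ∞ (fun x => (⟨a x, b x⟩ : ℂ)) :=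
  Complex.equivRealProdCLM.symm.contDiff.comp (ha.prodMk hb)

lemma contDiffOn_ofReal {G : Type*} [NormedAddCommGroup G] [NormedSpace ℝ G] {f : G → ℝ}
    {s : Set G} (hf : ContDiffOn ℝ ∞ f s) : ContDiffOn ℝ ∞ (fun x => (f x : ℂ)) s :=
  Complex.ofRealCLM.contDiff.comp_contDiffOn hf

lemma contDiffOn_div_complex {G : Type*} [NormedAddCommGroup G] [NormedSpace ℝ G] {f g : G → ℂ}
    {s : Set G} (hf : ContDiffOn ℝ ∞ f s) (hg : ContDiffOn ℝ ∞ g s) (h : ∀ x ∈ s, g x ≠ 0) :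
    ContDiffOn ℝ ∞ (fun x => f x / g x) s := by
  simp only [div_eq_mul_inv]
  exact hf.mul (hg.inv h)

lemma continuous_ofE (k : ℝ) : Continuous (ofE k) := by
  have h : Continuous fun x : E => (⟨x.1 / k, x.2.2 / k⟩ : ℂ) :=
    (contDiff_mk_complex (by fun_prop) (by fun_prop)).continuous
  exact h.prodMk (by fun_prop)

lemma continuous_toE (k : ℝ) : Continuous (toE k) := by
  unfold toE
  fun_prop

/-- A smooth retraction of the parameter space into a ball, equal to the identity near the
centre. -/
lemma exists_retraction (c : Param) {r : ℝ} (hr : 0 < r) : ∃ π : Param → Param, ContDiff ℝ ∞ π ∧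
    (∀ p, π p ∈ Metric.ball c r) ∧ ∀ᶠ p in 𝓝 c, π p = p := by
  let f : ContDiffBump c := ⟨r / 4, r / 2, by positivity, by linarith⟩
  refine ⟨fun p => c + f p • (p - c), ?_, fun p => ?_, ?_⟩
  · exact contDiff_const.add (f.contDiff.smul (contDiff_id.sub contDiff_const))
  · rw [Metric.mem_ball, dist_eq_norm, add_sub_cancel_left, norm_smul, Real.norm_eq_abs,
      abs_of_nonneg f.nonneg]
    by_cases hp : dist p c < r / 2
    · rw [← dist_eq_norm]
      have := mul_le_mul_of_nonneg_right (f.le_one (x := p)) (dist_nonneg (x := p) (y := c))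
      linarith
    · rw [f.zero_of_le_dist (not_lt.1 hp), zero_mul]
      exact hr
  · filter_upwards [Metric.closedBall_mem_nhds c (show 0 < r / 4 by positivity)] with p hp
    rw [f.one_of_mem_closedBall hp]
    simp

namespace RescaledFamily

variable (F : RescaledFamily)

lemma R1_neg {p : Param} (hp : p ∈ Metric.ball p0 F.r) (u : ℂ) (z : ℝ) :
    F.R1 p (-u, z) = -F.R1 p (u, z) := by
  have h : S (S (u, z)) = (-u, z) := by
    simp only [S, neg_neg, ← mul_assoc, Complex.I_mul_I, neg_one_mul]
  rw [← h, F.R1_symm p hp, F.R1_symm p hp, ← mul_assoc, Complex.I_mul_I, neg_one_mul]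

lemma R2_neg {p : Param} (hp : p ∈ Metric.ball p0 F.r) (u : ℂ) (z : ℝ) :
    F.R2 p (-u, z) = F.R2 p (u, z) := by
  have h : S (S (u, z)) = (-u, z) := by
    simp only [S, neg_neg, ← mul_assoc, Complex.I_mul_I, neg_one_mul]
  rw [← h, F.R2_symm p hp, F.R2_symm p hp, neg_neg]

lemma R2_zero {p : Param} (hp : p ∈ Metric.ball p0 F.r) : F.R2 p (0, 0) = 0 := by
  have h := F.R2_symm p hp (0, 0)
  have e : S (0, 0) = (0, 0) := by simp [S]
  rw [e] at h
  linarith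

lemma f1_neg {p : Param} (hp : p ∈ Metric.ball p0 F.r) (u : ℂ) (z : ℝ) :
    F.f1 p (-u, z) = -F.f1 p (u, z) := by
  simp only [f1, F.R1_neg hp, map_neg]
  ring

lemma f2_neg {p : Param} (hp : p ∈ Metric.ball p0 F.r) (u : ℂ) (z : ℝ) :
    F.f2 p (-u, z) = F.f2 p (u, z) := by
  simp only [f2, F.R2_neg hp, norm_neg]

lemma field_S {p : Param} (hp : p ∈ Metric.ball p0 F.r) (w : Phase) :
    F.field p (S w) = S (F.field p w) := by
  obtain ⟨u, z⟩ := w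
  have h1 := F.R1_symm p hp (u, z)
  have h2 := F.R2_symm p hp (u, z)
  simp only [S] at h1 h2
  have hI : Complex.I ^ 2 = -1 := Complex.I_sq
  have hI3 : Complex.I ^ 3 = -Complex.I := by rw [pow_succ, hI, neg_one_mul]
  simp only [field, f1, f2, S, h1, h2]
  refine Prod.ext ?_ ?_
  · simp only [map_mul, Complex.conj_I, Complex.ofReal_neg, mul_pow, hI, neg_sq]
    have e : (-Complex.I) ^ 3 = Complex.I := by rw [neg_pow, hI3]; ring
    rw [e]
    ring
  · simp only [map_mul, Complex.conj_I, mul_pow, hI, neg_sq, norm_mul, Complex.norm_I, one_mul]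
    have e : F.c.AB p * (-1 * u ^ 2) + (starRingEnd ℂ) (F.c.AB p) * (-1 * (starRingEnd ℂ) u ^ 2)
        = -(F.c.AB p * u ^ 2 + (starRingEnd ℂ) (F.c.AB p) * (starRingEnd ℂ) u ^ 2) := by ring
    rw [e, Complex.neg_re]
    ring

lemma contDiff_field_right {p : Param} (hp : p ∈ Metric.ball p0 F.r) :
    ContDiff ℝ ∞ (F.field p) := by
  have hm : ∀ w : Phase, (p, w) ∈ Metric.ball p0 F.r ×ˢ (univ : Set Phase) := fun w =>
    mk_mem_prod hp (mem_univ _)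
  have h1 : ContDiff ℝ ∞ (F.R1 p) := F.R1_smooth.comp_contDiff (contDiff_prodMk_right p) hm
  have h2 : ContDiff ℝ ∞ (F.R2 p) := F.R2_smooth.comp_contDiff (contDiff_prodMk_right p) hm
  have hz : ContDiff ℝ ∞ fun w : Phase => (w.2 : ℂ) := Complex.ofRealCLM.contDiff.comp contDiff_snd
  have hv : ContDiff ℝ ∞ fun w : Phase => (starRingEnd ℂ) w.1 :=
    Complex.conjCLE.contDiff.comp contDiff_fst
  have hn : ContDiff ℝ ∞ fun w : Phase => ‖w.1‖ ^ 2 := (contDiff_norm_sq ℝ).comp contDiff_fst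
  have hre : ContDiff ℝ ∞ fun w : Phase =>
      (F.c.AB p * w.1 ^ 2 + (starRingEnd ℂ) (F.c.AB p) * (starRingEnd ℂ) w.1 ^ 2).re :=
    Complex.reCLM.contDiff.comp ((contDiff_const.mul (contDiff_fst.pow 2)).add
      (contDiff_const.mul (hv.pow 2)))
  have hf1 : ContDiff ℝ ∞ (F.f1 p) := by
    unfold f1
    dsimp only
    exact ((((contDiff_const.mul (contDiff_fst.pow 2)).mul hv).add
      ((contDiff_const.mul (hz.pow 2)).mul contDiff_fst)).add (contDiff_const.mul (hv.pow 3))).add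
      (contDiff_const.mul h1)
  have hf2 : ContDiff ℝ ∞ (F.f2 p) := by
    unfold f2
    exact ((contDiff_const.mul (contDiff_snd.sub (contDiff_snd.pow 3))).add
      ((contDiff_const.mul contDiff_snd).mul hn)).add (contDiff_const.mul h2)
  unfold field
  exact (((contDiff_const.mul contDiff_fst).add (hz.mul hv)).add (contDiff_const.mul hf1)).prodMk
    (hre.add (contDiff_const.mul hf2))

section Good

variable {F} {U : Set Param}

lemma contDiffOn_sqrt_b1 (hU : U ⊆ Metric.ball p0 F.r) (hb : ∀ p ∈ U, F.c.b1 p < 0) :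
    ContDiffOn ℝ ∞ (fun p => √|F.c.b1 p|) U := by
  refine ((F.c_smooth.b1.mono hU).neg.sqrt fun p hp => ?_).congr fun p hp => ?_
  · have := hb p hp; simp; linarith
  · rw [abs_of_neg (hb p hp)]

lemma contDiffOn_norm_a0 (hU : U ⊆ Metric.ball p0 F.r) (ha : ∀ p ∈ U, F.c.a0 p ≠ 0) :
    ContDiffOn ℝ ∞ (fun p => ‖F.c.a0 p‖) U :=
  (F.c_smooth.a0.mono hU).norm ℝ ha

lemma contDiffOn_AB (hU : U ⊆ Metric.ball p0 F.r) (hb : ∀ p ∈ U, F.c.b1 p < 0)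
    (ha : ∀ p ∈ U, F.c.a0 p ≠ 0) : ContDiffOn ℝ ∞ F.c.AB U := by
  have h1 := contDiffOn_sqrt_b1 hU hb
  have h2 := contDiffOn_norm_a0 hU ha
  exact ((F.c_smooth.a0.mono hU).mul (F.c_smooth.b0.mono hU)).mul
    (contDiffOn_ofReal (h1.div (h2.pow 2) fun p hp => pow_ne_zero _ (norm_ne_zero_iff.2 (ha p hp))))

lemma contDiffOn_f1 (hU : U ⊆ Metric.ball p0 F.r) (hb : ∀ p ∈ U, F.c.b1 p < 0)
    (ha : ∀ p ∈ U, F.c.a0 p ≠ 0) :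
    ContDiffOn ℝ ∞ (fun q : Param × Phase => F.f1 q.1 q.2) (U ×ˢ univ) := by
  have hm : MapsTo Prod.fst (U ×ˢ (univ : Set Phase)) U := fun q hq => hq.1
  have h1 := (contDiffOn_sqrt_b1 hU hb).comp contDiffOn_fst hm
  have h2 := (contDiffOn_norm_a0 hU ha).comp contDiffOn_fst hm
  have h2' := contDiffOn_ofReal h2
  have c0 := (F.c_smooth.a0.mono hU).comp contDiffOn_fst hm
  have c1 := (F.c_smooth.a1.mono hU).comp contDiffOn_fst hm
  have c2 := (F.c_smooth.a2.mono hU).comp contDiffOn_fst hm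
  have c3 := (F.c_smooth.a3.mono hU).comp contDiffOn_fst hm
  have hu : ContDiffOn ℝ ∞ (fun q : Param × Phase => q.2.1) (U ×ˢ univ) := by fun_prop
  have hz : ContDiffOn ℝ ∞ (fun q : Param × Phase => (q.2.2 : ℂ)) (U ×ˢ univ) :=
    contDiffOn_ofReal (by fun_prop)
  have hs : ContDiffOn ℝ ∞ (fun q : Param × Phase => (q.1.2.2 : ℂ)) (U ×ˢ univ) :=
    contDiffOn_ofReal (by fun_prop)
  have hv : ContDiffOn ℝ ∞ (fun q : Param × Phase => (starRingEnd ℂ) q.2.1) (U ×ˢ univ) :=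
    Complex.conjCLE.contDiff.comp_contDiffOn hu
  have hR := F.R1_smooth.mono (prod_mono hU subset_rfl)
  have n0 : ∀ q ∈ U ×ˢ (univ : Set Phase), ‖F.c.a0 q.1‖ ≠ 0 := fun q hq =>
    norm_ne_zero_iff.2 (ha _ hq.1)
  have nb : ∀ q ∈ U ×ˢ (univ : Set Phase), √|F.c.b1 q.1| ≠ 0 := fun q hq =>
    (Real.sqrt_pos.2 (abs_pos.2 (hb _ hq.1).ne)).ne'
  have t1 := contDiffOn_div_complex c1 h2' fun q hq => Complex.ofReal_ne_zero.2 (n0 q hq)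
  have t2 := contDiffOn_div_complex c2 (contDiffOn_ofReal (h2.mul h1)) fun q hq =>
    Complex.ofReal_ne_zero.2 (mul_ne_zero (n0 q hq) (nb q hq))
  have t3 := contDiffOn_div_complex (c3.mul h2') (c0.pow 2) fun q hq => pow_ne_zero 2 (ha _ hq.1)
  exact ((((t1.mul (hu.pow 2)).mul hv).add ((t2.mul (hz.pow 2)).mul hu)).add
    (t3.mul (hv.pow 3))).add (hs.mul hR)

lemma contDiffOn_f2 (hU : U ⊆ Metric.ball p0 F.r) (hb : ∀ p ∈ U, F.c.b1 p < 0)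
    (ha : ∀ p ∈ U, F.c.a0 p ≠ 0) :
    ContDiffOn ℝ ∞ (fun q : Param × Phase => F.f2 q.1 q.2) (U ×ˢ univ) := by
  have hm : MapsTo Prod.fst (U ×ˢ (univ : Set Phase)) U := fun q hq => hq.1
  have h1 := (contDiffOn_sqrt_b1 hU hb).comp contDiffOn_fst hm
  have h2 := (contDiffOn_norm_a0 hU ha).comp contDiffOn_fst hm
  have c2 := (F.c_smooth.b2.mono hU).comp contDiffOn_fst hm
  have ce := (F.e_smooth.mono hU).comp contDiffOn_fst hm
  have hz : ContDiffOn ℝ ∞ (fun q : Param × Phase => q.2.2) (U ×ˢ univ) := by fun_prop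
  have hs : ContDiffOn ℝ ∞ (fun q : Param × Phase => q.1.2.2) (U ×ˢ univ) := by fun_prop
  have hn : ContDiffOn ℝ ∞ (fun q : Param × Phase => ‖q.2.1‖ ^ 2) (U ×ˢ univ) :=
    ((contDiff_norm_sq ℝ).comp (by fun_prop)).contDiffOn
  have hR := F.R2_smooth.mono (prod_mono hU subset_rfl)
  have n0 : ∀ q ∈ U ×ˢ (univ : Set Phase), ‖F.c.a0 q.1‖ ≠ 0 := fun q hq =>
    norm_ne_zero_iff.2 (ha _ hq.1)
  exact ((((h1.div h2 n0).add (hs.mul ce)).mul (hz.sub (hz.pow 3))).add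
    (((c2.div h2 n0).mul hz).mul hn)).add (hs.mul hR)

end Good

variable {F}

lemma exists_good_ball (hb : F.c.b1 p0 < 0) (hA : F.c.A p0 < 0) : ∃ r > 0,
    Metric.ball p0 r ⊆ Metric.ball p0 F.r ∧ (∀ p ∈ Metric.ball p0 r, F.c.b1 p < 0) ∧
    (∀ p ∈ Metric.ball p0 r, F.c.a0 p ≠ 0) ∧ ∀ p ∈ Metric.ball p0 r, F.c.A p < 0 := by
  have hn := Metric.ball_mem_nhds p0 F.r_pos
  have cb1 := (F.c_smooth.b1.contDiffAt hn).continuousAt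
  have ca0 := (F.c_smooth.a0.contDiffAt hn).continuousAt
  have cb0 := (F.c_smooth.b0.contDiffAt hn).continuousAt
  have ha0 : F.c.a0 p0 ≠ 0 := fun h => by
    simp [Coeffs.A, Coeffs.AB, h] at hA
  have cA : ContinuousAt F.c.A p0 :=
    Complex.continuous_re.continuousAt.comp ((ca0.mul cb0).mul
      (Complex.continuous_ofReal.continuousAt.comp
        ((Real.continuous_sqrt.continuousAt.comp cb1.abs).div (ca0.norm.pow 2)
          (pow_ne_zero 2 (norm_ne_zero_iff.2 ha0)))))
  have h := ((cb1.eventually (gt_mem_nhds hb)).and ((ca0.eventually_ne ha0).and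
    (cA.eventually (gt_mem_nhds hA)))).and hn
  obtain ⟨r, hr, h⟩ := Metric.eventually_nhds_iff_ball.1 h
  exact ⟨r, hr, fun p hp => (h p hp).2, fun p hp => (h p hp).1.1, fun p hp => (h p hp).1.2.1,
    fun p hp => (h p hp).1.2.2⟩

/-- In real coordinates, the rescaled family is a family in normal form. A retraction of the
parameters makes the family smooth for all parameters without changing it near `p0`. -/
theorem exists_normalFamily (hb : F.c.b1 p0 < 0) (hA : F.c.A p0 < 0) :
    ∃ (N : NormalFamily) (k : Param → ℝ), (∀ᶠ p in 𝓝 p0, ContDiffAt ℝ ∞ k p) ∧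
      k p0 = √(2 * |F.c.A p0|) ∧ N.slope = F.c.k1 p0 ∧
      -(N.b p0 * (9 - Real.pi ^ 2) / 3) = F.c.k2 p0 ∧
      ∀ᶠ p in 𝓝 p0, 0 < k p ∧ ∀ x, F.field p (ofE (k p) x) =
        (⟨(N.field (p, x)).1 / k p, (N.field (p, x)).2.2 / k p⟩, (N.field (p, x)).2.1) := by
  obtain ⟨r, hr, hU, hb', ha', hA'⟩ := exists_good_ball hb hA
  obtain ⟨π, hπ, hπm, hπe⟩ := exists_retraction p0 hr
  set U := Metric.ball p0 r with hUd
  have hπ0 : π p0 = p0 := hπe.self_of_nhds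
  set k : Param → ℝ := fun p => √(2 * |F.c.A p|) with hk
  have hkpos : ∀ p ∈ U, 0 < k p := fun p hp =>
    Real.sqrt_pos.2 (mul_pos two_pos (abs_pos.2 (hA' p hp).ne))
  have hksq : ∀ p, k p ^ 2 = 2 * |F.c.A p| := fun p => Real.sq_sqrt (by positivity)
  have hABs := contDiffOn_AB hU hb' ha'
  have hAs : ContDiffOn ℝ ∞ F.c.A U := Complex.reCLM.contDiff.comp_contDiffOn hABs
  have hBs : ContDiffOn ℝ ∞ F.c.B U := Complex.imCLM.contDiff.comp_contDiffOn hABs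
  have hks : ContDiffOn ℝ ∞ k U := by
    refine ((contDiffOn_const (c := (-2 : ℝ))).mul hAs |>.sqrt fun p hp => ?_).congr fun p hp => ?_
    · exact (mul_pos_of_neg_of_neg (by norm_num) (hA' p hp)).ne'
    · simp only [hk, abs_of_neg (hA' p hp)]; congr 1; ring
  -- the perturbation in real coordinates
  set w : Param × E → Param × Phase := fun q => (π q.1, ofE (k (π q.1)) q.2) with hw
  have hkπ : ContDiff ℝ ∞ fun q : Param × E => k (π q.1) :=
    hks.comp_contDiff (hπ.comp contDiff_fst) fun q => hπm _
  have hkπ0 : ∀ q : Param × E, k (π q.1) ≠ 0 := fun q => (hkpos _ (hπm _)).ne'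
  have hws : ContDiff ℝ ∞ w := by
    refine (hπ.comp contDiff_fst).prodMk (ContDiff.prodMk ?_ (by fun_prop))
    exact contDiff_mk_complex (ContDiff.div (by fun_prop) hkπ hkπ0)
      (ContDiff.div (by fun_prop) hkπ hkπ0)
  have hwm : ∀ q, w q ∈ U ×ˢ (univ : Set Phase) := fun q => mk_mem_prod (hπm _) (mem_univ _)
  have hf1 : ContDiff ℝ ∞ fun q => F.f1 (w q).1 (w q).2 :=
    (contDiffOn_f1 hU hb' ha').comp_contDiff hws hwm
  have hf2 : ContDiff ℝ ∞ fun q => F.f2 (w q).1 (w q).2 :=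
    (contDiffOn_f2 hU hb' ha').comp_contDiff hws hwm
  have hp0U : p0 ∈ U := Metric.mem_ball_self hr
  have hsb : 0 < √|F.c.b1 p0| := Real.sqrt_pos.2 (abs_pos.2 hb.ne)
  have hna : 0 < ‖F.c.a0 p0‖ := norm_pos_iff.2 (ha' p0 hp0U)
  have hk0 := hkpos p0 hp0U
  let N : NormalFamily :=
    { b := fun p => F.c.B (π p) / |F.c.A (π p)|
      g := fun q => (k (π q.1) * (F.f1 (w q).1 (w q).2).re, F.f2 (w q).1 (w q).2,
        k (π q.1) * (F.f1 (w q).1 (w q).2).im)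
      α₁ := ((F.c.a1 p0).re / ‖F.c.a0 p0‖ + (F.c.a3 p0 / F.c.a0 p0 ^ 2).re * ‖F.c.a0 p0‖)
        / (2 * |F.c.A p0|)
      α₂ := (F.c.a2 p0).re / (‖F.c.a0 p0‖ * √|F.c.b1 p0|)
      β₁ := ((F.c.a1 p0).im / ‖F.c.a0 p0‖ + (F.c.a3 p0 / F.c.a0 p0 ^ 2).im * ‖F.c.a0 p0‖)
        / (2 * |F.c.A p0|)
      β₂ := (F.c.a2 p0).im / (‖F.c.a0 p0‖ * √|F.c.b1 p0|)
      γ₀ := √|F.c.b1 p0| / ‖F.c.a0 p0‖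
      γ₁ := F.c.b2 p0 / (2 * |F.c.A p0| * ‖F.c.a0 p0‖)
      b_smooth := ?_
      g_smooth := ?_
      g_rot := ?_
      g_bot := ?_
      g_top := ?_
      g_base := ?_
      γ₀_pos := div_pos hsb hna }
  · refine ⟨N, k, ?_, rfl, ?_, ?_, ?_⟩
    · filter_upwards [Metric.ball_mem_nhds p0 hr] with p hp
      exact hks.contDiffAt (Metric.isOpen_ball.mem_nhds hp)
    · have hA0 : F.c.A p0 ≠ 0 := hA.ne
      simp only [NormalFamily.slope, Coeffs.k1, N, hπ0, abs_of_neg hA]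
      field_simp
      ring
    · have hA0 : F.c.A p0 ≠ 0 := hA.ne
      simp only [Coeffs.k2, N, hπ0, abs_of_neg hA]
      field_simp
    · filter_upwards [hπe, Metric.ball_mem_nhds p0 hr] with p hp hpU
      have hkp := hkpos p hpU
      refine ⟨hkp, fun x => ?_⟩
      have e : N.g (p, x) = (k p * (F.f1 p (ofE (k p) x)).re, F.f2 p (ofE (k p) x),
          k p * (F.f1 p (ofE (k p) x)).im) := by
        simp only [N, hw, hp]
      have eb : N.b p = F.c.B p / |F.c.A p| := by simp only [N, hp]
      have hAp := hA' p hpU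
      have hsq := hksq p
      rw [abs_of_neg hAp] at hsq eb
      simp only [NormalFamily.field, e, eb]
      obtain ⟨X, Z, Y⟩ := x
      simp only [field]
      generalize F.f1 p (ofE (k p) (X, Z, Y)) = f
      generalize F.f2 p (ofE (k p) (X, Z, Y)) = g
      have eA : (F.c.AB p).re = F.c.A p := rfl
      have eB : (F.c.AB p).im = F.c.B p := rfl
      generalize k p = κ at hkp hsq
      generalize F.c.A p = A at hsq eA hAp
      have hA0 : A ≠ 0 := hAp.ne
      have hκ : κ ≠ 0 := hkp.ne'
      refine Prod.ext (Complex.ext ?_ ?_) ?_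
      · simp [ofE]
        field_simp
        ring
      · simp [ofE]
        field_simp
        ring
      · simp [ofE, pow_two, eA, eB]
        field_simp
        rw [hsq]
        field_simp
        ring
  · exact (hBs.comp_contDiff hπ hπm).div (by
      simpa only [abs_of_neg (hA' _ (hπm _))] using! (hAs.comp_contDiff hπ hπm).neg)
      fun p => abs_ne_zero.2 (hA' _ (hπm p)).ne
  · exact (hkπ.mul (Complex.reCLM.contDiff.comp hf1)).prodMk
      (hf2.prodMk (hkπ.mul (Complex.imCLM.contDiff.comp hf1)))
  · intro p X Z Y
    have e : ofE (k (π p)) (-X, Z, -Y) = (-(ofE (k (π p)) (X, Z, Y)).1, Z + 1 / 2) := by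
      refine Prod.ext (Complex.ext ?_ ?_) rfl <;> simp [ofE, neg_div]
    have e' : ofE (k (π p)) (X, Z, Y) = ((ofE (k (π p)) (X, Z, Y)).1, Z + 1 / 2) := rfl
    simp only [hw]
    rw [e, f1_neg F (hU (hπm p)), f2_neg F (hU (hπm p)), ← e']
    simp
  · intro p
    have e : ofE (k (π p)) (0, -1 / 2, 0) = (0, 0) := by
      refine Prod.ext (Complex.ext ?_ ?_) ?_ <;> simp [ofE]
      norm_num
    simp only [hw, e, f2, R2_zero F (hU (hπm p))]
    simp
  · intro p
    have e : ofE (k (π p)) (0, 1 / 2, 0) = (0, 1) := by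
      refine Prod.ext (Complex.ext ?_ ?_) ?_ <;> simp [ofE]
      norm_num
    simp only [hw, e, f2, F.R2_equilibrium _ (hU (hπm p))]
    simp
  · intro X Z
    have e : ofE (k p0) (X, Z, 0) = (((X / k p0 : ℝ) : ℂ), Z + 1 / 2) := by
      refine Prod.ext (Complex.ext ?_ ?_) ?_ <;> simp [ofE]
    have hs0 : p0.2.2 = 0 := rfl
    have hsq := hksq p0
    have hA0 : |F.c.A p0| ≠ 0 := abs_ne_zero.2 hA.ne
    have e3 : F.c.a3 p0 * ‖F.c.a0 p0‖ / F.c.a0 p0 ^ 2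
        = F.c.a3 p0 / F.c.a0 p0 ^ 2 * ((‖F.c.a0 p0‖ : ℝ) : ℂ) := by ring
    simp only [hw, hπ0, e, f1, f2, hs0, e3, Complex.conj_ofReal]
    generalize F.c.a3 p0 / F.c.a0 p0 ^ 2 = c3
    generalize ‖F.c.a0 p0‖ = n at hna
    generalize |F.c.A p0| = A at hsq hA0
    generalize k p0 = κ at hk0 hsq
    generalize √|F.c.b1 p0| = β at hsb
    have hx : F.c.a1 p0 / (n : ℂ) * ((X / κ : ℝ) : ℂ) ^ 2 * ((X / κ : ℝ) : ℂ)
        + F.c.a2 p0 / ((n * β : ℝ) : ℂ) * ((Z + 1 / 2 : ℝ) : ℂ) ^ 2 * ((X / κ : ℝ) : ℂ)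
        + c3 * (n : ℂ) * ((X / κ : ℝ) : ℂ) ^ 3
        + ((0 : ℝ) : ℂ) * F.R1 p0 (((X / κ : ℝ) : ℂ), Z + 1 / 2)
        = F.c.a1 p0 * (((X / κ) ^ 3 / n : ℝ) : ℂ)
          + F.c.a2 p0 * (((Z + 1 / 2) ^ 2 * (X / κ) / (n * β) : ℝ) : ℂ)
          + c3 * ((n * (X / κ) ^ 3 : ℝ) : ℂ) := by
      push_cast
      ring
    rw [hx]
    simp only [Complex.add_re, Complex.add_im, Complex.re_mul_ofReal, Complex.im_mul_ofReal,
      Complex.norm_real, Real.norm_eq_abs, sq_abs]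
    rw [← hsq]
    refine Prod.ext ?_ (Prod.ext ?_ ?_) <;> dsimp only <;> field_simp <;> ring

end RescaledFamily

end Z4

namespace Z4

/-! ### The connection and its splitting for the rescaled family -/

section Conjugation

variable {X : Phase → Phase} {f : E → E} {k : ℝ}

lemma integralCurveOn_ofE (hc : ∀ x, X (ofE k x) = (⟨(f x).1 / k, (f x).2.2 / k⟩, (f x).2.1))
    {x : ℝ → E} {s : Set ℝ} (hx : IsIntegralCurveOn x (fun _ => f) s) :
    IsIntegralCurveOn (fun t => ofE k (x t)) (fun _ => X) s := by
  intro t ht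
  obtain ⟨h1, h2, h3⟩ := hasDerivWithinAt_triple.1 (hx t ht)
  beta_reduce
  rw [hc]
  have h := Complex.equivRealProdCLM.symm.hasFDerivAt.comp_hasDerivWithinAt t
    ((h1.div_const k).prodMk (h3.div_const k))
  exact h.prodMk (h2.add_const (1 / 2))

lemma integralCurveOn_toE (hk : k ≠ 0)
    (hc : ∀ x, X (ofE k x) = (⟨(f x).1 / k, (f x).2.2 / k⟩, (f x).2.1))
    {w : ℝ → Phase} {s : Set ℝ} (hw : IsIntegralCurveOn w (fun _ => X) s) :
    IsIntegralCurveOn (fun t => toE k (w t)) (fun _ => f) s := by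
  intro t ht
  have h := hw t ht
  have e := hc (toE k (w t))
  rw [ofE_toE hk] at e
  beta_reduce at h ⊢
  rw [e] at h
  have h1 : HasDerivWithinAt (fun t => (w t).1) _ s t := h.fst
  have h2 : HasDerivWithinAt (fun t => (w t).2) _ s t := h.snd
  have hr := Complex.reCLM.hasFDerivAt.comp_hasDerivWithinAt t h1
  have hi := Complex.imCLM.hasFDerivAt.comp_hasDerivWithinAt t h1
  refine hasDerivWithinAt_triple.2 ⟨?_, h2.sub_const _, ?_⟩
  · refine (hr.const_mul k).congr_deriv ?_
    simp only [Complex.reCLM_apply]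
    field_simp
  · refine (hi.const_mul k).congr_deriv ?_
    simp only [Complex.imCLM_apply]
    field_simp

end Conjugation

lemma ofE_rot (k : ℝ) (x : E) : ofE k (rot x) = S^[2] (ofE k x) := by
  rw [S_iterate]
  refine Prod.ext (Complex.ext ?_ ?_) ?_ <;> simp [ofE, rot, neg_div]

lemma ofE_eqTop (k : ℝ) : ofE k eqTop = (0, 1) := by
  refine Prod.ext (Complex.ext ?_ ?_) ?_ <;> simp [ofE, eqTop]
  norm_num

lemma ofE_eqO (k : ℝ) : ofE k eqO = 0 := by
  refine Prod.ext (Complex.ext ?_ ?_) ?_ <;> simp [ofE, eqO]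
  norm_num

lemma toE_top (k : ℝ) : toE k (0, 1) = eqTop := by
  simp [toE, eqTop]; norm_num

lemma toE_zero (k : ℝ) : toE k 0 = eqO := by
  simp [toE, eqO]; norm_num

/-- The part of `SplitsWithNonzeroVelocity` that concerns a single parameter value. -/
def SplitsAt (X : Param → Phase → Phase) (u₀ : ℂ) (V : Set Phase) (θ κ : ℝ) (P : Param → ℂ)
    (Q : Param × ℝ → ℝ) (h : ℝ × ℝ → ℝ) (p : Param) : Prop :=
  (∀ u : ℂ, ‖u - u₀‖ < θ → (X p (u, 1 / 2)).2 < 0) ∧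
  ‖P p - u₀‖ < θ ∧
  (∃ Γ : ℝ → Phase, Γ 0 = (P p, 1 / 2) ∧ IsIntegralCurveOn Γ (fun _ => X p) (Iic 0) ∧
    Tendsto Γ atBot (𝓝 (0, 1)) ∧ ∀ t < 0, 1 / 2 < (Γ t).2) ∧
  (∀ u : ℂ, ‖u - u₀‖ < θ →
    ((u, (1 / 2 : ℝ)) ∈ stableSetIn (X p) V 0 ↔ u.re = Q (p, u.im))) ∧
  ((P p).re - Q (p, (P p).im) = 0 ↔ p.1 = h p.2) ∧
  ∃ v : ℝ, HasDerivAt (fun ρ => (P (ρ, p.2)).re - Q ((ρ, p.2), (P (ρ, p.2)).im)) v p.1 ∧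
    κ ≤ |v|

namespace RescaledFamily

variable {F : RescaledFamily}

lemma field_top {p : Param} (hp : p ∈ Metric.ball p0 F.r) : F.field p (0, 1) = 0 := by
  have h := F.R1_neg hp 0 1
  have h1 : F.R1 p (0, 1) = 0 := by
    rw [neg_zero] at h
    exact self_eq_neg.1 h
  simp [field, f1, f2, h1, F.R2_equilibrium p hp]

/-- A connecting orbit in real coordinates that carries the unstable set of `O⁺` up to symmetry
yields the four-winged connection. -/
lemma fourWingedConnection {p : Param} (hp : p ∈ Metric.ball p0 F.r) {f : E → E} {k : ℝ}
    (hk : 0 < k) (hc : ∀ x, F.field p (ofE k x) = (⟨(f x).1 / k, (f x).2.2 / k⟩, (f x).2.1))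
    {Γ : ℝ → E} (hΓ : IsIntegralCurve Γ fun _ => f) (hbot : Tendsto Γ atBot (𝓝 eqTop))
    (htop : Tendsto Γ atTop (𝓝 eqO)) (hne : (Γ 0).1 ≠ 0)
    (hun : ∀ x : ℝ → E, IsIntegralCurveOn x (fun _ => f) (Iic 0) → Tendsto x atBot (𝓝 eqTop) →
      x 0 = eqTop ∨ (∃ t, x 0 = Γ t) ∨ ∃ t, x 0 = rot (Γ t)) :
    FourWingedConnection (F.field p) 1 := by
  have hcurve : IsIntegralCurve (fun t => ofE k (Γ t)) fun _ => F.field p := by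
    rw [← isIntegralCurveOn_univ] at hΓ ⊢
    exact integralCurveOn_ofE hc hΓ
  refine fourWingedConnection_of ((F.contDiff_field_right hp).of_le (by norm_cast)) (F.field_S hp)
    one_pos (field_top hp) hcurve ?_ ?_ ⟨0, ?_⟩ ?_
  · rw [← ofE_eqTop k]
    exact ((continuous_ofE k).tendsto _).comp hbot
  · rw [← ofE_eqO k]
    exact ((continuous_ofE k).tendsto _).comp htop
  · intro h
    have := congrArg Complex.re h
    simp only [ofE, Complex.zero_re, div_eq_zero_iff] at this
    exact this.elim hne hk.ne'
  · rintro w ⟨x, rfl, hx, hlim⟩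
    have hlim' : Tendsto (fun t => toE k (x t)) atBot (𝓝 eqTop) := by
      rw [← toE_top k]
      exact ((continuous_toE k).tendsto _).comp hlim
    rcases hun _ (integralCurveOn_toE hk.ne' hc hx) hlim' with h | ⟨t, h⟩ | ⟨t, h⟩
    · refine Or.inl (Or.inl ?_)
      rw [mem_singleton_iff, ← ofE_toE hk.ne' (x 0), h, ofE_eqTop]
    · refine Or.inl (Or.inr ⟨t, ?_⟩)
      beta_reduce
      rw [← h, ofE_toE hk.ne']
    · refine Or.inr ⟨t, ?_⟩
      rw [Function.comp_apply, ← ofE_rot, ← h, ofE_toE hk.ne']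

/-- The bifurcation surface of the rescaled family: the zero set of the splitting function, whose
linearization at the base parameter is given by the Melnikov integral. -/
theorem exists_bifurcation_surface (hb : F.c.b1 p0 < 0) (hA : F.c.A p0 < 0) :
    ∃ (h : ℝ × ℝ → ℝ) (C : ℝ), h (0, 0) = 1 / 2 ∧ 0 ≤ C ∧
      (∀ᶠ q in 𝓝 ((0, 0) : ℝ × ℝ), ContDiffAt ℝ ∞ h q) ∧
      (∀ᶠ q in 𝓝 ((0, 0) : ℝ × ℝ), |h q - (1 / 2 + F.c.k1 p0 * q.2 + F.c.k2 p0 * q.1)|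
        ≤ C * (q.2 ^ 2 + q.1 ^ 2)) ∧
      (∀ᶠ q in 𝓝 ((0, 0) : ℝ × ℝ), 0 < q.2 → FourWingedConnection (F.field (h q, q)) 1) ∧
      ∃ (V : Set Phase) (θ κ : ℝ) (P : Param → ℂ) (Q : Param × ℝ → ℝ),
        IsOpen V ∧ (0 : Phase) ∈ V ∧ 0 < θ ∧ 0 < κ ∧
        (∀ᶠ p in 𝓝 p0, ContDiffAt ℝ ∞ P p) ∧
        (∀ᶠ p in 𝓝 p0, ∀ y, |y| < θ → ContDiffAt ℝ ∞ Q (p, y)) ∧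
        ∀ᶠ p in 𝓝 p0, 0 < p.2.2 → SplitsAt F.field
          ((1 / (2 * √(2 * |F.c.A p0|)) : ℝ) : ℂ) V θ κ P Q h p := by
  obtain ⟨N, k, hks, hk0, hslope, hk2, hconj⟩ := exists_normalFamily hb hA
  obtain ⟨P, Q, hP0, hQ0, hPs, hQs, ⟨D', hD', hval⟩, ⟨η, hη, θ₁, hθ₁, hst⟩, hun,
    ⟨θ₂, hθ₂, hneg⟩, hconn⟩ := N.exists_splitting
  rw [← hk0]
  set k₀ := k p0 with hk₀
  have hkpos : 0 < k₀ := hconj.self_of_nhds.1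
  have hkc : ContinuousAt k p0 := hks.self_of_nhds.continuousAt
  -- smoothness of the splitting function
  have hPP : Tendsto (fun p => (p, (P p).2)) (𝓝 p0) (𝓝 (p0, 0)) := by
    have h := continuousAt_id.tendsto.prodMk_nhds hPs.self_of_nhds.continuousAt.snd.tendsto
    simpa only [hP0, id] using h
  have hDs : ∀ᶠ p in 𝓝 p0, ContDiffAt ℝ ∞ (fun p => (P p).1 - Q (p, (P p).2)) p := by
    filter_upwards [hPs, hPP.eventually hQs] with p h1 h2
    exact (contDiffAt_fst.comp p h1).sub
      (ContDiffAt.comp p h2 (contDiffAt_id.prodMk (contDiffAt_snd.comp p h1)))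
  have hD0 : (P p0).1 - Q (p0, (P p0).2) = 0 := by rw [hP0, hQ0, sub_self]
  obtain ⟨h, C, h0, hC, hhs, hhD, hhb⟩ := exists_surface hDs hD0 hD' (a := 2)
    (k₁ := F.c.k1 p0) (k₂ := F.c.k2 p0) two_ne_zero (fun v => by
      rw [hval, ← hslope, ← hk2]; ring)
  refine ⟨h, C, h0, hC, hhs, hhb, ?_, ?_⟩
  · have ht : Tendsto (fun q : ℝ × ℝ => ((h q, q) : Param)) (𝓝 (0, 0)) (𝓝 p0) := by
      have h1 := hhs.self_of_nhds.continuousAt.tendsto.prodMk_nhds continuousAt_id.tendsto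
      rwa [h0] at h1
    filter_upwards [ht.eventually hhD, ht.eventually hconj, ht.eventually hconn,
      ht.eventually (Metric.ball_mem_nhds p0 F.r_pos)] with q q1 ⟨q2, q3⟩ q4 q5 hq
    obtain ⟨Γ, g1, g2, g3, g4, g5⟩ := q4 hq (sub_eq_zero.1 (q1.2 rfl))
    exact fourWingedConnection q5 q2 q3 g1 g2 g3 g4 g5
  · obtain ⟨θ₃, hθ₃, hQb⟩ := Metric.eventually_nhds_iff_ball.1 hQs
    set m := min θ₁ (min θ₂ θ₃) with hm
    have hm0 : 0 < m := lt_min hθ₁ (lt_min hθ₂ hθ₃)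
    set θ := m / (4 * k₀) with hθ
    have hθ0 : 0 < θ := by positivity
    have hkθ : k₀ * θ = m / 4 := by rw [hθ]; field_simp
    have hm1 : m ≤ θ₁ := min_le_left _ _
    have hm2 : m ≤ θ₂ := (min_le_right _ _).trans (min_le_left _ _)
    have hm3 : m ≤ θ₃ := (min_le_right _ _).trans (min_le_right _ _)
    -- `k` is close to its value at the base parameter
    have hkb : ∀ᶠ p in 𝓝 p0, 3 / 4 * k₀ ≤ k p ∧ k p ≤ 3 / 2 * k₀ ∧
        |k p * (1 / (2 * k₀)) - 1 / 2| < m / 2 := by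
      have h1 := hkc.eventually (lt_mem_nhds (show 3 / 4 * k₀ < k p0 by linarith))
      have h2 := hkc.eventually (gt_mem_nhds (show k p0 < 3 / 2 * k₀ by linarith))
      have h3 : ContinuousAt (fun p => |k p * (1 / (2 * k₀)) - 1 / 2|) p0 :=
        ((hkc.mul continuousAt_const).sub continuousAt_const).abs
      have h4 := h3.eventually (gt_mem_nhds (show |k p0 * (1 / (2 * k₀)) - 1 / 2| < m / 2 by
        rw [show k p0 * (1 / (2 * k₀)) - 1 / 2 = 0 by rw [← hk₀]; field_simp; ring, abs_zero]
        positivity))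
      filter_upwards [h1, h2, h4] with p a b c using ⟨a.le, b.le, c⟩
    have hpt : ∀ p, k p ≤ 3 / 2 * k₀ → 0 < k p → |k p * (1 / (2 * k₀)) - 1 / 2| < m / 2 →
        ∀ u : ℂ, ‖u - ((1 / (2 * k₀) : ℝ) : ℂ)‖ < θ →
        |k p * u.re - 1 / 2| < m ∧ |k p * u.im| < m := by
      intro p h1 h2 h3 u hu
      have hre : |u.re - 1 / (2 * k₀)| < θ :=
        (by simpa using Complex.abs_re_le_norm (u - ((1 / (2 * k₀) : ℝ) : ℂ)) :
          |u.re - 1 / (2 * k₀)| ≤ _).trans_lt (by simpa using hu)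
      have him : |u.im| < θ := lt_of_le_of_lt
        (by simpa using Complex.abs_im_le_norm (u - ((1 / (2 * k₀) : ℝ) : ℂ))) (by simpa using hu)
      have hb1 : k p * θ ≤ 3 / 2 * (m / 4) := by
        rw [← hkθ, ← mul_assoc]; exact mul_le_mul_of_nonneg_right h1 hθ0.le
      constructor
      · have e : k p * u.re - 1 / 2 = k p * (u.re - 1 / (2 * k₀))
            + (k p * (1 / (2 * k₀)) - 1 / 2) := by ring
        rw [e]
        refine (abs_add_le _ _).trans_lt ?_
        rw [abs_mul, abs_of_pos h2]
        have := mul_le_mul_of_nonneg_left hre.le h2.le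
        linarith
      · rw [abs_mul, abs_of_pos h2]
        have := mul_le_mul_of_nonneg_left him.le h2.le
        linarith
    set P' : Param → ℂ := fun p => ⟨(P p).1 / k p, (P p).2 / k p⟩ with hP'
    set Q' : Param × ℝ → ℝ := fun q => Q (q.1, k q.1 * q.2) / k q.1 with hQ'
    have hkev : ∀ᶠ p in 𝓝 p0, k p ≠ 0 := by filter_upwards [hconj] with p hp using hp.1.ne'
    have hP's : ∀ᶠ p in 𝓝 p0, ContDiffAt ℝ ∞ P' p := by
      filter_upwards [hPs, hks, hkev] with p h1 h2 h3
      exact Complex.equivRealProdCLM.symm.contDiff.contDiffAt.comp p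
        (((contDiffAt_fst.comp p h1).div h2 h3).prodMk ((contDiffAt_snd.comp p h1).div h2 h3))
    set D : Param → ℝ := fun p => (P p).1 - Q (p, (P p).2) with hD
    have hsplit : ∀ p, k p ≠ 0 → (P' p).re - Q' (p, (P' p).im) = D p / k p := by
      intro p hp
      simp only [hP', hQ', hD, mul_div_cancel₀ _ hp]
      ring
    -- the velocity of the splitting
    have hDks : ∀ᶠ p in 𝓝 p0, ContDiffAt ℝ ∞ (fun p => D p / k p) p := by
      filter_upwards [hDs, hks, hkev] with p h1 h2 h3 using h1.div h2 h3
    have hDk0 : HasFDerivAt (fun p => D p / k p) (k₀⁻¹ • D') p0 := by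
      have hki : DifferentiableAt ℝ (fun p => (k p)⁻¹) p0 :=
        (hks.self_of_nhds.differentiableAt (by simp)).inv hkpos.ne'
      have h := hD'.mul hki.hasFDerivAt
      simp only [div_eq_mul_inv]
      refine h.congr_fderiv ?_
      rw [show D p0 = 0 from hD0, zero_smul, zero_add]
    set vel : Param → ℝ := fun p => fderiv ℝ (fun p => D p / k p) p (1, 0, 0) with hvel
    have hvelc : ContinuousAt vel p0 := by
      have h := (hDks.self_of_nhds.fderiv_right (m := 0) (by norm_cast)).continuousAt
      exact h.clm_apply continuousAt_const
    have hvel0 : vel p0 = -2 / k₀ := by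
      simp only [hvel, hDk0.fderiv, _root_.smul_apply, hval, smul_eq_mul]
      ring
    have hvelb : ∀ᶠ p in 𝓝 p0, vel p < -1 / k₀ := hvelc.eventually (gt_mem_nhds (by
      rw [hvel0]; exact div_lt_div_of_pos_right (by norm_num) hkpos))
    refine ⟨{w | |w.2| < 3 / 2 * k₀ * (|w.1.re| + |w.1.im|) + η}, θ, 1 / k₀, P', Q', ?_, ?_, hθ0,
      by positivity, hP's, ?_, ?_⟩
    · exact isOpen_lt (by fun_prop) (by
        have h1 : Continuous fun w : Phase => w.1.re := Complex.continuous_re.comp continuous_fst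
        have h2 : Continuous fun w : Phase => w.1.im := Complex.continuous_im.comp continuous_fst
        fun_prop)
    · simpa using hη
    · filter_upwards [hks, hkb, hconj, Metric.ball_mem_nhds p0 hθ₃] with p h1 h2 h3 h4 y hy
      have hQy : ContDiffAt ℝ ∞ Q (p, k p * y) := hQb _ (by
        rw [← ball_prod_same]
        refine mk_mem_prod h4 ?_
        rw [mem_ball_zero_iff, Real.norm_eq_abs, abs_mul, abs_of_pos h3.1]
        have := mul_le_mul h2.2.1 hy.le (abs_nonneg _) (by positivity)
        linarith)
      have hk' : ContDiffAt ℝ ∞ (fun q : Param × ℝ => k q.1) (p, y) :=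
        ContDiffAt.comp (p, y) h1 contDiffAt_fst
      exact (ContDiffAt.comp (p, y) hQy
        (contDiffAt_fst.prodMk (hk'.mul contDiffAt_snd))).div hk' h3.1.ne'
    · have hP'c := hP's.self_of_nhds.continuousAt
      have hP'0 : P' p0 = ((1 / (2 * k₀) : ℝ) : ℂ) := by
        simp only [hP', hP0]
        refine Complex.ext ?_ ?_
        · rw [Complex.ofReal_re, ← hk₀]; field_simp
        · simp
      have hP'e : ∀ᶠ p in 𝓝 p0, ‖P' p - ((1 / (2 * k₀) : ℝ) : ℂ)‖ < θ := by
        have h : ContinuousAt (fun p => ‖P' p - ((1 / (2 * k₀) : ℝ) : ℂ)‖) p0 :=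
          (hP'c.sub continuousAt_const).norm
        exact h.eventually (gt_mem_nhds (by simpa [hP'0] using hθ0))
      filter_upwards [hconj, hkb, hst, hun, hneg, hhD, hP'e, hvelb, hDks,
        hkev.eventually_nhds] with p ⟨hkp, hc⟩ ⟨hk1, hk2, hk3⟩ hst ⟨x, hx0, hx, hxlim, hxpos⟩ hneg
          hhD hP'e hvelp hDkp hkn hs
      have hkp' := hkp.ne'
      have hsec : ∀ u : ℂ, toE (k p) (u, 1 / 2) = (k p * u.re, 0, k p * u.im) := fun u => by
        simp [toE]
      refine ⟨fun u hu => ?_, hP'e, ⟨fun t => ofE (k p) (x t), ?_, integralCurveOn_ofE hc hx, ?_,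
        fun t ht => ?_⟩, fun u hu => ?_, ?_, vel p, ?_, ?_⟩
      · obtain ⟨a, b⟩ := hpt p hk2 hkp hk3 u hu
        rw [← ofE_toE hkp' (u, 1 / 2), hc, hsec]
        exact hneg _ _ (a.trans_le hm2) (b.trans_le hm2)
      · beta_reduce
        rw [hx0]
        simp [ofE, hP']
      · rw [← ofE_eqTop (k p)]
        exact ((continuous_ofE _).tendsto _).comp hxlim
      · have := hxpos t ht
        simp only [ofE]
        linarith
      · obtain ⟨a, b⟩ := hpt p hk2 hkp hk3 u hu
        have hmain := hst hs.le
          ((ofE (k p)) ⁻¹' {w | |w.2| < 3 / 2 * k₀ * (|w.1.re| + |w.1.im|) + η})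
          (fun y hy => by
            change |y.2.1 + 1 / 2| < 1 * (|y.1| + |y.2.2|) + η at hy
            change |y.2.1 + 1 / 2| < 3 / 2 * k₀ * (|y.1 / k p| + |y.2.2 / k p|) + η
            rw [abs_div, abs_div, abs_of_pos hkp, ← add_div]
            refine hy.trans_le (add_le_add_left ?_ _)
            rw [mul_div_assoc', mul_comm, mul_comm (3 / 2 * k₀), mul_div_assoc]
            refine mul_le_mul_of_nonneg_left ?_ (by positivity)
            rwa [le_div_iff₀ hkp, one_mul])
          (fun y hy => by
            change |y.2.1 + 1 / 2| < 3 / 2 * k₀ * (|y.1 / k p| + |y.2.2 / k p|) + η at hy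
            change |y.2.1 + 1 / 2| < 2 * (|y.1| + |y.2.2|) + η
            rw [abs_div, abs_div, abs_of_pos hkp, ← add_div] at hy
            refine hy.trans_le (add_le_add_left ?_ _)
            rw [mul_div_assoc', mul_comm 2, mul_comm (3 / 2 * k₀), mul_div_assoc]
            refine mul_le_mul_of_nonneg_left ?_ (by positivity)
            rw [div_le_iff₀ hkp]
            linarith)
          (k p * u.re) (k p * u.im) (a.trans_le hm1) (b.trans_le hm1)
        have e : u.re = Q' (p, u.im) ↔ k p * u.re = Q (p, k p * u.im) := by
          simp only [hQ']
          rw [eq_div_iff hkp', mul_comm]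
        rw [e, ← hmain]
        constructor
        · rintro ⟨w, hw0, hw, hwV, hwl⟩
          refine ⟨fun t => toE (k p) (w t), ?_, integralCurveOn_toE hkp' hc hw, fun t ht => ?_, ?_⟩
          · beta_reduce
            rw [hw0, hsec]
          · rw [mem_preimage, ofE_toE hkp']
            exact hwV t ht
          · rw [← toE_zero (k p)]
            exact ((continuous_toE _).tendsto _).comp hwl
        · rintro ⟨y, hy0, hy, hyV, hyl⟩
          refine ⟨fun t => ofE (k p) (y t), ?_, integralCurveOn_ofE hc hy, hyV, ?_⟩
          · beta_reduce
            rw [hy0, ← hsec, ofE_toE hkp']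
          · rw [← ofE_eqO (k p)]
            exact ((continuous_ofE _).tendsto _).comp hyl
      · rw [hsplit p hkp', div_eq_zero_iff, or_iff_left hkp', eq_comm (a := p.1)]
        exact hhD
      · have h1 : HasDerivAt (fun ρ : ℝ => ((ρ, p.2) : Param)) (1, 0, 0) p.1 :=
          (hasDerivAt_id p.1).prodMk (hasDerivAt_const _ _)
        have h2 := ((hDkp.differentiableAt (by simp)).hasFDerivAt).comp_hasDerivAt p.1 h1
        refine h2.congr_of_eventuallyEq ?_
        filter_upwards [h1.continuousAt.eventually hkn] with ρ hρ
        exact hsplit (ρ, p.2) hρ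
      · have hneg' : -1 / k₀ < 0 := div_neg_of_neg_of_pos (by norm_num) hkpos
        rw [abs_of_neg (hvelp.trans hneg')]
        rw [neg_div] at hvelp
        linarith

end RescaledFamily

end Z4

namespace Z4

namespace RescaledFamily

/-- The bifurcation surface and the splitting of the connection on a box of parameters. -/
theorem exists_surface_on_box {F : RescaledFamily} (hb : F.c.b1 p0 < 0) (hA : F.c.A p0 < 0) :
    ∃ (ε δ C : ℝ) (h : ℝ × ℝ → ℝ), 0 < ε ∧ 0 < δ ∧
      ContDiffOn ℝ ∞ h (Ioo (-δ) δ ×ˢ Ico 0 δ) ∧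
      (∀ om s : ℝ, |om| < δ → 0 ≤ s → s < δ →
        |h (om, s) - 1 / 2| < ε ∧
        |h (om, s) - (1 / 2 + F.c.k1 p0 * s + F.c.k2 p0 * om)| ≤ C * (s ^ 2 + om ^ 2)) ∧
      (∀ om s : ℝ, |om| < δ → 0 < s → s < δ →
        FourWingedConnection (F.field (h (om, s), om, s)) 1) ∧
      SplitsWithNonzeroVelocity F.field
        ((1 / (2 * √(2 * |F.c.A p0|)) : ℝ) : ℂ) ε δ h := by
  obtain ⟨h, C, h0, -, hs, hbd, hfw, V, θ, κ, P, Q, hV, hV0, hθ, hκ, hP, hQ, hsp⟩ :=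
    exists_bifurcation_surface hb hA
  obtain ⟨ε, hε, hball⟩ := Metric.eventually_nhds_iff_ball.1 (hP.and (hQ.and hsp))
  have hclose : ∀ᶠ q in 𝓝 ((0, 0) : ℝ × ℝ), |h q - 1 / 2| < ε := by
    have h1 : ContinuousAt (fun q => |h q - 1 / 2|) (0, 0) :=
      (hs.self_of_nhds.continuousAt.sub continuousAt_const).abs
    exact h1.eventually (gt_mem_nhds (by simpa [h0] using hε))
  obtain ⟨δ₁, hδ₁, hball'⟩ := Metric.eventually_nhds_iff_ball.1
    (hclose.and (hs.and (hbd.and hfw)))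
  set δ := min δ₁ ε with hδ
  have hmem : ∀ om s : ℝ, |om| < δ → |s| < δ → ((om, s) : ℝ × ℝ) ∈ Metric.ball (0, 0) δ₁ := by
    intro om s h1 h2
    rw [Metric.mem_ball, Prod.dist_eq]
    exact max_lt (by simpa using h1.trans_le (min_le_left _ _))
      (by simpa using h2.trans_le (min_le_left _ _))
  have hbox : ∀ p ∈ box ε δ, p ∈ Metric.ball p0 ε := by
    rintro p ⟨h1, h2, h3, h4⟩
    rw [Metric.mem_ball, Prod.dist_eq, Prod.dist_eq]
    refine max_lt h1 (max_lt ?_ ?_)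
    · simpa [p0] using h2.trans_le (min_le_right _ _)
    · simpa [p0, abs_of_nonneg h3] using h4.trans_le (min_le_right _ _)
  refine ⟨ε, δ, C, h, hε, lt_min hδ₁ hε, ?_, ?_, ?_, V, θ, P, Q, κ, hV, hV0, hθ, hκ, ?_, ?_, ?_⟩
  · rintro ⟨om, s⟩ ⟨h1, h2⟩
    exact (hball' _ (hmem om s (abs_lt.2 h1)
      (by rw [abs_of_nonneg h2.1]; exact h2.2))).2.1.contDiffWithinAt
  · intro om s h1 h2 h3
    have := hball' _ (hmem om s h1 (by rwa [abs_of_nonneg h2]))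
    exact ⟨this.1, this.2.2.1⟩
  · intro om s h1 h2 h3
    exact (hball' _ (hmem om s h1 (by rwa [abs_of_pos h2]))).2.2.2 h2
  · exact fun p hp => (hball p (hbox p hp)).1.contDiffWithinAt
  · rintro ⟨p, y⟩ ⟨hp, hy⟩
    refine ((hball p (hbox p hp)).2.1 y ?_).contDiffWithinAt
    rw [Complex.ofReal_im] at hy
    exact abs_lt.2 ⟨by linarith [hy.1], by linarith [hy.2]⟩
  · exact fun p hp hs => (hball p (hbox p hp)).2.2 hs

end RescaledFamily

/-! ### Rescaling of the phase space and of time -/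

section Scaling

variable {X Y : Phase → Phase} {a : ℂ} {b τ : ℝ}

/-- The scaling of the phase space. -/
def scale (a : ℂ) (b : ℝ) (w : Phase) : Phase := (a * w.1, b * w.2)

lemma continuous_scale : Continuous (scale a b) := by unfold scale; fun_prop

lemma scale_inv (ha : a ≠ 0) (hb : b ≠ 0) (w : Phase) : scale a⁻¹ b⁻¹ (scale a b w) = w := by
  simp [scale, ha, hb]

lemma scale_inv' (ha : a ≠ 0) (hb : b ≠ 0) (w : Phase) : scale a b (scale a⁻¹ b⁻¹ w) = w := by
  simp [scale, ha, hb]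

lemma scale_S (w : Phase) : scale a b (S w) = S (scale a b w) := by
  simp only [scale, S]
  refine Prod.ext ?_ ?_ <;> dsimp only <;> ring

lemma scale_S_iterate (k : ℕ) (w : Phase) : scale a b (S^[k] w) = S^[k] (scale a b w) := by
  rw [S_iterate, S_iterate]
  simp only [scale]
  refine Prod.ext ?_ ?_ <;> dsimp only <;> ring

lemma integralCurveOn_scale (h : ∀ w, X (scale a b w) = τ • scale a b (Y w)) {x : ℝ → Phase}
    {s s' : Set ℝ} (hs : ∀ t ∈ s', τ * t ∈ s) (hx : IsIntegralCurveOn x (fun _ => Y) s) :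
    IsIntegralCurveOn (fun t => scale a b (x (τ * t))) (fun _ => X) s' := by
  intro t ht
  have h1 : HasDerivWithinAt (fun t : ℝ => τ * t) τ s' t := by
    simpa using ((hasDerivAt_id t).const_mul τ).hasDerivWithinAt
  have h2 := (hx (τ * t) (hs t ht)).scomp t h1 hs
  have h3 : HasDerivWithinAt (fun t => (x (τ * t)).1) _ s' t := h2.fst
  have h4 : HasDerivWithinAt (fun t => (x (τ * t)).2) _ s' t := h2.snd
  have hu := (h3.const_mul a).prodMk (h4.const_mul b)
  beta_reduce
  rw [h]
  refine HasDerivWithinAt.congr_deriv hu ?_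
  simp only [scale, Prod.smul_fst, Prod.smul_snd, Prod.smul_mk, smul_eq_mul, Complex.real_smul]
  refine Prod.ext ?_ ?_ <;> dsimp only <;> ring

lemma scale_mem_unstableSet (hτ : 0 < τ) (h : ∀ w, X (scale a b w) = τ • scale a b (Y w))
    {w e : Phase} (hw : w ∈ unstableSet Y e) : scale a b w ∈ unstableSet X (scale a b e) := by
  obtain ⟨x, rfl, hx, hl⟩ := hw
  refine ⟨fun t => scale a b (x (τ * t)), by simp, integralCurveOn_scale h (fun t ht =>
    mul_nonpos_of_nonneg_of_nonpos hτ.le ht) hx, ?_⟩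
  exact (continuous_scale.tendsto _).comp (hl.comp (tendsto_id.const_mul_atBot hτ))

lemma unstableSet_scale (ha : a ≠ 0) (hb : b ≠ 0) (hτ : 0 < τ)
    (h : ∀ w, X (scale a b w) = τ • scale a b (Y w)) (e : Phase) :
    unstableSet X (scale a b e) = scale a b '' unstableSet Y e := by
  refine Subset.antisymm (fun w hw => ⟨scale a⁻¹ b⁻¹ w, ?_, scale_inv' ha hb w⟩) ?_
  · have h' : ∀ w, Y (scale a⁻¹ b⁻¹ w) = τ⁻¹ • scale a⁻¹ b⁻¹ (X w) := fun w => by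
      have e1 := h (scale a⁻¹ b⁻¹ w)
      rw [scale_inv' ha hb] at e1
      have e2 : ∀ v : Phase, scale a⁻¹ b⁻¹ (τ • v) = τ • scale a⁻¹ b⁻¹ v := fun v => by
        simp only [scale, Prod.smul_fst, Prod.smul_snd, Prod.smul_mk, smul_eq_mul,
          Complex.real_smul]
        refine Prod.ext ?_ ?_ <;> dsimp only <;> ring
      rw [e1, e2, scale_inv ha hb, inv_smul_smul₀ hτ.ne']
    have := scale_mem_unstableSet (inv_pos.2 hτ) h' hw
    rwa [scale_inv ha hb] at this
  · rintro _ ⟨w, hw, rfl⟩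
    exact scale_mem_unstableSet hτ h hw

/-- The four-winged connection is invariant under scalings of the phase space and of time. -/
theorem FourWingedConnection.scale {ζ : ℝ} (ha : a ≠ 0) (hb : 0 < b) (hτ : 0 < τ)
    (h : ∀ w, X (scale a b w) = τ • scale a b (Y w)) (hY : FourWingedConnection Y ζ) :
    FourWingedConnection X (b * ζ) := by
  obtain ⟨hζ, h0, h1, h2, hS, Γ, hΓ, hdis, hu1, hu2⟩ := hY
  have e0 : Z4.scale a b 0 = 0 := by simp [Z4.scale]
  have e1 : ∀ ζ, Z4.scale a b (0, ζ) = (0, b * ζ) := fun ζ => by simp [Z4.scale]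
  have e2 : ((0, -(b * ζ)) : Phase) = Z4.scale a b (0, -ζ) := by simp [Z4.scale]
  have hiter : ∀ k : ℕ, S^[k] ∘ (fun t => Z4.scale a b (Γ (τ * t)))
      = fun t => Z4.scale a b ((S^[k] ∘ Γ) (τ * t)) := fun k => by
    funext t
    simp only [Function.comp_apply, scale_S_iterate]
  have hsurj : Function.Surjective fun t : ℝ => τ * t := fun t =>
    ⟨τ⁻¹ * t, by simp [hτ.ne']⟩
  have hrange : ∀ k : ℕ, range (S^[k] ∘ fun t => Z4.scale a b (Γ (τ * t)))
      = Z4.scale a b '' range (S^[k] ∘ Γ) := fun k => by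
    rw [hiter, ← range_comp, ← hsurj.range_comp (Z4.scale a b ∘ (S^[k] ∘ Γ))]
    rfl
  have hinj : Function.Injective (Z4.scale a b) :=
    Function.LeftInverse.injective (scale_inv ha hb.ne')
  have hr0 := hrange 0
  have hr1 := hrange 1
  simp only [Function.iterate_zero, Function.id_comp, Function.iterate_one] at hr0 hr1
  refine ⟨mul_pos hb hζ, ?_, ?_, ?_, fun w => ?_, fun t => Z4.scale a b (Γ (τ * t)),
    fun k => ⟨?_, ?_, ?_⟩, fun j hj k hk hjk => ?_, ?_, ?_⟩
  · rw [← e0, h, h0, e0, smul_zero]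
  · rw [← e1, h, h1, e0, smul_zero]
  · rw [e2, h, h2, e0, smul_zero]
  · have e3 := scale_inv' ha hb.ne' w
    rw [← e3, ← scale_S, h, h, hS, scale_S]
    simp only [S]
    refine Prod.ext ?_ ?_ <;> simp
    ring
  · rw [hiter, ← isIntegralCurveOn_univ]
    exact integralCurveOn_scale h (fun t _ => mem_univ _) ((hΓ k).1.isIntegralCurveOn _)
  · rw [hiter, ← e1, ← scale_S_iterate]
    exact (continuous_scale.tendsto _).comp ((hΓ k).2.1.comp (tendsto_id.const_mul_atBot hτ))
  · rw [hiter]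
    have := (continuous_scale (a := a) (b := b)).tendsto 0
    rw [e0] at this
    exact this.comp ((hΓ k).2.2.comp (tendsto_id.const_mul_atTop hτ))
  · rw [hrange, hrange, disjoint_image_iff hinj]
    exact hdis j hj k hk hjk
  · rw [← e1, unstableSet_scale ha hb.ne' hτ h, hu1, image_union, image_union, image_singleton,
      hrange, hr0]
  · rw [e2, unstableSet_scale ha hb.ne' hτ h, hu2, image_union, image_union, image_singleton,
      hrange, hr1]

end Scaling

/-! ### Terms of fourth order -/

/-- A smooth family of functions of `s` that vanish to order `n` at `s = 0` is divisible by
`s ^ n`. -/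
lemma exists_smooth_div_pow {Q W : Type} [NormedAddCommGroup Q] [NormedSpace ℝ Q]
    [FiniteDimensional ℝ Q] [NormedAddCommGroup W] [NormedSpace ℝ W] [FiniteDimensional ℝ W]
    {φ : Q × ℝ → W} (hφ : ContDiff ℝ ∞ φ) (n : ℕ)
    (h : ∀ q, (fun s => φ (q, s)) =O[𝓝 0] fun s : ℝ => s ^ n) :
    ∃ ψ : Q × ℝ → W, ContDiff ℝ ∞ ψ ∧ ∀ q s, φ (q, s) = s ^ n • ψ (q, s) := by
  induction n with
  | zero => exact ⟨φ, hφ, fun q s => by simp⟩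
  | succ n ih =>
    obtain ⟨ψ, hψ, hφψ⟩ := ih fun q => (h q).trans
      (Asymptotics.IsBigO.of_bound 1 (by
        filter_upwards [Metric.ball_mem_nhds (0 : ℝ) one_pos] with s hs
        rw [mem_ball_zero_iff] at hs
        rw [norm_pow, norm_pow, one_mul, pow_succ]
        exact mul_le_of_le_one_right (by positivity) hs.le))
    have h0 : ∀ q, ψ (q, 0) = 0 := by
      intro q
      have hc : Tendsto (fun s => ψ (q, s)) (𝓝[≠] 0) (𝓝 (ψ (q, 0))) :=
        ((hψ.continuous.comp (by fun_prop : Continuous fun s : ℝ => (q, s))).tendsto 0).mono_left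
          nhdsWithin_le_nhds
      refine tendsto_nhds_unique hc ?_
      obtain ⟨C, hC⟩ := (h q).bound
      have hlim : Tendsto (fun s : ℝ => C * |s|) (𝓝[≠] 0) (𝓝 0) := by
        have : Tendsto (fun s : ℝ => C * |s|) (𝓝 0) (𝓝 (C * |0|)) :=
          (by fun_prop : Continuous fun s : ℝ => C * |s|).tendsto 0
        simpa using this.mono_left nhdsWithin_le_nhds
      refine squeeze_zero_norm' ?_ hlim
      filter_upwards [nhdsWithin_le_nhds hC, self_mem_nhdsWithin] with s hs hs0
      rw [hφψ, norm_smul, norm_pow, norm_pow, pow_succ, Real.norm_eq_abs] at hs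
      have hp : 0 < |s| ^ n := pow_pos (abs_pos.2 hs0) n
      refine le_of_mul_le_mul_left (hs.trans_eq ?_) hp
      ring
    obtain ⟨M, hM, hψM⟩ := exists_smooth_factor hψ h0
    refine ⟨fun v => M v 1, hM.clm_apply contDiff_const, fun q s => ?_⟩
    have e : M (q, s) s = s • M (q, s) 1 := by rw [← map_smul, smul_eq_mul, mul_one]
    rw [hφψ, hψM, e, pow_succ, mul_smul]

/-- A smooth family of vector fields of fourth order at the origin, in scaled coordinates. -/
lemma exists_quartic {W : Type} [NormedAddCommGroup W] [NormedSpace ℝ W] [FiniteDimensional ℝ W]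
    {R : Param × Phase → W} (hR : ContDiff ℝ ∞ R)
    (h : ∀ η, (fun w => R (η, w)) =O[𝓝 0] fun w : Phase => ‖w‖ ^ 4) (A : W →L[ℝ] W)
    (hA : ∀ η w, R (η, S w) = A (R (η, w))) :
    ∃ T : Param × ℝ × Phase → W, ContDiff ℝ ∞ T ∧
      (∀ η s w, R (η, s • w) = s ^ 4 • T (η, s, w)) ∧
      (∀ η s w, T (η, s, S w) = A (T (η, s, w))) ∧
      ∀ η s, (fun w => T (η, s, w)) =O[𝓝 0] fun w : Phase => ‖w‖ ^ 4 := by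
  obtain ⟨ψ, hψ, hRψ⟩ := exists_smooth_div_pow (Q := Param × Phase)
    (φ := fun v : (Param × Phase) × ℝ => R (v.1.1, v.2 • v.1.2)) (hR.comp (by fun_prop)) 4 (by
      rintro ⟨η, w⟩
      have ht : Tendsto (fun s : ℝ => s • w) (𝓝 0) (𝓝 0) := by
        have := (by fun_prop : Continuous fun s : ℝ => s • w).tendsto 0
        simpa using this
      refine ((h η).comp_tendsto ht).trans (Asymptotics.IsBigO.of_bound (‖w‖ ^ 4)
        (Eventually.of_forall fun s => ?_))
      simp only [Function.comp_apply, norm_smul, norm_pow, norm_norm, mul_pow, norm_mul]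
      rw [mul_comm])
  have hT : ContDiff ℝ ∞ fun v : Param × ℝ × Phase => ψ ((v.1, v.2.2), v.2.1) :=
    hψ.comp (by fun_prop)
  have hTc := hT.continuous
  have hR' : ∀ η (s : ℝ) w, R (η, s • w) = s ^ 4 • ψ ((η, w), s) := fun η s w => hRψ (η, w) s
  have hext : ∀ f g : ℝ → W, Continuous f → Continuous g → (∀ s ≠ 0, f s = g s) → ∀ s, f s = g s :=
    fun f g hf hg hfg => congrFun (hf.ext_on (dense_compl_singleton (0 : ℝ)) hg hfg)
  have hhom : ∀ η s (l : ℝ) w, ψ ((η, l • w), s) = l ^ 4 • ψ ((η, w), l * s) := by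
    intro η s l w
    refine hext (fun s => ψ ((η, l • w), s)) (fun s => l ^ 4 • ψ ((η, w), l * s))
      (hψ.continuous.comp (by fun_prop)) ((hψ.continuous.comp (by fun_prop)).const_smul _)
      (fun s hs => ?_) s
    have e1 := hR' η s (l • w)
    rw [smul_smul, mul_comm s l, hR', mul_pow, mul_comm, mul_smul] at e1
    exact (smul_right_injective W (pow_ne_zero 4 hs) e1).symm
  refine ⟨_, hT, hR', fun η s w => ?_, fun η s => ?_⟩
  · refine hext (fun s => ψ ((η, S w), s)) (fun s => A (ψ ((η, w), s)))
      (hψ.continuous.comp (by fun_prop)) (A.continuous.comp (hψ.continuous.comp (by fun_prop)))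
      (fun s hs => ?_) s
    have e1 := hR' η s (S w)
    have e2 : s • S w = S (s • w) := by
      simp only [S]
      refine Prod.ext ?_ ?_ <;> simp
      ring
    rw [e2, hA, hR', map_smul] at e1
    exact (smul_right_injective W (pow_ne_zero 4 hs) e1).symm
  · -- homogeneity reduces the bound to the compact unit ball
    have hK : IsCompact (Metric.closedBall (0 : ℝ) |s| ×ˢ Metric.closedBall (0 : Phase) 1) :=
      (isCompact_closedBall _ _).prod (isCompact_closedBall _ _)
    obtain ⟨C, hC⟩ := hK.exists_bound_of_continuousOn (f := fun v : ℝ × Phase => ψ ((η, v.2), v.1))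
      (hψ.continuous.comp (by fun_prop)).continuousOn
    refine Asymptotics.IsBigO.of_bound C ?_
    filter_upwards [Metric.closedBall_mem_nhds (0 : Phase) one_pos] with w hw
    rw [mem_closedBall_zero_iff] at hw
    by_cases h0 : w = 0
    · subst h0
      have := hhom η s 0 0
      rw [smul_zero, zero_pow (by norm_num), zero_smul] at this
      rw [this]
      simp
    · have hn : ‖w‖ ≠ 0 := norm_ne_zero_iff.2 h0
      have e := hhom η s ‖w‖ (‖w‖⁻¹ • w)
      rw [smul_inv_smul₀ hn] at e
      have hb := hC (‖w‖ * s, ‖w‖⁻¹ • w) (mk_mem_prod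
        (by rw [mem_closedBall_zero_iff, norm_mul, norm_norm, Real.norm_eq_abs]
            exact mul_le_of_le_one_left (abs_nonneg _) hw)
        (by rw [mem_closedBall_zero_iff, norm_smul, norm_inv, norm_norm, inv_mul_cancel₀ hn]))
      rw [e, norm_smul, norm_pow, norm_norm, mul_comm]
      exact mul_le_mul_of_nonneg_right hb (by positivity)

end Z4

namespace Z4

/-! ### Localization of the original family -/

/-- Reparametrization of the coefficients. -/
def Coeffs.comp (c : Coeffs) (π : Param → Param) : Coeffs where
  a0 p := c.a0 (π p)
  a1 p := c.a1 (π p)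
  a2 p := c.a2 (π p)
  a3 p := c.a3 (π p)
  b0 p := c.b0 (π p)
  b1 p := c.b1 (π p)
  b2 p := c.b2 (π p)

/-- A smooth unitary square root near a non-zero value. -/
lemma exists_unit_sqrt {a : Param → ℂ} (ha : ContDiff ℝ ∞ a) (h0 : ∀ η, a η ≠ 0)
    (hre : ∀ η, 0 < (a η / a 0).re) :
    ∃ r : Param → ℂ, ContDiff ℝ ∞ r ∧ (∀ η, ‖r η‖ = 1) ∧ ∀ η, a η = ‖a η‖ * r η ^ 2 := by
  -- the bisector of the angle between `1` and a unit complex number `v ≠ -1` is `v + 1`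
  set v : Param → ℂ := fun η => a η * (‖a η‖ : ℂ)⁻¹ * ((‖a 0‖ : ℂ) * (a 0)⁻¹) with hv
  have hna : ∀ η, ‖a η‖ ≠ 0 := fun η => norm_ne_zero_iff.2 (h0 η)
  have hnc : ∀ η, (‖a η‖ : ℂ) ≠ 0 := fun η => Complex.ofReal_ne_zero.2 (hna η)
  have hvn : ∀ η, ‖v η‖ = 1 := fun η => by
    simp only [hv, norm_mul, norm_inv, Complex.norm_real, norm_norm]
    field_simp [hna η, hna 0]
  have hvre : ∀ η, 0 < (v η).re := fun η => by
    have e : v η = ((‖a η‖⁻¹ * ‖a 0‖ : ℝ) : ℂ) * (a η / a 0) := by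
      simp only [hv]; push_cast; ring
    rw [e, Complex.re_ofReal_mul]
    have := hre η
    have h1 : 0 < ‖a η‖ := norm_pos_iff.2 (h0 η)
    have h2 : 0 < ‖a 0‖ := norm_pos_iff.2 (h0 0)
    positivity
  have hv1 : ∀ η, v η + 1 ≠ 0 := fun η h => by
    have := congrArg Complex.re h
    simp only [Complex.add_re, Complex.one_re, Complex.zero_re] at this
    linarith [hvre η]
  have hvs : ContDiff ℝ ∞ v := by
    have hn : ContDiff ℝ ∞ fun η => (‖a η‖ : ℂ) :=
      Complex.ofRealCLM.contDiff.comp (ha.norm ℝ h0)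
    exact (ha.mul (hn.inv hnc)).mul contDiff_const
  obtain ⟨c, hc⟩ : ∃ c : ℂ, c ^ 2 = a 0 * (‖a 0‖ : ℂ)⁻¹ := IsAlgClosed.exists_pow_nat_eq _ two_pos
  have hcn : ‖c‖ = 1 := by
    have h := congrArg norm hc
    rw [norm_pow, norm_mul, norm_inv, Complex.norm_real, norm_norm, mul_inv_cancel₀ (hna 0)] at h
    exact (pow_eq_one_iff_of_nonneg (norm_nonneg _) two_ne_zero).1 h
  have hn1 : ∀ η, (‖v η + 1‖ : ℂ) ≠ 0 := fun η =>
    Complex.ofReal_ne_zero.2 (norm_ne_zero_iff.2 (hv1 η))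
  refine ⟨fun η => c * ((v η + 1) * (‖v η + 1‖ : ℂ)⁻¹), ?_, fun η => ?_, fun η => ?_⟩
  · have hs := hvs.add (contDiff_const (c := (1 : ℂ)))
    have hn : ContDiff ℝ ∞ fun η => (‖v η + 1‖ : ℂ) :=
      Complex.ofRealCLM.contDiff.comp (hs.norm ℝ hv1)
    exact contDiff_const.mul (hs.mul (hn.inv hn1))
  · rw [norm_mul, norm_mul, norm_inv, Complex.norm_real, norm_norm, hcn, one_mul,
      mul_inv_cancel₀ (norm_ne_zero_iff.2 (hv1 η))]
  · have h1 : v η * (starRingEnd ℂ) (v η) = 1 := by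
      rw [Complex.mul_conj, Complex.normSq_eq_norm_sq, hvn]; simp
    have h2 : (‖v η + 1‖ : ℂ) ^ 2 = (v η + 1) * ((starRingEnd ℂ) (v η) + 1) := by
      rw [← Complex.ofReal_pow, ← Complex.normSq_eq_norm_sq, ← Complex.mul_conj, map_add, map_one]
    have h3 : (v η + 1) ^ 2 = v η * (‖v η + 1‖ : ℂ) ^ 2 := by
      rw [h2]; linear_combination (-v η - 1) * h1
    have h4 : ((v η + 1) * (‖v η + 1‖ : ℂ)⁻¹) ^ 2 = v η := by
      rw [mul_pow, h3, inv_pow, mul_assoc, mul_inv_cancel₀ (pow_ne_zero 2 (hn1 η)), mul_one]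
    rw [mul_pow, hc, h4]
    simp only [hv]
    have e1 := hnc η
    have e2 := hnc 0
    have e3 := h0 0
    field_simp

/-- The data of the original family near the bifurcation moment, extended to all parameters. The
map `π` retracts the parameters into a small ball, `r ^ 2` is the phase of `a₀`, and `Tu`, `Tz`
are the fourth order terms in scaled coordinates. -/
structure ScaledData (G : GeneralFamily) where
  π : Param → Param
  r : Param → ℂ
  Tu : Param × ℝ × Phase → ℂ
  Tz : Param × ℝ × Phase → ℝ
  π_eq : ∀ᶠ η in 𝓝 0, π η = η
  a0_smooth : ContDiff ℝ ∞ (G.c.comp π).a0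
  a1_smooth : ContDiff ℝ ∞ (G.c.comp π).a1
  a2_smooth : ContDiff ℝ ∞ (G.c.comp π).a2
  a3_smooth : ContDiff ℝ ∞ (G.c.comp π).a3
  b0_smooth : ContDiff ℝ ∞ (G.c.comp π).b0
  b1_smooth : ContDiff ℝ ∞ (G.c.comp π).b1
  b2_smooth : ContDiff ℝ ∞ (G.c.comp π).b2
  b1_neg : ∀ η, (G.c.comp π).b1 η < 0
  a0_ne : ∀ η, (G.c.comp π).a0 η ≠ 0
  r_smooth : ContDiff ℝ ∞ r
  r_norm : ∀ η, ‖r η‖ = 1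
  r_sq : ∀ η, (G.c.comp π).a0 η = ‖(G.c.comp π).a0 η‖ * r η ^ 2
  Tu_smooth : ContDiff ℝ ∞ Tu
  Tz_smooth : ContDiff ℝ ∞ Tz
  Ru_eq : ∀ η s w, G.Ru (π η) (s • w) = s ^ 4 • Tu (η, s, w)
  Rz_eq : ∀ η s w, G.Rz (π η) (s • w) = s ^ 4 • Tz (η, s, w)
  Tu_symm : ∀ η s w, Tu (η, s, S w) = Complex.I * Tu (η, s, w)
  Tz_symm : ∀ η s w, Tz (η, s, S w) = -Tz (η, s, w)
  Tu_order : ∀ η s, (fun w => Tu (η, s, w)) =O[𝓝 0] fun w : Phase => ‖w‖ ^ 4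
  Tz_order : ∀ η s, (fun w => Tz (η, s, w)) =O[𝓝 0] fun w : Phase => ‖w‖ ^ 4

lemma GeneralFamily.nonempty_scaledData (G : GeneralFamily) (hb : G.c.b1 0 < 0)
    (ha : G.c.a0 0 ≠ 0) : Nonempty (ScaledData G) := by
  have hn := Metric.ball_mem_nhds (0 : Param) G.r_pos
  have cb1 := (G.c_smooth.b1.contDiffAt hn).continuousAt
  have ca0 := (G.c_smooth.a0.contDiffAt hn).continuousAt
  have cre : ContinuousAt (fun η => (G.c.a0 η / G.c.a0 0).re) 0 :=
    Complex.continuous_re.continuousAt.comp (ca0.div_const _)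
  obtain ⟨ε, hε, hball⟩ := Metric.eventually_nhds_iff_ball.1
    ((cb1.eventually (gt_mem_nhds hb)).and ((ca0.eventually_ne ha).and
      ((cre.eventually (lt_mem_nhds (a := 0) (by simp [ha]))).and hn)))
  obtain ⟨π, hπ, hπm, hπe⟩ := exists_retraction 0 hε
  have hm : ∀ η, π η ∈ Metric.ball (0 : Param) G.r := fun η => (hball _ (hπm η)).2.2.2
  have hπ0 : π 0 = 0 := hπe.self_of_nhds
  obtain ⟨r, hr, hrn, hrs⟩ := exists_unit_sqrt (a := fun η => G.c.a0 (π η))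
    (G.c_smooth.a0.comp_contDiff hπ hm) (fun η => (hball _ (hπm η)).2.1)
    (fun η => by rw [hπ0]; exact (hball _ (hπm η)).2.2.1)
  have hmm : ∀ v : Param × Phase,
      (π v.1, v.2) ∈ Metric.ball (0 : Param) G.r ×ˢ (univ : Set Phase) :=
    fun v => mk_mem_prod (hm _) (mem_univ _)
  have hπs : ContDiff ℝ ∞ fun v : Param × Phase => (π v.1, v.2) :=
    (hπ.comp contDiff_fst).prodMk contDiff_snd
  obtain ⟨Tu, u1, u2, u3, u4⟩ := exists_quartic (R := fun v : Param × Phase => G.Ru (π v.1) v.2)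
    (G.Ru_smooth.comp_contDiff hπs hmm) (fun η => G.Ru_order _ (hm η))
    (Complex.I • ContinuousLinearMap.id ℝ ℂ) (fun η w => by simpa using G.Ru_symm _ (hm η) w)
  obtain ⟨Tz, z1, z2, z3, z4⟩ := exists_quartic (R := fun v : Param × Phase => G.Rz (π v.1) v.2)
    (G.Rz_smooth.comp_contDiff hπs hmm) (fun η => G.Rz_order _ (hm η))
    (-ContinuousLinearMap.id ℝ ℝ) (fun η w => by simpa using G.Rz_symm _ (hm η) w)
  exact ⟨{
    π := π
    r := r
    Tu := Tu
    Tz := Tz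
    π_eq := hπe
    a0_smooth := G.c_smooth.a0.comp_contDiff hπ hm
    a1_smooth := G.c_smooth.a1.comp_contDiff hπ hm
    a2_smooth := G.c_smooth.a2.comp_contDiff hπ hm
    a3_smooth := G.c_smooth.a3.comp_contDiff hπ hm
    b0_smooth := G.c_smooth.b0.comp_contDiff hπ hm
    b1_smooth := G.c_smooth.b1.comp_contDiff hπ hm
    b2_smooth := G.c_smooth.b2.comp_contDiff hπ hm
    b1_neg := fun η => (hball _ (hπm η)).1
    a0_ne := fun η => (hball _ (hπm η)).2.1
    r_smooth := hr
    r_norm := hrn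
    r_sq := hrs
    Tu_smooth := u1
    Tz_smooth := z1
    Ru_eq := u2
    Rz_eq := z2
    Tu_symm := fun η s w => by simpa using u3 η s w
    Tz_symm := fun η s w => by simpa using z3 η s w
    Tu_order := u4
    Tz_order := z4 }⟩

end Z4

namespace Z4

/-! ### The scales of the phase space and of time -/

/-- The original parameters `(γ, β, μ)` for rescaled parameters `(ρ, ω, s)`, when time is scaled
by `s * T`. -/
def originalParam (p : Param) (T : ℝ) : Param :=
  (p.1 * (p.2.2 * T), p.2.1 * (p.2.2 * T), p.2.2 ^ 2)

lemma contDiff_originalParam :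
    ContDiff ℝ ∞ fun v : Param × ℝ => originalParam v.1 v.2 := by
  unfold originalParam
  fun_prop

lemma originalParam_of_zero {p : Param} (hp : p.2.2 = 0) (T : ℝ) : originalParam p T = 0 := by
  simp [originalParam, hp]

namespace ScaledData

variable {G : GeneralFamily} (D : ScaledData G)

/-- The localized coefficients. -/
def c : Coeffs := G.c.comp D.π

/-- The limit of `z₀ / √μ`. -/
noncomputable def zeta₀ : ℝ := (√|D.c.b1 0|)⁻¹

lemma zeta₀_pos : 0 < D.zeta₀ := inv_pos.2 (Real.sqrt_pos.2 (abs_pos.2 (D.b1_neg 0).ne))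

lemma b1_mul_zeta₀_sq : D.c.b1 0 * D.zeta₀ ^ 2 = -1 := by
  have h := D.b1_neg 0
  change D.c.b1 0 < 0 at h
  rw [zeta₀, inv_pow, Real.sq_sqrt (abs_nonneg _), abs_of_neg h, inv_neg, mul_neg,
    mul_inv_cancel₀ h.ne]

/-- The equilibrium `z = s ζ` of the original family and the scale `s T` of time, with
`T = ζ |a₀|`, depend smoothly on the rescaled parameters. -/
lemma exists_scales : ∃ ψ : Param → ℝ × ℝ, ψ p0 = (D.zeta₀, D.zeta₀ * ‖D.c.a0 0‖) ∧
    (∀ᶠ p in 𝓝 p0, ContDiffAt ℝ ∞ ψ p) ∧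
    (∀ᶠ p in 𝓝 p0, p.2.2 = 0 → ψ p = (D.zeta₀, D.zeta₀ * ‖D.c.a0 0‖)) ∧
    ∀ᶠ p in 𝓝 p0, (ψ p).1 + D.c.b1 (originalParam p (ψ p).2) * (ψ p).1 ^ 3
        + p.2.2 * D.Tz (originalParam p (ψ p).2, p.2.2, (0, (ψ p).1)) = 0 ∧
      (ψ p).2 = (ψ p).1 * ‖D.c.a0 (originalParam p (ψ p).2)‖ := by
  set ζ := D.zeta₀ with hζ
  set T := ζ * ‖D.c.a0 0‖ with hT
  have hb := D.b1_mul_zeta₀_sq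
  rw [← hζ] at hb
  have hη : ContDiff ℝ ∞ fun v : Param × ℝ × ℝ => originalParam v.1 v.2.2 :=
    contDiff_originalParam.comp (by fun_prop : ContDiff ℝ ∞ fun v : Param × ℝ × ℝ => (v.1, v.2.2))
  have h1 : ContDiff ℝ ∞ fun v : Param × ℝ × ℝ => D.c.b1 (originalParam v.1 v.2.2) :=
    D.b1_smooth.comp hη
  have h2 : ContDiff ℝ ∞ fun v : Param × ℝ × ℝ => ‖D.c.a0 (originalParam v.1 v.2.2)‖ :=
    (D.a0_smooth.comp hη).norm ℝ fun v => D.a0_ne _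
  have h3 : ContDiff ℝ ∞ fun v : Param × ℝ × ℝ =>
      D.Tz (originalParam v.1 v.2.2, v.1.2.2, ((0 : ℂ), v.2.1)) :=
    D.Tz_smooth.comp (hη.prodMk (by fun_prop))
  set f : Param × ℝ × ℝ → ℝ × ℝ := fun v =>
    (v.2.1 + D.c.b1 (originalParam v.1 v.2.2) * v.2.1 ^ 3
      + v.1.2.2 * D.Tz (originalParam v.1 v.2.2, v.1.2.2, (0, v.2.1)),
     v.2.2 - v.2.1 * ‖D.c.a0 (originalParam v.1 v.2.2)‖) with hf
  have hfs : ContDiff ℝ ∞ f := by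
    refine ContDiff.prodMk ?_ ?_ <;> fun_prop
  -- at `s = 0` the equations do not depend on the other parameters
  have hf0 : ∀ p : Param, p.2.2 = 0 → ∀ x, f (p, x)
      = (x.1 + D.c.b1 0 * x.1 ^ 3, x.2 - x.1 * ‖D.c.a0 0‖) := fun p hp x => by
    simp only [hf, originalParam_of_zero hp, hp, zero_mul, add_zero]
  have hz : ∀ p : Param, p.2.2 = 0 → f (p, (ζ, T)) = 0 := fun p hp => by
    rw [hf0 p hp]
    refine Prod.ext ?_ ?_
    · simp only [Prod.fst_zero]; linear_combination ζ * hb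
    · simp [hT]
  have hder : HasFDerivAt (fun x : ℝ × ℝ => f (p0, x))
      (((-2 : ℝ) • ContinuousLinearMap.fst ℝ ℝ ℝ).prod
        (ContinuousLinearMap.snd ℝ ℝ ℝ - ‖D.c.a0 0‖ • ContinuousLinearMap.fst ℝ ℝ ℝ)) (ζ, T) := by
    simp only [hf0 p0 rfl]
    have d1 : HasFDerivAt (fun x : ℝ × ℝ => x.1) (ContinuousLinearMap.fst ℝ ℝ ℝ) (ζ, T) :=
      hasFDerivAt_fst
    have d2 : HasFDerivAt (fun x : ℝ × ℝ => x.2) (ContinuousLinearMap.snd ℝ ℝ ℝ) (ζ, T) :=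
      hasFDerivAt_snd
    have d3 := (d1.fun_add ((d1.pow 3).const_mul (D.c.b1 0))).prodMk
      (d2.fun_sub (d1.mul_const ‖D.c.a0 0‖))
    refine d3.congr_fderiv ?_
    ext <;> simp
    linear_combination 3 * hb
  have hpart : fderiv ℝ f (p0, (ζ, T)) ∘L .inr ℝ Param (ℝ × ℝ)
      = ((-2 : ℝ) • ContinuousLinearMap.fst ℝ ℝ ℝ).prod
        (ContinuousLinearMap.snd ℝ ℝ ℝ - ‖D.c.a0 0‖ • ContinuousLinearMap.fst ℝ ℝ ℝ) :=
    (((hfs.differentiable (by simp) (p0, (ζ, T))).hasFDerivAt).comp (ζ, T)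
      (hasFDerivAt_prodMk_right p0 (ζ, T))).unique hder
  obtain ⟨ψ, hψ0, hψs, hψ⟩ := exists_smooth_implicit (f := f) (q₀ := p0) (x₀ := (ζ, T))
    (Eventually.of_forall fun v => hfs.contDiffAt) (hz p0 rfl) (by
      rw [hpart]
      refine ⟨ContinuousLinearEquiv.equivOfInverse
        (((-2 : ℝ) • ContinuousLinearMap.fst ℝ ℝ ℝ).prod
          (ContinuousLinearMap.snd ℝ ℝ ℝ - ‖D.c.a0 0‖ • ContinuousLinearMap.fst ℝ ℝ ℝ))
        (((-2⁻¹ : ℝ) • ContinuousLinearMap.fst ℝ ℝ ℝ).prod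
        (ContinuousLinearMap.snd ℝ ℝ ℝ
          - (2⁻¹ * ‖D.c.a0 0‖) • ContinuousLinearMap.fst ℝ ℝ ℝ)) (fun x => ?_) (fun x => ?_), rfl⟩
      · refine Prod.ext ?_ ?_ <;> simp
        ring
      · refine Prod.ext ?_ ?_ <;> simp
        ring)
  have hc : Tendsto (fun p => (p, ψ p)) (𝓝 p0) (𝓝 (p0, (ζ, T))) := by
    have h := continuousAt_id.tendsto.prodMk_nhds hψs.self_of_nhds.continuousAt.tendsto
    simpa only [hψ0, id] using h
  have hc' : Tendsto (fun p => (p, (ζ, T))) (𝓝 p0) (𝓝 (p0, (ζ, T))) :=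
    (by fun_prop : Continuous fun p : Param => (p, (ζ, T))).tendsto p0
  refine ⟨ψ, hψ0, hψs, ?_, ?_⟩
  · filter_upwards [hc'.eventually hψ] with p hp hs using hp.1 (hz p hs)
  · filter_upwards [hc.eventually hψ] with p hp
    have h := hp.2 rfl
    exact ⟨congrArg Prod.fst h, sub_eq_zero.1 (congrArg Prod.snd h)⟩

end ScaledData

/-! ### The rescaled family of a general family -/

/-- The planar component of the scaling, as an identity between polynomials. Here `n = |a₀|`,
`r` is the square root of the phase of `a₀`, `c ^ 2 = √|b₁|` and `s Q = c² ζ - 1`. -/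
lemma planar_scaling {s ζ c n r u v z a₁ a₂ a₃ R ρ om Q : ℂ} (hζ : ζ ≠ 0)
    (hc : c ≠ 0) (hn : n ≠ 0) (hr : r ≠ 0) (hQ : s * Q = c ^ 2 * ζ - 1) :
    (-(ρ * (s * (ζ * n))) + Complex.I * (om * (s * (ζ * n)))) * (s * ζ * c * r * u)
      + n * r ^ 2 * (s * ζ * z) * (s * ζ * c * r⁻¹ * v)
      + a₁ * (s * ζ * c * r * u) ^ 2 * (s * ζ * c * r⁻¹ * v)
      + a₂ * (s * ζ * z) ^ 2 * (s * ζ * c * r * u) + a₃ * (s * ζ * c * r⁻¹ * v) ^ 3 + s ^ 4 * R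
    = s * (ζ * n) * (s * ζ * c * r * ((-ρ + Complex.I * om) * u + z * v
      + s * (a₁ / n * u ^ 2 * v + a₂ / (n * c ^ 2) * z ^ 2 * u + a₃ * n / (n * r ^ 2) ^ 2 * v ^ 3
        + s * (Q * (a₁ / n * u ^ 2 * v + a₂ / (n * c ^ 2) * z ^ 2 * u
          + a₃ * n / (n * r ^ 2) ^ 2 * v ^ 3) + R / (ζ ^ 2 * c * r * n))))) := by
  set K := a₁ / n * u ^ 2 * v + a₂ / (n * c ^ 2) * z ^ 2 * u
    + a₃ * n / (n * r ^ 2) ^ 2 * v ^ 3 with hK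
  have e : K + s * (Q * K + R / (ζ ^ 2 * c * r * n))
      = c ^ 2 * ζ * K + s * (R / (ζ ^ 2 * c * r * n)) := by
    linear_combination K * hQ
  rw [e, hK]
  field_simp
  ring

/-- The axial component of the scaling. Here `n = |a₀|`, `c ^ 2 = √|b₁|`, and `s R₀`, `s Q` are
the defects of `|b₁| ζ ^ 2` and of `√|b₁| ζ` from `1`. -/
lemma axial_scaling {s ζ c n z b₁ b₂ R R₀ Q U : ℝ} (hζ : ζ ≠ 0) (hc : c ≠ 0) (hn : n ≠ 0)
    (hQ : s * Q = c ^ 2 * ζ - 1) (hb : b₁ * ζ ^ 2 = -(1 + s * R₀)) :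
    s ^ 2 * (s * ζ * z) + b₁ * (s * ζ * z) ^ 3 + b₂ * (s * ζ * z) * ((s * ζ * c) ^ 2 * U)
      + s ^ 4 * R
    = s * (ζ * n) * (s * ζ * (s * ((c ^ 2 / n
        + s * (-(c ^ 2 * Q) / (n * (c ^ 2 * ζ)))) * (z - z ^ 3)
      + b₂ / n * z * U + s * (-(R₀ / (ζ * n)) * z ^ 3 + Q * (b₂ / n) * z * U
        + R / (ζ ^ 2 * n))))) := by
  have e1 : c ^ 2 / n + s * (-(c ^ 2 * Q) / (n * (c ^ 2 * ζ))) = 1 / (ζ * n) := by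
    field_simp
    linear_combination -hQ
  have e2 : b₂ / n * z * U + s * (-(R₀ / (ζ * n)) * z ^ 3 + Q * (b₂ / n) * z * U + R / (ζ ^ 2 * n))
      = c ^ 2 * ζ * (b₂ / n * z * U) + s * (-(R₀ / (ζ * n)) * z ^ 3 + R / (ζ ^ 2 * n)) := by
    linear_combination (b₂ / n * z * U) * hQ
  rw [e1, add_assoc (1 / (ζ * n) * (z - z ^ 3)), e2]
  field_simp
  linear_combination s ^ 3 * ζ * z ^ 3 * hb

end Z4

namespace Z4

lemma isBigO_fst_pow : (fun w : Phase => w.1) =O[𝓝 0] fun w : Phase => ‖w‖ :=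
  Asymptotics.IsBigO.of_bound 1 (Eventually.of_forall fun w => by
    rw [norm_norm, one_mul]; exact norm_fst_le w)

lemma isBigO_conj : (fun w : Phase => (starRingEnd ℂ) w.1) =O[𝓝 0] fun w : Phase => ‖w‖ :=
  Asymptotics.IsBigO.of_bound 1 (Eventually.of_forall fun w => by
    rw [norm_norm, one_mul, Complex.norm_conj]; exact norm_fst_le w)

lemma isBigO_snd : (fun w : Phase => w.2) =O[𝓝 0] fun w : Phase => ‖w‖ :=
  Asymptotics.IsBigO.of_bound 1 (Eventually.of_forall fun w => by
    rw [norm_norm, one_mul]; exact norm_snd_le w)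

lemma isBigO_norm_four : (fun w : Phase => ‖w‖ ^ 4) =O[𝓝 0] fun w : Phase => ‖w‖ ^ 3 :=
  Asymptotics.IsBigO.of_bound 1 (by
    filter_upwards [Metric.closedBall_mem_nhds (0 : Phase) one_pos] with w hw
    rw [mem_closedBall_zero_iff] at hw
    rw [norm_pow, norm_pow, norm_norm, one_mul, pow_succ]
    exact mul_le_of_le_one_right (by positivity) hw)

lemma isBigO_scale (a : ℂ) (b : ℝ) : scale a b =O[𝓝 0] fun w : Phase => ‖w‖ := by
  have h1 : (fun w : Phase => a * w.1) =O[𝓝 0] fun w : Phase => ‖w‖ :=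
    isBigO_fst_pow.const_mul_left a
  have h2 : (fun w : Phase => b * w.2) =O[𝓝 0] fun w : Phase => ‖w‖ :=
    isBigO_snd.const_mul_left b
  exact h1.prod_left h2

lemma tendsto_scale (a : ℂ) (b : ℝ) : Tendsto (scale a b) (𝓝 0) (𝓝 0) := by
  have h := (continuous_scale (a := a) (b := b)).tendsto 0
  have e : scale a b 0 = 0 := by simp [scale]
  rwa [e] at h

namespace ScaledData

variable {G : GeneralFamily} (D : ScaledData G) (ψ : Param → ℝ × ℝ)

/-- The original parameters along the scales `ψ`. -/
def eta (p : Param) : Param := originalParam p (ψ p).2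

/-- The modulus of `a₀`. -/
noncomputable def n (p : Param) : ℝ := ‖D.c.a0 (eta ψ p)‖

/-- The square root of `|b₁|`. -/
noncomputable def sb (p : Param) : ℝ := √|D.c.b1 (eta ψ p)|

/-- The factor `R₀` with `|b₁| ζ ^ 2 = 1 + s R₀`. -/
noncomputable def defect (p : Param) : ℝ :=
  D.Tz (eta ψ p, p.2.2, (0, (ψ p).1)) / (ψ p).1

/-- The factor `Q` with `√|b₁| ζ = 1 + s Q`. -/
noncomputable def rootDefect (p : Param) : ℝ := D.defect ψ p / (1 + D.sb ψ p * (ψ p).1)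

/-- The variable `u` is scaled by `s` times this factor. -/
noncomputable def planarScale (p : Param) : ℂ := (ψ p).1 * √(D.sb ψ p) * D.r (eta ψ p)

/-- The planar third order term of the rescaled family. The first part comes from replacing
`√|b₁| ζ = 1 + s Q` by `1` in the cubic terms. -/
noncomputable def rem1 (p : Param) (w : Phase) : ℂ :=
  D.rootDefect ψ p * (D.c.a1 (eta ψ p) / D.n ψ p * w.1 ^ 2 * (starRingEnd ℂ) w.1
    + D.c.a2 (eta ψ p) / (D.n ψ p * D.sb ψ p : ℝ) * w.2 ^ 2 * w.1
    + D.c.a3 (eta ψ p) * D.n ψ p / D.c.a0 (eta ψ p) ^ 2 * (starRingEnd ℂ) w.1 ^ 3)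
  + D.Tu (eta ψ p, p.2.2, scale (D.planarScale ψ p) (ψ p).1 w)
    / ((ψ p).1 ^ 2 * √(D.sb ψ p) * D.r (eta ψ p) * D.n ψ p)

/-- The axial third order term of the rescaled family. The part in `z ^ 3` makes `(0, 1)` an exact
equilibrium. -/
noncomputable def rem2 (p : Param) (w : Phase) : ℝ :=
  -(D.defect ψ p / ((ψ p).1 * D.n ψ p)) * w.2 ^ 3
    + D.rootDefect ψ p * (D.c.b2 (eta ψ p) / D.n ψ p) * w.2 * ‖w.1‖ ^ 2
    + D.Tz (eta ψ p, p.2.2, scale (D.planarScale ψ p) (ψ p).1 w) / ((ψ p).1 ^ 2 * D.n ψ p)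

/-- The correction of the axial linear term. -/
noncomputable def corr (p : Param) : ℝ :=
  -(D.sb ψ p * D.rootDefect ψ p) / (D.n ψ p * (D.sb ψ p * (ψ p).1))

lemma n_pos (p : Param) : 0 < D.n ψ p := norm_pos_iff.2 (D.a0_ne _)

lemma sb_pos (p : Param) : 0 < D.sb ψ p := Real.sqrt_pos.2 (abs_pos.2 (D.b1_neg _).ne)

lemma r_ne (η : Param) : D.r η ≠ 0 := norm_ne_zero_iff.1 (by rw [D.r_norm]; exact one_ne_zero)

lemma rem1_symm (p : Param) (w : Phase) : D.rem1 ψ p (S w) = Complex.I * D.rem1 ψ p w := by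
  have hI : Complex.I ^ 2 = -1 := Complex.I_sq
  have hI3 : Complex.I ^ 3 = -Complex.I := by rw [pow_succ, hI, neg_one_mul]
  have e : (-Complex.I) ^ 3 = Complex.I := by rw [neg_pow, hI3]; ring
  simp only [rem1, scale_S, D.Tu_symm]
  simp only [S, map_mul, Complex.conj_I, Complex.ofReal_neg, mul_pow, hI, neg_sq, e]
  ring

lemma rem2_symm (p : Param) (w : Phase) : D.rem2 ψ p (S w) = -D.rem2 ψ p w := by
  simp only [rem2, scale_S, D.Tz_symm]
  simp only [S, norm_mul, Complex.norm_I, one_mul]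
  ring

lemma rem1_order (p : Param) : D.rem1 ψ p =O[𝓝 0] fun w : Phase => ‖w‖ ^ 3 := by
  have hz : (fun w : Phase => (w.2 : ℂ)) =O[𝓝 0] fun w : Phase => ‖w‖ :=
    (isBigO_snd.norm_left.congr_left fun w => by rw [← Complex.norm_real]).of_norm_left
  have t1 := (((isBigO_fst_pow.pow 2).const_mul_left
    (D.c.a1 (eta ψ p) / D.n ψ p)).mul isBigO_conj).congr_right
      (g₂ := fun w : Phase => ‖w‖ ^ 3) fun w => by ring
  have t2 := (((hz.pow 2).const_mul_left
    (D.c.a2 (eta ψ p) / (D.n ψ p * D.sb ψ p : ℝ))).mul isBigO_fst_pow).congr_right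
      (g₂ := fun w : Phase => ‖w‖ ^ 3) fun w => by ring
  have t3 := (isBigO_conj.pow 3).const_mul_left
    (D.c.a3 (eta ψ p) * D.n ψ p / D.c.a0 (eta ψ p) ^ 2)
  have t4 := (((D.Tu_order (eta ψ p) p.2.2).comp_tendsto
    (tendsto_scale (D.planarScale ψ p) (ψ p).1)).trans
      ((isBigO_scale (D.planarScale ψ p) (ψ p).1).norm_left.pow 4)).trans isBigO_norm_four
  exact (((t1.add t2).add t3).const_mul_left _).add
    ((t4.const_mul_left ((ψ p).1 ^ 2 * √(D.sb ψ p) * D.r (eta ψ p) * D.n ψ p : ℂ)⁻¹).congr_left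
      fun w => by rw [Function.comp_apply, div_eq_inv_mul])

lemma rem2_order (p : Param) : D.rem2 ψ p =O[𝓝 0] fun w : Phase => ‖w‖ ^ 3 := by
  have t1 := (isBigO_snd.pow 3).const_mul_left (-(D.defect ψ p / ((ψ p).1 * D.n ψ p)))
  have t2 := ((isBigO_snd.const_mul_left (D.rootDefect ψ p * (D.c.b2 (eta ψ p) / D.n ψ p))).mul
    (isBigO_fst_pow.norm_left.pow 2)).congr_right
      (g₂ := fun w : Phase => ‖w‖ ^ 3) fun w => by ring
  have t3 := (((D.Tz_order (eta ψ p) p.2.2).comp_tendsto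
    (tendsto_scale (D.planarScale ψ p) (ψ p).1)).trans
      ((isBigO_scale (D.planarScale ψ p) (ψ p).1).norm_left.pow 4)).trans isBigO_norm_four
  exact (t1.add t2).add ((t3.const_mul_left ((ψ p).1 ^ 2 * D.n ψ p)⁻¹).congr_left
      fun w => by rw [Function.comp_apply, div_eq_inv_mul])

lemma rem2_equilibrium {p : Param} (hζ : (ψ p).1 ≠ 0) : D.rem2 ψ p (0, 1) = 0 := by
  have hn := (D.n_pos ψ p).ne'
  simp only [rem2, scale, mul_zero, mul_one, norm_zero, defect]
  field_simp
  ring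

section Smooth

variable {D ψ} {U : Set Param}

lemma contDiffOn_eta (hψ : ContDiffOn ℝ ∞ ψ U) : ContDiffOn ℝ ∞ (eta ψ) U :=
  contDiff_originalParam.comp_contDiffOn (contDiffOn_id.prodMk hψ.snd)

lemma contDiffOn_n (hψ : ContDiffOn ℝ ∞ ψ U) : ContDiffOn ℝ ∞ (D.n ψ) U :=
  (D.a0_smooth.comp_contDiffOn (contDiffOn_eta hψ)).norm ℝ fun _ _ => D.a0_ne _

lemma contDiffOn_sb (hψ : ContDiffOn ℝ ∞ ψ U) : ContDiffOn ℝ ∞ (D.sb ψ) U := by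
  refine ((D.b1_smooth.comp_contDiffOn (contDiffOn_eta hψ)).neg.sqrt fun p _ => ?_).congr
    fun p _ => ?_
  · exact (neg_pos.2 (D.b1_neg _)).ne'
  · have h : D.c.b1 (eta ψ p) < 0 := D.b1_neg _
    rw [sb, abs_of_neg h]; rfl

lemma contDiffOn_sqrt_sb (hψ : ContDiffOn ℝ ∞ ψ U) :
    ContDiffOn ℝ ∞ (fun p => √(D.sb ψ p)) U :=
  (contDiffOn_sb hψ).sqrt fun p _ => (D.sb_pos ψ p).ne'

lemma contDiffOn_r (hψ : ContDiffOn ℝ ∞ ψ U) : ContDiffOn ℝ ∞ (fun p => D.r (eta ψ p)) U :=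
  D.r_smooth.comp_contDiffOn (contDiffOn_eta hψ)

lemma contDiffOn_defect (hψ : ContDiffOn ℝ ∞ ψ U) (hζ : ∀ p ∈ U, 0 < (ψ p).1) :
    ContDiffOn ℝ ∞ (D.defect ψ) U := by
  have hs : ContDiffOn ℝ ∞ (fun p : Param => p.2.2) U := by fun_prop
  exact (D.Tz_smooth.comp_contDiffOn ((contDiffOn_eta hψ).prodMk
    (hs.prodMk (contDiffOn_const.prodMk hψ.fst)))).div hψ.fst fun p hp => (hζ p hp).ne'

lemma contDiffOn_rootDefect (hψ : ContDiffOn ℝ ∞ ψ U) (hζ : ∀ p ∈ U, 0 < (ψ p).1) :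
    ContDiffOn ℝ ∞ (D.rootDefect ψ) U :=
  (contDiffOn_defect hψ hζ).div (contDiffOn_const.add ((contDiffOn_sb hψ).mul hψ.fst))
    fun p hp => by have := D.sb_pos ψ p; have := hζ p hp; positivity

lemma contDiffOn_corr (hψ : ContDiffOn ℝ ∞ ψ U) (hζ : ∀ p ∈ U, 0 < (ψ p).1) :
    ContDiffOn ℝ ∞ (D.corr ψ) U :=
  ((contDiffOn_sb hψ).mul (contDiffOn_rootDefect hψ hζ)).neg.div
    ((contDiffOn_n hψ).mul ((contDiffOn_sb hψ).mul hψ.fst)) fun p hp => by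
      have := D.sb_pos ψ p; have := hζ p hp; have := D.n_pos ψ p; positivity

lemma contDiffOn_scaled (hψ : ContDiffOn ℝ ∞ ψ U) :
    ContDiffOn ℝ ∞ (fun q : Param × Phase =>
      (eta ψ q.1, q.1.2.2, scale (D.planarScale ψ q.1) (ψ q.1).1 q.2)) (U ×ˢ univ) := by
  have hm : MapsTo Prod.fst (U ×ˢ (univ : Set Phase)) U := fun q hq => hq.1
  have h1 : ContDiffOn ℝ ∞ (D.planarScale ψ) U :=
    ((contDiffOn_ofReal hψ.fst).mul (contDiffOn_ofReal (contDiffOn_sqrt_sb hψ))).mul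
      (contDiffOn_r hψ)
  have hu : ContDiffOn ℝ ∞ (fun q : Param × Phase => q.2.1) (U ×ˢ univ) := by fun_prop
  have hz : ContDiffOn ℝ ∞ (fun q : Param × Phase => q.2.2) (U ×ˢ univ) := by fun_prop
  have hs : ContDiffOn ℝ ∞ (fun q : Param × Phase => q.1.2.2) (U ×ˢ univ) := by fun_prop
  exact ((contDiffOn_eta hψ).comp contDiffOn_fst hm).prodMk (hs.prodMk
    (((h1.comp contDiffOn_fst hm).mul hu).prodMk ((hψ.fst.comp contDiffOn_fst hm).mul hz)))

lemma contDiffOn_rem1 (hψ : ContDiffOn ℝ ∞ ψ U) (hζ : ∀ p ∈ U, 0 < (ψ p).1) :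
    ContDiffOn ℝ ∞ (fun q : Param × Phase => D.rem1 ψ q.1 q.2) (U ×ˢ univ) := by
  have hm : MapsTo Prod.fst (U ×ˢ (univ : Set Phase)) U := fun q hq => hq.1
  have hη := contDiffOn_eta hψ
  have hn := contDiffOn_ofReal (contDiffOn_n (D := D) hψ)
  have hnb := contDiffOn_ofReal ((contDiffOn_n (D := D) hψ).mul (contDiffOn_sb (D := D) hψ))
  have nn : ∀ p, (D.n ψ p : ℂ) ≠ 0 := fun p => Complex.ofReal_ne_zero.2 (D.n_pos ψ p).ne'
  have nb : ∀ p, ((D.n ψ p * D.sb ψ p : ℝ) : ℂ) ≠ 0 := fun p =>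
    Complex.ofReal_ne_zero.2 (mul_pos (D.n_pos ψ p) (D.sb_pos ψ p)).ne'
  have c1 := contDiffOn_div_complex (D.a1_smooth.comp_contDiffOn hη) hn fun p _ => nn p
  have c2 := contDiffOn_div_complex (D.a2_smooth.comp_contDiffOn hη) hnb fun p _ => nb p
  have c3 := contDiffOn_div_complex ((D.a3_smooth.comp_contDiffOn hη).mul hn)
    ((D.a0_smooth.comp_contDiffOn hη).pow 2) fun p _ => pow_ne_zero 2 (D.a0_ne _)
  have c4 := contDiffOn_ofReal (contDiffOn_rootDefect (D := D) hψ hζ)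
  have c5 : ContDiffOn ℝ ∞ (fun p => ((ψ p).1 : ℂ) ^ 2 * √(D.sb ψ p) * D.r (eta ψ p) * D.n ψ p) U :=
    ((((contDiffOn_ofReal hψ.fst).pow 2).mul (contDiffOn_ofReal (contDiffOn_sqrt_sb hψ))).mul
      (contDiffOn_r hψ)).mul hn
  have n5 : ∀ p ∈ U, ((ψ p).1 : ℂ) ^ 2 * √(D.sb ψ p) * D.r (eta ψ p) * D.n ψ p ≠ 0 := fun p hp =>
    mul_ne_zero (mul_ne_zero (mul_ne_zero
      (pow_ne_zero 2 (Complex.ofReal_ne_zero.2 (hζ p hp).ne'))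
      (Complex.ofReal_ne_zero.2 (Real.sqrt_pos.2 (D.sb_pos ψ p)).ne')) (D.r_ne _)) (nn p)
  have hu : ContDiffOn ℝ ∞ (fun q : Param × Phase => q.2.1) (U ×ˢ univ) := by fun_prop
  have hz : ContDiffOn ℝ ∞ (fun q : Param × Phase => (q.2.2 : ℂ)) (U ×ˢ univ) :=
    contDiffOn_ofReal (by fun_prop)
  have hv : ContDiffOn ℝ ∞ (fun q : Param × Phase => (starRingEnd ℂ) q.2.1) (U ×ˢ univ) :=
    Complex.conjCLE.contDiff.comp_contDiffOn hu
  exact ((c4.comp contDiffOn_fst hm).mul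
    (((((c1.comp contDiffOn_fst hm).mul (hu.pow 2)).mul hv).add
      (((c2.comp contDiffOn_fst hm).mul (hz.pow 2)).mul hu)).add
      ((c3.comp contDiffOn_fst hm).mul (hv.pow 3)))).add
    (contDiffOn_div_complex (D.Tu_smooth.comp_contDiffOn (contDiffOn_scaled hψ))
      (c5.comp contDiffOn_fst hm) fun q hq => n5 q.1 hq.1)

lemma contDiffOn_rem2 (hψ : ContDiffOn ℝ ∞ ψ U) (hζ : ∀ p ∈ U, 0 < (ψ p).1) :
    ContDiffOn ℝ ∞ (fun q : Param × Phase => D.rem2 ψ q.1 q.2) (U ×ˢ univ) := by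
  have hm : MapsTo Prod.fst (U ×ˢ (univ : Set Phase)) U := fun q hq => hq.1
  have hη := contDiffOn_eta hψ
  have hn := contDiffOn_n (D := D) hψ
  have nn : ∀ p, D.n ψ p ≠ 0 := fun p => (D.n_pos ψ p).ne'
  have c1 := ((contDiffOn_defect (D := D) hψ hζ).div (hψ.fst.mul hn)
    fun p hp => mul_ne_zero (hζ p hp).ne' (nn p)).neg
  have c2 := (contDiffOn_rootDefect (D := D) hψ hζ).mul
    ((D.b2_smooth.comp_contDiffOn hη).div hn fun p _ => nn p)
  have c3 := (hψ.fst.pow 2).mul hn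
  have hz : ContDiffOn ℝ ∞ (fun q : Param × Phase => q.2.2) (U ×ˢ univ) := by fun_prop
  have hN : ContDiffOn ℝ ∞ (fun q : Param × Phase => ‖q.2.1‖ ^ 2) (U ×ˢ univ) :=
    ((contDiff_norm_sq ℝ).comp (by fun_prop)).contDiffOn
  exact (((c1.comp contDiffOn_fst hm).mul (hz.pow 3)).add
    (((c2.comp contDiffOn_fst hm).mul hz).mul hN)).add
    ((D.Tz_smooth.comp_contDiffOn (contDiffOn_scaled hψ)).div (c3.comp contDiffOn_fst hm)
      fun q hq => mul_ne_zero (pow_ne_zero 2 (hζ q.1 hq.1).ne') (nn _))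

end Smooth

/-- The rescaled family of a general family. -/
noncomputable def rescaled {ρ : ℝ} (hρ : 0 < ρ) (hψ : ContDiffOn ℝ ∞ ψ (Metric.ball p0 ρ))
    (hζ : ∀ p ∈ Metric.ball p0 ρ, 0 < (ψ p).1) : RescaledFamily where
  c := D.c.comp (eta ψ)
  e := D.corr ψ
  R1 := D.rem1 ψ
  R2 := D.rem2 ψ
  r := ρ
  r_pos := hρ
  c_smooth :=
    ⟨D.a0_smooth.comp_contDiffOn (contDiffOn_eta hψ),
      D.a1_smooth.comp_contDiffOn (contDiffOn_eta hψ),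
      D.a2_smooth.comp_contDiffOn (contDiffOn_eta hψ),
      D.a3_smooth.comp_contDiffOn (contDiffOn_eta hψ),
      D.b0_smooth.comp_contDiffOn (contDiffOn_eta hψ),
      D.b1_smooth.comp_contDiffOn (contDiffOn_eta hψ),
      D.b2_smooth.comp_contDiffOn (contDiffOn_eta hψ)⟩
  e_smooth := contDiffOn_corr hψ hζ
  R1_smooth := contDiffOn_rem1 hψ hζ
  R2_smooth := contDiffOn_rem2 hψ hζ
  R1_symm := fun p _ => D.rem1_symm ψ p
  R2_symm := fun p _ => D.rem2_symm ψ p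
  R1_order := fun p _ => D.rem1_order ψ p
  R2_order := fun p _ => D.rem2_order ψ p
  R2_equilibrium := fun p hp => D.rem2_equilibrium ψ (hζ p hp).ne'

/-- The scaling conjugates the original family with the rescaled family. -/
lemma field_scale {ρ : ℝ} (hρ : 0 < ρ) (hψ : ContDiffOn ℝ ∞ ψ (Metric.ball p0 ρ))
    (hζ : ∀ p ∈ Metric.ball p0 ρ, 0 < (ψ p).1) {p : Param} (hp : p ∈ Metric.ball p0 ρ)
    (hπ : D.π (eta ψ p) = eta ψ p)
    (h1 : (ψ p).1 + D.c.b1 (eta ψ p) * (ψ p).1 ^ 3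
        + p.2.2 * D.Tz (eta ψ p, p.2.2, (0, (ψ p).1)) = 0)
    (h2 : (ψ p).2 = (ψ p).1 * D.n ψ p) (w : Phase) :
    G.field (eta ψ p) (scale (p.2.2 * D.planarScale ψ p) (p.2.2 * (ψ p).1) w) =
      (p.2.2 * (ψ p).2) • scale (p.2.2 * D.planarScale ψ p) (p.2.2 * (ψ p).1)
        ((D.rescaled ψ hρ hψ hζ).field p w) := by
  have hζp := hζ p hp
  have hn := D.n_pos ψ p
  have hsb := D.sb_pos ψ p
  have hr := D.r_ne (eta ψ p)
  obtain ⟨u, z⟩ := w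
  have hs : scale (p.2.2 * D.planarScale ψ p) (p.2.2 * (ψ p).1) (u, z)
      = p.2.2 • scale (D.planarScale ψ p) (ψ p).1 (u, z) := by
    simp only [scale, Prod.smul_mk, smul_eq_mul, Complex.real_smul, mul_assoc]
  have eu := D.Ru_eq (eta ψ p) p.2.2 (scale (D.planarScale ψ p) (ψ p).1 (u, z))
  have ez := D.Rz_eq (eta ψ p) p.2.2 (scale (D.planarScale ψ p) (ψ p).1 (u, z))
  rw [hπ, ← hs] at eu ez
  -- the equation of the equilibrium `(0, s ζ)`, read as `|b₁| ζ ^ 2 = 1 + s R₀`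
  have hb : D.c.b1 (eta ψ p) * (ψ p).1 ^ 2 = -(1 + p.2.2 * D.defect ψ p) := by
    rw [defect]
    field_simp
    linear_combination h1
  have hsq : D.sb ψ p ^ 2 = -D.c.b1 (eta ψ p) := by
    rw [sb, Real.sq_sqrt (abs_nonneg _)]
    exact abs_of_neg (D.b1_neg _)
  have hQ : p.2.2 * D.rootDefect ψ p = D.sb ψ p * (ψ p).1 - 1 := by
    have h : 1 + D.sb ψ p * (ψ p).1 ≠ 0 := by positivity
    rw [rootDefect, mul_div_assoc', div_eq_iff h]
    linear_combination hb - (ψ p).1 ^ 2 * hsq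
  set κ := √(D.sb ψ p) with hκ
  have hκ0 : 0 < κ := Real.sqrt_pos.2 hsb
  have hκ2 : D.sb ψ p = κ ^ 2 := (Real.sq_sqrt hsb.le).symm
  have hconj : (starRingEnd ℂ) (D.r (eta ψ p)) = (D.r (eta ψ p))⁻¹ :=
    (Complex.inv_eq_conj (D.r_norm _)).symm
  have ha0 : D.c.a0 (eta ψ p) = (D.n ψ p : ℂ) * D.r (eta ψ p) ^ 2 := D.r_sq _
  have hps : D.planarScale ψ p = (ψ p).1 * κ * D.r (eta ψ p) := rfl
  have hcu : (starRingEnd ℂ) (p.2.2 * D.planarScale ψ p * u)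
      = p.2.2 * (ψ p).1 * κ * (D.r (eta ψ p))⁻¹ * (starRingEnd ℂ) u := by
    simp only [hps, map_mul, Complex.conj_ofReal, hconj, mul_assoc]
  have hG : ∀ {α : Type} (f : Param → α), f (D.π (eta ψ p)) = f (eta ψ p) := fun f => by rw [hπ]
  have g0 : D.c.a0 (eta ψ p) = G.c.a0 (eta ψ p) := hG _
  have g1 : D.c.a1 (eta ψ p) = G.c.a1 (eta ψ p) := hG _
  have g2 : D.c.a2 (eta ψ p) = G.c.a2 (eta ψ p) := hG _
  have g3 : D.c.a3 (eta ψ p) = G.c.a3 (eta ψ p) := hG _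
  have g4 : D.c.b0 (eta ψ p) = G.c.b0 (eta ψ p) := hG _
  have g5 : D.c.b1 (eta ψ p) = G.c.b1 (eta ψ p) := hG _
  have g6 : D.c.b2 (eta ψ p) = G.c.b2 (eta ψ p) := hG _
  refine Prod.ext ?_ ?_
  · have hcz : ((p.2.2 : ℂ)) * D.rootDefect ψ p = (κ : ℂ) ^ 2 * (ψ p).1 - 1 := by
      rw [hκ2] at hQ; exact_mod_cast hQ
    have hL := planar_scaling (s := p.2.2) (ζ := (ψ p).1) (c := κ) (n := D.n ψ p)
      (r := D.r (eta ψ p)) (u := u) (v := (starRingEnd ℂ) u) (z := z) (a₁ := D.c.a1 (eta ψ p))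
      (a₂ := D.c.a2 (eta ψ p)) (a₃ := D.c.a3 (eta ψ p))
      (R := D.Tu (eta ψ p, p.2.2, scale (D.planarScale ψ p) (ψ p).1 (u, z)))
      (ρ := p.1) (om := p.2.1) (Complex.ofReal_ne_zero.2 hζp.ne')
      (Complex.ofReal_ne_zero.2 hκ0.ne') (Complex.ofReal_ne_zero.2 hn.ne') hr hcz
    have hl : (G.field (eta ψ p) (scale (p.2.2 * D.planarScale ψ p) (p.2.2 * (ψ p).1) (u, z))).1
        = (-((p.1 * (p.2.2 * (ψ p).2) : ℝ) : ℂ)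
            + Complex.I * ((p.2.1 * (p.2.2 * (ψ p).2) : ℝ) : ℂ)) * (p.2.2 * D.planarScale ψ p * u)
          + G.c.a0 (eta ψ p) * ((p.2.2 * (ψ p).1 * z : ℝ) : ℂ)
            * (starRingEnd ℂ) (p.2.2 * D.planarScale ψ p * u)
          + G.c.a1 (eta ψ p) * (p.2.2 * D.planarScale ψ p * u) ^ 2
            * (starRingEnd ℂ) (p.2.2 * D.planarScale ψ p * u)
          + G.c.a2 (eta ψ p) * ((p.2.2 * (ψ p).1 * z : ℝ) : ℂ) ^ 2
            * (p.2.2 * D.planarScale ψ p * u)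
          + G.c.a3 (eta ψ p) * (starRingEnd ℂ) (p.2.2 * D.planarScale ψ p * u) ^ 3
          + G.Ru (eta ψ p) (scale (p.2.2 * D.planarScale ψ p) (p.2.2 * (ψ p).1) (u, z)) := rfl
    have hr' : ((p.2.2 * (ψ p).2) • scale (p.2.2 * D.planarScale ψ p) (p.2.2 * (ψ p).1)
          ((D.rescaled ψ hρ hψ hζ).field p (u, z))).1
        = (p.2.2 * (ψ p).2) • (p.2.2 * D.planarScale ψ p
          * ((-(p.1 : ℂ) + Complex.I * (p.2.1 : ℂ)) * u + z * (starRingEnd ℂ) u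
            + p.2.2 * (D.c.a1 (eta ψ p) / D.n ψ p * u ^ 2 * (starRingEnd ℂ) u
              + D.c.a2 (eta ψ p) / (D.n ψ p * D.sb ψ p : ℝ) * z ^ 2 * u
              + D.c.a3 (eta ψ p) * D.n ψ p / D.c.a0 (eta ψ p) ^ 2 * (starRingEnd ℂ) u ^ 3
              + p.2.2 * D.rem1 ψ p (u, z)))) := rfl
    rw [hl, hr', eu, hcu, ← g0, ← g1, ← g2, ← g3, rem1, ← hκ, hps, ha0, hκ2, h2,
      Complex.real_smul]
    push_cast
    rw [hps] at hL
    simp only [Complex.real_smul] at hL ⊢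
    push_cast
    linear_combination hL
  · rw [hκ2] at hQ
    have hL := axial_scaling (z := z) (b₂ := D.c.b2 (eta ψ p)) (U := ‖u‖ ^ 2)
      (R := D.Tz (eta ψ p, p.2.2, scale (D.planarScale ψ p) (ψ p).1 (u, z)))
      hζp.ne' hκ0.ne' hn.ne' hQ hb
    have hl : (G.field (eta ψ p) (scale (p.2.2 * D.planarScale ψ p) (p.2.2 * (ψ p).1) (u, z))).2
        = p.2.2 ^ 2 * (p.2.2 * (ψ p).1 * z)
          + (G.c.b0 (eta ψ p) * (p.2.2 * D.planarScale ψ p * u) ^ 2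
            + (starRingEnd ℂ) (G.c.b0 (eta ψ p))
              * (starRingEnd ℂ) (p.2.2 * D.planarScale ψ p * u) ^ 2).re
          + G.c.b1 (eta ψ p) * (p.2.2 * (ψ p).1 * z) ^ 3
          + G.c.b2 (eta ψ p) * (p.2.2 * (ψ p).1 * z) * ‖p.2.2 * D.planarScale ψ p * u‖ ^ 2
          + G.Rz (eta ψ p) (scale (p.2.2 * D.planarScale ψ p) (p.2.2 * (ψ p).1) (u, z)) := rfl
    have hr' : ((p.2.2 * (ψ p).2) • scale (p.2.2 * D.planarScale ψ p) (p.2.2 * (ψ p).1)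
          ((D.rescaled ψ hρ hψ hζ).field p (u, z))).2
        = (p.2.2 * (ψ p).2) * (p.2.2 * (ψ p).1
          * ((D.c.a0 (eta ψ p) * D.c.b0 (eta ψ p) * ((D.sb ψ p / D.n ψ p ^ 2 : ℝ) : ℂ) * u ^ 2
              + (starRingEnd ℂ) (D.c.a0 (eta ψ p) * D.c.b0 (eta ψ p)
                * ((D.sb ψ p / D.n ψ p ^ 2 : ℝ) : ℂ)) * (starRingEnd ℂ) u ^ 2).re
            + p.2.2 * ((D.sb ψ p / D.n ψ p + p.2.2 * D.corr ψ p) * (z - z ^ 3)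
              + D.c.b2 (eta ψ p) / D.n ψ p * z * ‖u‖ ^ 2 + p.2.2 * D.rem2 ψ p (u, z)))) := rfl
    have hN : ‖p.2.2 * D.planarScale ψ p * u‖ ^ 2 = (p.2.2 * (ψ p).1 * κ) ^ 2 * ‖u‖ ^ 2 := by
      rw [hps, norm_mul, norm_mul, norm_mul, norm_mul, D.r_norm]
      simp only [Complex.norm_real, Real.norm_eq_abs, mul_pow, sq_abs, mul_one]
      ring
    have hcr : (starRingEnd ℂ) (D.c.a0 (eta ψ p)) = (D.n ψ p : ℂ) * (D.r (eta ψ p))⁻¹ ^ 2 := by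
      rw [ha0, map_mul, map_pow, hconj, Complex.conj_ofReal]
    have hX : D.c.b0 (eta ψ p) * (p.2.2 * D.planarScale ψ p * u) ^ 2
          + (starRingEnd ℂ) (D.c.b0 (eta ψ p))
            * (starRingEnd ℂ) (p.2.2 * D.planarScale ψ p * u) ^ 2
        = ((p.2.2 * ((ψ p).1 * D.n ψ p) * (p.2.2 * (ψ p).1) : ℝ) : ℂ)
          * (D.c.a0 (eta ψ p) * D.c.b0 (eta ψ p) * ((D.sb ψ p / D.n ψ p ^ 2 : ℝ) : ℂ) * u ^ 2
              + (starRingEnd ℂ) (D.c.a0 (eta ψ p) * D.c.b0 (eta ψ p)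
                * ((D.sb ψ p / D.n ψ p ^ 2 : ℝ) : ℂ)) * (starRingEnd ℂ) u ^ 2) := by
      have hn' : (D.n ψ p : ℂ) ≠ 0 := Complex.ofReal_ne_zero.2 hn.ne'
      rw [hcu, hps, map_mul, map_mul, hcr, ha0, Complex.conj_ofReal, hκ2]
      push_cast
      field_simp
    rw [hl, hr', ez, hN, ← g4, ← g5, ← g6, hX, Complex.re_ofReal_mul, rem2, corr, hκ2, h2]
    simp only [smul_eq_mul] at hL ⊢
    linear_combination hL

end ScaledData

end Z4

namespace Z4

/-! ### Bifurcation surface of the original family -/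

lemma tendsto_graph {H : ℝ × ℝ → ℝ} (hH0 : H (0, 0) = 1 / 2) (hH : ContinuousAt H (0, 0)) :
    Tendsto (fun q : ℝ × ℝ => ((H q, q) : Param)) (𝓝 (0, 0)) (𝓝 p0) := by
  have h := hH.tendsto.prodMk_nhds (continuousAt_id (x := ((0, 0) : ℝ × ℝ))).tendsto
  rw [hH0] at h
  exact h

/-- The bifurcation surface of the original family in the rescaled parameters, together with the
scales `ψ = (ζ, T)` of the phase space and of time. -/
lemma GeneralFamily.exists_surface_rescaled (G : GeneralFamily) (hb : G.c.b1 0 < 0)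
    (hA : (G.c.a0 0 * G.c.b0 0).re < 0) :
    ∃ (H : ℝ × ℝ → ℝ) (ψ : Param → ℝ × ℝ) (C : ℝ), H (0, 0) = 1 / 2 ∧ 0 ≤ C ∧ 0 < (ψ p0).2 ∧
      (∀ᶠ q in 𝓝 ((0, 0) : ℝ × ℝ), ContDiffAt ℝ ∞ H q) ∧
      (∀ᶠ p in 𝓝 p0, ContDiffAt ℝ ∞ ψ p) ∧
      (∀ᶠ q in 𝓝 ((0, 0) : ℝ × ℝ), |H q - (1 / 2 + G.c.k1 0 * q.2 + G.c.k2 0 * q.1)|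
        ≤ C * (q.2 ^ 2 + q.1 ^ 2)) ∧
      (∀ᶠ p in 𝓝 p0, |(ψ p).1 - (√|G.c.b1 0|)⁻¹| ≤ C * |p.2.2|) ∧
      (∀ᶠ p in 𝓝 p0, (ψ p).2 = (ψ p).1 * ‖G.c.a0 (originalParam p (ψ p).2)‖) ∧
      (∀ᶠ q in 𝓝 ((0, 0) : ℝ × ℝ), 0 < q.2 →
        FourWingedConnection (G.field (originalParam (H q, q) (ψ (H q, q)).2))
          (q.2 * (ψ (H q, q)).1)) := by
  have ha : G.c.a0 0 ≠ 0 := fun h => by simp [h] at hA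
  obtain ⟨D⟩ := G.nonempty_scaledData hb ha
  have hπ0 : D.π 0 = 0 := D.π_eq.self_of_nhds
  have hb0 : D.c.b1 0 = G.c.b1 0 := congrArg G.c.b1 hπ0
  obtain ⟨ψ, hψ0, hψs, hψz, hψe⟩ := D.exists_scales
  have hψ1 : 0 < (ψ p0).1 := by rw [hψ0]; exact D.zeta₀_pos
  have hψ2 : 0 < (ψ p0).2 := by
    rw [hψ0]; exact mul_pos D.zeta₀_pos (norm_pos_iff.2 (D.a0_ne 0))
  have hψc : ContinuousAt ψ p0 := hψs.self_of_nhds.continuousAt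
  have he0 : ScaledData.eta ψ p0 = 0 := originalParam_of_zero rfl _
  have hec : Tendsto (ScaledData.eta ψ) (𝓝 p0) (𝓝 0) := by
    have h := contDiff_originalParam.continuous.continuousAt.tendsto.comp
      (continuousAt_id.tendsto.prodMk_nhds hψc.snd.tendsto)
    have e : originalParam p0 (ψ p0).2 = 0 := he0
    simp only [id, e] at h
    exact h
  have hπe : ∀ᶠ p in 𝓝 p0, D.π (ScaledData.eta ψ p) = ScaledData.eta ψ p :=
    hec.eventually D.π_eq
  obtain ⟨ρ, hρ, hball⟩ := Metric.eventually_nhds_iff_ball.1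
    (hψs.and (hψc.fst.tendsto.eventually (lt_mem_nhds hψ1)))
  have hψU : ContDiffOn ℝ ∞ ψ (Metric.ball p0 ρ) := fun p hp => (hball p hp).1.contDiffWithinAt
  have hζU : ∀ p ∈ Metric.ball p0 ρ, 0 < (ψ p).1 := fun p hp => (hball p hp).2
  set F := D.rescaled ψ hρ hψU hζU with hF
  have hpe : D.π (ScaledData.eta ψ p0) = 0 := by rw [he0, hπ0]
  have hFb : F.c.b1 p0 < 0 := D.b1_neg _
  have eA : F.c.A p0 = G.c.A 0 := congrArg G.c.A hpe
  have e1 : F.c.k1 p0 = G.c.k1 0 := congrArg G.c.k1 hpe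
  have e2 : F.c.k2 p0 = G.c.k2 0 := congrArg G.c.k2 hpe
  have hFA : F.c.A p0 < 0 := by
    rw [eA, Coeffs.A, Coeffs.AB, Complex.re_mul_ofReal]
    exact mul_neg_of_neg_of_pos hA (div_pos (Real.sqrt_pos.2 (abs_pos.2 hb.ne))
      (pow_pos (norm_pos_iff.2 ha) 2))
  obtain ⟨H, C, hH0, hC, hHs, hHe, hHc, -⟩ := F.exists_bifurcation_surface hFb hFA
  rw [e1, e2] at hHe
  have hgr := tendsto_graph hH0 hHs.self_of_nhds.continuousAt
  obtain ⟨L, t, ht, hL⟩ := (hψs.self_of_nhds.of_le (by simp : (1 : ℕ∞ω) ≤ ∞)).exists_lipschitzOnWith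
  have hproj : Tendsto (fun p : Param => ((p.1, p.2.1, 0) : Param)) (𝓝 p0) (𝓝 p0) :=
    (by fun_prop : Continuous fun p : Param => ((p.1, p.2.1, 0) : Param)).tendsto p0
  refine ⟨H, ψ, max C L, hH0, le_max_of_le_left hC, hψ2, hHs, hψs, ?_, ?_, ?_, ?_⟩
  · filter_upwards [hHe] with q hq
    exact hq.trans (mul_le_mul_of_nonneg_right (le_max_left _ _) (by positivity))
  · filter_upwards [ht, hproj.eventually ht, hproj.eventually hψz] with p h1 h2 h3
    have h := hL.dist_le_mul p h1 _ h2
    -- `ψ` is Lipschitz and constant on `s = 0`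
    rw [h3 rfl] at h
    have h4 : dist p (p.1, p.2.1, 0) = |p.2.2| := by
      simp [Prod.dist_eq]
    have h5 : dist (ψ p).1 D.zeta₀ ≤ dist (ψ p) (D.zeta₀, D.zeta₀ * ‖D.c.a0 0‖) := le_max_left _ _
    have h6 : (√|G.c.b1 0|)⁻¹ = D.zeta₀ := by rw [ScaledData.zeta₀, hb0]
    rw [h6, ← Real.dist_eq]
    rw [h4] at h
    exact (h5.trans h).trans (mul_le_mul_of_nonneg_right (le_max_right _ _) (abs_nonneg _))
  · filter_upwards [hψe, hπe] with p h1 h2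
    have h3 : D.c.a0 (originalParam p (ψ p).2) = G.c.a0 (originalParam p (ψ p).2) :=
      congrArg G.c.a0 h2
    rw [← h3]
    exact h1.2
  · filter_upwards [hHc, hgr.eventually hψe, hgr.eventually hπe,
      hgr.eventually (Metric.ball_mem_nhds p0 hρ)] with q h1 h2 h3 h4 hq
    have hζ := hζU _ h4
    have hT : 0 < (ψ (H q, q)).2 := by
      rw [h2.2]; exact mul_pos hζ (norm_pos_iff.2 (D.a0_ne _))
    have hps : D.planarScale ψ (H q, q) ≠ 0 :=
      mul_ne_zero (mul_ne_zero (Complex.ofReal_ne_zero.2 hζ.ne')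
        (Complex.ofReal_ne_zero.2 (Real.sqrt_pos.2 (D.sb_pos ψ _)).ne')) (D.r_ne _)
    have h := FourWingedConnection.scale (a := q.2 * D.planarScale ψ (H q, q))
      (mul_ne_zero (Complex.ofReal_ne_zero.2 hq.ne') hps) (mul_pos hq hζ) (mul_pos hq hT)
      (D.field_scale ψ hρ hψU hζU h4 h3 h2.1 h2.2) (h1 hq)
    rwa [mul_one] at h

/-- The frequency of the rescaled family as a smooth function `Ω` of `(b, s)`, from
`Ω T (Ω, s) = b`. -/
lemma exists_smooth_frequency {T : ℝ × ℝ → ℝ} (hT : ∀ᶠ q in 𝓝 ((0, 0) : ℝ × ℝ), ContDiffAt ℝ ∞ T q)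
    (hT0 : 0 < T (0, 0)) :
    ∃ Ω : ℝ × ℝ → ℝ, Ω (0, 0) = 0 ∧ (∀ᶠ q in 𝓝 ((0, 0) : ℝ × ℝ), ContDiffAt ℝ ∞ Ω q) ∧
      ∀ᶠ q in 𝓝 ((0, 0) : ℝ × ℝ), Ω q * T (Ω q, q.2) = q.1 := by
  have hσ : Continuous fun v : (ℝ × ℝ) × ℝ => (v.2, v.1.2) := by fun_prop
  set f : (ℝ × ℝ) × ℝ → ℝ := fun v => v.2 * T (v.2, v.1.2) - v.1.1 with hf
  have hfs : ∀ᶠ v in 𝓝 (((0, 0), 0) : (ℝ × ℝ) × ℝ), ContDiffAt ℝ ∞ f v := by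
    filter_upwards [(hσ.tendsto ((0, 0), 0)).eventually hT] with v hv
    have h : ContDiffAt ℝ ∞ (fun v : (ℝ × ℝ) × ℝ => T (v.2, v.1.2)) v :=
      ContDiffAt.comp (g := T) (f := fun v : (ℝ × ℝ) × ℝ => (v.2, v.1.2)) v hv (by fun_prop)
    fun_prop
  have hder : HasFDerivAt (fun x : ℝ => f ((0, 0), x))
      (T (0, 0) • ContinuousLinearMap.id ℝ ℝ) 0 := by
    have hd : DifferentiableAt ℝ (fun x : ℝ => T (x, (0 : ℝ))) 0 :=
      DifferentiableAt.comp (g := T) (f := fun x : ℝ => (x, (0 : ℝ))) 0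
        (hT.self_of_nhds.differentiableAt (by simp)) (by fun_prop)
    have h := ((hasFDerivAt_id (𝕜 := ℝ) (0 : ℝ)).mul hd.hasFDerivAt).sub_const (0 : ℝ)
    refine h.congr_fderiv ?_
    ext
    simp
  have hpart : fderiv ℝ f ((0, 0), 0) ∘L .inr ℝ (ℝ × ℝ) ℝ = T (0, 0) • ContinuousLinearMap.id ℝ ℝ :=
    ((hfs.self_of_nhds.differentiableAt (by simp)).hasFDerivAt.comp (0 : ℝ)
      (hasFDerivAt_prodMk_right ((0, 0) : ℝ × ℝ) (0 : ℝ))).unique hder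
  obtain ⟨Ω, hΩ0, hΩs, hΩ⟩ := exists_smooth_implicit (f := f) (q₀ := ((0, 0) : ℝ × ℝ))
    (x₀ := (0 : ℝ)) hfs (by simp [hf]) (by
      rw [hpart]
      refine ⟨ContinuousLinearEquiv.equivOfInverse (T (0, 0) • ContinuousLinearMap.id ℝ ℝ)
        ((T (0, 0))⁻¹ • ContinuousLinearMap.id ℝ ℝ) (fun x => ?_) (fun x => ?_), rfl⟩
      · simp [hT0.ne']
      · simp [hT0.ne'])
  refine ⟨Ω, hΩ0, hΩs, ?_⟩
  have hc : Tendsto (fun q => (q, Ω q)) (𝓝 (0, 0)) (𝓝 (((0, 0), 0) : (ℝ × ℝ) × ℝ)) := by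
    have h := continuousAt_id.tendsto.prodMk_nhds hΩs.self_of_nhds.continuousAt.tendsto
    simpa only [hΩ0, id] using h
  filter_upwards [hc.eventually hΩ] with q hq
  exact sub_eq_zero.1 (hq.2 rfl)

/-- The bifurcation surface of the original family in the parameters `b = β / √μ` and `s = √μ`:
the connection exists at `(γ, β, μ) = (s g, s b, s ^ 2)`, between the equilibria `(0, ± s ζ)` and
`0`. -/
lemma GeneralFamily.exists_surface_polar (G : GeneralFamily) (hb : G.c.b1 0 < 0)
    (hA : (G.c.a0 0 * G.c.b0 0).re < 0) :
    ∃ (g ζ : ℝ × ℝ → ℝ) (C : ℝ), 0 ≤ C ∧ ∀ᶠ q in 𝓝 ((0, 0) : ℝ × ℝ),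
      ContDiffAt ℝ ∞ g q ∧ |g q| ≤ C ∧ |ζ q - (√|G.c.b1 0|)⁻¹| ≤ C * |q.2| ∧ (0 < q.2 →
      FourWingedConnection (G.field (q.2 * g q, q.2 * q.1, q.2 ^ 2)) (q.2 * ζ q) ∧
      (let T : ℝ := ζ q * ‖G.c.a0 (q.2 * g q, q.2 * q.1, q.2 ^ 2)‖
       |g q / T - (1 / 2 + G.c.k1 0 * q.2 + G.c.k2 0 * (q.1 / T))|
        ≤ C * (q.2 ^ 2 + (q.1 / T) ^ 2))) := by
  obtain ⟨H, ψ, C, hH0, hC, hψ2, hHs, hψs, hHe, hψe, hT, hHc⟩ := G.exists_surface_rescaled hb hA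
  have hgr := tendsto_graph hH0 hHs.self_of_nhds.continuousAt
  have hψH : ∀ᶠ q in 𝓝 ((0, 0) : ℝ × ℝ), ContDiffAt ℝ ∞ (fun q => ψ (H q, q)) q := by
    filter_upwards [hHs, hgr.eventually hψs] with q h1 h2
    exact ContDiffAt.comp (g := ψ) (f := fun q : ℝ × ℝ => ((H q, q) : Param)) q h2
      (h1.prodMk contDiffAt_id)
  obtain ⟨Ω, hΩ0, hΩs, hΩ⟩ := exists_smooth_frequency (T := fun q => (ψ (H q, q)).2)
    (hψH.mono fun q h => h.snd) (by rw [hH0]; exact hψ2)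
  have hk : Tendsto (fun q : ℝ × ℝ => (Ω q, q.2)) (𝓝 (0, 0)) (𝓝 (0, 0)) := by
    have h := hΩs.self_of_nhds.continuousAt.tendsto.prodMk_nhds
      (continuous_snd.tendsto ((0, 0) : ℝ × ℝ))
    simpa only [hΩ0] using h
  have hp := hgr.comp hk
  set g : ℝ × ℝ → ℝ := fun q => H (Ω q, q.2) * (ψ (H (Ω q, q.2), (Ω q, q.2))).2 with hg
  have hgs : ∀ᶠ q in 𝓝 ((0, 0) : ℝ × ℝ), ContDiffAt ℝ ∞ g q := by
    filter_upwards [hΩs, hk.eventually hHs, hk.eventually hψH] with q h1 h2 h3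
    have hk' : ContDiffAt ℝ ∞ (fun q : ℝ × ℝ => (Ω q, q.2)) q := h1.prodMk contDiffAt_snd
    exact (ContDiffAt.comp (g := H) (f := fun q : ℝ × ℝ => (Ω q, q.2)) q h2 hk').mul
      (ContDiffAt.comp (g := fun q => ψ (H q, q)) (f := fun q : ℝ × ℝ => (Ω q, q.2)) q h3 hk').snd
  have hgb : ∀ᶠ q in 𝓝 ((0, 0) : ℝ × ℝ), |g q| < |g (0, 0)| + 1 :=
    hgs.self_of_nhds.continuousAt.abs.tendsto.eventually (gt_mem_nhds (lt_add_one _))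
  have hTp : ∀ᶠ p in 𝓝 p0, 0 < (ψ p).2 :=
    hψs.self_of_nhds.continuousAt.snd.tendsto.eventually (lt_mem_nhds hψ2)
  refine ⟨g, fun q => (ψ (H (Ω q, q.2), (Ω q, q.2))).1, max C (|g (0, 0)| + 1),
    le_max_of_le_left hC, ?_⟩
  filter_upwards [hgs, hgb, hp.eventually hψe, hp.eventually hT, hp.eventually hTp,
    hk.eventually hHe, hk.eventually hHc, hΩ] with q h1 h2 h3 h4 h5 h6 h7 h8
  simp only [Function.comp_apply] at h3 h4 h5
  have hη : originalParam (H (Ω q, q.2), (Ω q, q.2)) (ψ (H (Ω q, q.2), (Ω q, q.2))).2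
      = (q.2 * g q, q.2 * q.1, q.2 ^ 2) := by
    refine Prod.ext ?_ (Prod.ext ?_ rfl)
    · change H (Ω q, q.2) * (q.2 * _) = q.2 * (H (Ω q, q.2) * _)
      ring
    · change Ω q * (q.2 * _) = q.2 * q.1
      rw [← h8]; ring
  rw [hη] at h4 h7
  refine ⟨h1, h2.le.trans (le_max_right _ _),
    h3.trans (mul_le_mul_of_nonneg_right (le_max_left _ _) (abs_nonneg _)), fun hq => ⟨h7 hq, ?_⟩⟩
  simp only
  rw [← h4]
  have e1 : g q / (ψ (H (Ω q, q.2), (Ω q, q.2))).2 = H (Ω q, q.2) :=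
    mul_div_cancel_right₀ _ h5.ne'
  have e2 : q.1 / (ψ (H (Ω q, q.2), (Ω q, q.2))).2 = Ω q := (eq_div_iff h5.ne').2 h8 |>.symm
  rw [e1, e2]
  exact h6.trans (mul_le_mul_of_nonneg_right (le_max_left _ _) (by positivity))

lemma isOpen_wedge (δ : ℝ) : IsOpen (wedge δ) :=
  (isOpen_lt continuous_const continuous_snd).inter
    ((isOpen_lt continuous_snd continuous_const).inter
      (isOpen_lt continuous_fst.abs (continuous_const.mul continuous_snd.sqrt)))

/-- The bifurcation surface of the original family on a wedge of parameters. -/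
theorem GeneralFamily.exists_surface_on_wedge (G : GeneralFamily) (hb : G.c.b1 0 < 0)
    (hA : (G.c.a0 0 * G.c.b0 0).re < 0) :
    ∃ (δ C : ℝ) (h ζ : ℝ × ℝ → ℝ), 0 < δ ∧
      h (0, 0) = 0 ∧
      ContDiffOn ℝ ∞ h (wedge δ) ∧
      ContinuousOn h (insert (0, 0) (wedge δ)) ∧
      ∀ β μ : ℝ, (β, μ) ∈ wedge δ →
        FourWingedConnection (G.field (h (β, μ), β, μ)) (ζ (β, μ)) ∧
        |ζ (β, μ) - √(μ / |G.c.b1 0|)| ≤ C * μ ∧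
        (let T : ℝ := ζ (β, μ) * ‖G.c.a0 (h (β, μ), β, μ)‖
         |h (β, μ) / T - (1 / 2 + G.c.k1 0 * √μ + G.c.k2 0 * (β / T))|
           ≤ C * (μ + (β / T) ^ 2)) := by
  obtain ⟨g, ζ, C, hC, hev⟩ := G.exists_surface_polar hb hA
  obtain ⟨ε, hε, hball⟩ := Metric.eventually_nhds_iff_ball.1 hev
  set σ : ℝ × ℝ → ℝ × ℝ := fun q => (q.1 / √q.2, √q.2) with hσ
  -- `μ < ε ^ 2` gives `√μ < ε`
  have hmem : ∀ q ∈ wedge (min ε (ε ^ 2)), 0 < √q.2 ∧ σ q ∈ Metric.ball ((0, 0) : ℝ × ℝ) ε := by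
    rintro q ⟨h1, h2, h3⟩
    have hs := Real.sqrt_pos.2 h1
    refine ⟨hs, ?_⟩
    rw [Metric.mem_ball, Prod.dist_eq, max_lt_iff, Real.dist_0_eq_abs, Real.dist_0_eq_abs]
    refine ⟨?_, ?_⟩
    · rw [hσ, abs_div, abs_of_pos hs, div_lt_iff₀ hs]
      exact h3.trans_le (mul_le_mul_of_nonneg_right (min_le_left _ _) hs.le)
    · rw [hσ, abs_of_pos hs]
      exact (Real.sqrt_lt' hε).2 (h2.trans_le (min_le_right _ _))
  set h : ℝ × ℝ → ℝ := fun q => √q.2 * g (σ q) with hh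
  have hsm : ContDiffOn ℝ ∞ h (wedge (min ε (ε ^ 2))) := by
    have hs : ContDiffOn ℝ ∞ (fun q : ℝ × ℝ => √q.2) (wedge (min ε (ε ^ 2))) :=
      contDiffOn_snd.sqrt fun q hq => hq.1.ne'
    refine hs.mul fun q hq => ?_
    exact ContDiffWithinAt.comp (g := g) (f := σ) (t := univ) q
      (hball _ (hmem q hq).2).1.contDiffWithinAt
      (((contDiffOn_fst.div hs fun q hq => (hmem q hq).1.ne').prodMk hs) q hq) (mapsTo_univ _ _)
  refine ⟨min ε (ε ^ 2), C, h, fun q => √q.2 * ζ (σ q), lt_min hε (pow_pos hε 2), by simp [hh], hsm,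
    ?_, fun β μ hq => ?_⟩
  · rintro q (rfl | hq)
    · -- at the origin, `h = O(√μ)`
      have h0 : h (0, 0) = 0 := by simp [hh]
      rw [ContinuousWithinAt, h0]
      have ht : Tendsto (fun q : ℝ × ℝ => C * √q.2)
          (𝓝[insert (0, 0) (wedge (min ε (ε ^ 2)))] (0, 0)) (𝓝 0) := by
        have h1 := (by fun_prop : Continuous fun q : ℝ × ℝ => C * √q.2).tendsto ((0, 0) : ℝ × ℝ)
        simp only [Real.sqrt_zero, mul_zero] at h1
        exact h1.mono_left inf_le_left
      refine squeeze_zero_norm' ?_ ht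
      filter_upwards [self_mem_nhdsWithin] with q hq
      rcases hq with rfl | hq
      · simp [h0]
      · obtain ⟨hs, hm⟩ := hmem q hq
        rw [Real.norm_eq_abs, hh, abs_mul, abs_of_pos hs, mul_comm]
        exact mul_le_mul_of_nonneg_right (hball _ hm).2.1 hs.le
    · exact (hsm.continuousOn.continuousAt ((isOpen_wedge _).mem_nhds hq)).continuousWithinAt
  · obtain ⟨hs, hm⟩ := hmem _ hq
    obtain ⟨-, -, h3, h4⟩ := hball _ hm
    obtain ⟨h4, h5⟩ := h4 hs
    have hμ : √μ ^ 2 = μ := Real.sq_sqrt hq.1.le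
    have hβ : √μ * (β / √μ) = β := mul_div_cancel₀ _ hs.ne'
    simp only [hσ, hμ, hβ] at h3 h4 h5 hs
    refine ⟨h4, ?_, ?_⟩
    · simp only [hσ]
      rw [Real.sqrt_div (show 0 ≤ μ from hq.1.le), div_eq_mul_inv (√μ) (√|G.c.b1 0|), ← mul_sub,
        abs_mul, abs_of_pos hs]
      rw [abs_of_pos hs] at h3
      calc √μ * |ζ (β / √μ, √μ) - (√|G.c.b1 0|)⁻¹| ≤ √μ * (C * √μ) :=
            mul_le_mul_of_nonneg_left h3 hs.le
        _ = C * √μ ^ 2 := by ring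
        _ = C * μ := by rw [hμ]
    · simp only [hh, hσ]
      set N := ‖G.c.a0 (√μ * g (β / √μ, √μ), β, μ)‖
      have e1 : √μ * g (β / √μ, √μ) / (√μ * ζ (β / √μ, √μ) * N)
          = g (β / √μ, √μ) / (ζ (β / √μ, √μ) * N) := by
        rw [mul_assoc, mul_div_mul_left _ _ hs.ne']
      have e2 : β / (√μ * ζ (β / √μ, √μ) * N) = β / √μ / (ζ (β / √μ, √μ) * N) := by
        rw [mul_assoc, div_div]
      rw [e1, e2]
      exact h5

end Z4

theorem theorem5 :
    (∀ F : Z4.RescaledFamily, F.c.b1 Z4.p0 < 0 → F.c.A Z4.p0 < 0 →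
      ∃ (ε δ C : ℝ) (h : ℝ × ℝ → ℝ), 0 < ε ∧ 0 < δ ∧
        ContDiffOn ℝ ∞ h (Ioo (-δ) δ ×ˢ Ico 0 δ) ∧
        (∀ om s : ℝ, |om| < δ → 0 ≤ s → s < δ →
          |h (om, s) - 1 / 2| < ε ∧
          |h (om, s) - (1 / 2 + F.c.k1 Z4.p0 * s + F.c.k2 Z4.p0 * om)| ≤ C * (s ^ 2 + om ^ 2)) ∧
        (∀ om s : ℝ, |om| < δ → 0 < s → s < δ →
          Z4.FourWingedConnection (F.field (h (om, s), om, s)) 1) ∧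
        Z4.SplitsWithNonzeroVelocity F.field
          ((1 / (2 * √(2 * |F.c.A Z4.p0|)) : ℝ) : ℂ) ε δ h) ∧
    (∀ G : Z4.GeneralFamily, G.c.b1 0 < 0 → (G.c.a0 0 * G.c.b0 0).re < 0 →
      ∃ (δ C : ℝ) (h ζ : ℝ × ℝ → ℝ), 0 < δ ∧
        h (0, 0) = 0 ∧
        ContDiffOn ℝ ∞ h (Z4.wedge δ) ∧
        ContinuousOn h (insert (0, 0) (Z4.wedge δ)) ∧
        ∀ β μ : ℝ, (β, μ) ∈ Z4.wedge δ →
          Z4.FourWingedConnection (G.field (h (β, μ), β, μ)) (ζ (β, μ)) ∧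
          |ζ (β, μ) - √(μ / |G.c.b1 0|)| ≤ C * μ ∧
          (let T : ℝ := ζ (β, μ) * ‖G.c.a0 (h (β, μ), β, μ)‖
           |h (β, μ) / T - (1 / 2 + G.c.k1 0 * √μ + G.c.k2 0 * (β / T))|
             ≤ C * (μ + (β / T) ^ 2))) := by
  exact ⟨fun _ hb hA => Z4.RescaledFamily.exists_surface_on_box hb hA,
    fun G hb hA => G.exists_surface_on_wedge hb hA⟩
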